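/- Let $X$ be a complex Banach space, let $A$ and $B$ be closed linear operators on $X$ with domains $D(A)$, $D(B)$, let $T>0$, and let $\Sigma_\varphi=\{\lambda\in\mathbb C\setminus\{0\}:|\arg\lambda|\le\varphi\}\cup\{0\}$. Assume that for some $\varphi\in(\frac{\pi}{2},\pi)$: (b) for every $\lambda\in\Sigma_\varphi\setminus\{0\}$ the operator $\lambda^2+\lambda B+A$, with domain $D(A)\cap D(B)$, has an inverse $H(\lambda)\in\mathcal L(X)$; (c) $H$ is bounded on $\Sigma_\varphi\setminus\{0\}$ and holomorphic in the interior of $\Sigma_\varphi$, with values in $\mathcal L(X)$; (d) the functions $\lambda\mapsto\lambda^2H(\lambda)$, $\lambda\mapsto\lambda BH(\lambda)$ and $\lambda\mapsto AH(\lambda)$ are uniformly bounded on $\Sigma_\varphi\setminus\{0\}$ with values in $\mathcal L(X)$. Consider the problem $$\ddot u+B\dot u+Au=f\ \text{ on }[0,T],\qquad u(0)=\dot u(0)=0. \tag{P}$$ For $a<b$, $0<\theta<1$, $1\le p<\infty$ and $1\le q\le\infty$, let $B^\theta_{pq}(a,b;X)$ be the space of all $u\in L^p(a,b;X)$ such that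 $h\mapsto h^{-\theta}\|u(\cdot+h)-u\|_{L^p(a,b-h;X)}$ belongs to $L^q\big((0,b-a);\frac{dh}{h}\big)$. If $\theta>\frac1p$, let $\mathring B^\theta_{pq}(0,T;X)$ be the space of those $u\in B^\theta_{pq}(0,T;X)$ whose continuous representative on $[0,T]$ satisfies $u(0)=0$; if $\theta=\frac1p$, let $\mathring B^\theta_{pq}(0,T;X)$ be the space of those $u\in B^\theta_{pq}(0,T;X)$ whose extension by $0$ to $(-T,T)$ belongs to $B^\theta_{pq}(-T,T;X)$. Let $C^\theta([0,T];X)$ be the space of $\theta$-Hölder continuous functions, let $h^\theta([0,T];X)$ be the space of all $u\in C^\theta([0,T];X)$ with $\lim_{|t-s|\to0}\|u(t)-u(s)\|/|t-s|^\theta=0$, and let $\mathring C^\theta([0,T];X)$ and $\mathring h^\theta([0,T];X)$ be their subspaces of functions with $u(0)=0$. Then for every $\theta\in(0,1)$ the problem (P) has Besov and Hölder maximal regularity in the following sense. Let $\mathbb E$ be one of the spaces 1. $B^\theta_{pq}(0,T;X)$ with $1\le p<\infty$, $1\le q\le\infty$ and $\theta<\frac1p$; 2. $\mathring B^\theta_{pq}(0,T;X)$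 with $1\le p<\infty$, $1\le q\le\infty$ and $\theta\ge\frac1p$; 3. $\mathring C^\theta([0,T];X)$; 4. $\mathring h^\theta([0,T];X)$. For every $f\in\mathbb E$ the problem (P) has a unique solution $u$, and it satisfies $$u,\ \dot u,\ \ddot u,\ B\dot u,\ Au\in\mathbb E .$$ Here, in cases 1 and 2, a solution is a function $u\in W^{2,p}(0,T;X)$ with $u(0)=\dot u(0)=0$, with $\dot u(t)\in D(B)$ and $u(t)\in D(A)$ for almost every $t$, with $B\dot u,Au\in L^p(0,T;X)$, and with $\ddot u+B\dot u+Au=f$ almost everywhere on $(0,T)$. In cases 3 and 4, a solution is a function $u\in C^2([0,T];X)$ with $u(0)=\dot u(0)=0$, with $\dot u(t)\in D(B)$ and $u(t)\in D(A)$ for every $t\in[0,T]$, with $B\dot u,Au\in C([0,T];X)$, and with $\ddot u+B\dot u+Au=f$ everywhere on $[0,T]$. -/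

import Mathlib

open MeasureTheory Set

/-- The closed sector of half-angle `φ`; it contains `0`, since `Complex.arg 0 = 0`. -/
def sector (φ : ℝ) : Set ℂ := {z | |Complex.arg z| ≤ φ}

/-- The bounded operator `R` is the inverse of `z² + z B + A`, whose domain is `dom A ∩ dom B`:
`R` maps into `dom A ∩ dom B`, is a right inverse and is a left inverse. -/
def IsPencilInverse {X : Type*} [NormedAddCommGroup X] [NormedSpace ℂ X]
    (A B : X →ₗ.[ℂ] X) (z : ℂ) (R : X →L[ℂ] X) : Prop :=
  (∀ x : X, ∃ b a : X, (R x, b) ∈ B.graph ∧ (R x, a) ∈ A.graph ∧ z ^ 2 • R x + z • b + a = x) ∧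
  (∀ y b a : X, (y, b) ∈ B.graph → (y, a) ∈ A.graph → R (z ^ 2 • y + z • b + a) = y)

/-- The `Lᵖ`-modulus `‖u(· + h) - u‖` in `Lᵖ(a, b - h; X)`. -/
noncomputable def lpDiff {X : Type*} [NormedAddCommGroup X]
    (a b : ℝ) (p : ENNReal) (u : ℝ → X) (h : ℝ) : ENNReal :=
  eLpNorm (fun t => u (t + h) - u t) p (volume.restrict (Ioo a (b - h)))

/-- The Besov space `B^θ_{pq}(a, b; X)`, for `0 < θ < 1`: all `u ∈ Lᵖ(a, b; X)` such that
`h ↦ h^{-θ} ‖u(· + h) - u‖_{Lᵖ(a, b - h; X)}` belongs to `L^q((0, b - a); dh / h)`. -/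
def MemBesov {X : Type*} [NormedAddCommGroup X]
    (a b θ : ℝ) (p q : ENNReal) (u : ℝ → X) : Prop :=
  MemLp u p (volume.restrict (Ioo a b)) ∧
  eLpNorm (fun h : ℝ => ENNReal.ofReal (h ^ (-θ)) * lpDiff a b p u h) q
    ((volume.restrict (Ioo 0 (b - a))).withDensity (fun h => ENNReal.ofReal h⁻¹)) < ⊤

/-- Functions in `B^θ_{pq}(0, T; X)` whose continuous representative on `[0, T]` vanishes
at `0`; meant for `θ > 1 / p`, where a continuous representative always exists. -/
def MemBesovZeroTrace {X : Type*} [NormedAddCommGroup X]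
    (T θ : ℝ) (p q : ENNReal) (u : ℝ → X) : Prop :=
  MemBesov 0 T θ p q u ∧
  ∃ v : ℝ → X, ContinuousOn v (Icc 0 T) ∧ u =ᵐ[volume.restrict (Ioo 0 T)] v ∧ v 0 = 0

/-- Functions in `B^θ_{pq}(0, T; X)` whose extension by zero to `(-T, T)` belongs to
`B^θ_{pq}(-T, T; X)`. This is the meaning of a vanishing trace at `0` in the critical case
`θ = 1 / p`, where a trace need not exist. -/
def MemBesovZeroExt {X : Type*} [NormedAddCommGroup X]
    (T θ : ℝ) (p q : ENNReal) (u : ℝ → X) : Prop :=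
  MemBesov 0 T θ p q u ∧ MemBesov (-T) T θ p q ((Ioo 0 T).indicator u)

/-- The Hölder space `C^θ([0, T]; X)`. -/
def MemHolderSpace {X : Type*} [NormedAddCommGroup X] (T θ : ℝ) (u : ℝ → X) : Prop :=
  ContinuousOn u (Icc 0 T) ∧
  ∃ C : ℝ, ∀ s ∈ Icc (0 : ℝ) T, ∀ t ∈ Icc (0 : ℝ) T, ‖u t - u s‖ ≤ C * |t - s| ^ θ

/-- The little Hölder space `h^θ([0, T]; X)`. -/
def MemLittleHolderSpace {X : Type*} [NormedAddCommGroup X] (T θ : ℝ) (u : ℝ → X) : Prop :=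
  MemHolderSpace T θ u ∧
  ∀ ε > 0, ∃ δ > 0, ∀ s ∈ Icc (0 : ℝ) T, ∀ t ∈ Icc (0 : ℝ) T, |t - s| < δ →
    ‖u t - u s‖ ≤ ε * |t - s| ^ θ

/-- `u` is the absolutely continuous representative on `[0, T]` of an element of
`W^{1,p}(0, T; X)` with derivative `u'`. -/
def IsSobolevDeriv {X : Type*} [NormedAddCommGroup X] [NormedSpace ℝ X]
    (T : ℝ) (p : ENNReal) (u u' : ℝ → X) : Prop :=
  MemLp u' p (volume.restrict (Ioo 0 T)) ∧
  ∀ t ∈ Icc (0 : ℝ) T, u t = u 0 + ∫ s in (0 : ℝ)..t, u' s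

/-- `u` is a strong `Lᵖ`-solution of `ü + B u̇ + A u = f`, `u(0) = u̇(0) = 0` on `(0, T)`, and
`u₁ = u̇`, `u₂ = ü`, `Bu₁ = B u̇`, `Au = A u`. -/
structure IsStrongSolution {X : Type*} [NormedAddCommGroup X] [NormedSpace ℂ X]
    (A B : X →ₗ.[ℂ] X) (T : ℝ) (p : ENNReal) (f u u₁ u₂ Bu₁ Au : ℝ → X) : Prop where
  deriv_fst : IsSobolevDeriv T p u u₁
  deriv_snd : IsSobolevDeriv T p u₁ u₂
  init_fst : u 0 = 0
  init_snd : u₁ 0 = 0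
  memLp_B : MemLp Bu₁ p (volume.restrict (Ioo 0 T))
  memLp_A : MemLp Au p (volume.restrict (Ioo 0 T))
  graph_B : ∀ᵐ t ∂(volume.restrict (Ioo 0 T)), (u₁ t, Bu₁ t) ∈ B.graph
  graph_A : ∀ᵐ t ∂(volume.restrict (Ioo 0 T)), (u t, Au t) ∈ A.graph
  equation : ∀ᵐ t ∂(volume.restrict (Ioo 0 T)), u₂ t + Bu₁ t + Au t = f t

/-- `u ∈ C²([0, T]; X)` is a solution of `ü + B u̇ + A u = f`, `u(0) = u̇(0) = 0` on `[0, T]` with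
`B u̇`, `A u` continuous, and `u₁ = u̇`, `u₂ = ü`, `Bu₁ = B u̇`, `Au = A u`. -/
structure IsClassicalSolution {X : Type*} [NormedAddCommGroup X] [NormedSpace ℂ X]
    (A B : X →ₗ.[ℂ] X) (T : ℝ) (f u u₁ u₂ Bu₁ Au : ℝ → X) : Prop where
  deriv_fst : ∀ t ∈ Icc (0 : ℝ) T, HasDerivWithinAt u (u₁ t) (Icc 0 T) t
  deriv_snd : ∀ t ∈ Icc (0 : ℝ) T, HasDerivWithinAt u₁ (u₂ t) (Icc 0 T) t
  cont_snd : ContinuousOn u₂ (Icc 0 T)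
  init_fst : u 0 = 0
  init_snd : u₁ 0 = 0
  cont_B : ContinuousOn Bu₁ (Icc 0 T)
  cont_A : ContinuousOn Au (Icc 0 T)
  graph_B : ∀ t ∈ Icc (0 : ℝ) T, (u₁ t, Bu₁ t) ∈ B.graph
  graph_A : ∀ t ∈ Icc (0 : ℝ) T, (u t, Au t) ∈ A.graph
  equation : ∀ t ∈ Icc (0 : ℝ) T, u₂ t + Bu₁ t + Au t = f t

/-- Maximal regularity in the function space `E` on `[0, T]`, for a solution concept
`Sol f u u̇ ü (B u̇) (A u)`: for every `f ∈ E` there is exactly one solution `u`, and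
`u, u̇, ü, B u̇, A u` all belong to `E`. -/
def HasMaximalRegularity {X : Type*} (T : ℝ)
    (Sol : (f u u₁ u₂ Bu₁ Au : ℝ → X) → Prop) (E : (ℝ → X) → Prop) : Prop :=
  ∀ f : ℝ → X, E f →
    (∃ u u₁ u₂ Bu₁ Au : ℝ → X, Sol f u u₁ u₂ Bu₁ Au ∧ E u ∧ E u₁ ∧ E u₂ ∧ E Bu₁ ∧ E Au) ∧
    (∀ u u₁ u₂ Bu₁ Au v v₁ v₂ Bv₁ Av : ℝ → X,
      Sol f u u₁ u₂ Bu₁ Au → Sol f v v₁ v₂ Bv₁ Av → EqOn u v (Icc 0 T))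

/-! With `d/dt` in the place of `z`, the problem reads `(z² + zB + A) u = f`, so formally `u =
H(d/dt) f`, and `ü`, `B u̇`, `A u` arise from `f` through the symbols `z²H(z)`, `zBH(z)`, `AH(z)`.
These are bounded and holomorphic on a sector larger than the right half-plane. Bounded holomorphic
functions of `d/dt` need not act on `Lᵖ`, but they do act on the real interpolation spaces between
`Lᵖ` and the domain of `d/dt` (the Da Prato–Grisvard principle). The Besov and Hölder spaces with
vanishing trace are spaces of this kind. The argument below is a direct version of this principle,
without interpolation theory.

Functional calculus. Let `y_z = duhamel z g` solve `y' = z y + g`, `y(0) = 0`. For a bounded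
holomorphic `G` put `G(d/dt) g (t) = (2πi)⁻¹ ∫ G(z) z⁻¹ y_z'(t) dz` over two rays from `1` in the
directions `± α`, with `π/2 < α < φ`; this is `contourOp` with `contourMultiplier`. By
`duhamelDeriv_eq`, `y_z'` is an average of differences `g(t - s) - g(t)` up to an exponentially
small term, so the integral converges wherever `g` has some smoothness, measured by `meanOsc`.

Boundedness. To estimate the increment of `G(d/dt) g` over a time step `h`, the contour is cut at
`|z| ~ 1/h` (`exists_contourOp_bounds`). The far part is bounded by `meanOsc` at scale `h`. On the
near part `y_z' = g + z y_z`. The first summand meets a truncated integral of `G(z)/z`, which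
Cauchy's theorem bounds, and in the second `y_z(t + h) - y_z(t)` is the time integral of `y_z'`.
Hardy's inequality with kernel `min(1, h/s)` (`exists_hardy_const`) then yields the Besov and the
Hölder bounds.

Zero extension. The calculus needs functions on `(-T, T)` that vanish for negative times. The zero
extension stays in the Besov space when `θ < 1/p` (`memBesov_neg_of_lt`) and when `θ > 1/p` with
zero trace (`memBesov_neg_of_gt`); for `θ = 1/p` this is the definition. Conversely
`MemBesov.exists_continuousOn` returns the zero trace of the solution.

Solving the equation. Set `ü`, `B u̇`, `A u` to be the images of `f` under `z²H`, `zBH` and `1 - z²H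
- zBH`. Their sum is `f` because the calculus maps the symbol `1` to the identity
(`integral_contour_duhamelDeriv`). The relations with `A` and `B` hold first after integration in
time, which turns `y_z'` into `y_z` and each further time removes a factor `z`
(`integral_contourMultiplier_smul`); closedness of the operators allows differentiating back.

Uniqueness. For a solution of the homogeneous problem, `z ↦ ∫₀ᵀ e^{z(T - s)} u(s) ds` is entire. It
is bounded on the left half-plane trivially and on the right half-plane through the pencil inverse.
By Liouville it is constant; it tends to `0` along the negative integers, so it vanishes, and
Fourier inversion gives `u = 0`. -/

set_option linter.unusedSectionVars false

/-! ### Minkowski's inequality, the measure `dh/h`, weighted norms and Hardy's inequality. -/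

/-- **Minkowski's integral inequality**. -/
theorem eLpNorm_lintegral_le {α β : Type*} [MeasurableSpace α] [MeasurableSpace β]
    {μ : Measure α} {ν : Measure β} [SFinite μ] [SFinite ν] {F : α → β → ENNReal}
    (hF : Measurable (Function.uncurry F)) {p : ENNReal} (hp : 1 ≤ p) :
    eLpNorm (fun x => ∫⁻ y, F x y ∂ν) p μ ≤ ∫⁻ y, eLpNorm (fun x => F x y) p μ ∂ν := by
  have hFx : ∀ x, Measurable (F x) := fun x => hF.comp measurable_prodMk_left
  have hFy : ∀ y, Measurable (fun x => F x y) := fun y => hF.comp measurable_prodMk_right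
  rcases eq_or_ne p ⊤ with rfl | hpt
  -- For `p = ∞` the point is measurability of `N`, read off from its superlevel sets: it makes `{F
  -- ≤ N}` measurable, so that the two "almost every" quantifiers can be exchanged.
  · set N : β → ENNReal := fun y => eLpNorm (fun x => F x y) ⊤ μ with hN
    have hNm : Measurable N := by
      refine measurable_of_Ioi fun c => ?_
      have h1 : N ⁻¹' Ioi c = {y | 0 < μ {x | c < F x y}} := by
        ext y
        simp only [hN, mem_preimage, mem_Ioi, mem_ofPred_eq, eLpNorm_exponent_top]
        rw [← not_le, ← not_le, not_iff_not, nonpos_iff_eq_zero]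
        constructor
        · intro h
          have := ae_le_eLpNormEssSup (f := fun x => F x y) (μ := μ)
          rw [← compl_mem_ae_iff]
          filter_upwards [this] with x hx
          simpa using (show F x y ≤ c from le_trans (by simpa using hx) h)
        · intro h
          refine eLpNormEssSup_le_of_ae_enorm_bound (C := c) ?_
          rw [← compl_mem_ae_iff] at h
          filter_upwards [h] with x hx
          simpa using hx
      rw [h1]
      have h2 : MeasurableSet {z : β × α | c < F z.2 z.1} :=
        measurableSet_lt measurable_const (hF.comp measurable_swap)
      exact measurableSet_lt measurable_const (measurable_measure_prodMk_left h2)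
    have hm : MeasurableSet {z : β × α | F z.2 z.1 ≤ N z.1} :=
      measurableSet_le (hF.comp measurable_swap) (hNm.comp measurable_fst)
    have hae : ∀ᵐ y ∂ν, ∀ᵐ x ∂μ, F x y ≤ N y := by
      refine Filter.Eventually.of_forall fun y => ?_
      have := ae_le_eLpNormEssSup (f := fun x => F x y) (μ := μ)
      simpa [hN] using this
    have hae' := (Measure.ae_ae_comm hm).1 hae
    rw [eLpNorm_exponent_top]
    refine eLpNormEssSup_le_of_ae_enorm_bound (C := ∫⁻ y, N y ∂ν) ?_
    filter_upwards [hae'] with x hx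
    simpa using lintegral_mono_ae hx
  · set r := p.toReal with hr
    have hr1 : 1 ≤ r := by
      have := ENNReal.toReal_mono hpt hp
      simpa using this
    have hp0 : p ≠ 0 := (zero_lt_one.trans_le hp).ne'
    set N : β → ENNReal := fun y => eLpNorm (fun x => F x y) p μ with hN
    have hNr : ∀ y, N y = (∫⁻ x, F x y ^ r ∂μ) ^ (1 / r) := fun y => by
      simp [hN, eLpNorm_eq_lintegral_rpow_enorm_toReal hp0 hpt, hr]
    have hNm : Measurable N := by
      have : N = fun y => (∫⁻ x, F x y ^ r ∂μ) ^ (1 / r) := funext hNr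
      rw [this]
      refine Measurable.pow_const ?_ _
      exact Measurable.lintegral_prod_right' (f := fun z : β × α => F z.2 z.1 ^ r)
        ((hF.comp measurable_swap).pow_const r)
    rw [eLpNorm_eq_lintegral_rpow_enorm_toReal hp0 hpt]
    simp only [enorm_eq_self]
    rcases eq_or_lt_of_le hr1 with h1 | h1
    · have hr1' : r = 1 := h1.symm
      rw [← hr, hr1']
      simp only [ENNReal.rpow_one, div_one]
      have : ∀ y, N y = ∫⁻ x, F x y ∂μ := fun y => by rw [hNr, hr1']; simp
      rw [lintegral_congr this, lintegral_lintegral_swap hF.aemeasurable]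
    rcases eq_or_ne (∫⁻ y, N y ∂ν) ⊤ with hI | hI
    · rw [show (∫⁻ y, eLpNorm (fun x => F x y) p μ ∂ν) = ∫⁻ y, N y ∂ν from rfl, hI]
      exact le_top
    have hr0 : 0 < r := zero_lt_one.trans h1
    have hfin : ∀ᵐ y ∂ν, N y < ⊤ := ae_lt_top hNm hI
    set r' := r.conjExponent with hr'
    have hconj : r'.HolderConjugate r := (Real.HolderConjugate.conjExponent h1).symm
    have hr'0 : 0 < r' := hconj.pos
    -- Hölder is applied in `y` to `F = N^{1/r'} · G`. The normalisation makes `∫ G^r dx ≤ N`, so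
    -- both factors reproduce the integral of `N`.
    set G : α → β → ENNReal := fun x y => F x y * N y ^ (-(1 / r')) with hG
    have hGm : Measurable (Function.uncurry G) :=
      hF.mul ((hNm.comp measurable_snd).pow_const _)
    have hae : ∀ᵐ y ∂ν, ∀ᵐ x ∂μ, F x y ≤ N y ^ (1 / r') * G x y := by
      filter_upwards [hfin] with y hy
      rcases eq_or_ne (N y) 0 with h0 | h0
      · have : eLpNorm (fun x => F x y) p μ = 0 := h0
        rw [eLpNorm_eq_zero_iff (hFy y).aestronglyMeasurable hp0] at this
        filter_upwards [this] with x hx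
        simp only [Pi.zero_apply] at hx
        simp [hx]
      · refine Filter.Eventually.of_forall fun x => ?_
        rw [hG]
        simp only
        rw [mul_left_comm, ← ENNReal.rpow_add _ _ h0 hy.ne]
        simp
    have hm : MeasurableSet {z : β × α | F z.2 z.1 ≤ N z.1 ^ (1 / r') * G z.2 z.1} :=
      measurableSet_le (hF.comp measurable_swap)
        (((hNm.comp measurable_fst).pow_const _).mul (hGm.comp measurable_swap))
    have hae' := (Measure.ae_ae_comm hm).1 hae
    have hrr' : r / r' = r - 1 := by
      have := hconj.symm.sub_one_mul_conj
      field_simp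
      linarith
    set I := ∫⁻ y, N y ∂ν with hIdef
    have key : ∀ᵐ x ∂μ, (∫⁻ y, F x y ∂ν) ^ r ≤ I ^ (r - 1) * ∫⁻ y, G x y ^ r ∂ν := by
      filter_upwards [hae'] with x hx
      have h2 : ∫⁻ y, F x y ∂ν ≤ I ^ (1 / r') * (∫⁻ y, G x y ^ r ∂ν) ^ (1 / r) := by
        refine (lintegral_mono_ae hx).trans ?_
        have := ENNReal.lintegral_mul_le_Lp_mul_Lq ν hconj
          (f := fun y => N y ^ (1 / r')) (g := G x) (hNm.pow_const _).aemeasurable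
          (hGm.comp measurable_prodMk_left).aemeasurable
        refine this.trans_eq ?_
        congr 2
        refine lintegral_congr fun y => ?_
        rw [← ENNReal.rpow_mul]
        simp [hr'0.ne']
      calc (∫⁻ y, F x y ∂ν) ^ r ≤ (I ^ (1 / r') * (∫⁻ y, G x y ^ r ∂ν) ^ (1 / r)) ^ r := by
            gcongr
        _ = _ := by
            rw [ENNReal.mul_rpow_of_nonneg _ _ hr0.le, ← ENNReal.rpow_mul, ← ENNReal.rpow_mul]
            congr 2
            · rw [← hrr']; ring
            · simp [hr0.ne']
    have hGint : ∀ y, N y < ⊤ → ∫⁻ x, G x y ^ r ∂μ ≤ N y := by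
      intro y hy
      have h3 : ∫⁻ x, G x y ^ r ∂μ = N y ^ (-(r - 1)) * ∫⁻ x, F x y ^ r ∂μ := by
        rw [← lintegral_const_mul _ ((hFy y).pow_const r)]
        refine lintegral_congr fun x => ?_
        rw [hG]
        simp only
        rw [ENNReal.mul_rpow_of_nonneg _ _ hr0.le, ← ENNReal.rpow_mul, mul_comm]
        congr 2
        rw [← hrr']; ring
      have h4 : ∫⁻ x, F x y ^ r ∂μ = N y ^ r := by
        rw [hNr, ← ENNReal.rpow_mul]; simp [hr0.ne']
      rw [h3, h4]
      rcases eq_or_ne (N y) 0 with h0 | h0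
      · rw [h0, ENNReal.zero_rpow_of_pos hr0]; simp
      · rw [← ENNReal.rpow_add _ _ h0 hy.ne]; simp
    have h5 : ∫⁻ x, (∫⁻ y, F x y ∂ν) ^ r ∂μ ≤ I ^ r := by
      calc ∫⁻ x, (∫⁻ y, F x y ∂ν) ^ r ∂μ
          ≤ ∫⁻ x, I ^ (r - 1) * ∫⁻ y, G x y ^ r ∂ν ∂μ := lintegral_mono_ae key
        _ = I ^ (r - 1) * ∫⁻ x, ∫⁻ y, G x y ^ r ∂ν ∂μ := by
            rw [lintegral_const_mul]
            exact Measurable.lintegral_prod_right' (hGm.pow_const r)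
        _ = I ^ (r - 1) * ∫⁻ y, ∫⁻ x, G x y ^ r ∂μ ∂ν := by
            rw [lintegral_lintegral_swap]
            exact (hGm.pow_const r).aemeasurable
        _ ≤ I ^ (r - 1) * I := by
            gcongr
            refine lintegral_mono_ae ?_
            filter_upwards [hfin] with y hy using hGint y hy
        _ = I ^ r := by
            conv_lhs => rw [← ENNReal.rpow_one I, ← ENNReal.rpow_mul, one_mul]
            rw [← ENNReal.rpow_add_of_nonneg _ _ (by linarith) zero_le_one]
            congr 1; ring
    calc (∫⁻ x, (∫⁻ y, F x y ∂ν) ^ r ∂μ) ^ (1 / r) ≤ (I ^ r) ^ (1 / r) := by gcongr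
      _ = I := by rw [← ENNReal.rpow_mul]; simp [hr0.ne']

/-- The invariant measure `dh / h` of the multiplicative group of positive reals. -/
noncomputable def mulHaar : Measure ℝ :=
  (volume.restrict (Ioi 0)).withDensity (fun h => ENNReal.ofReal h⁻¹)

instance : SFinite mulHaar := by unfold mulHaar; infer_instance

theorem lintegral_mulHaar {F : ℝ → ENNReal} (hF : Measurable F) :
    ∫⁻ h, F h ∂mulHaar = ∫⁻ h in Ioi 0, ENNReal.ofReal h⁻¹ * F h := by
  unfold mulHaar
  rw [lintegral_withDensity_eq_lintegral_mul _ (by fun_prop) hF]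
  rfl

theorem mulHaar_restrict_Ioo (a : ℝ) : mulHaar.restrict (Ioo 0 a) =
    (volume.restrict (Ioo 0 a)).withDensity (fun h => ENNReal.ofReal h⁻¹) := by
  unfold mulHaar
  rw [restrict_withDensity measurableSet_Ioo, Measure.restrict_restrict measurableSet_Ioo]
  congr 2
  exact inter_eq_left.2 fun x hx => hx.1

theorem measurePreserving_mul_mulHaar {c : ℝ} (hc : 0 < c) :
    MeasurePreserving (fun h => c * h) mulHaar mulHaar := by
  refine ⟨by fun_prop, ?_⟩
  ext s hs
  have hm : Measurable fun h : ℝ => c * h := by fun_prop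
  rw [Measure.map_apply hm hs, ← lintegral_indicator_one hs, ← lintegral_indicator_one (hm hs),
    lintegral_mulHaar (measurable_one.indicator hs),
    lintegral_mulHaar (measurable_one.indicator (hm hs))]
  have key := Real.map_volume_mul_left hc.ne'
  rw [← lintegral_indicator measurableSet_Ioi, ← lintegral_indicator measurableSet_Ioi]
  have hvol : (volume : Measure ℝ) = ENNReal.ofReal c • Measure.map (fun x => c * x) volume := by
    rw [key, smul_smul, ← ENNReal.ofReal_mul hc.le, abs_of_pos (inv_pos.2 hc),
      mul_inv_cancel₀ hc.ne']
    simp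
  conv_rhs => rw [hvol]
  rw [lintegral_smul_measure, lintegral_map _ hm, smul_eq_mul, ← lintegral_const_mul]
  · refine lintegral_congr fun h => ?_
    by_cases h0 : 0 < h
    · have h1 : 0 < c * h := mul_pos hc h0
      rw [indicator_of_mem (show h ∈ Ioi (0 : ℝ) from h0),
        indicator_of_mem (show c * h ∈ Ioi (0 : ℝ) from h1), ← mul_assoc,
        ← ENNReal.ofReal_mul hc.le]
      have h2 : c * (c * h)⁻¹ = h⁻¹ := by field_simp
      rw [h2]
      rfl
    · have h1 : ¬ 0 < c * h := by
        intro h2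
        exact h0 (pos_of_mul_pos_right h2 hc.le)
      rw [indicator_of_notMem (show h ∉ Ioi (0 : ℝ) from h0),
        indicator_of_notMem (show c * h ∉ Ioi (0 : ℝ) from h1), mul_zero]
  all_goals
    first
    | exact ((by fun_prop : Measurable fun h : ℝ => ENNReal.ofReal h⁻¹).mul
        (measurable_one.indicator hs)).indicator measurableSet_Ioi
    | exact (((by fun_prop : Measurable fun h : ℝ => ENNReal.ofReal h⁻¹).mul
        (measurable_one.indicator hs)).indicator measurableSet_Ioi).comp hm

/-- The weighted norm `‖h^{-θ} F(h)‖` in `L^q((0,∞); dh/h)`. -/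
noncomputable def wNorm (θ : ℝ) (q : ENNReal) (F : ℝ → ENNReal) : ENNReal :=
  eLpNorm (fun h => ENNReal.ofReal (h ^ (-θ)) * F h) q mulHaar

theorem ae_mulHaar_pos : ∀ᵐ h ∂mulHaar, 0 < h := by
  unfold mulHaar
  exact (withDensity_absolutelyContinuous _ _).ae_le (ae_restrict_mem measurableSet_Ioi)

theorem measurable_weight (θ : ℝ) : Measurable fun h : ℝ => ENNReal.ofReal (h ^ (-θ)) := by
  fun_prop

theorem wNorm_mono {θ : ℝ} {q : ENNReal} {F G : ℝ → ENNReal} (h : ∀ s, 0 < s → F s ≤ G s) :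
    wNorm θ q F ≤ wNorm θ q G := by
  refine eLpNorm_mono_enorm_ae ?_
  filter_upwards [ae_mulHaar_pos] with s hs
  simp only [enorm_eq_self]
  gcongr
  exact h s hs

theorem wNorm_add_le {θ : ℝ} {q : ENNReal} (hq : 1 ≤ q) {F G : ℝ → ENNReal} (hF : Measurable F)
    (hG : Measurable G) : wNorm θ q (fun h => F h + G h) ≤ wNorm θ q F + wNorm θ q G := by
  unfold wNorm
  simp only [mul_add]
  exact eLpNorm_add_le ((measurable_weight θ).mul hF).aestronglyMeasurable
    ((measurable_weight θ).mul hG).aestronglyMeasurable hq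

/-- Finiteness of `c` takes the place of measurability of `F`. -/
theorem eLpNorm_const_mul_ennreal {α : Type*} [MeasurableSpace α] {μ : Measure α}
    {c : ENNReal} (hc : c ≠ ⊤) (F : α → ENNReal) (q : ENNReal) :
    eLpNorm (fun x => c * F x) q μ ≤ c * eLpNorm F q μ := by
  rcases eq_or_ne q 0 with rfl | hq0
  · simp
  rcases eq_or_ne q ⊤ with rfl | hqt
  · simp only [eLpNorm_exponent_top, eLpNormEssSup, enorm_eq_self]
    rw [ENNReal.essSup_const_mul]
  · have hqr : 0 < q.toReal := ENNReal.toReal_pos hq0 hqt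
    simp only [eLpNorm_eq_lintegral_rpow_enorm_toReal hq0 hqt, enorm_eq_self]
    simp only [ENNReal.mul_rpow_of_nonneg _ _ hqr.le]
    rw [lintegral_const_mul' _ _ (ENNReal.rpow_ne_top_of_nonneg hqr.le hc),
      ENNReal.mul_rpow_of_nonneg _ _ (by positivity), ← ENNReal.rpow_mul,
      mul_one_div_cancel hqr.ne', ENNReal.rpow_one]

theorem wNorm_const_mul_le {θ : ℝ} {q : ENNReal} {c : ENNReal} (hc : c ≠ ⊤) (F : ℝ → ENNReal) :
    wNorm θ q (fun h => c * F h) ≤ c * wNorm θ q F := by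
  unfold wNorm
  simp only [mul_left_comm _ c]
  exact eLpNorm_const_mul_ennreal hc _ q

/-- The measure `dh/h` is invariant under dilations and the weight is homogeneous. The factor `c ^
θ` is what competes with the `Lᵖ` gain in the zero-extension arguments. -/
theorem wNorm_comp_mul {θ : ℝ} {q : ENNReal} {c : ℝ} (hc : 0 < c) {F : ℝ → ENNReal}
    (hF : Measurable F) :
    wNorm θ q (fun h => F (c * h)) ≤ ENNReal.ofReal (c ^ θ) * wNorm θ q F := by
  have h1 := eLpNorm_comp_measurePreserving (p := q)
    ((measurable_weight θ).mul hF).aestronglyMeasurable (measurePreserving_mul_mulHaar hc)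
  have h2 : wNorm θ q (fun h => F (c * h)) = eLpNorm (fun h => ENNReal.ofReal (c ^ θ) *
      (((fun h : ℝ => ENNReal.ofReal (h ^ (-θ))) * F) ∘ fun h => c * h) h) q mulHaar := by
    refine eLpNorm_congr_ae ?_
    filter_upwards [ae_mulHaar_pos] with h hh
    simp only [Function.comp, Pi.mul_apply]
    rw [← mul_assoc, ← ENNReal.ofReal_mul (by positivity), Real.mul_rpow hc.le hh.le, ← mul_assoc,
      ← Real.rpow_add hc]
    simp
  rw [h2]
  refine (eLpNorm_const_mul_ennreal ENNReal.ofReal_ne_top _ q).trans ?_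
  rw [h1]
  rfl


/-- Against `ds/s` the integrand is `s^{θ-1}` near `0` and `s^{θ-2}` at infinity, so `0 < θ < 1` is
exactly the range of convergence. The value is the constant in Hardy's inequality. -/
theorem lintegral_Ioi_mul_rpow_lt_top {θ : ℝ} (hθ : θ ∈ Ioo (0 : ℝ) 1) :
    ∫⁻ s, ENNReal.ofReal (min 1 s⁻¹ * s ^ θ) ∂mulHaar < ⊤ := by
  rw [lintegral_mulHaar (by fun_prop), ← Ioc_union_Ioi_eq_Ioi zero_le_one,
    lintegral_union measurableSet_Ioi (Set.Ioc_disjoint_Ioi le_rfl)]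
  have h1 : IntegrableOn (fun s : ℝ => s ^ (θ - 1)) (Ioc 0 1) := by
    have := intervalIntegral.intervalIntegrable_rpow' (a := 0) (b := 1) (r := θ - 1)
      (by linarith [hθ.1])
    rwa [intervalIntegrable_iff_integrableOn_Ioc_of_le zero_le_one] at this
  have h2 : IntegrableOn (fun s : ℝ => s ^ (θ - 2)) (Ioi 1) :=
    integrableOn_Ioi_rpow_of_lt (by linarith [hθ.2]) one_pos
  refine ENNReal.add_lt_top.2 ⟨?_, ?_⟩
  · refine lt_of_le_of_lt (setLIntegral_mono_ae' measurableSet_Ioc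
      (Filter.Eventually.of_forall fun s hs => ?_)) h1.lintegral_lt_top
    rw [← ENNReal.ofReal_mul (inv_nonneg.2 hs.1.le)]
    refine ENNReal.ofReal_le_ofReal ?_
    rw [Real.rpow_sub hs.1, Real.rpow_one, div_eq_inv_mul]
    have : min 1 s⁻¹ * s ^ θ ≤ s ^ θ :=
      mul_le_of_le_one_left (Real.rpow_nonneg hs.1.le _) (min_le_left _ _)
    gcongr
    exact inv_nonneg.2 hs.1.le
  · refine lt_of_le_of_lt (setLIntegral_mono_ae' measurableSet_Ioi
      (Filter.Eventually.of_forall fun s hs => ?_)) h2.lintegral_lt_top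
    have hs0 : (0 : ℝ) < s := zero_lt_one.trans hs
    rw [← ENNReal.ofReal_mul (inv_nonneg.2 hs0.le)]
    refine ENNReal.ofReal_le_ofReal ?_
    have e : s ^ (θ - 2) = s⁻¹ * (s⁻¹ * s ^ θ) := by
      rw [Real.rpow_sub hs0, Real.rpow_two]; field_simp
    rw [e]
    have := inv_nonneg.2 hs0.le
    gcongr
    exact min_le_right _ _

/-- **Hardy's inequality** for the kernel `min(1, h / s)`. -/
theorem exists_hardy_const {θ : ℝ} (hθ : θ ∈ Ioo (0 : ℝ) 1) :
    ∃ C : ENNReal, C ≠ ⊤ ∧ ∀ q : ENNReal, 1 ≤ q → ∀ ω : ℝ → ENNReal, Measurable ω →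
      wNorm θ q (fun h => ∫⁻ s, ENNReal.ofReal (min 1 (h / s)) * ω s ∂mulHaar) ≤
        C * wNorm θ q ω := by
  refine ⟨_, (lintegral_Ioi_mul_rpow_lt_top hθ).ne, fun q hq ω hω => ?_⟩
  set W : ℝ → ENNReal := fun h => ENNReal.ofReal (h ^ (-θ)) * ω h with hW
  have hWm : Measurable W := (measurable_weight θ).mul hω
  set k : ℝ → ENNReal := fun s => ENNReal.ofReal (min 1 s⁻¹ * s ^ θ) with hk
  have hkm : Measurable k := by fun_prop
  -- The substitution `s = hσ` turns the kernel into a convolution on the multiplicative group.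
  -- Minkowski and dilation invariance then leave only the integral of `k`.
  have h1 : wNorm θ q (fun h => ∫⁻ s, ENNReal.ofReal (min 1 (h / s)) * ω s ∂mulHaar) =
      eLpNorm (fun h => ∫⁻ σ, k σ * W (h * σ) ∂mulHaar) q mulHaar := by
    refine eLpNorm_congr_ae ?_
    filter_upwards [ae_mulHaar_pos] with h hh
    rw [← lintegral_const_mul _ (by fun_prop),
      ← (measurePreserving_mul_mulHaar hh).lintegral_comp (by fun_prop)]
    refine lintegral_congr_ae ?_
    filter_upwards [ae_mulHaar_pos] with σ hσ
    simp only [hk, hW]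
    rw [← mul_assoc, ← mul_assoc, ← ENNReal.ofReal_mul (by positivity),
      ← ENNReal.ofReal_mul (by positivity)]
    congr 2
    have e1 : h / (h * σ) = σ⁻¹ := by field_simp
    rw [e1, Real.mul_rpow hh.le hσ.le, mul_comm (h ^ (-θ)) (min 1 _), mul_assoc]
    congr 1
    rw [mul_left_comm, ← Real.rpow_add hσ]
    simp
  rw [h1]
  have hF : Measurable (Function.uncurry fun h σ => k σ * W (h * σ)) :=
    (hkm.comp measurable_snd).mul (hWm.comp (by fun_prop))
  refine (eLpNorm_lintegral_le hF hq).trans ?_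
  rw [← lintegral_mul_const _ hkm]
  refine lintegral_mono_ae ?_
  filter_upwards [ae_mulHaar_pos] with σ hσ
  refine (eLpNorm_const_mul_ennreal ENNReal.ofReal_ne_top _ q).trans ?_
  gcongr
  have := eLpNorm_comp_measurePreserving (p := q) hWm.aestronglyMeasurable
    (measurePreserving_mul_mulHaar hσ)
  simp only [mul_comm _ σ]
  exact this.le

/-- Since `θ < 1`, a modulus of order `h` on a bounded range has finite Besov norm. All
Lipschitz-type remainders are absorbed by this. -/
theorem wNorm_indicator_id_lt_top {θ : ℝ} (hθ : θ ∈ Ioo (0 : ℝ) 1) {q : ENNReal} (hq : 1 ≤ q)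
    (a : ℝ) : wNorm θ q ((Ioo 0 a).indicator fun h => ENNReal.ofReal h) < ⊤ := by
  have hae : ∀ᵐ h ∂mulHaar, ENNReal.ofReal (h ^ (-θ)) *
      (Ioo 0 a).indicator (fun h => ENNReal.ofReal h) h =
      (Ioo 0 a).indicator (fun h => ENNReal.ofReal (h ^ (1 - θ))) h := by
    filter_upwards [ae_mulHaar_pos] with h hh
    by_cases hm : h ∈ Ioo 0 a
    · rw [indicator_of_mem hm, indicator_of_mem hm, ← ENNReal.ofReal_mul (by positivity),
        mul_comm, sub_eq_add_neg, Real.rpow_add hh, Real.rpow_one]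
    · rw [indicator_of_notMem hm, indicator_of_notMem hm, mul_zero]
  unfold wNorm
  rw [eLpNorm_congr_ae hae]
  have hbd : ∀ h, (Ioo 0 a).indicator (fun h : ℝ => ENNReal.ofReal (h ^ (1 - θ))) h ≤
      ENNReal.ofReal (a ^ (1 - θ)) := by
    intro h
    refine indicator_le' (fun h hh => ENNReal.ofReal_le_ofReal ?_) (fun _ _ => zero_le) h
    exact Real.rpow_le_rpow hh.1.le hh.2.le (by linarith [hθ.2])
  rcases eq_or_ne q ⊤ with rfl | hqt
  · rw [eLpNorm_exponent_top]
    exact (eLpNormEssSup_le_of_ae_enorm_bound (C := ENNReal.ofReal (a ^ (1 - θ)))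
      (Filter.Eventually.of_forall fun h => by simpa using hbd h)).trans_lt ENNReal.ofReal_lt_top
  have hq0 : q ≠ 0 := (zero_lt_one.trans_le hq).ne'
  have hqr : 0 < q.toReal := ENNReal.toReal_pos hq0 hqt
  refine (eLpNorm_lt_top_iff_lintegral_rpow_enorm_lt_top hq0 hqt).2 ?_
  have h1 : IntegrableOn (fun s : ℝ => s ^ ((1 - θ) * q.toReal - 1)) (Ioc 0 (max a 0)) := by
    have := intervalIntegral.intervalIntegrable_rpow' (a := 0) (b := max a 0)
      (r := (1 - θ) * q.toReal - 1) (by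
        have : 0 < (1 - θ) * q.toReal := mul_pos (by linarith [hθ.2]) hqr
        linarith)
    rwa [intervalIntegrable_iff_integrableOn_Ioc_of_le (le_max_right _ _)] at this
  refine lt_of_le_of_lt ?_ h1.lintegral_lt_top
  have hm : Measurable fun h : ℝ => ‖(Ioo 0 a).indicator
      (fun h : ℝ => ENNReal.ofReal (h ^ (1 - θ))) h‖ₑ ^ q.toReal := by
    refine Measurable.pow_const ?_ _
    simp only [enorm_eq_self]
    exact Measurable.indicator (by fun_prop) measurableSet_Ioo
  rw [lintegral_mulHaar hm, ← lintegral_indicator measurableSet_Ioi,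
    ← lintegral_indicator measurableSet_Ioc]
  refine lintegral_mono fun h => ?_
  by_cases hh : h ∈ Ioo 0 a
  · rw [indicator_of_mem (show h ∈ Ioi (0 : ℝ) from hh.1), indicator_of_mem hh,
      indicator_of_mem (show h ∈ Ioc 0 (max a 0) from ⟨hh.1, hh.2.le.trans (le_max_left _ _)⟩),
      enorm_eq_self, ENNReal.ofReal_rpow_of_nonneg (Real.rpow_nonneg hh.1.le _) hqr.le,
      ← Real.rpow_mul hh.1.le, ← ENNReal.ofReal_mul (inv_nonneg.2 hh.1.le)]
    refine ENNReal.ofReal_le_ofReal (le_of_eq ?_)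
    rw [Real.rpow_sub hh.1, Real.rpow_one, div_eq_inv_mul]
  · by_cases h0 : h ∈ Ioi (0 : ℝ)
    · rw [indicator_of_mem h0, indicator_of_notMem hh]; simp [hqr]
    · rw [indicator_of_notMem h0]; exact zero_le

/-! ### Rays from `1`, sectors, and Cauchy's theorem for rotated rays. -/

section

open Complex (I exp)

/-- The point at distance `r` from `1` in the direction `β`. -/
noncomputable def rayPoint (r β : ℝ) : ℂ := 1 + r * exp (β * I)

theorem rayPoint_re (r β : ℝ) : (rayPoint r β).re = 1 + r * Real.cos β := by
  simp [rayPoint, Complex.exp_ofReal_mul_I_re]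

theorem rayPoint_im (r β : ℝ) : (rayPoint r β).im = r * Real.sin β := by
  simp [rayPoint, Complex.exp_ofReal_mul_I_im]

theorem continuous_rayPoint (β : ℝ) : Continuous fun r => rayPoint r β := by
  unfold rayPoint; fun_prop

/-- With `c = cos α`, the constant comes from the identity `1 + 2rc + r² - (1 + c)/2 · (1 + r)² = (1
- c)/2 · (1 - r)² ≥ 0`. -/
theorem norm_rayPoint_ge {α β r : ℝ} (h : Real.cos α ≤ Real.cos β) (hr : 0 ≤ r) :
    √((1 + Real.cos α) / 2) * (1 + r) ≤ ‖rayPoint r β‖ := by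
  have h1 := Real.neg_one_le_cos α
  rw [Complex.norm_def]
  refine Real.le_sqrt_of_sq_le ?_
  rw [mul_pow, Real.sq_sqrt (by linarith), Complex.normSq_apply, rayPoint_re, rayPoint_im]
  have h2 := Real.sin_sq_add_cos_sq β
  have h3 := Real.cos_le_one α
  have e : (1 + r * Real.cos β) * (1 + r * Real.cos β) + r * Real.sin β * (r * Real.sin β) =
      1 + 2 * r * Real.cos β + r ^ 2 := by linear_combination r ^ 2 * h2
  rw [e]
  have h4 : r * Real.cos α ≤ r * Real.cos β := by gcongr
  nlinarith [mul_nonneg (sub_nonneg.2 h3) (sq_nonneg (1 - r))]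

theorem norm_rayPoint_le {β r : ℝ} (hr : 0 ≤ r) : ‖rayPoint r β‖ ≤ 1 + r := by
  refine (norm_add_le _ _).trans ?_
  simp [Complex.norm_exp_ofReal_mul_I, abs_of_nonneg hr]

theorem norm_rayPoint_sub_one {β r : ℝ} (hr : 0 ≤ r) : ‖rayPoint r β - 1‖ = r := by
  simp [rayPoint, Complex.norm_exp_ofReal_mul_I, abs_of_nonneg hr]

theorem cos_le_cos_of_abs_le {α β : ℝ} (hα : α ≤ Real.pi) (h : |β| ≤ α) :
    Real.cos α ≤ Real.cos β := by
  rw [← Real.cos_abs β]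
  exact Real.cos_le_cos_of_nonneg_of_le_pi (abs_nonneg β) hα h

theorem cos_le_cos_of_mem_left {α β : ℝ} (hα : 0 ≤ α)
    (h : β ∈ Icc α (2 * Real.pi - α)) : Real.cos β ≤ Real.cos α := by
  have h1 : Real.cos (Real.pi - α) ≤ Real.cos (β - Real.pi) := by
    refine cos_le_cos_of_abs_le (by linarith) ?_
    rw [abs_le]; constructor <;> linarith [h.1, h.2]
  rw [Real.cos_pi_sub] at h1
  have : Real.cos (β - Real.pi) = -Real.cos β := by
    rw [Real.cos_sub_pi]
  linarith

/-- An open set inside the sector of half-angle `arccos (-k)`. -/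
def openSector (k : ℝ) : Set ℂ := {z | 0 < z.re + k * ‖z‖}

theorem isOpen_openSector (k : ℝ) : IsOpen (openSector k) :=
  isOpen_lt continuous_const (by fun_prop)

theorem ne_zero_of_mem_openSector {k : ℝ} {z : ℂ} (h : z ∈ openSector k) : z ≠ 0 := by
  rintro rfl
  simp [openSector] at h

theorem openSector_subset_sector {φ : ℝ} (hφ : φ ∈ Ioo (Real.pi / 2) Real.pi) :
    openSector (-Real.cos φ) ⊆ sector φ := by
  intro z hz
  have hz0 := ne_zero_of_mem_openSector hz
  simp only [openSector, mem_ofPred_eq] at hz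
  simp only [sector, mem_ofPred_eq]
  by_contra! h
  have h1 : Real.cos |Complex.arg z| < Real.cos φ :=
    Real.cos_lt_cos_of_nonneg_of_le_pi (by linarith [hφ.1, Real.pi_pos])
      (abs_le.2 ⟨(Complex.neg_pi_lt_arg z).le, Complex.arg_le_pi z⟩) h
  rw [Real.cos_abs, Complex.cos_arg hz0, div_lt_iff₀ (norm_pos_iff.2 hz0)] at h1
  linarith

theorem openSector_subset_interior {φ : ℝ} (hφ : φ ∈ Ioo (Real.pi / 2) Real.pi) :
    openSector (-Real.cos φ) ⊆ interior (sector φ) :=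
  interior_maximal (openSector_subset_sector hφ) (isOpen_openSector _)

/-- By `‖z‖ ≥ r - 1`, the defining quantity is at least `(1 - k) + r (k + cos α) > 0`. -/
theorem rayPoint_mem_openSector {α β k r : ℝ} (h : Real.cos α ≤ Real.cos β) (hr : 0 ≤ r)
    (hk : -Real.cos α < k) (hk0 : 0 ≤ k) (hk1 : k < 1) : rayPoint r β ∈ openSector k := by
  simp only [openSector, mem_ofPred_eq, rayPoint_re]
  have h1 : r - 1 ≤ ‖rayPoint r β‖ := by
    have := norm_sub_le (rayPoint r β) 1
    rw [norm_rayPoint_sub_one hr, norm_one] at this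
    linarith
  have h2 : r * Real.cos α ≤ r * Real.cos β := by gcongr
  have h3 : k * (r - 1) ≤ k * ‖rayPoint r β‖ := by gcongr
  nlinarith [mul_nonneg hr (by linarith : 0 ≤ k + Real.cos α)]

section Cauchy

variable {E : Type*} [NormedAddCommGroup E] [NormedSpace ℂ E]

/-- In the coordinate `w` with `z = 1 + e^w`, rays from `1` become horizontal lines and arcs around
`1` become vertical ones, which allows Cauchy's theorem on rectangles. -/
theorem integral_exp_substitution {ε ρ : ℝ} (hε : 0 < ε) (hρ : 0 < ρ) (β : ℝ) (G : ℂ → E)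
    (hG : Continuous fun r => G (rayPoint r β)) :
    ∫ x in Real.log ε..Real.log ρ, exp (x + β * I) • G (1 + exp (x + β * I)) =
      ∫ r in ε..ρ, exp (β * I) • G (rayPoint r β) := by
  have h := intervalIntegral.integral_deriv_smul_comp (a := Real.log ε) (b := Real.log ρ)
    (f := Real.exp) (f' := Real.exp) (g := fun r => exp (β * I) • G (rayPoint r β))
    (fun x _ => Real.hasDerivAt_exp x) Real.continuous_exp.continuousOn
    (hG.const_smul _)
  rw [Real.exp_log hε, Real.exp_log hρ] at h
  rw [← h]
  refine intervalIntegral.integral_congr fun x _ => ?_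
  simp only [Function.comp, rayPoint]
  rw [Complex.exp_add, Complex.ofReal_exp, mul_smul, ← Complex.ofReal_exp, Complex.coe_smul]

/-- Rotating a segment from `1` of length `ρ`: Cauchy's theorem in a sector. -/
theorem norm_ray_integral_sub_le {G : ℂ → E} {U : Set ℂ} (hG : DifferentiableOn ℂ G U)
    (hU : IsOpen U) {β₁ β₂ ρ S : ℝ} (hβ : β₁ ≤ β₂) (hρ : 0 < ρ)
    (hmem : ∀ r, ∀ β ∈ Icc β₁ β₂, 0 ≤ r → rayPoint r β ∈ U)
    (hS : ∀ β ∈ Icc β₁ β₂, ‖G (rayPoint ρ β)‖ ≤ S) :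
    ‖(∫ r in (0 : ℝ)..ρ, exp (β₂ * I) • G (rayPoint r β₂)) -
      ∫ r in (0 : ℝ)..ρ, exp (β₁ * I) • G (rayPoint r β₁)‖ ≤ (β₂ - β₁) * (ρ * S) := by
  -- extend along the rays by a constant to have globally continuous integrands
  have hcont : ∀ β ∈ Icc β₁ β₂, Continuous fun r : ℝ => G (rayPoint (max r 0) β) := by
    intro β hβ'
    refine hG.continuousOn.comp_continuous
      ((continuous_rayPoint β).comp (continuous_id.max continuous_const)) fun r => ?_
    exact hmem _ β hβ' (le_max_right _ _)
  have hint : ∀ β ∈ Icc β₁ β₂, ∀ a b : ℝ, 0 ≤ a → 0 ≤ b →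
      IntervalIntegrable (fun r => exp (β * I) • G (rayPoint r β)) volume a b := by
    intro β hβ' a b ha hb
    refine (((hcont β hβ').const_smul (exp (β * I))).intervalIntegrable a b).congr_ae ?_
    refine (ae_restrict_mem measurableSet_uIoc).mono fun r hr => ?_
    have : 0 ≤ r := (le_min ha hb).trans hr.1.le
    simp [max_eq_left this]
  -- Boundedness near the vertex makes the contribution of the small arc of radius `ε` vanish in the
  -- limit.
  obtain ⟨δ, hδ, M, hM⟩ : ∃ δ > 0, ∃ M : ℝ, ∀ z : ℂ, ‖z - 1‖ < δ → ‖G z‖ ≤ M := by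
    have h1 : (1 : ℂ) ∈ U := by
      have := hmem 0 β₁ ⟨le_rfl, hβ⟩ le_rfl
      simpa [rayPoint] using this
    have h2 : ContinuousAt G 1 := (hG.differentiableAt (hU.mem_nhds h1)).continuousAt
    obtain ⟨δ, hδ, h3⟩ := Metric.continuousAt_iff.1 h2 1 one_pos
    refine ⟨δ, hδ, ‖G 1‖ + 1, fun z hz => ?_⟩
    have h4 := h3 (x := z) (by rwa [dist_eq_norm])
    rw [dist_eq_norm] at h4
    have := norm_le_norm_add_norm_sub' (G z) (G 1)
    linarith
  set P : ℝ → ℝ → E := fun ε β => ∫ r in ε..ρ, exp (β * I) • G (rayPoint r β) with hP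
  have hstep : ∀ ε, 0 < ε → ε < δ → ε ≤ ρ →
      ‖P ε β₂ - P ε β₁‖ ≤ (β₂ - β₁) * (ρ * S) + (β₂ - β₁) * (ε * M) := by
    intro ε hε hεδ hερ
    -- The rectangle `[log ε, log ρ] × [β₁, β₂]` corresponds to the truncated sector between the two
    -- rays; its vertical sides are the arcs of radius `ε` and `ρ`.
    set f : ℂ → E := fun w => exp w • G (1 + exp w) with hf
    have hfd : DifferentiableOn ℂ f
        (uIcc (Real.log ε + β₁ * I : ℂ).re (Real.log ρ + β₂ * I : ℂ).re ×ℂ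
          uIcc (Real.log ε + β₁ * I : ℂ).im (Real.log ρ + β₂ * I : ℂ).im) := by
      refine Complex.differentiable_exp.differentiableOn.smul
        (hG.comp (by fun_prop) fun w hw => ?_)
      rw [Complex.mem_reProdIm] at hw
      have him : w.im ∈ Icc β₁ β₂ := by simpa [uIcc_of_le hβ] using hw.2
      have := hmem (Real.exp w.re) w.im him (Real.exp_pos _).le
      convert this using 1
      rw [rayPoint, Complex.ofReal_exp, ← Complex.exp_add, Complex.re_add_im]
    have hrect := Complex.integral_boundary_rect_eq_zero_of_differentiableOn f
      (Real.log ε + β₁ * I) (Real.log ρ + β₂ * I) hfd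
    simp only [Complex.add_re, Complex.ofReal_re, Complex.mul_re, Complex.I_re, mul_zero,
      Complex.ofReal_im, Complex.I_im, mul_one, sub_self, add_zero, Complex.add_im, Complex.mul_im,
      zero_add] at hrect
    have hsub : ∀ β ∈ Icc β₁ β₂, ∫ x in Real.log ε..Real.log ρ, f (x + β * I) = P ε β := by
      intro β hβ'
      -- The substitution asks for continuity at all real `r`, while `G` is controlled only for `r ≥
      -- 0`. Hence `G` is precomposed with a retraction onto the ray, which changes nothing on the
      -- ray itself.
      have h1 := integral_exp_substitution hε hρ β
        (fun z => G (rayPoint (max ((z - 1) * exp (-(β * I))).re 0) β)) ?_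
      · have e : ∀ r : ℝ, 0 ≤ r →
            rayPoint (max ((rayPoint r β - 1) * exp (-(β * I))).re 0) β = rayPoint r β := by
          intro r hr
          have : (rayPoint r β - 1) * exp (-(β * I)) = r := by
            simp [rayPoint, mul_assoc, ← Complex.exp_add]
          rw [this, Complex.ofReal_re, max_eq_left hr]
        have h2 : ∫ x in Real.log ε..Real.log ρ, f (x + β * I) =
            ∫ x in Real.log ε..Real.log ρ, exp (x + β * I) •
              (fun z => G (rayPoint (max ((z - 1) * exp (-(β * I))).re 0) β))
                (1 + exp (x + β * I)) := by
          refine intervalIntegral.integral_congr fun x _ => ?_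
          have e2 : 1 + exp (x + β * I) = rayPoint (Real.exp x) β := by
            rw [rayPoint, Complex.ofReal_exp, Complex.exp_add]
          simp only [hf]
          rw [e2, e _ (Real.exp_pos x).le]
        rw [h2, h1, hP]
        refine intervalIntegral.integral_congr fun r hr => ?_
        rw [uIcc_of_le hερ] at hr
        rw [e r (hε.le.trans hr.1)]
      · have : (fun r : ℝ => G (rayPoint (max ((rayPoint r β - 1) * exp (-(β * I))).re 0) β)) =
            fun r : ℝ => G (rayPoint (max r 0) β) := by
          funext r
          have : (rayPoint r β - 1) * exp (-(β * I)) = r := by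
            simp [rayPoint, mul_assoc, ← Complex.exp_add]
          rw [this, Complex.ofReal_re]
        simp only [this]
        exact hcont β hβ'
    rw [hsub β₁ ⟨le_rfl, hβ⟩, hsub β₂ ⟨hβ, le_rfl⟩] at hrect
    have harc : ∀ a : ℝ, 0 < a → ∀ K : ℝ, (∀ β ∈ Icc β₁ β₂, ‖G (rayPoint a β)‖ ≤ K) →
        ‖I • ∫ y in β₁..β₂, f (Real.log a + y * I)‖ ≤ (β₂ - β₁) * (a * K) := by
      intro a ha K hK
      rw [norm_smul, Complex.norm_I, one_mul]
      have := intervalIntegral.norm_integral_le_of_norm_le_const (a := β₁) (b := β₂)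
        (f := fun y : ℝ => f (Real.log a + y * I)) (C := a * K) fun y hy => by
          rw [uIoc_of_le hβ] at hy
          have e2 : exp (Real.log a + y * I) = a * exp (y * I) := by
            rw [Complex.exp_add, ← Complex.ofReal_exp, Real.exp_log ha]
          simp only [hf, e2]
          rw [norm_smul, norm_mul, Complex.norm_exp_ofReal_mul_I, mul_one, Complex.norm_real,
            Real.norm_of_nonneg ha.le]
          gcongr
          exact hK y ⟨hy.1.le, hy.2⟩
      rw [abs_of_nonneg (sub_nonneg.2 hβ)] at this
      linarith
    have h5 := harc ρ hρ S hS
    have h6 := harc ε hε M fun β hβ' => hM _ (by rwa [norm_rayPoint_sub_one hε.le])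
    have h7 : P ε β₂ - P ε β₁ = I • (∫ y in β₁..β₂, f (Real.log ρ + y * I)) -
        I • ∫ y in β₁..β₂, f (Real.log ε + y * I) := by
      rw [← sub_eq_zero, ← neg_eq_zero]
      rw [← hrect]
      abel
    rw [h7]
    exact (norm_sub_le _ _).trans (add_le_add h5 h6)
  have hlim : ∀ β ∈ Icc β₁ β₂,
      Filter.Tendsto (fun ε => P ε β) (nhdsWithin 0 (Ioi 0)) (nhds (P 0 β)) := by
    intro β hβ'
    have h1 : ContinuousOn (fun ε => ∫ r in ρ..ε, exp (β * I) • G (rayPoint r β)) (uIcc ρ 0) :=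
      intervalIntegral.continuousOn_primitive_interval' (hint β hβ' _ _ hρ.le le_rfl)
        left_mem_uIcc
    have h2 := (h1 0 right_mem_uIcc).neg
    rw [uIcc_of_ge hρ.le] at h2
    have h3 : ∀ ε, P ε β = -∫ r in ρ..ε, exp (β * I) • G (rayPoint r β) := fun ε =>
      intervalIntegral.integral_symm _ _
    simp only [h3]
    refine h2.tendsto.mono_left ?_
    rw [← nhdsWithin_Ioc_eq_nhdsGT hρ]
    exact nhdsWithin_mono _ Ioc_subset_Icc_self
  have hl := ((hlim β₂ ⟨hβ, le_rfl⟩).sub (hlim β₁ ⟨le_rfl, hβ⟩)).norm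
  have hr : Filter.Tendsto (fun ε : ℝ => (β₂ - β₁) * (ρ * S) + (β₂ - β₁) * (ε * M))
      (nhdsWithin 0 (Ioi 0)) (nhds ((β₂ - β₁) * (ρ * S) + (β₂ - β₁) * (0 * M))) := by
    refine Filter.Tendsto.mono_left ?_ nhdsWithin_le_nhds
    exact Continuous.tendsto (by fun_prop) 0
  have := le_of_tendsto_of_tendsto hl hr (by
    have h1 : Ioo 0 (min δ ρ) ∈ nhdsWithin (0 : ℝ) (Ioi 0) := Ioo_mem_nhdsGT (lt_min hδ hρ)
    filter_upwards [h1] with ε hε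
    exact hstep ε hε.1 (hε.2.trans_le (min_le_left _ _)) (hε.2.le.trans (min_le_right _ _)))
  simp only [zero_mul, mul_zero, add_zero] at this
  exact this

end Cauchy

end

/-! ### The contour of two rays, closed on the right or on the left. -/

section

open Complex (I exp)

/-- The contour formed by the two rays from `1` in the directions `± α`, traversed upwards. -/
noncomputable def contour (α x : ℝ) : ℂ := 1 + |x| * Real.cos α + x * Real.sin α * I

/-- The derivative of `contour`. -/
noncomputable def contourDeriv (α x : ℝ) : ℂ :=
  if 0 ≤ x then exp (α * I) else -exp (-(α * I))

theorem contour_of_nonneg {α x : ℝ} (hx : 0 ≤ x) : contour α x = rayPoint x α := by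
  rw [contour, rayPoint, abs_of_nonneg hx, Complex.exp_mul_I, Complex.ofReal_cos,
    Complex.ofReal_sin]
  ring

theorem contour_of_nonpos {α x : ℝ} (hx : x ≤ 0) : contour α x = rayPoint (-x) (-α) := by
  rw [contour, rayPoint, abs_of_nonpos hx, Complex.exp_mul_I, Complex.ofReal_cos,
    Complex.ofReal_sin]
  simp only [Complex.ofReal_neg, Complex.cos_neg, Complex.sin_neg]
  ring

theorem contour_eq_rayPoint (α x : ℝ) :
    ∃ β : ℝ, |β| = |α| ∧ contour α x = rayPoint |x| β := by
  rcases le_total 0 x with h | h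
  · exact ⟨α, rfl, by rw [contour_of_nonneg h, abs_of_nonneg h]⟩
  · exact ⟨-α, abs_neg α, by rw [contour_of_nonpos h, abs_of_nonpos h]⟩

theorem continuous_contour (α : ℝ) : Continuous (contour α) := by
  unfold contour; fun_prop

theorem measurable_contourDeriv (α : ℝ) : Measurable (contourDeriv α) := by
  unfold contourDeriv
  exact Measurable.ite measurableSet_Ici measurable_const measurable_const

theorem norm_contourDeriv (α x : ℝ) : ‖contourDeriv α x‖ = 1 := by
  unfold contourDeriv
  split_ifs
  · exact Complex.norm_exp_ofReal_mul_I α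
  · rw [norm_neg, ← neg_mul, ← Complex.ofReal_neg, Complex.norm_exp_ofReal_mul_I]

theorem contour_re (α x : ℝ) : (contour α x).re = 1 + |x| * Real.cos α := by
  simp [contour, -Complex.ofReal_cos, -Complex.ofReal_sin]

theorem norm_contour_le (α x : ℝ) : ‖contour α x‖ ≤ 1 + |x| := by
  obtain ⟨β, -, h⟩ := contour_eq_rayPoint α x
  rw [h]; exact norm_rayPoint_le (abs_nonneg x)

theorem norm_contour_ge (α x : ℝ) : √((1 + Real.cos α) / 2) * (1 + |x|) ≤ ‖contour α x‖ := by
  obtain ⟨β, hβ, h⟩ := contour_eq_rayPoint α x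
  rw [h]
  refine norm_rayPoint_ge ?_ (abs_nonneg x)
  rw [← Real.cos_abs β, hβ, Real.cos_abs]

theorem contour_mem_openSector {α k : ℝ} (hk : -Real.cos α < k) (hk0 : 0 ≤ k) (hk1 : k < 1)
    (x : ℝ) : contour α x ∈ openSector k := by
  obtain ⟨β, hβ, h⟩ := contour_eq_rayPoint α x
  rw [h]
  refine rayPoint_mem_openSector (α := α) ?_ (abs_nonneg x) hk hk0 hk1
  rw [← Real.cos_abs β, hβ, Real.cos_abs]

section

variable {E : Type*} [NormedAddCommGroup E] [NormedSpace ℂ E]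

theorem intervalIntegral_contour {α : ℝ} {G : ℂ → E} (hG : Continuous fun x => G (contour α x))
    {ρ : ℝ} (hρ : 0 ≤ ρ) :
    ∫ x in -ρ..ρ, contourDeriv α x • G (contour α x) =
      (∫ r in (0 : ℝ)..ρ, exp (α * I) • G (rayPoint r α)) -
        ∫ r in (0 : ℝ)..ρ, exp ((-α : ℝ) * I) • G (rayPoint r (-α)) := by
  have e1 : ∀ x ∈ uIoc 0 ρ, contourDeriv α x • G (contour α x) =
      exp (α * I) • G (contour α x) := by
    intro x hx
    rw [uIoc_of_le hρ] at hx
    rw [contourDeriv, if_pos hx.1.le]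
  have e2 : ∀ᵐ x : ℝ, x ∈ uIoc (-ρ) 0 → contourDeriv α x • G (contour α x) =
      -(exp ((-α : ℝ) * I) • G (contour α x)) := by
    have h0 : ∀ᵐ x : ℝ, x ≠ 0 := by simp [ae_iff]
    filter_upwards [h0] with x hx0 hx
    rw [uIoc_of_le (by linarith)] at hx
    have : ¬ 0 ≤ x := not_le.2 (lt_of_le_of_ne hx.2 hx0)
    rw [contourDeriv, if_neg this, neg_smul, Complex.ofReal_neg, neg_mul]
  have i1 : IntervalIntegrable (fun x => contourDeriv α x • G (contour α x)) volume 0 ρ :=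
    ((hG.const_smul (exp (α * I))).intervalIntegrable 0 ρ).congr
      (fun x hx => (e1 x hx).symm)
  have i2 : IntervalIntegrable (fun x => contourDeriv α x • G (contour α x)) volume (-ρ) 0 :=
    ((hG.const_smul (exp ((-α : ℝ) * I))).neg.intervalIntegrable (-ρ) 0).congr_ae (by
      rw [Filter.EventuallyEq, ae_restrict_iff' measurableSet_uIoc]
      filter_upwards [e2] with x hx hm using (hx hm).symm)
  rw [← intervalIntegral.integral_add_adjacent_intervals i2 i1,
    intervalIntegral.integral_congr_ae e2,
    intervalIntegral.integral_congr_ae (Filter.Eventually.of_forall e1)]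
  have h1 : ∫ x in (0 : ℝ)..ρ, exp (α * I) • G (contour α x) =
      ∫ r in (0 : ℝ)..ρ, exp (α * I) • G (rayPoint r α) := by
    refine intervalIntegral.integral_congr fun x hx => ?_
    rw [uIcc_of_le hρ] at hx
    simp only [contour_of_nonneg hx.1]
  have h2 : ∫ x in -ρ..0, -(exp ((-α : ℝ) * I) • G (contour α x)) =
      -∫ r in (0 : ℝ)..ρ, exp ((-α : ℝ) * I) • G (rayPoint r (-α)) := by
    rw [intervalIntegral.integral_neg]
    congr 1
    have := intervalIntegral.integral_comp_neg (a := -ρ) (b := 0)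
      (f := fun r => exp ((-α : ℝ) * I) • G (rayPoint r (-α)))
    rw [neg_zero, neg_neg] at this
    rw [← this]
    refine intervalIntegral.integral_congr fun x hx => ?_
    rw [uIcc_of_le (by linarith)] at hx
    simp only [contour_of_nonpos hx.2]
  rw [h1, h2]
  abel

/-- Closing the truncated contour on the right. -/
theorem norm_intervalIntegral_contour_le_right {α : ℝ} (hα : α ∈ Ioo (Real.pi / 2) Real.pi)
    {k : ℝ} (hk : -Real.cos α < k) (hk1 : k < 1) {G : ℂ → E}
    (hG : DifferentiableOn ℂ G (openSector k)) {ρ S : ℝ} (hρ : 0 < ρ)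
    (hS : ∀ z ∈ openSector k, √((1 + Real.cos α) / 2) * (1 + ρ) ≤ ‖z‖ → ‖G z‖ ≤ S) :
    ‖∫ x in -ρ..ρ, contourDeriv α x • G (contour α x)‖ ≤ 2 * α * (ρ * S) := by
  have hk0 : 0 ≤ k := by
    have := Real.cos_nonpos_of_pi_div_two_le_of_le hα.1.le (by linarith [hα.2, Real.pi_pos])
    linarith
  have hα0 : 0 ≤ α := by linarith [hα.1, Real.pi_pos]
  rw [intervalIntegral_contour (hG.continuousOn.comp_continuous (continuous_contour α)
    (contour_mem_openSector hk hk0 hk1)) hρ.le]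
  have hcos : ∀ β ∈ Icc (-α) α, Real.cos α ≤ Real.cos β := fun β hβ =>
    cos_le_cos_of_abs_le hα.2.le (abs_le.2 hβ)
  have hmem : ∀ r, ∀ β ∈ Icc (-α) α, 0 ≤ r → rayPoint r β ∈ openSector k := fun r β hβ hr =>
    rayPoint_mem_openSector (hcos β hβ) hr hk hk0 hk1
  have := norm_ray_integral_sub_le hG (isOpen_openSector k) (by linarith : -α ≤ α) hρ hmem
    (S := S) fun β hβ => hS _ (hmem ρ β hβ hρ.le) (norm_rayPoint_ge (hcos β hβ) hρ.le)
  refine this.trans_eq ?_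
  ring

/-- Closing the truncated contour on the left. -/
theorem norm_intervalIntegral_contour_le_left {α : ℝ} (hα : α ∈ Ioo (Real.pi / 2) Real.pi)
    {G : ℂ → E} {U : Set ℂ} (hU : IsOpen U) (hG : DifferentiableOn ℂ G U)
    (hmem : ∀ z : ℂ, z.re ≤ 1 → z ∈ U) {ρ S : ℝ} (hρ : 0 < ρ)
    (hS : ∀ z : ℂ, z.re ≤ 1 + ρ * Real.cos α → ‖z - 1‖ = ρ → ‖G z‖ ≤ S) :
    ‖∫ x in -ρ..ρ, contourDeriv α x • G (contour α x)‖ ≤ 2 * (Real.pi - α) * (ρ * S) := by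
  have hcα : Real.cos α ≤ 0 :=
    Real.cos_nonpos_of_pi_div_two_le_of_le hα.1.le (by linarith [hα.2, Real.pi_pos])
  have hα0 : 0 ≤ α := by linarith [hα.1, Real.pi_pos]
  have hcm : ∀ x, contour α x ∈ U := fun x => hmem _ (by
    rw [contour_re]
    linarith [mul_nonpos_of_nonneg_of_nonpos (abs_nonneg x) hcα])
  rw [intervalIntegral_contour (hG.continuousOn.comp_continuous (continuous_contour α) hcm) hρ.le]
  have hcos : ∀ β ∈ Icc α (2 * Real.pi - α), Real.cos β ≤ Real.cos α := fun β hβ =>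
    cos_le_cos_of_mem_left hα0 hβ
  have hre : ∀ r, ∀ β ∈ Icc α (2 * Real.pi - α), 0 ≤ r →
      (rayPoint r β).re ≤ 1 + r * Real.cos α := by
    intro r β hβ hr
    rw [rayPoint_re]
    have := mul_le_mul_of_nonneg_left (hcos β hβ) hr
    linarith
  have := norm_ray_integral_sub_le hG hU (by linarith [hα.2] : α ≤ 2 * Real.pi - α) hρ
    (fun r β hβ hr => hmem _ ((hre r β hβ hr).trans
      (by linarith [mul_nonpos_of_nonneg_of_nonpos hr hcα])))
    (S := S) fun β hβ => hS _ (hre ρ β hβ hρ.le) (norm_rayPoint_sub_one hρ.le)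
  -- Rotating from angle `α` through the negative axis to `2π - α` ends on the lower ray, because
  -- the exponential has period `2πi`.
  have e : exp ((2 * Real.pi - α : ℝ) * I) = exp ((-α : ℝ) * I) := by
    rw [show ((2 * Real.pi - α : ℝ) * I : ℂ) = (-α : ℝ) * I + 2 * Real.pi * I by push_cast; ring,
      Complex.exp_add, Complex.exp_two_pi_mul_I, mul_one]
  have e' : ∀ r, rayPoint r (2 * Real.pi - α) = rayPoint r (-α) := fun r => by
    rw [rayPoint, rayPoint, e]
  simp only [e, e'] at this
  rw [← norm_neg, neg_sub]
  refine this.trans_eq ?_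
  ring

theorem integrable_one_add_abs_sq_inv : Integrable fun x : ℝ => ((1 + |x|) ^ 2)⁻¹ := by
  refine (integrable_inv_one_add_sq).mono' (by fun_prop) ?_
  refine Filter.Eventually.of_forall fun x => ?_
  rw [Real.norm_of_nonneg (by positivity)]
  have : 1 + x ^ 2 ≤ (1 + |x|) ^ 2 := by nlinarith [abs_nonneg x, sq_abs x]
  gcongr

theorem integral_eq_zero_of_truncated_tendsto {f : ℝ → E} (hf : Integrable f) {b : ℝ → ℝ}
    (hb : Filter.Tendsto b Filter.atTop (nhds 0))
    (h : ∀ᶠ ρ in Filter.atTop, ‖∫ x in -ρ..ρ, f x‖ ≤ b ρ) : ∫ x, f x = 0 := by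
  have h1 : Filter.Tendsto (fun ρ : ℝ => ∫ x in -ρ..ρ, f x) Filter.atTop (nhds (∫ x, f x)) :=
    intervalIntegral_tendsto_integral hf Filter.tendsto_neg_atTop_atBot Filter.tendsto_id
  exact tendsto_nhds_unique h1 (squeeze_zero_norm' h hb)

end

theorem one_add_cos_pos {α : ℝ} (hα : α ∈ Ioo (Real.pi / 2) Real.pi) : 0 < 1 + Real.cos α := by
  have := Real.cos_lt_cos_of_nonneg_of_le_pi (by linarith [hα.1, Real.pi_pos]) le_rfl hα.2
  rw [Real.cos_pi] at this
  linarith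

theorem cos_neg_of_mem {α : ℝ} (hα : α ∈ Ioo (Real.pi / 2) Real.pi) : Real.cos α < 0 :=
  Real.cos_neg_of_pi_div_two_lt_of_lt hα.1 (by linarith [hα.2, Real.pi_pos])

section

variable {E : Type*} [NormedAddCommGroup E] [NormedSpace ℂ E]

/-- Cauchy's theorem for functions decaying quadratically in a sector. -/
theorem integral_contour_eq_zero {α : ℝ} (hα : α ∈ Ioo (Real.pi / 2) Real.pi)
    {k : ℝ} (hk : -Real.cos α < k) (hk1 : k < 1) {G : ℂ → E}
    (hG : DifferentiableOn ℂ G (openSector k)) {C : ℝ}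
    (hC : ∀ z ∈ openSector k, √((1 + Real.cos α) / 2) ≤ ‖z‖ → ‖G z‖ ≤ C / ‖z‖ ^ 2) :
    ∫ x, contourDeriv α x • G (contour α x) = 0 := by
  set δ := √((1 + Real.cos α) / 2) with hδ
  have hδ0 : 0 < δ := Real.sqrt_pos.2 (by linarith [one_add_cos_pos hα])
  have hk0 : 0 ≤ k := by linarith [cos_neg_of_mem hα]
  have hcm := contour_mem_openSector hk hk0 hk1
  have hC' : ∀ z ∈ openSector k, ∀ ρ, 0 ≤ ρ → δ * (1 + ρ) ≤ ‖z‖ →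
      ‖G z‖ ≤ |C| / δ ^ 2 * ((1 + ρ) ^ 2)⁻¹ := by
    intro z hz ρ hρ hzρ
    have h1 : δ ≤ ‖z‖ := le_trans (by nlinarith) hzρ
    refine (hC z hz h1).trans ?_
    have : |C| / δ ^ 2 * ((1 + ρ) ^ 2)⁻¹ = |C| / (δ * (1 + ρ)) ^ 2 := by
      field_simp
    rw [this]
    have h2 : 0 < δ * (1 + ρ) := by positivity
    calc C / ‖z‖ ^ 2 ≤ |C| / ‖z‖ ^ 2 := by gcongr; exact le_abs_self C
      _ ≤ _ := by gcongr
  have hint : Integrable fun x => contourDeriv α x • G (contour α x) := by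
    refine (integrable_one_add_abs_sq_inv.const_mul (|C| / δ ^ 2)).mono' ?_ ?_
    · exact (measurable_contourDeriv α).aestronglyMeasurable.smul
        (hG.continuousOn.comp_continuous (continuous_contour α) hcm).aestronglyMeasurable
    · refine Filter.Eventually.of_forall fun x => ?_
      rw [norm_smul, norm_contourDeriv, one_mul]
      exact hC' _ (hcm x) _ (abs_nonneg x) (norm_contour_ge α x)
  refine integral_eq_zero_of_truncated_tendsto hint
    (b := fun ρ => 2 * α * (|C| / δ ^ 2 * ρ⁻¹)) ?_ ?_
  · have := (tendsto_inv_atTop_zero (𝕜 := ℝ)).const_mul (|C| / δ ^ 2)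
    have := this.const_mul (2 * α)
    simpa using this
  · filter_upwards [Filter.eventually_gt_atTop 0] with ρ hρ
    refine (norm_intervalIntegral_contour_le_right hα hk hk1 hG hρ
      (S := |C| / δ ^ 2 * ((1 + ρ) ^ 2)⁻¹) fun z hz h => hC' z hz ρ hρ.le h).trans ?_
    have hα0 : 0 ≤ α := by linarith [hα.1, Real.pi_pos]
    have : ρ * (|C| / δ ^ 2 * ((1 + ρ) ^ 2)⁻¹) ≤ |C| / δ ^ 2 * ρ⁻¹ := by
      rw [mul_left_comm]
      gcongr
      rw [← div_eq_mul_inv, div_le_iff₀ (by positivity), inv_mul_eq_div, le_div_iff₀ hρ]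
      nlinarith
    gcongr

/-- Truncated contour integrals of functions of order `1 / |z|` are bounded. -/
theorem exists_bound_intervalIntegral_contour {α : ℝ} (hα : α ∈ Ioo (Real.pi / 2) Real.pi)
    {k : ℝ} (hk : -Real.cos α < k) (hk1 : k < 1) {G : ℂ → E}
    (hG : DifferentiableOn ℂ G (openSector k)) {C : ℝ}
    (hC : ∀ z ∈ openSector k, ‖G z‖ ≤ C / ‖z‖) {ρ : ℝ} (hρ : 0 < ρ) :
    ‖∫ x in -ρ..ρ, contourDeriv α x • G (contour α x)‖ ≤
      2 * α * (|C| / √((1 + Real.cos α) / 2)) := by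
  set δ := √((1 + Real.cos α) / 2) with hδ
  have hδ0 : 0 < δ := Real.sqrt_pos.2 (by linarith [one_add_cos_pos hα])
  -- A function of order `1/|z|` is not absolutely integrable along the contour. The truncated
  -- integral equals one over the arc of radius `ρ`, whose length `O(ρ)` compensates the size
  -- `O(1/ρ)`.
  refine (norm_intervalIntegral_contour_le_right hα hk hk1 hG hρ
      (S := |C| / (δ * (1 + ρ))) fun z hz h => ?_).trans ?_
  · refine (hC z hz).trans ?_
    calc C / ‖z‖ ≤ |C| / ‖z‖ := by gcongr; exact le_abs_self C
      _ ≤ _ := by gcongr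
  · have hα0 : 0 ≤ α := by linarith [hα.1, Real.pi_pos]
    have : ρ * (|C| / (δ * (1 + ρ))) ≤ |C| / δ := by
      rw [mul_div_assoc', div_le_div_iff₀ (by positivity) hδ0]
      nlinarith [mul_nonneg (abs_nonneg C) hδ0.le]
    gcongr

end

theorem integrable_exp_neg_mul_abs {c : ℝ} (hc : 0 < c) :
    Integrable fun x : ℝ => Real.exp (-(c * |x|)) := by
  have h1 : IntegrableOn (fun x : ℝ => Real.exp (-(c * |x|))) (Ioi 0) := by
    refine (integrableOn_congr_fun (fun x hx => ?_) measurableSet_Ioi).1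
      (exp_neg_integrableOn_Ioi 0 hc)
    simp [abs_of_pos (show 0 < x from hx)]
  have h2 : IntegrableOn (fun x : ℝ => Real.exp (-(c * |x|))) (Iic 0) := by
    have := (integrableOn_Iic_iff_integrableOn_Iio (μ := volume)
      (f := fun x : ℝ => Real.exp (-(c * |x|))) (b := 0)).2 ?_
    · exact this
    · have h3 := h1.comp_neg
      simpa using h3
  have := h2.union h1
  rwa [Iic_union_Ioi, integrableOn_univ] at this

theorem norm_exp_contour_mul (α x s : ℝ) :
    ‖exp (contour α x * s)‖ = Real.exp s * Real.exp (-(-Real.cos α * s * |x|)) := by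
  rw [Complex.norm_exp, ← Real.exp_add]
  congr 1
  rw [Complex.re_mul_ofReal, contour_re]
  ring

theorem integrable_exp_contour {α : ℝ} (hα : α ∈ Ioo (Real.pi / 2) Real.pi) {s : ℝ} (hs : 0 < s) :
    Integrable fun x => contourDeriv α x • exp (contour α x * s) := by
  have hc : 0 < -Real.cos α * s := mul_pos (by linarith [cos_neg_of_mem hα]) hs
  refine ((integrable_exp_neg_mul_abs hc).const_mul (Real.exp s)).mono' ?_ ?_
  · refine (measurable_contourDeriv α).aestronglyMeasurable.smul ?_
    have := continuous_contour α
    exact (by fun_prop : Continuous fun x => exp (contour α x * s)).aestronglyMeasurable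
  · refine Filter.Eventually.of_forall fun x => ?_
    rw [norm_smul, norm_contourDeriv, one_mul, norm_exp_contour_mul]

/-- The integrand is entire and decays exponentially to the left because `cos α < 0`; closing the
contour on the left leaves nothing. -/
theorem integral_exp_contour {α : ℝ} (hα : α ∈ Ioo (Real.pi / 2) Real.pi) {s : ℝ} (hs : 0 < s) :
    ∫ x, contourDeriv α x • exp (contour α x * s) = 0 := by
  set c := -Real.cos α * s with hcdef
  have hc : 0 < c := mul_pos (by linarith [cos_neg_of_mem hα]) hs
  refine integral_eq_zero_of_truncated_tendsto (integrable_exp_contour hα hs)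
    (b := fun ρ => 2 * (Real.pi - α) * (ρ * (Real.exp s * Real.exp (-(c * ρ))))) ?_ ?_
  · have h1 : Filter.Tendsto (fun ρ : ℝ => ρ ^ (1 : ℝ) * Real.exp (-c * ρ)) Filter.atTop (nhds 0) :=
      tendsto_rpow_mul_exp_neg_mul_atTop_nhds_zero 1 c hc
    have h2 := h1.const_mul (2 * (Real.pi - α) * Real.exp s)
    rw [mul_zero] at h2
    refine h2.congr fun ρ => ?_
    rw [Real.rpow_one, neg_mul]; ring
  · filter_upwards [Filter.eventually_gt_atTop 0] with ρ hρ
    refine norm_intervalIntegral_contour_le_left hα isOpen_univ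
      (G := fun z => exp (z * s)) (by fun_prop) (fun _ _ => mem_univ _) hρ fun z hz _ => ?_
    rw [Complex.norm_exp, Complex.re_mul_ofReal, ← Real.exp_add]
    refine Real.exp_le_exp.2 ?_
    rw [hcdef]
    nlinarith

end

/-! ### The residue of `e^{zT}/z` at the origin, by an explicit comparison function. -/

section

open Complex (I exp)

/-- With `e = e^{iα}`, the integrand is the derivative of `log ((1 + re)/(1 - re))`, which vanishes
at `r = 0` and tends to a logarithm of `-1`. The function `2/((2 - z)z)` is chosen for having
residue `1` at `0` and decaying quadratically. -/
theorem integral_Ioi_ray_two_div {α : ℝ} (hα : α ∈ Ioo (Real.pi / 2) Real.pi) :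
    IntegrableOn (fun r : ℝ => exp (α * I) * (2 / ((2 - rayPoint r α) * rayPoint r α))) (Ioi 0) ∧
    ∫ r in Ioi (0 : ℝ), exp (α * I) * (2 / ((2 - rayPoint r α) * rayPoint r α)) =
      Real.pi * I := by
  set e := exp (α * I) with he
  have hsin : 0 < Real.sin α := Real.sin_pos_of_pos_of_lt_pi (by linarith [hα.1, Real.pi_pos]) hα.2
  have heim : e.im = Real.sin α := by simp [he, Complex.exp_ofReal_mul_I_im]
  have hen : ‖e‖ = 1 := Complex.norm_exp_ofReal_mul_I α
  have hre : e.re = Real.cos α := by simp [he, Complex.exp_ofReal_mul_I_re]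
  have hcos := cos_neg_of_mem hα
  have hp : ∀ r : ℝ, rayPoint r α = 1 + r * e := fun r => rfl
  have hm : ∀ r : ℝ, 2 - rayPoint r α = 1 - r * e := fun r => by rw [hp]; ring
  have hd : ∀ r : ℝ, 0 ≤ r → 1 - r * e ≠ 0 := fun r hr h0 => by
    have := congrArg Complex.re h0
    simp [hre, -Complex.ofReal_cos] at this
    nlinarith
  have hd' : ∀ r : ℝ, 0 ≤ r → 1 + r * e ≠ 0 := fun r hr h0 => by
    have h1 := congrArg Complex.im h0
    have h2 := congrArg Complex.re h0
    simp [heim] at h1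
    rcases h1 with h1 | h1
    · simp [h1] at h2
    · exact hsin.ne' h1
  set q : ℝ → ℂ := fun r => (1 + r * e) / (1 - r * e) with hq
  have hqim : ∀ r : ℝ, 0 ≤ r → (q r).im = 2 * r * Real.sin α / Complex.normSq (1 - r * e) := by
    intro r hr
    have : (1 + (r : ℂ) * e).im * (1 - (r : ℂ) * e).re - (1 + (r : ℂ) * e).re *
        (1 - (r : ℂ) * e).im = 2 * r * Real.sin α := by
      simp [heim, hre, -Complex.ofReal_cos]; ring
    rw [hq]; simp only
    rw [Complex.div_im, ← sub_div, this]
  have hslit : ∀ r : ℝ, 0 ≤ r → q r ∈ Complex.slitPlane := by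
    intro r hr
    rcases hr.eq_or_lt with rfl | hr'
    · simp [hq]
    · right
      rw [hqim r hr]
      have : 0 < Complex.normSq (1 - r * e) := Complex.normSq_pos.2 (hd r hr)
      positivity
  set f' : ℝ → ℂ := fun r => e * (2 / ((2 - rayPoint r α) * rayPoint r α)) with hf'
  have hderiv : ∀ r ∈ Ici (0 : ℝ), HasDerivAt (fun r => Complex.log (q r)) (f' r) r := by
    intro r hr
    have h1 : HasDerivAt (fun r : ℝ => 1 + (r : ℂ) * e) e r := by
      simpa using ((Complex.ofRealCLM.hasDerivAt (x := r)).mul_const e).const_add 1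
    have h2 : HasDerivAt (fun r : ℝ => 1 - (r : ℂ) * e) (-e) r := by
      simpa using ((Complex.ofRealCLM.hasDerivAt (x := r)).mul_const e).const_sub 1
    have h3 := (h1.div h2 (hd r hr)).clog_real (hslit r hr)
    refine h3.congr_deriv ?_
    have a1 := hd r hr
    have a2 := hd' r hr
    have e3 : ((fun r : ℝ => 1 + (r : ℂ) * e) / fun r : ℝ => 1 - (r : ℂ) * e) r =
        (1 + r * e) / (1 - r * e) := rfl
    rw [e3, hf']; simp only [hm]; rw [hp]
    field_simp
    ring
  have hint : IntegrableOn f' (Ioi 0) := by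
    set δ := √((1 + Real.cos α) / 2) with hδ
    have hδ0 : 0 < δ := Real.sqrt_pos.2 (by linarith [one_add_cos_pos hα])
    refine ((integrable_inv_one_add_sq.const_mul (2 / δ)).integrableOn).mono' ?_ ?_
    · refine ContinuousOn.aestronglyMeasurable ?_ measurableSet_Ioi
      refine continuousOn_const.mul (continuousOn_const.div ?_ fun r hr => ?_)
      · exact ((continuous_const.sub (continuous_rayPoint α)).mul (continuous_rayPoint α)).continuousOn
      · exact mul_ne_zero (by rw [hm]; exact hd r (le_of_lt hr))
          (by rw [hp]; exact hd' r (le_of_lt hr))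
    · refine (ae_restrict_mem measurableSet_Ioi).mono fun r hr => ?_
      have hr0 : (0 : ℝ) ≤ r := le_of_lt hr
      have h1 : δ * (1 + r) ≤ ‖rayPoint r α‖ := norm_rayPoint_ge le_rfl hr0
      -- Both `‖1 - re‖² ≥ 1 + r²`, since `cos α < 0`, and `‖1 - re‖ ≤ 1 + r` are used.
      have h2 : (1 + r ^ 2) / (1 + r) ≤ ‖2 - rayPoint r α‖ := by
        have hre2 : 1 + r ^ 2 ≤ ‖2 - rayPoint r α‖ ^ 2 := by
          rw [hm, ← Complex.normSq_eq_norm_sq, Complex.normSq_apply]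
          simp [heim, hre, -Complex.ofReal_cos]
          have := Real.sin_sq_add_cos_sq α
          nlinarith [mul_nonneg hr0 (neg_nonneg.2 hcos.le)]
        rw [div_le_iff₀ (by positivity)]
        have h3 : ‖2 - rayPoint r α‖ ≤ 1 + r := by
          rw [hm]
          refine (norm_sub_le _ _).trans ?_
          simp [hen, abs_of_nonneg hr0]
        calc 1 + r ^ 2 ≤ ‖2 - rayPoint r α‖ ^ 2 := hre2
          _ = ‖2 - rayPoint r α‖ * ‖2 - rayPoint r α‖ := by ring
          _ ≤ _ := by gcongr
      rw [hf']; simp only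
      rw [norm_mul, hen, one_mul, norm_div, norm_mul, Complex.norm_ofNat]
      calc 2 / (‖2 - rayPoint r α‖ * ‖rayPoint r α‖)
          ≤ 2 / ((1 + r ^ 2) / (1 + r) * (δ * (1 + r))) := by gcongr
        _ = 2 / δ * (1 + r ^ 2)⁻¹ := by field_simp
  refine ⟨hint, ?_⟩
  have hlim : Filter.Tendsto (fun r => Complex.log (q r)) Filter.atTop (nhds (Real.pi * I)) := by
    -- The approach to `-1` takes place in the closed upper half-plane, which selects the value `πi`
    -- and not `-πi`.
    have h1 : Filter.Tendsto q Filter.atTop (nhdsWithin (-1) {z | 0 ≤ z.im}) := by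
      refine tendsto_nhdsWithin_iff.2 ⟨?_, ?_⟩
      · have h2 : Filter.Tendsto (fun r : ℝ => ((r⁻¹ : ℝ) : ℂ)) Filter.atTop (nhds 0) := by
          have := (Complex.continuous_ofReal.tendsto 0).comp (tendsto_inv_atTop_zero (𝕜 := ℝ))
          rw [Complex.ofReal_zero] at this
          exact this
        have he0 : e ≠ 0 := Complex.exp_ne_zero _
        have h3 : Filter.Tendsto (fun r : ℝ => (((r⁻¹ : ℝ) : ℂ) + e) / (((r⁻¹ : ℝ) : ℂ) - e))
            Filter.atTop (nhds ((0 + e) / (0 - e))) :=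
          (h2.add_const e).div (h2.sub_const e) (by simpa using he0)
        have h4 : (0 + e) / (0 - e) = -1 := by field_simp; ring
        rw [h4] at h3
        refine h3.congr' ?_
        filter_upwards [Filter.eventually_gt_atTop 0] with r hr
        have hr' : (r : ℂ) ≠ 0 := by exact_mod_cast hr.ne'
        rw [hq]; simp only
        rw [← mul_div_mul_left _ _ hr']
        push_cast
        rw [mul_add, mul_sub, mul_inv_cancel₀ hr']
      · filter_upwards [Filter.eventually_ge_atTop 0] with r hr
        show 0 ≤ (q r).im
        rw [hqim r hr]
        have : 0 ≤ Complex.normSq (1 - r * e) := Complex.normSq_nonneg _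
        positivity
    have h2 := Complex.tendsto_log_nhdsWithin_im_nonneg_of_re_neg_of_im_zero
      (z := -1) (by simp) (by simp)
    have h3 := h2.comp h1
    rw [norm_neg, norm_one, Real.log_one, Complex.ofReal_zero, zero_add] at h3
    exact h3
  have := integral_Ioi_of_hasDerivAt_of_tendsto
    (hderiv 0 self_mem_Ici).continuousAt.continuousWithinAt
    (fun r hr => hderiv r (mem_Ici.2 (le_of_lt hr))) hint hlim
  rw [this]
  simp [hq]

/-- The lower ray is the complex conjugate of the upper one, so it contributes the same value `πi`.
-/
theorem integral_contour_two_div {α : ℝ} (hα : α ∈ Ioo (Real.pi / 2) Real.pi) :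
    Integrable (fun x => contourDeriv α x • (2 / ((2 - contour α x) * contour α x))) ∧
    ∫ x, contourDeriv α x • (2 / ((2 - contour α x) * contour α x)) = 2 * Real.pi * I := by
  obtain ⟨hi, hv⟩ := integral_Ioi_ray_two_div hα
  set F : ℝ → ℂ := fun x => contourDeriv α x • (2 / ((2 - contour α x) * contour α x)) with hF
  set f : ℝ → ℂ := fun r => exp (α * I) * (2 / ((2 - rayPoint r α) * rayPoint r α)) with hf
  have e1 : ∀ x ∈ Ioi (0 : ℝ), f x = F x := by
    intro x hx
    have hx' : (0 : ℝ) ≤ x := le_of_lt hx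
    rw [hF, hf]; simp only
    rw [contourDeriv, if_pos hx', contour_of_nonneg hx', smul_eq_mul]
  have e2 : ∀ x ∈ Ioi (0 : ℝ), -(starRingEnd ℂ) (f x) = F (-x) := by
    intro x hx
    have hx' : (0 : ℝ) < x := hx
    have hr : (starRingEnd ℂ) (rayPoint x α) = rayPoint x (-α) := by
      simp [rayPoint, ← Complex.exp_conj]
    rw [hF, hf]; simp only
    rw [contourDeriv, if_neg (by linarith), contour_of_nonpos (by linarith), neg_neg, smul_eq_mul,
      map_mul, map_div₀, map_mul, map_sub, hr, ← Complex.exp_conj, Complex.conj_ofNat]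
    simp
  have i1 : IntegrableOn F (Ioi 0) := (integrableOn_congr_fun e1 measurableSet_Ioi).1 hi
  have hic : IntegrableOn (fun x => (starRingEnd ℂ) (f x)) (Ioi 0) :=
    (integrable_norm_iff (Complex.continuous_conj.comp_aestronglyMeasurable hi.1)).1
      (by simpa using hi.norm)
  have i2' : IntegrableOn (fun x => F (-x)) (Ioi 0) :=
    (integrableOn_congr_fun e2 measurableSet_Ioi).1 hic.neg
  have i2 : IntegrableOn F (Iic 0) := by
    rw [integrableOn_Iic_iff_integrableOn_Iio]
    have := i2'.comp_neg
    simpa using this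
  have hI : Integrable F := by
    have := i2.union i1
    rwa [Iic_union_Ioi, integrableOn_univ] at this
  refine ⟨hI, ?_⟩
  rw [← intervalIntegral.integral_Iic_add_Ioi i2 i1]
  have v1 : ∫ x in Ioi 0, F x = Real.pi * I := by
    rw [← setIntegral_congr_fun measurableSet_Ioi e1, hv]
  have v2 : ∫ x in Iic 0, F x = Real.pi * I := by
    have := integral_comp_neg_Ioi (0 : ℝ) F
    rw [neg_zero] at this
    rw [← this, ← setIntegral_congr_fun measurableSet_Ioi e2, integral_neg, integral_conj, hv]
    simp
  rw [v1, v2]; ring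

/-- The functions `e^{zT}/z` and `2/((2 - z)z)` have the same residue at `0`. Their difference
extends holomorphically across `0`, and its only pole `2` lies to the right of the contour. Closing
on the left shows that the two integrals agree. -/
theorem integral_exp_div_contour {α : ℝ} (hα : α ∈ Ioo (Real.pi / 2) Real.pi) {T : ℝ}
    (hT : 0 < T) :
    ∫ x, contourDeriv α x • (exp (contour α x * T) / contour α x) = 2 * Real.pi * I := by
  obtain ⟨hi, hv⟩ := integral_contour_two_div hα
  set δ := √((1 + Real.cos α) / 2) with hδ
  have hδ0 : 0 < δ := Real.sqrt_pos.2 (by linarith [one_add_cos_pos hα])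
  have hcos := cos_neg_of_mem hα
  have hz : ∀ x, δ ≤ ‖contour α x‖ := fun x =>
    le_trans (by nlinarith [abs_nonneg x]) (norm_contour_ge α x)
  have hz0 : ∀ x, contour α x ≠ 0 := fun x => norm_pos_iff.1 (hδ0.trans_le (hz x))
  have hi2 : Integrable fun x => contourDeriv α x • (exp (contour α x * T) / contour α x) := by
    refine ((integrable_exp_contour hα hT).norm.const_mul δ⁻¹).mono' ?_ ?_
    · refine (measurable_contourDeriv α).aestronglyMeasurable.smul ?_
      have := continuous_contour α
      exact ((by fun_prop : Continuous fun x => exp (contour α x * T)).div this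
        hz0).aestronglyMeasurable
    · refine Filter.Eventually.of_forall fun x => ?_
      rw [norm_smul, norm_smul, norm_div, mul_left_comm, div_eq_inv_mul]
      gcongr
      exact hz x
  -- Since `K 0 = 0`, the divided difference `dslope K 0` is `K z / z` with the singularity at `0`
  -- removed.
  set K : ℂ → ℂ := fun z => exp (z * T) - 2 / (2 - z) with hK
  set U : Set ℂ := {z | z ≠ 2} with hU
  have hUo : IsOpen U := isOpen_ne
  have hKd : DifferentiableOn ℂ K U := by
    refine DifferentiableOn.sub (by fun_prop) (DifferentiableOn.div (by fun_prop) (by fun_prop) ?_)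
    intro z hz h
    exact hz (sub_eq_zero.1 h).symm
  have hK0 : K 0 = 0 := by simp [hK]
  have hGd : DifferentiableOn ℂ (dslope K 0) U := by
    rw [Complex.differentiableOn_dslope (hUo.mem_nhds (by simp [hU]))]
    exact hKd
  have hG : ∀ z, z ≠ 0 → z ≠ 2 → dslope K 0 z = exp (z * T) / z - 2 / ((2 - z) * z) := by
    intro z hz hz2
    rw [dslope_of_ne _ hz, slope_def_field, hK0, hK]
    have : 2 - z ≠ 0 := sub_ne_zero.2 hz2.symm
    simp only [sub_zero]
    field_simp
  have hre : ∀ x, contour α x ≠ 2 := fun x h => by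
    have := congrArg Complex.re h
    rw [contour_re] at this
    simp at this
    nlinarith [abs_nonneg x]
  have hcongr : (fun x => contourDeriv α x • dslope K 0 (contour α x)) = fun x =>
      contourDeriv α x • (exp (contour α x * T) / contour α x) -
        contourDeriv α x • (2 / ((2 - contour α x) * contour α x)) := by
    funext x
    rw [hG _ (hz0 x) (hre x), smul_sub]
  have hzero : ∫ x, contourDeriv α x • dslope K 0 (contour α x) = 0 := by
    set c := -Real.cos α * T with hcdef
    have hc : 0 < c := mul_pos (by linarith) hT
    refine integral_eq_zero_of_truncated_tendsto (by rw [hcongr]; exact hi2.sub hi)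
      (b := fun ρ => 2 * (Real.pi - α) * (ρ * ((Real.exp T * Real.exp (-(c * ρ)) + 2 / (ρ - 1)) /
        (ρ - 1)))) ?_ ?_
    · have h1 : Filter.Tendsto (fun ρ : ℝ => Real.exp (-(c * ρ))) Filter.atTop (nhds 0) := by
        refine Real.tendsto_exp_neg_atTop_nhds_zero.comp ?_
        exact Filter.tendsto_id.const_mul_atTop hc
      have h2 : Filter.Tendsto (fun ρ : ℝ => (ρ - 1)⁻¹) Filter.atTop (nhds 0) :=
        tendsto_inv_atTop_zero.comp (Filter.tendsto_atTop_add_const_right _ _ Filter.tendsto_id)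
      have h3 := (((h1.const_mul (Real.exp T)).add (h2.const_mul 2)).mul
        (h2.const_add 1)).const_mul (2 * (Real.pi - α))
      simp only [mul_zero, add_zero, zero_mul] at h3
      refine h3.congr' ?_
      filter_upwards [Filter.eventually_gt_atTop 1] with ρ hρ
      have : ρ - 1 ≠ 0 := by linarith
      field_simp
      ring
    · filter_upwards [Filter.eventually_gt_atTop 1] with ρ hρ
      refine norm_intervalIntegral_contour_le_left hα hUo hGd ?_ (by linarith) ?_
      · rintro z hz rfl
        simp at hz
      · intro z hz hz1
        have hn : ρ - 1 ≤ ‖z‖ := by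
          have := norm_sub_le z 1
          rw [hz1, norm_one] at this; linarith
        have hn2 : ρ - 1 ≤ ‖2 - z‖ := by
          have := norm_sub_le (2 - z) 1
          rw [show 2 - z - 1 = -(z - 1) by ring, norm_neg, hz1, norm_one] at this
          linarith
        have h0 : z ≠ 0 := norm_pos_iff.1 (by linarith)
        have h2 : z ≠ 2 := by
          rintro rfl
          simp at hn2
          linarith
        have hρ1 : 0 < ρ - 1 := by linarith
        have he : exp (z * T) / z - 2 / ((2 - z) * z) = (exp (z * T) - 2 / (2 - z)) / z := by
          have : 2 - z ≠ 0 := sub_ne_zero.2 h2.symm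
          field_simp
        rw [hG z h0 h2, he, norm_div]
        have h5 : ‖exp (z * T) - 2 / (2 - z)‖ ≤ Real.exp T * Real.exp (-(c * ρ)) + 2 / (ρ - 1) := by
          refine (norm_sub_le _ _).trans (add_le_add ?_ ?_)
          · rw [Complex.norm_exp, Complex.re_mul_ofReal, ← Real.exp_add]
            refine Real.exp_le_exp.2 ?_
            rw [hcdef]
            nlinarith
          · rw [norm_div, Complex.norm_ofNat]
            gcongr
        gcongr
  rw [hcongr, integral_sub hi2 hi, hv, sub_eq_zero] at hzero
  exact hzero

end

/-! ### Duhamel integrals, the resolvent of `d/dt` with zero initial value. -/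

section

open Complex (I exp)

section Duhamel

variable {X : Type*} [NormedAddCommGroup X] [NormedSpace ℂ X]

/-- The solution at time `t` of `y' = z y + g`, `y 0 = 0`. -/
noncomputable def duhamel (z : ℂ) (g : ℝ → X) (t : ℝ) : X :=
  ∫ s in (0 : ℝ)..t, exp (z * (t - s)) • g s

/-- The derivative of `duhamel z g`. -/
noncomputable def duhamelDeriv (z : ℂ) (g : ℝ → X) (t : ℝ) : X := g t + z • duhamel z g t

theorem intervalIntegrable_exp_smul {z : ℂ} {g : ℝ → X} {a b t : ℝ}
    (hg : IntervalIntegrable g volume a b) :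
    IntervalIntegrable (fun s : ℝ => exp (z * (t - s)) • g s) volume a b :=
  hg.continuousOn_smul (by fun_prop)

theorem duhamel_eq_exp_smul (z : ℂ) (g : ℝ → X) (t : ℝ) :
    duhamel z g t = exp (z * t) • ∫ s in (0 : ℝ)..t, exp (-(z * s)) • g s := by
  rw [duhamel, ← intervalIntegral.integral_smul]
  refine intervalIntegral.integral_congr fun s _ => ?_
  simp only [smul_smul, ← Complex.exp_add]
  congr 2; ring

/-- Being entire in `z` gives continuity along the contour for existence, and Liouville's theorem
for uniqueness. -/
theorem differentiable_duhamel {g : ℝ → X} {t : ℝ} (hg : IntervalIntegrable g volume 0 t) :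
    Differentiable ℂ fun z => duhamel z g t := by
  intro z₀
  have h := intervalIntegral.hasDerivAt_integral_of_dominated_loc_of_deriv_le (𝕜 := ℂ)
    (μ := volume) (a := 0) (b := t) (F := fun z s => exp (z * (t - s)) • g s)
    (F' := fun z s => (exp (z * (t - s)) * (t - s)) • g s) (x₀ := z₀) (s := Metric.ball z₀ 1)
    (bound := fun s => (Real.exp ((‖z₀‖ + 1) * |t|) * |t|) * ‖g s‖)
    (Metric.ball_mem_nhds z₀ one_pos)
    (Filter.Eventually.of_forall fun z =>
      (intervalIntegrable_exp_smul hg).def'.aestronglyMeasurable)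
    (intervalIntegrable_exp_smul hg) ?_ ?_ (hg.norm.const_mul _) ?_
  · exact h.2.differentiableAt
  · exact (hg.continuousOn_smul (f := fun s : ℝ => exp (z₀ * (t - s)) * (t - s))
      (by fun_prop)).def'.aestronglyMeasurable
  · refine Filter.Eventually.of_forall fun s hs z hz => ?_
    have hts : |t - s| ≤ |t| := by
      rcases le_total 0 t with h0 | h0
      · rw [uIoc_of_le h0] at hs
        rw [abs_of_nonneg (by linarith [hs.2]), abs_of_nonneg h0]; linarith [hs.1]
      · rw [uIoc_of_ge h0] at hs
        rw [abs_of_nonpos (by linarith [hs.1]), abs_of_nonpos h0]; linarith [hs.2]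
    have hz' : ‖z‖ ≤ ‖z₀‖ + 1 := by
      rw [Metric.mem_ball, dist_eq_norm] at hz
      have := norm_le_norm_add_norm_sub' z z₀
      linarith
    have e : ‖(t : ℂ) - s‖ = |t - s| := by
      rw [← Complex.ofReal_sub, Complex.norm_real, Real.norm_eq_abs]
    rw [norm_smul, norm_mul, e]
    gcongr
    rw [Complex.norm_exp]
    refine Real.exp_le_exp.2 ((Complex.re_le_norm _).trans ?_)
    rw [norm_mul, e]
    gcongr
  · refine Filter.Eventually.of_forall fun s _ z _ => ?_
    have : HasDerivAt (fun z : ℂ => exp (z * (t - s))) (exp (z * (t - s)) * (t - s)) z := by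
      simpa using ((hasDerivAt_id z).mul_const ((t : ℂ) - s)).cexp
    exact this.smul_const (g s)

variable [CompleteSpace X]

/-- Integration by parts for primitives of integrable functions. -/
theorem duhamel_eq_integral_add {z : ℂ} {v : ℝ → X} {t : ℝ} (ht : 0 ≤ t)
    (hv : IntervalIntegrable v volume 0 t) :
    duhamel z v t = (∫ s in (0 : ℝ)..t, v s) +
      z • duhamel z (fun τ => ∫ s in (0 : ℝ)..τ, v s) t := by
  set μ := volume.restrict (Ioc (0 : ℝ) t) with hμ
  have hv' : Integrable v μ := (intervalIntegrable_iff_integrableOn_Ioc_of_le ht).1 hv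
  set c : ℝ → ℂ := fun τ => z * exp (z * (t - τ)) with hc
  have hcc : Continuous c := by fun_prop
  have hci : Integrable c μ := (hcc.integrableOn_Icc (a := 0) (b := t)).mono_set Ioc_subset_Icc_self
  -- As `v` is only integrable, integration by parts is done by Fubini on the triangle `s < τ`. The
  -- inner integral of `z e^{z(t-τ)}` over `(s, t)` is `e^{z(t-s)} - 1`.
  have hf : Integrable (Function.uncurry fun τ s => ({p : ℝ × ℝ | p.2 < p.1}.indicator
      (fun p => c p.1 • v p.2) (τ, s))) (μ.prod μ) :=
    (hci.smul_prod hv').indicator (measurableSet_lt measurable_snd measurable_fst)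
  have hswap := integral_integral_swap hf
  have hl : ∀ τ ∈ Ioc 0 t, ∫ s, {p : ℝ × ℝ | p.2 < p.1}.indicator (fun p => c p.1 • v p.2) (τ, s) ∂μ =
      c τ • ∫ s in (0 : ℝ)..τ, v s := by
    intro τ hτ
    have : (fun s => {p : ℝ × ℝ | p.2 < p.1}.indicator (fun p => c p.1 • v p.2) (τ, s)) =
        (Iio τ).indicator fun s => c τ • v s := by
      funext s
      by_cases h : s < τ <;> simp [indicator, h]
    rw [this, integral_indicator measurableSet_Iio, hμ, Measure.restrict_restrict measurableSet_Iio,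
      show Iio τ ∩ Ioc 0 t = Ioo 0 τ from ?_, integral_smul, ← integral_Ioc_eq_integral_Ioo,
      intervalIntegral.integral_of_le hτ.1.le]
    ext s
    simp only [mem_inter_iff, mem_Iio, mem_Ioc, mem_Ioo]
    constructor
    · rintro ⟨h1, h2, h3⟩; exact ⟨h2, h1⟩
    · rintro ⟨h1, h2⟩; exact ⟨h2, h1, h2.le.trans hτ.2⟩
  have hr : ∀ s ∈ Ioc 0 t, ∫ τ, {p : ℝ × ℝ | p.2 < p.1}.indicator (fun p => c p.1 • v p.2) (τ, s) ∂μ =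
      exp (z * (t - s)) • v s - v s := by
    intro s hs
    have : (fun τ => {p : ℝ × ℝ | p.2 < p.1}.indicator (fun p => c p.1 • v p.2) (τ, s)) =
        (Ioi s).indicator fun τ => c τ • v s := by
      funext τ
      by_cases h : s < τ <;> simp [indicator, h]
    rw [this, integral_indicator measurableSet_Ioi, hμ, Measure.restrict_restrict measurableSet_Ioi,
      show Ioi s ∩ Ioc 0 t = Ioc s t from ?_, ← intervalIntegral.integral_of_le hs.2,
      intervalIntegral.integral_smul_const]
    · have hd : ∀ τ ∈ uIcc s t, HasDerivAt (fun τ : ℝ => -exp (z * (t - τ))) (c τ) τ := by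
        intro τ _
        have h1 : HasDerivAt (fun τ : ℝ => z * ((t : ℂ) - τ)) (z * (-1)) τ := by
          have := (Complex.ofRealCLM.hasDerivAt (x := τ)).const_sub (t : ℂ)
          simpa using this.const_mul z
        refine h1.cexp.neg.congr_deriv ?_
        rw [hc]; simp only; ring
      rw [intervalIntegral.integral_eq_sub_of_hasDerivAt hd (hcc.intervalIntegrable _ _), sub_smul]
      simp
      abel
    · ext τ
      simp only [mem_inter_iff, mem_Ioi, mem_Ioc]
      constructor
      · rintro ⟨h1, h2, h3⟩; exact ⟨h1, h3⟩
      · rintro ⟨h1, h2⟩; exact ⟨h1, hs.1.trans h1, h2⟩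
  have hl' : ∫ τ, ∫ s, {p : ℝ × ℝ | p.2 < p.1}.indicator (fun p => c p.1 • v p.2) (τ, s) ∂μ ∂μ =
      z • duhamel z (fun τ => ∫ s in (0 : ℝ)..τ, v s) t := by
    rw [duhamel, intervalIntegral.integral_of_le ht, ← integral_smul]
    refine setIntegral_congr_fun measurableSet_Ioc fun τ hτ => ?_
    rw [hl τ hτ, smul_smul]
  have hr' : ∫ s, ∫ τ, {p : ℝ × ℝ | p.2 < p.1}.indicator (fun p => c p.1 • v p.2) (τ, s) ∂μ ∂μ =
      duhamel z v t - ∫ s in (0 : ℝ)..t, v s := by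
    rw [duhamel, ← intervalIntegral.integral_sub (intervalIntegrable_exp_smul hv) hv,
      intervalIntegral.integral_of_le ht]
    exact setIntegral_congr_fun measurableSet_Ioc fun s hs => hr s hs
  rw [← hl', hswap, hr']
  abel

theorem hasDerivAt_duhamel (z : ℂ) {W : ℝ → X} {t : ℝ}
    (hW : IntervalIntegrable W volume 0 t) (hWm : StronglyMeasurableAtFilter W (nhds t))
    (hWc : ContinuousAt W t) :
    HasDerivAt (duhamel z W) (duhamelDeriv z W t) t := by
  have h1 : HasDerivAt (fun t : ℝ => ∫ s in (0 : ℝ)..t, exp (-(z * s)) • W s)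
      (exp (-(z * t)) • W t) t := by
    refine intervalIntegral.integral_hasDerivAt_right (hW.continuousOn_smul (by fun_prop)) ?_ ?_
    · obtain ⟨s, hs, hm⟩ := hWm
      exact ⟨s, hs, (by fun_prop : Continuous fun s : ℝ => exp (-(z * s))).aestronglyMeasurable.smul
        hm⟩
    · exact (by fun_prop : ContinuousAt (fun s : ℝ => exp (-(z * s))) t).smul hWc
  have h2 : HasDerivAt (fun t : ℝ => exp (z * t)) (exp (z * t) * z) t := by
    have := ((Complex.ofRealCLM.hasDerivAt (x := t)).const_mul z).cexp
    simpa using this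
  have h3 := h2.smul h1
  have e : (duhamel z W) = fun t : ℝ => exp (z * t) • ∫ s in (0 : ℝ)..t, exp (-(z * s)) • W s :=
    funext fun t => duhamel_eq_exp_smul z W t
  rw [e]
  refine h3.congr_deriv ?_
  rw [duhamelDeriv, duhamel_eq_exp_smul, smul_smul, ← Complex.exp_add, smul_smul]
  simp [mul_comm z]

theorem continuous_primitive_of_integrable {g : ℝ → X} (hg : Integrable g) :
    Continuous fun t => ∫ s in (0 : ℝ)..t, g s :=
  intervalIntegral.continuous_primitive (fun _ _ => hg.intervalIntegrable) 0

theorem duhamel_of_nonpos {z : ℂ} {g : ℝ → X} (hg0 : ∀ t ≤ 0, g t = 0) {t : ℝ} (ht : t ≤ 0) :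
    duhamel z g t = 0 := by
  rw [duhamel, intervalIntegral.integral_congr (g := fun _ => 0)]
  · simp
  · intro s hs
    rw [uIcc_of_ge ht] at hs
    simp [hg0 s hs.2]

theorem duhamelDeriv_of_nonpos {z : ℂ} {g : ℝ → X} (hg0 : ∀ t ≤ 0, g t = 0) {t : ℝ} (ht : t ≤ 0) :
    duhamelDeriv z g t = 0 := by
  rw [duhamelDeriv, duhamel_of_nonpos hg0 ht, hg0 t ht]; simp

theorem continuous_duhamel {z : ℂ} {g : ℝ → X} (hg : Integrable g) :
    Continuous (duhamel z g) := by
  rw [show duhamel z g = _ from funext fun t => duhamel_eq_exp_smul z g t]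
  refine Continuous.smul (by fun_prop) ?_
  exact intervalIntegral.continuous_primitive
    (fun a b => hg.intervalIntegrable.continuousOn_smul (by fun_prop)) 0

theorem intervalIntegrable_duhamelDeriv {z : ℂ} {g : ℝ → X} (hg : Integrable g) (a b : ℝ) :
    IntervalIntegrable (duhamelDeriv z g) volume a b :=
  hg.intervalIntegrable.add (((continuous_duhamel hg).const_smul z).intervalIntegrable a b)

/-- `∫ duhamel z g = duhamel z (∫ g)`. -/
theorem smul_integral_duhamel {z : ℂ} {g : ℝ → X} (hg : Integrable g) {t : ℝ} (ht : 0 ≤ t) :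
    z • ∫ s in (0 : ℝ)..t, duhamel z g s = duhamel z g t - ∫ s in (0 : ℝ)..t, g s := by
  set W : ℝ → X := fun τ => ∫ s in (0 : ℝ)..τ, g s with hW
  have hWc : Continuous W := continuous_primitive_of_integrable hg
  -- For the continuous primitive `W` the differential equation holds classically, and integration
  -- by parts identifies the derivative of `duhamel z W` as `duhamel z g`.
  have h1 : ∫ s in (0 : ℝ)..t, duhamel z g s = duhamel z W t := by
    have hd : ∀ s ∈ uIcc 0 t, HasDerivAt (duhamel z W) (duhamel z g s) s := by
      intro s hs
      rw [uIcc_of_le ht] at hs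
      refine (hasDerivAt_duhamel z (hWc.intervalIntegrable _ _)
        hWc.stronglyMeasurable.stronglyMeasurableAtFilter hWc.continuousAt).congr_deriv ?_
      rw [duhamelDeriv, duhamel_eq_integral_add hs.1 hg.intervalIntegrable]
    rw [intervalIntegral.integral_eq_sub_of_hasDerivAt hd
      ((continuous_duhamel hg).intervalIntegrable _ _)]
    simp [duhamel]
  rw [h1, duhamel_eq_integral_add ht hg.intervalIntegrable]
  abel

theorem integral_duhamelDeriv {z : ℂ} {g : ℝ → X} (hg : Integrable g) {t : ℝ} (ht : 0 ≤ t) :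
    ∫ s in (0 : ℝ)..t, duhamelDeriv z g s = duhamel z g t := by
  unfold duhamelDeriv
  rw [intervalIntegral.integral_add (g := fun s => z • duhamel z g s) hg.intervalIntegrable
    (((continuous_duhamel hg).const_smul z).intervalIntegrable _ _),
    intervalIntegral.integral_smul, smul_integral_duhamel hg ht]
  abel

theorem duhamel_sub {z : ℂ} {g : ℝ → X} (hg : Integrable g) (hg0 : ∀ t ≤ 0, g t = 0) (t t' : ℝ) :
    duhamel z g t' - duhamel z g t = ∫ s in t..t', duhamelDeriv z g s := by
  have h : ∀ t, duhamel z g t = ∫ s in (0 : ℝ)..t, duhamelDeriv z g s := by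
    intro t
    rcases le_total 0 t with ht | ht
    · rw [integral_duhamelDeriv hg ht]
    · rw [duhamel_of_nonpos hg0 ht, intervalIntegral.integral_congr (g := fun _ => 0)]
      · simp
      · intro s hs
        rw [uIcc_of_ge ht] at hs
        simp [duhamelDeriv_of_nonpos hg0 hs.2]
  rw [h t, h t', intervalIntegral.integral_interval_sub_left
    (intervalIntegrable_duhamelDeriv hg _ _) (intervalIntegrable_duhamelDeriv hg _ _)]

/-- Since `g` vanishes for negative times, the convolution may be taken over all of `(0, T)`.
Subtracting `g t` inside it costs `z ∫₀ᵀ e^{zs} ds = e^{zT} - 1` times `g t`, which cancels the free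
term `g t`. What remains are differences of `g`, the form in which smoothness enters. -/
theorem duhamelDeriv_eq {z : ℂ} {g : ℝ → X} (hg : Integrable g) (hg0 : ∀ t ≤ 0, g t = 0)
    {t T : ℝ} (ht : t ≤ T) :
    duhamelDeriv z g t = exp (z * T) • g t +
      z • ∫ s in (0 : ℝ)..T, exp (z * s) • (g (t - s) - g t) := by
  rcases eq_or_ne z 0 with rfl | hz
  · simp [duhamelDeriv]
  have hgt : Integrable fun s => g (t - s) := hg.comp_sub_left t
  have i1 : IntervalIntegrable (fun s : ℝ => exp (z * s) • g (t - s)) volume 0 T :=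
    hgt.intervalIntegrable.continuousOn_smul (by fun_prop)
  have i2 : IntervalIntegrable (fun s : ℝ => exp (z * s) • g t) volume 0 T :=
    (by fun_prop : Continuous fun s : ℝ => exp (z * s) • g t).intervalIntegrable _ _
  have h1 : ∫ s in (0 : ℝ)..T, exp (z * s) • g (t - s) = duhamel z g t := by
    have e1 : ∫ s in (0 : ℝ)..T, exp (z * s) • g (t - s) =
        ∫ s in t - T..t, exp (z * (t - s)) • g s := by
      have := intervalIntegral.integral_comp_sub_left (a := 0) (b := T)
        (fun s : ℝ => exp (z * (t - s)) • g s) t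
      rw [sub_zero] at this
      rw [← this]
      refine intervalIntegral.integral_congr fun s _ => ?_
      simp
    rw [e1, duhamel, ← intervalIntegral.integral_add_adjacent_intervals (b := 0)
      (intervalIntegrable_exp_smul hg.intervalIntegrable)
      (intervalIntegrable_exp_smul hg.intervalIntegrable)]
    rw [intervalIntegral.integral_congr (a := t - T) (g := fun _ => 0)]
    · simp
    · intro s hs
      rw [uIcc_of_le (by linarith)] at hs
      simp [hg0 s hs.2]
  simp only [smul_sub]
  rw [intervalIntegral.integral_sub i1 i2, h1, intervalIntegral.integral_smul_const,
    integral_exp_mul_complex hz, duhamelDeriv, smul_sub, smul_smul, mul_div_cancel₀ _ hz, sub_smul]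
  simp
  abel

end Duhamel

end

/-! ### Pointwise bounds for singular contour operators. -/

section

open Complex (I exp)

theorem lintegral_exp_neg_mul_abs {a : ℝ} (ha : 0 < a) :
    ∫⁻ x : ℝ, ENNReal.ofReal (Real.exp (-(a * |x|))) =
      ENNReal.ofReal (a⁻¹ * ∫ x : ℝ, Real.exp (-|x|)) := by
  rw [← ofReal_integral_eq_lintegral_ofReal (integrable_exp_neg_mul_abs ha)
    (Filter.Eventually.of_forall fun x => (Real.exp_pos _).le)]
  congr 1
  have := Measure.integral_comp_mul_left (fun x : ℝ => Real.exp (-|x|)) a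
  simp only [abs_mul, abs_of_pos ha, abs_inv, smul_eq_mul] at this
  exact this

/-- Two bounds for the weight give the two entries of the minimum. From `h (1 + |x|) ≤ (H + 1)(1 +
h|x|)` the integral is `O(1/s)`. From `h/(1 + h|x|) ≤ h` it is `O(h/s²)`, half of the exponential
being spent on the factor `1 + |x|`. The result `s⁻¹ min(1, h/s)` is the Hardy kernel with respect
to `ds/s`. -/
theorem exists_lintegral_weight_le {c T H : ℝ} (hc : 0 < c) (hT : 0 < T) (hH : 0 < H) :
    ∃ C : ℝ, 0 ≤ C ∧ ∀ h ∈ Ioc 0 H, ∀ s ∈ Ioo 0 T,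
      ∫⁻ x : ℝ, ENNReal.ofReal (h / (1 + h * |x|) * ((1 + |x|) * Real.exp (-(c * s * |x|)))) ≤
        ENNReal.ofReal (C * (s⁻¹ * min 1 (h / s))) := by
  set κ := ∫ x : ℝ, Real.exp (-|x|) with hκ
  have hκ0 : 0 ≤ κ := integral_nonneg fun x => (Real.exp_pos _).le
  refine ⟨(H + 1) * κ / c + (T + 2 / c) * (2 / c) * κ, by positivity, fun h hh s hs => ?_⟩
  have hh0 := hh.1
  have hs0 := hs.1
  have ha : 0 < c * s := mul_pos hc hs.1
  have b1 : ∫⁻ x : ℝ, ENNReal.ofReal (h / (1 + h * |x|) * ((1 + |x|) *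
      Real.exp (-(c * s * |x|)))) ≤ ENNReal.ofReal ((H + 1) * κ / c * s⁻¹) := by
    have : ∀ x : ℝ, ENNReal.ofReal (h / (1 + h * |x|) * ((1 + |x|) *
        Real.exp (-(c * s * |x|)))) ≤ ENNReal.ofReal (H + 1) *
          ENNReal.ofReal (Real.exp (-(c * s * |x|))) := by
      intro x
      rw [← ENNReal.ofReal_mul (by positivity), ← mul_assoc]
      refine ENNReal.ofReal_le_ofReal ?_
      gcongr
      rw [div_mul_eq_mul_div, div_le_iff₀ (by positivity)]
      have h1 := hh.2
      nlinarith [mul_nonneg hh0.le (abs_nonneg x), mul_nonneg (mul_nonneg hH.le hh0.le)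
        (abs_nonneg x)]
    refine (lintegral_mono this).trans ?_
    rw [lintegral_const_mul _ (by fun_prop), lintegral_exp_neg_mul_abs ha,
      ← ENNReal.ofReal_mul (by positivity)]
    refine ENNReal.ofReal_le_ofReal (le_of_eq ?_)
    rw [← hκ]
    field_simp
  have b2 : ∫⁻ x : ℝ, ENNReal.ofReal (h / (1 + h * |x|) * ((1 + |x|) *
      Real.exp (-(c * s * |x|)))) ≤
        ENNReal.ofReal ((T + 2 / c) * (2 / c) * κ * (s⁻¹ * (h / s))) := by
    have : ∀ x : ℝ, ENNReal.ofReal (h / (1 + h * |x|) * ((1 + |x|) *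
        Real.exp (-(c * s * |x|)))) ≤ ENNReal.ofReal (h * (1 + 2 / (c * s))) *
          ENNReal.ofReal (Real.exp (-(c * s / 2 * |x|))) := by
      intro x
      rw [← ENNReal.ofReal_mul (by positivity)]
      refine ENNReal.ofReal_le_ofReal ?_
      have e : Real.exp (-(c * s * |x|)) =
          Real.exp (-(c * s / 2 * |x|)) * Real.exp (-(c * s / 2 * |x|)) := by
        rw [← Real.exp_add]; congr 1; ring
      have e1 : h / (1 + h * |x|) ≤ h :=
        div_le_self hh0.le (by nlinarith [mul_nonneg hh0.le (abs_nonneg x)])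
      have e2 : (1 + |x|) * Real.exp (-(c * s / 2 * |x|)) ≤ 1 + 2 / (c * s) := by
        rw [Real.exp_neg, ← div_eq_mul_inv, div_le_iff₀ (Real.exp_pos _)]
        have h1 := Real.add_one_le_exp (c * s / 2 * |x|)
        have h2 : (1 + 2 / (c * s)) * (c * s / 2 * |x| + 1) ≤
            (1 + 2 / (c * s)) * Real.exp (c * s / 2 * |x|) := by gcongr
        refine le_trans ?_ h2
        have e3 : 2 / (c * s) * (c * s / 2 * |x|) = |x| := by field_simp
        have e4 : 0 ≤ c * s / 2 * |x| := by positivity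
        have e5 : 0 ≤ 2 / (c * s) := by positivity
        nlinarith
      calc h / (1 + h * |x|) * ((1 + |x|) * Real.exp (-(c * s * |x|)))
          ≤ h * ((1 + |x|) * Real.exp (-(c * s * |x|))) := by gcongr
        _ = h * ((1 + |x|) * Real.exp (-(c * s / 2 * |x|))) * Real.exp (-(c * s / 2 * |x|)) := by
            rw [e]; ring
        _ ≤ _ := by gcongr
    refine (lintegral_mono this).trans ?_
    rw [lintegral_const_mul _ (by fun_prop), lintegral_exp_neg_mul_abs (by positivity),
      ← ENNReal.ofReal_mul (by positivity)]
    refine ENNReal.ofReal_le_ofReal ?_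
    rw [← hκ]
    have e : h * (1 + 2 / (c * s)) * ((c * s / 2)⁻¹ * κ) =
        (s + 2 / c) * (2 / c) * κ * (s⁻¹ * (h / s)) := by field_simp
    rw [e]
    have := hs.2.le
    gcongr
  rcases le_total 1 (h / s) with h1 | h1
  · rw [min_eq_left h1, mul_one]
    refine b1.trans (ENNReal.ofReal_le_ofReal ?_)
    have : 0 ≤ (T + 2 / c) * (2 / c) * κ * s⁻¹ := by positivity
    linarith
  · rw [min_eq_right h1]
    refine b2.trans (ENNReal.ofReal_le_ofReal ?_)
    have : 0 ≤ (H + 1) * κ / c * (s⁻¹ * (h / s)) := by positivity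
    linarith

theorem setLIntegral_mulHaar {T : ℝ} {F : ℝ → ENNReal} (hF : Measurable F) :
    ∫⁻ s in Ioo 0 T, F s ∂mulHaar = ∫⁻ s in Ioo 0 T, ENNReal.ofReal s⁻¹ * F s := by
  rw [mulHaar_restrict_Ioo, lintegral_withDensity_eq_lintegral_mul _ (by fun_prop) hF]
  rfl

section Pointwise

variable {X : Type*} [NormedAddCommGroup X] [NormedSpace ℂ X]

/-- The averaged oscillation of `g` near `t` at scale `h`. -/
noncomputable def meanOsc (T : ℝ) (g : ℝ → X) (h t : ℝ) : ENNReal :=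
  ENNReal.ofReal h * ‖g t‖ₑ +
    ∫⁻ s in Ioo 0 T, ENNReal.ofReal (min 1 (h / s)) * ‖g (t - s) - g t‖ₑ ∂mulHaar

theorem measurable_meanOsc {T : ℝ} {g : ℝ → X} (hg : StronglyMeasurable g) (h : ℝ) :
    Measurable (meanOsc T g h) := by
  unfold meanOsc
  refine (Measurable.const_mul hg.enorm _).add ?_
  refine Measurable.lintegral_prod_right' (f := fun p : ℝ × ℝ =>
    ENNReal.ofReal (min 1 (h / p.2)) * ‖g (p.1 - p.2) - g p.1‖ₑ) ?_
  have hm : Measurable fun p : ℝ × ℝ => ENNReal.ofReal (min 1 (h / p.2)) := by fun_prop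
  exact hm.mul ((hg.comp_measurable (by fun_prop)).sub (hg.comp_measurable (by fun_prop))).enorm

variable [CompleteSpace X]

theorem enorm_duhamelDeriv_contour_le {α T : ℝ} {g : ℝ → X} (hg : Integrable g)
    (hg0 : ∀ t ≤ 0, g t = 0) {t : ℝ} (hT : 0 < T) (ht : t ≤ T) (x : ℝ) :
    ‖duhamelDeriv (contour α x) g t‖ₑ ≤ ENNReal.ofReal (Real.exp T) *
      (ENNReal.ofReal (Real.exp (-(-Real.cos α * T * |x|))) * ‖g t‖ₑ +
        ∫⁻ s in Ioo 0 T, ENNReal.ofReal ((1 + |x|) * Real.exp (-(-Real.cos α * s * |x|))) *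
          ‖g (t - s) - g t‖ₑ) := by
  have hexp : ∀ s : ℝ, ‖exp (contour α x * s)‖ₑ =
      ENNReal.ofReal (Real.exp s) * ENNReal.ofReal (Real.exp (-(-Real.cos α * s * |x|))) := by
    intro s
    rw [← ofReal_norm, norm_exp_contour_mul, ENNReal.ofReal_mul (Real.exp_pos _).le]
  rw [duhamelDeriv_eq hg hg0 ht]
  refine (enorm_add_le _ _).trans ?_
  rw [enorm_smul, enorm_smul, hexp, mul_add, mul_assoc]
  refine add_le_add le_rfl ?_
  rw [intervalIntegral.integral_of_le hT.le, integral_Ioc_eq_integral_Ioo]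
  calc ‖contour α x‖ₑ * ‖∫ s in Ioo 0 T, exp (contour α x * s) • (g (t - s) - g t)‖ₑ
      ≤ ENNReal.ofReal (1 + |x|) * ∫⁻ s in Ioo 0 T, ‖exp (contour α x * s) • (g (t - s) - g t)‖ₑ := by
        gcongr
        · rw [← ofReal_norm]
          exact ENNReal.ofReal_le_ofReal (norm_contour_le α x)
        · exact enorm_integral_le_lintegral_enorm _
    _ ≤ ENNReal.ofReal (1 + |x|) * ∫⁻ s in Ioo 0 T, ENNReal.ofReal (Real.exp T) *
          (ENNReal.ofReal (Real.exp (-(-Real.cos α * s * |x|))) * ‖g (t - s) - g t‖ₑ) := by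
        refine mul_le_mul_right (setLIntegral_mono' measurableSet_Ioo fun s hs => ?_) _
        rw [enorm_smul, hexp, mul_assoc]
        gcongr
        exact hs.2.le
    _ = _ := by
        rw [lintegral_const_mul' _ _ ENNReal.ofReal_ne_top, mul_left_comm,
          ← lintegral_const_mul' _ _ ENNReal.ofReal_ne_top]
        simp only [← mul_assoc, ← ENNReal.ofReal_mul (by positivity : 0 ≤ 1 + |x|)]

/-- The contour weight at scale `h` turns `duhamelDeriv` into the oscillation at scale `h`. -/
theorem exists_lintegral_duhamelDeriv_le {α : ℝ} (hα : α ∈ Ioo (Real.pi / 2) Real.pi) {T H : ℝ}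
    (hT : 0 < T) (hH : 0 < H) :
    ∃ C : ENNReal, C ≠ ⊤ ∧ ∀ g : ℝ → X, StronglyMeasurable g → Integrable g →
      (∀ t ≤ 0, g t = 0) → ∀ h ∈ Ioc 0 H, ∀ t ≤ T,
      ∫⁻ x, ENNReal.ofReal (h / (1 + h * |x|)) * ‖duhamelDeriv (contour α x) g t‖ₑ ≤
        C * meanOsc T g h t := by
  set c := -Real.cos α with hcdef
  have hc : 0 < c := by linarith [cos_neg_of_mem hα]
  obtain ⟨C, hC0, hC⟩ := exists_lintegral_weight_le hc hT hH
  set κ := ∫ x : ℝ, Real.exp (-|x|) with hκ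
  have hκ0 : 0 ≤ κ := integral_nonneg fun x => (Real.exp_pos _).le
  refine ⟨ENNReal.ofReal (Real.exp T) * ENNReal.ofReal ((c * T)⁻¹ * κ + C),
    ENNReal.mul_ne_top ENNReal.ofReal_ne_top ENNReal.ofReal_ne_top,
    fun g hgm hg hg0 h hh t ht => ?_⟩
  have hh0 := hh.1
  set D : ℝ → ENNReal := fun s => ‖g (t - s) - g t‖ₑ with hD
  have hDm : Measurable D :=
    ((hgm.comp_measurable (by fun_prop)).sub stronglyMeasurable_const).enorm
  set w : ℝ → ℝ := fun x => h / (1 + h * |x|) with hw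
  have hw0 : ∀ x, 0 ≤ w x := fun x => by positivity
  have hwm : Measurable w := by fun_prop
  have step1 : ∫⁻ x, ENNReal.ofReal (w x) * ‖duhamelDeriv (contour α x) g t‖ₑ ≤
      ENNReal.ofReal (Real.exp T) * (∫⁻ x, ENNReal.ofReal (w x) *
        ENNReal.ofReal (Real.exp (-(c * T * |x|))) * ‖g t‖ₑ) +
      ENNReal.ofReal (Real.exp T) * ∫⁻ x, ∫⁻ s in Ioo 0 T, ENNReal.ofReal (w x *
        ((1 + |x|) * Real.exp (-(c * s * |x|)))) * D s := by
    rw [← lintegral_const_mul _ (by fun_prop), ← lintegral_const_mul' _ _ ENNReal.ofReal_ne_top,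
      ← lintegral_add_left (by fun_prop)]
    refine lintegral_mono fun x => ?_
    refine (mul_le_mul_right (enorm_duhamelDeriv_contour_le hg hg0 hT ht x) _).trans_eq ?_
    rw [mul_left_comm, mul_add, mul_add, ← mul_assoc (ENNReal.ofReal (w x))]
    congr 2
    rw [← lintegral_const_mul' _ _ ENNReal.ofReal_ne_top]
    refine lintegral_congr fun s => ?_
    rw [← mul_assoc, ← ENNReal.ofReal_mul (hw0 x)]
  have step2 : ∫⁻ x, ENNReal.ofReal (w x) * ENNReal.ofReal (Real.exp (-(c * T * |x|))) * ‖g t‖ₑ ≤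
      ENNReal.ofReal ((c * T)⁻¹ * κ) * (ENNReal.ofReal h * ‖g t‖ₑ) := by
    rw [lintegral_mul_const _ (by fun_prop), ← mul_assoc]
    gcongr
    rw [← lintegral_exp_neg_mul_abs (by positivity), ← lintegral_mul_const _ (by fun_prop)]
    refine lintegral_mono fun x => ?_
    rw [mul_comm]
    gcongr
    exact div_le_self hh0.le (by nlinarith [mul_nonneg hh0.le (abs_nonneg x)])
  have step3 : ∫⁻ x, ∫⁻ s in Ioo 0 T, ENNReal.ofReal (w x *
        ((1 + |x|) * Real.exp (-(c * s * |x|)))) * D s ≤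
      ENNReal.ofReal C * ∫⁻ s in Ioo 0 T, ENNReal.ofReal (min 1 (h / s)) * D s ∂mulHaar := by
    rw [lintegral_lintegral_swap (by fun_prop), setLIntegral_mulHaar (by fun_prop),
      ← lintegral_const_mul _ (by fun_prop)]
    refine setLIntegral_mono' measurableSet_Ioo fun s hs => ?_
    rw [lintegral_mul_const _ (by fun_prop)]
    refine (mul_le_mul_left (hC h hh s hs) _).trans_eq ?_
    have := inv_nonneg.2 hs.1.le
    rw [ENNReal.ofReal_mul hC0, ENNReal.ofReal_mul this]
    ring
  refine step1.trans ?_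
  rw [← mul_add, mul_assoc]
  gcongr
  refine (add_le_add step2 step3).trans ?_
  unfold meanOsc
  rw [ENNReal.ofReal_add (by positivity) hC0, add_mul]
  gcongr
  · exact le_self_add
  · exact le_add_self

/-- An operator-valued weight on the contour, of order `1 / |x|` with bounded truncated
integrals. -/
structure IsContourMultiplier (m : ℝ → X →L[ℂ] X) (C : ℝ) : Prop where
  stronglyMeasurable : StronglyMeasurable m
  norm_le : ∀ x, ‖m x‖ ≤ C / (1 + |x|)
  truncated : ∀ ρ > 0, ‖∫ x in -ρ..ρ, m x‖ ≤ C

/-- The singular integral operator with multiplier `m`. -/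
noncomputable def contourOp (α : ℝ) (m : ℝ → X →L[ℂ] X) (g : ℝ → X) (t : ℝ) : X :=
  ∫ x, m x (duhamelDeriv (contour α x) g t)

/-- Because `g` vanishes for negative times, the integral with moving endpoint is a whole-line
integral of a jointly measurable function cut off to `s ≤ t`. -/
theorem stronglyMeasurable_duhamel {α : ℝ} {g : ℝ → X} (hg : StronglyMeasurable g)
    (hg0 : ∀ t ≤ 0, g t = 0) :
    StronglyMeasurable fun p : ℝ × ℝ => duhamel (contour α p.1) g p.2 := by
  have hc := continuous_contour α
  have e : (fun p : ℝ × ℝ => duhamel (contour α p.1) g p.2) = fun p : ℝ × ℝ =>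
      ∫ s, {q : (ℝ × ℝ) × ℝ | q.2 ≤ q.1.2}.indicator
        (fun q => exp (contour α q.1.1 * (q.1.2 - q.2)) • g q.2) (p, s) := by
    funext p
    have h1 : (fun s => {q : (ℝ × ℝ) × ℝ | q.2 ≤ q.1.2}.indicator
        (fun q => exp (contour α q.1.1 * (q.1.2 - q.2)) • g q.2) (p, s)) =
        (Iic p.2).indicator fun s => exp (contour α p.1 * (p.2 - s)) • g s := by
      funext s
      by_cases h : s ≤ p.2 <;> simp [indicator, h]
    rw [h1, integral_indicator measurableSet_Iic, duhamel]
    rcases le_total 0 p.2 with h | h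
    · rw [intervalIntegral.integral_of_le h]
      refine (setIntegral_eq_of_subset_of_forall_sdiff_eq_zero measurableSet_Iic
        Ioc_subset_Iic_self ?_).symm
      intro s hs
      have : s ≤ 0 := by
        by_contra hc
        exact hs.2 ⟨not_le.1 hc, hs.1⟩
      simp [hg0 s this]
    · have := duhamel_of_nonpos (z := contour α p.1) hg0 h
      rw [duhamel] at this
      rw [this, setIntegral_eq_zero_of_forall_eq_zero]
      intro s hs
      simp [hg0 s (le_trans hs h)]
  rw [e]
  refine StronglyMeasurable.integral_prod_right' (f := {q : (ℝ × ℝ) × ℝ | q.2 ≤ q.1.2}.indicator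
        (fun q => exp (contour α q.1.1 * (q.1.2 - q.2)) • g q.2)) ?_
  refine StronglyMeasurable.indicator ?_ (measurableSet_le (by fun_prop) (by fun_prop))
  refine StronglyMeasurable.smul ?_ (hg.comp_measurable measurable_snd)
  exact (by fun_prop : Continuous fun q : (ℝ × ℝ) × ℝ =>
    exp (contour α q.1.1 * (q.1.2 - q.2))).stronglyMeasurable

theorem stronglyMeasurable_duhamelDeriv {α : ℝ} {g : ℝ → X} (hg : StronglyMeasurable g)
    (hg0 : ∀ t ≤ 0, g t = 0) :
    StronglyMeasurable fun p : ℝ × ℝ => duhamelDeriv (contour α p.1) g p.2 := by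
  refine (hg.comp_measurable measurable_snd).add ?_
  exact ((continuous_contour α).comp continuous_fst).stronglyMeasurable.smul
    (stronglyMeasurable_duhamel hg hg0)

theorem _root_.MeasureTheory.StronglyMeasurable.clm_apply_of {β : Type*} [MeasurableSpace β]
    {m : β → X →L[ℂ] X} {f : β → X} (hm : StronglyMeasurable m) (hf : StronglyMeasurable f) :
    StronglyMeasurable fun b => m b (f b) :=
  isBoundedBilinearMap_apply.continuous.comp_stronglyMeasurable (hm.prodMk hf)

theorem stronglyMeasurable_contourOp {α : ℝ} {m : ℝ → X →L[ℂ] X} (hm : StronglyMeasurable m)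
    {g : ℝ → X} (hg : StronglyMeasurable g) (hg0 : ∀ t ≤ 0, g t = 0) :
    StronglyMeasurable (contourOp α m g) := by
  refine StronglyMeasurable.integral_prod_right' (f := fun p : ℝ × ℝ =>
    m p.2 (duhamelDeriv (contour α p.2) g p.1)) ?_
  refine StronglyMeasurable.clm_apply_of (hm.comp_measurable measurable_snd) ?_
  exact (stronglyMeasurable_duhamelDeriv hg hg0).comp_measurable measurable_swap

theorem contourOp_of_nonpos {α : ℝ} {m : ℝ → X →L[ℂ] X} {g : ℝ → X} (hg0 : ∀ t ≤ 0, g t = 0)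
    {t : ℝ} (ht : t ≤ 0) : contourOp α m g t = 0 := by
  simp [contourOp, duhamelDeriv_of_nonpos hg0 ht]

theorem continuous_duhamelDeriv_contour {α : ℝ} {g : ℝ → X} (hg : Integrable g) (t : ℝ) :
    Continuous fun x => duhamelDeriv (contour α x) g t := by
  have h1 := (differentiable_duhamel (hg.intervalIntegrable (a := 0) (b := t))).continuous.comp
    (continuous_contour α)
  exact continuous_const.add ((continuous_contour α).smul h1)

/-- This is the central estimate. Splitting the contour at `|x| = 1/h`, the far part is small by the
decay of the weight. On the near part `y_z' = g + z y_z`: the increment of `g` is multiplied by a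
truncated integral of the multiplier, which is bounded although the multiplier is not absolutely
integrable, and the increment of `z y_z` is `z` times a time integral of `y_z'` over `(t, t + h)`.
The constant depends on the multiplier only through `C₀`. -/
theorem exists_contourOp_bounds {α : ℝ} (hα : α ∈ Ioo (Real.pi / 2) Real.pi) {T H : ℝ}
    (hT : 0 < T) (hH : 0 < H) (C₀ : ℝ) :
    ∃ C : ENNReal, C ≠ ⊤ ∧ ∀ m : ℝ → X →L[ℂ] X, IsContourMultiplier m C₀ →
      ∀ g : ℝ → X, StronglyMeasurable g → Integrable g → (∀ t ≤ 0, g t = 0) → ∀ h ∈ Ioc 0 H,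
      (∀ t ≤ T, ∫⁻ x, ‖m x (duhamelDeriv (contour α x) g t)‖ₑ ≤
        C * (ENNReal.ofReal h⁻¹ * meanOsc T g h t)) ∧
      ∀ t, t + h ≤ T → ‖contourOp α m g (t + h) - contourOp α m g t‖ₑ ≤
        C * (‖g (t + h) - g t‖ₑ + meanOsc T g h t + meanOsc T g h (t + h) +
          ENNReal.ofReal h⁻¹ * ∫⁻ τ in Ioc t (t + h), meanOsc T g h τ) := by
  obtain ⟨C₁, hC₁t, hC₁⟩ := exists_lintegral_duhamelDeriv_le (X := X) hα hT hH
  -- The summand `1` keeps the final constant nonzero, so that the claim is trivial whenever the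
  -- right-hand side contains an infinite term.
  set K := ENNReal.ofReal (|C₀| + 1) with hK
  have hK0 : K ≠ 0 := by
    rw [hK, ne_eq, ENNReal.ofReal_eq_zero, not_le]; positivity
  have hKt : K ≠ ⊤ := ENNReal.ofReal_ne_top
  refine ⟨2 * K * (C₁ + 1) * ENNReal.ofReal (H + 1), by finiteness, fun m hm g hgm hg hg0 h hh => ?_⟩
  have hh0 := hh.1
  set ψ : ℝ → ℝ → X := fun t x => duhamelDeriv (contour α x) g t with hψ
  set w : ℝ → ℝ := fun x => h / (1 + h * |x|) with hw
  have hw0 : ∀ x, 0 ≤ w x := fun x => by positivity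
  have hwm : Measurable w := by fun_prop
  set P : ℝ → ENNReal := fun t => ∫⁻ x, ENNReal.ofReal (w x) * ‖ψ t x‖ₑ with hP
  have hPle : ∀ t ≤ T, P t ≤ C₁ * meanOsc T g h t := fun t ht => hC₁ g hgm hg hg0 h hh t ht
  have hψc : ∀ t, Continuous (ψ t) := fun t => continuous_duhamelDeriv_contour hg t
  have hmK : ∀ x y, ‖m x y‖ₑ ≤ ENNReal.ofReal ((|C₀| + 1) / (1 + |x|)) * ‖y‖ₑ := by
    intro x y
    rw [← ofReal_norm, ← ofReal_norm, ← ENNReal.ofReal_mul (by positivity)]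
    refine ENNReal.ofReal_le_ofReal (((m x).le_opNorm y).trans ?_)
    gcongr
    refine (hm.norm_le x).trans ?_
    gcongr
    linarith [le_abs_self C₀]
  have hH1 : 1 ≤ ENNReal.ofReal (H + 1) := by
    rw [ENNReal.one_le_ofReal]; linarith
  -- For `h ≤ H` one has `1 + h|x| ≤ (H + 1)(1 + |x|)`, so the multiplier is dominated by `h⁻¹`
  -- times the weight at scale `h`.
  have hall : ∀ t ≤ T, ∫⁻ x, ‖m x (ψ t x)‖ₑ ≤ K * ENNReal.ofReal (H + 1) *
      (ENNReal.ofReal h⁻¹ * P t) := by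
    intro t ht
    rw [hP]; simp only
    rw [← lintegral_const_mul' _ _ ENNReal.ofReal_ne_top,
      ← lintegral_const_mul' _ _ (by finiteness)]
    refine lintegral_mono fun x => (hmK x _).trans ?_
    rw [← mul_assoc, ← mul_assoc, hK, ← ENNReal.ofReal_mul (by positivity),
      ← ENNReal.ofReal_mul (by positivity), ← ENNReal.ofReal_mul (by positivity)]
    gcongr
    rw [hw]; simp only
    have e : (|C₀| + 1) * (H + 1) * h⁻¹ * (h / (1 + h * |x|)) =
      (|C₀| + 1) * ((H + 1) / (1 + h * |x|)) := by field_simp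
    rw [e, div_eq_mul_one_div]
    refine mul_le_mul_of_nonneg_left ?_ (by positivity)
    rw [div_le_div_iff₀ (by positivity) (by positivity)]
    have := hh.2
    nlinarith [mul_nonneg hh0.le (abs_nonneg x), abs_nonneg x, mul_nonneg hH.le (abs_nonneg x),
      mul_nonneg (sub_nonneg.2 this) (abs_nonneg x)]
  have hint : ∀ t ≤ T, P t ≠ ⊤ → Integrable fun x => m x (ψ t x) := by
    intro t ht hPt
    refine ⟨(hm.stronglyMeasurable.clm_apply_of (hψc t).stronglyMeasurable).aestronglyMeasurable,
      (hall t ht).trans_lt ?_⟩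
    finiteness
  refine ⟨fun t ht => ?_, fun t ht => ?_⟩
  · refine (hall t ht).trans ?_
    calc K * ENNReal.ofReal (H + 1) * (ENNReal.ofReal h⁻¹ * P t)
        ≤ K * ENNReal.ofReal (H + 1) * (ENNReal.ofReal h⁻¹ * (C₁ * meanOsc T g h t)) := by
          gcongr; exact hPle t ht
      _ = K * C₁ * ENNReal.ofReal (H + 1) * (ENNReal.ofReal h⁻¹ * meanOsc T g h t) := by ring
      _ ≤ _ := by
          gcongr
          · exact le_mul_of_one_le_left zero_le one_le_two
          · exact le_self_add
  have ht0 : t ≤ T := by linarith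
  set RHS := ‖g (t + h) - g t‖ₑ + meanOsc T g h t + meanOsc T g h (t + h) +
          ENNReal.ofReal h⁻¹ * ∫⁻ τ in Ioc t (t + h), meanOsc T g h τ with hRHS
  have hC0 : 2 * K * (C₁ + 1) * ENNReal.ofReal (H + 1) ≠ 0 := by
    have : ENNReal.ofReal (H + 1) ≠ 0 := (zero_lt_one.trans_le hH1).ne'
    simp [hK0, this]
  -- If the contour integral may diverge at `t` or at `t + h`, the mean oscillation there is
  -- infinite and there is nothing to prove. Otherwise both integrals converge absolutely and can be
  -- split.
  by_cases hPt : P t = ⊤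
  · have : meanOsc T g h t = ⊤ := by
      by_contra hne
      have := hPle t ht0
      rw [hPt, top_le_iff] at this
      exact (ENNReal.mul_ne_top hC₁t hne) this
    rw [hRHS, this]
    simp [ENNReal.mul_top, hC0]
  by_cases hPt' : P (t + h) = ⊤
  · have : meanOsc T g h (t + h) = ⊤ := by
      by_contra hne
      have := hPle (t + h) ht
      rw [hPt', top_le_iff] at this
      exact (ENNReal.mul_ne_top hC₁t hne) this
    rw [hRHS, this]
    simp [ENNReal.mul_top, hC0]
  set ρ := h⁻¹ with hρ
  have hρ0 : 0 < ρ := inv_pos.2 hh0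
  set S := Ioc (-ρ) ρ with hS
  have hSm : MeasurableSet S := measurableSet_Ioc
  set R : ℝ → ℝ → X := fun t x => duhamel (contour α x) g t with hR
  have hRc : ∀ t, Continuous (R t) := fun t =>
    (differentiable_duhamel (hg.intervalIntegrable (a := 0) (b := t))).continuous.comp
    (continuous_contour α)
  have hγR : ∀ t, Continuous fun x => contour α x • R t x := fun t =>
    (continuous_contour α).smul (hRc t)
  have hSint : ∀ f : ℝ → X, Continuous f → IntegrableOn (fun x => m x (f x)) S := by
    intro f hf
    obtain ⟨M, hM⟩ := (isCompact_Icc (a := -ρ) (b := ρ)).exists_bound_of_continuousOn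
      hf.continuousOn
    refine Measure.integrableOn_of_bounded (M := C₀ * M) (by simp [hS]) ?_ ?_
    · exact (hm.stronglyMeasurable.clm_apply_of hf.stronglyMeasurable).aestronglyMeasurable
    · refine (ae_restrict_mem hSm).mono fun x hx => ((m x).le_opNorm _).trans ?_
      have hC₀ : 0 ≤ C₀ := (norm_nonneg _).trans (hm.truncated ρ hρ0)
      have h1 : ‖m x‖ ≤ C₀ := (hm.norm_le x).trans
        (div_le_self hC₀ (by linarith [abs_nonneg x]))
      have h2 := hM x (Ioc_subset_Icc_self hx)
      gcongr
  have hmS : IntegrableOn m S := by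
    refine Measure.integrableOn_of_bounded (M := C₀) (by simp [hS])
      hm.stronglyMeasurable.aestronglyMeasurable ?_
    refine Filter.Eventually.of_forall fun x => ?_
    have hC₀ : 0 ≤ C₀ := (norm_nonneg _).trans (hm.truncated ρ hρ0)
    exact (hm.norm_le x).trans (div_le_self hC₀ (by linarith [abs_nonneg x]))
  have hsplit : ∀ t ≤ T, P t ≠ ⊤ → contourOp α m g t = (∫ x in Sᶜ, m x (ψ t x)) +
      ((∫ x in S, m x) (g t) + ∫ x in S, m x (contour α x • R t x)) := by
    intro t ht hPt
    rw [contourOp, ← integral_add_compl hSm (hint t ht hPt), add_comm]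
    congr 1
    rw [ContinuousLinearMap.integral_apply hmS, ← integral_add (hmS.apply_continuousLinearMap _)
      (hSint _ (hγR t))]
    refine setIntegral_congr_fun hSm fun x _ => ?_
    simp only [hψ, duhamelDeriv, map_add, hR]
  -- Off `S` one has `1 ≤ h|x|`, hence `1 + h|x| ≤ 2h(1 + |x|)`.
  have hfar : ∀ t ≤ T, ‖∫ x in Sᶜ, m x (ψ t x)‖ₑ ≤ 2 * K * P t := by
    intro t ht
    refine (enorm_integral_le_lintegral_enorm _).trans ?_
    calc ∫⁻ x in Sᶜ, ‖m x (ψ t x)‖ₑ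
        ≤ ∫⁻ x in Sᶜ, 2 * K * (ENNReal.ofReal (w x) * ‖ψ t x‖ₑ) := by
          refine setLIntegral_mono' hSm.compl fun x hx => (hmK x _).trans ?_
          rw [← mul_assoc, hK, ← ENNReal.ofReal_ofNat 2, ← ENNReal.ofReal_mul (by positivity),
            ← ENNReal.ofReal_mul (by positivity)]
          gcongr
          have hx1 : ρ ≤ |x| := by
            by_contra hlt
            have := abs_lt.1 (not_le.1 hlt)
            exact hx ⟨this.1, this.2.le⟩
          have hx2 : 1 ≤ h * |x| := by
            have := mul_le_mul_of_nonneg_left hx1 hh0.le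
            rwa [hρ, mul_inv_cancel₀ hh0.ne'] at this
          rw [hw]; simp only
          rw [mul_div_assoc', div_le_div_iff₀ (by positivity) (by positivity)]
          have : 0 ≤ |C₀| + 1 := by positivity
          have hx3 : 1 + h * |x| ≤ 2 * h * (1 + |x|) := by nlinarith
          calc (|C₀| + 1) * (1 + h * |x|) ≤ (|C₀| + 1) * (2 * h * (1 + |x|)) := by gcongr
            _ = _ := by ring
      _ ≤ ∫⁻ x, 2 * K * (ENNReal.ofReal (w x) * ‖ψ t x‖ₑ) := setLIntegral_le_lintegral _ _
      _ = 2 * K * P t := lintegral_const_mul' _ _ (by finiteness)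
  have hmid : ‖(∫ x in S, m x) (g (t + h) - g t)‖ₑ ≤ K * ‖g (t + h) - g t‖ₑ := by
    rw [← ofReal_norm, ← ofReal_norm, hK, ← ENNReal.ofReal_mul (by positivity)]
    refine ENNReal.ofReal_le_ofReal ((ContinuousLinearMap.le_opNorm _ _).trans ?_)
    gcongr
    have := hm.truncated ρ hρ0
    rw [intervalIntegral.integral_of_le (by linarith)] at this
    linarith [le_abs_self C₀]
  -- The growth `1 + |x|` of the contour cancels the decay of the multiplier, and on `S` the weight
  -- satisfies `1 ≤ 2 h⁻¹ · h/(1 + h|x|)`.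
  have hnear : ‖∫ x in S, m x (contour α x • (R (t + h) x - R t x))‖ₑ ≤
      2 * K * (ENNReal.ofReal h⁻¹ * ∫⁻ τ in Ioc t (t + h), P τ) := by
    refine (enorm_integral_le_lintegral_enorm _).trans ?_
    have hmeas : AEMeasurable (Function.uncurry fun x τ => ENNReal.ofReal (w x) * ‖ψ τ x‖ₑ)
        ((volume.restrict S).prod (volume.restrict (Ioc t (t + h)))) := by
      refine Measurable.aemeasurable ?_
      exact ((hwm.comp measurable_fst).ennreal_ofReal).mul
        (stronglyMeasurable_duhamelDeriv hgm hg0).enorm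
    calc ∫⁻ x in S, ‖m x (contour α x • (R (t + h) x - R t x))‖ₑ
        ≤ ∫⁻ x in S, 2 * K * (ENNReal.ofReal h⁻¹ *
            ∫⁻ τ in Ioc t (t + h), ENNReal.ofReal (w x) * ‖ψ τ x‖ₑ) := by
          refine setLIntegral_mono' hSm fun x hx => (hmK x _).trans ?_
          have h1 : ‖contour α x • (R (t + h) x - R t x)‖ₑ ≤ ENNReal.ofReal (1 + |x|) *
              ∫⁻ τ in Ioc t (t + h), ‖ψ τ x‖ₑ := by
            rw [enorm_smul]
            gcongr
            · rw [← ofReal_norm]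
              exact ENNReal.ofReal_le_ofReal (norm_contour_le α x)
            · rw [hR]; simp only
              rw [duhamel_sub hg hg0, intervalIntegral.integral_of_le (by linarith)]
              exact enorm_integral_le_lintegral_enorm _
          refine (mul_le_mul_right h1 _).trans ?_
          rw [lintegral_const_mul' _ _ ENNReal.ofReal_ne_top, ← mul_assoc, ← mul_assoc, ← mul_assoc,
            hK, ← ENNReal.ofReal_ofNat 2, ← ENNReal.ofReal_mul (by positivity),
            ← ENNReal.ofReal_mul (by positivity), ← ENNReal.ofReal_mul (by positivity),
            ← ENNReal.ofReal_mul (by positivity)]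
          refine mul_le_mul_left (ENNReal.ofReal_le_ofReal ?_) _
          rw [div_mul_cancel₀ _ (by positivity)]
          have hx1 : |x| ≤ ρ := abs_le.2 ⟨hx.1.le, hx.2⟩
          have hx2 : h * |x| ≤ 1 := by
            have := mul_le_mul_of_nonneg_left hx1 hh0.le
            rwa [hρ, mul_inv_cancel₀ hh0.ne'] at this
          have e : 2 * (|C₀| + 1) * ρ * w x = (|C₀| + 1) * (2 / (1 + h * |x|)) := by
            rw [hw, hρ]; field_simp
          rw [e]
          refine le_mul_of_one_le_right (by positivity) ?_
          rw [one_le_div (by positivity)]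
          linarith
      _ = 2 * K * (ENNReal.ofReal h⁻¹ * ∫⁻ x in S, ∫⁻ τ in Ioc t (t + h),
            ENNReal.ofReal (w x) * ‖ψ τ x‖ₑ) := by
          rw [lintegral_const_mul' _ _ (by finiteness), lintegral_const_mul' _ _ (by finiteness)]
      _ = 2 * K * (ENNReal.ofReal h⁻¹ * ∫⁻ τ in Ioc t (t + h), ∫⁻ x in S,
            ENNReal.ofReal (w x) * ‖ψ τ x‖ₑ) := by
          rw [lintegral_lintegral_swap hmeas]
      _ ≤ _ := by
          gcongr with τ
          exact setLIntegral_le_lintegral _ _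
  have hdiff : contourOp α m g (t + h) - contourOp α m g t =
      (∫ x in Sᶜ, m x (ψ (t + h) x)) - (∫ x in Sᶜ, m x (ψ t x)) +
      ((∫ x in S, m x) (g (t + h) - g t) +
        ∫ x in S, m x (contour α x • (R (t + h) x - R t x))) := by
    rw [hsplit _ ht hPt', hsplit _ ht0 hPt, map_sub]
    have : ∫ x in S, m x (contour α x • (R (t + h) x - R t x)) =
        (∫ x in S, m x (contour α x • R (t + h) x)) - ∫ x in S, m x (contour α x • R t x) := by
      rw [← integral_sub (hSint _ (hγR _))
        (hSint _ (hγR _))]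
      refine integral_congr_ae (Filter.Eventually.of_forall fun x => ?_)
      simp only [smul_sub, map_sub]
    rw [this]
    abel
  have hPint : ∫⁻ τ in Ioc t (t + h), P τ ≤ C₁ * ∫⁻ τ in Ioc t (t + h), meanOsc T g h τ := by
    rw [← lintegral_const_mul' _ _ hC₁t]
    exact setLIntegral_mono' measurableSet_Ioc fun τ hτ => hPle τ (hτ.2.trans ht)
  rw [hdiff]
  calc _ ≤ (2 * K * P (t + h) + 2 * K * P t) + (K * ‖g (t + h) - g t‖ₑ +
        2 * K * (ENNReal.ofReal h⁻¹ * ∫⁻ τ in Ioc t (t + h), P τ)) := by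
        refine (enorm_add_le _ _).trans (add_le_add ?_ ?_)
        · exact (enorm_sub_le).trans (add_le_add (hfar _ ht) (hfar _ ht0))
        · exact (enorm_add_le _ _).trans (add_le_add hmid hnear)
    _ ≤ (2 * K * (C₁ * meanOsc T g h (t + h)) + 2 * K * (C₁ * meanOsc T g h t)) +
        (K * ‖g (t + h) - g t‖ₑ +
        2 * K * (ENNReal.ofReal h⁻¹ * (C₁ * ∫⁻ τ in Ioc t (t + h), meanOsc T g h τ))) := by
        gcongr
        · exact hPle _ ht
        · exact hPle _ ht0
    _ ≤ (2 * K * ((C₁ + 1) * meanOsc T g h (t + h)) + 2 * K * ((C₁ + 1) * meanOsc T g h t)) +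
        (2 * K * ((C₁ + 1) * ‖g (t + h) - g t‖ₑ) +
        2 * K * (ENNReal.ofReal h⁻¹ * ((C₁ + 1) *
          ∫⁻ τ in Ioc t (t + h), meanOsc T g h τ))) := by
        have e1 : C₁ ≤ C₁ + 1 := le_self_add
        gcongr
        · exact le_mul_of_one_le_left zero_le one_le_two
        · exact le_mul_of_one_le_left zero_le le_add_self
    _ = 2 * K * (C₁ + 1) * RHS := by rw [hRHS]; ring
    _ ≤ _ := mul_le_mul_left (le_mul_of_one_le_right zero_le hH1) _

end Pointwise

end

/-! ### Contour operators on Besov spaces. -/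

theorem ae_lt_top_of_eLpNorm_lt_top {α : Type*} [MeasurableSpace α] {μ : Measure α}
    {F : α → ENNReal} (hF : Measurable F) {q : ENNReal} (hq : q ≠ 0) (h : eLpNorm F q μ < ⊤) :
    ∀ᵐ x ∂μ, F x < ⊤ := by
  rcases eq_or_ne q ⊤ with rfl | hqt
  · rw [eLpNorm_exponent_top] at h
    filter_upwards [ae_le_eLpNormEssSup (f := F) (μ := μ)] with x hx
    exact lt_of_le_of_lt (by simpa using hx) h
  · have hqr : 0 < q.toReal := ENNReal.toReal_pos hq hqt
    have h1 := lintegral_rpow_enorm_lt_top_of_eLpNorm_lt_top hq hqt h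
    filter_upwards [ae_lt_top (hF.pow_const q.toReal) h1.ne] with x hx
    exact (ENNReal.rpow_lt_top_iff_of_pos hqr).1 hx

/-- One scale with finite oscillation is enough to make the contour integrals converge almost
everywhere. -/
theorem exists_lt_top_of_wNorm_lt_top {θ : ℝ} {q : ENNReal} (hq : 1 ≤ q) {F : ℝ → ENNReal}
    (hF : Measurable F) (h : wNorm θ q F < ⊤) {b : ℝ} (hb : 0 < b) :
    ∃ s ∈ Ioo 0 b, F s < ⊤ := by
  have h1 := ae_lt_top_of_eLpNorm_lt_top ((measurable_weight θ).mul hF)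
    (zero_lt_one.trans_le hq).ne' h
  have h2 : ∀ᵐ s ∂(volume.restrict (Ioi (0 : ℝ))), F s < ⊤ := by
    unfold mulHaar at h1
    rw [ae_withDensity_iff (by fun_prop)] at h1
    filter_upwards [h1, ae_restrict_mem measurableSet_Ioi] with s hs hs0
    have hs0' : (0 : ℝ) < s := hs0
    have h3 := hs (by simpa using hs0')
    by_contra hne
    have h4 : ENNReal.ofReal (s ^ (-θ)) * F s < ⊤ := h3
    rw [not_lt_top_iff.1 hne, ENNReal.mul_top
      (ENNReal.ofReal_pos.2 (Real.rpow_pos_of_pos hs0' _)).ne'] at h4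
    exact h4.ne rfl
  rw [ae_restrict_iff' measurableSet_Ioi] at h2
  by_contra! hcon
  have h3 : volume (Ioo 0 b) = 0 := by
    refine measure_mono_null (fun s hs => ?_) h2
    intro h4
    exact absurd (h4 hs.1) (not_lt.2 (hcon s hs))
  rw [Real.volume_Ioo, ENNReal.ofReal_eq_zero] at h3
  linarith

section

variable {X : Type*} [NormedAddCommGroup X]

theorem memBesov_iff {a b θ : ℝ} {p q : ENNReal} {u : ℝ → X} :
    MemBesov a b θ p q u ↔ MemLp u p (volume.restrict (Ioo a b)) ∧
      wNorm θ q ((Ioo 0 (b - a)).indicator (lpDiff a b p u)) < ⊤ := by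
  unfold MemBesov wNorm
  rw [← mulHaar_restrict_Ioo, ← eLpNorm_indicator_eq_eLpNorm_restrict measurableSet_Ioo]
  have : ((Ioo 0 (b - a)).indicator fun h => ENNReal.ofReal (h ^ (-θ)) * lpDiff a b p u h) =
      fun h => ENNReal.ofReal (h ^ (-θ)) * (Ioo 0 (b - a)).indicator (lpDiff a b p u) h := by
    funext h
    by_cases hh : h ∈ Ioo 0 (b - a)
    · rw [indicator_of_mem hh, indicator_of_mem hh]
    · rw [indicator_of_notMem hh, indicator_of_notMem hh, mul_zero]
  rw [this]

theorem measurable_lpDiff {a b : ℝ} {p : ENNReal} (hp : 1 ≤ p) (hpt : p ≠ ⊤) {u : ℝ → X}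
    (hu : StronglyMeasurable u) : Measurable (lpDiff a b p u) := by
  have hp0 : p ≠ 0 := (zero_lt_one.trans_le hp).ne'
  have h1 : lpDiff a b p u = fun h => (∫⁻ t, {z : ℝ × ℝ | z.2 ∈ Ioo a (b - z.1)}.indicator
      (fun z => ‖u (z.2 + z.1) - u z.2‖ₑ ^ p.toReal) (h, t)) ^ (1 / p.toReal) := by
    funext h
    unfold lpDiff
    rw [eLpNorm_eq_lintegral_rpow_enorm_toReal hp0 hpt, ← lintegral_indicator measurableSet_Ioo]
    congr 1
  rw [h1]
  refine Measurable.pow_const (Measurable.lintegral_prod_right' ?_) _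
  refine Measurable.indicator ?_ ?_
  · exact (((hu.comp_measurable (by fun_prop)).sub
      (hu.comp_measurable (by fun_prop))).enorm).pow_const _
  · exact (measurableSet_lt measurable_const measurable_snd).inter
      (measurableSet_lt measurable_snd (by fun_prop))

theorem eLpNorm_comp_add_restrict_le {E : Type*} [TopologicalSpace E] [ContinuousENorm E]
    {G : ℝ → E} (hG : StronglyMeasurable G) {S S' : Set ℝ} (hS : MeasurableSet S)
    {σ : ℝ} (h : ∀ t ∈ S, t + σ ∈ S') {p : ENNReal} :
    eLpNorm (fun t => G (t + σ)) p (volume.restrict S) ≤ eLpNorm G p (volume.restrict S') := by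
  have h1 : MeasurePreserving (fun t : ℝ => t + σ) (volume.restrict S)
      (volume.restrict ((fun t : ℝ => t - σ) ⁻¹' S)) := by
    have := (measurePreserving_add_right (volume : Measure ℝ) σ).restrict_preimage
      (s := (fun t : ℝ => t - σ) ⁻¹' S) (hS.preimage (by fun_prop))
    have e : (fun t : ℝ => t + σ) ⁻¹' ((fun t : ℝ => t - σ) ⁻¹' S) = S := by
      ext t; simp
    rwa [e] at this
  have h2 := eLpNorm_comp_measurePreserving (p := p) hG.aestronglyMeasurable h1
  rw [show (fun t => G (t + σ)) = G ∘ fun t => t + σ from rfl, h2]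
  refine eLpNorm_mono_measure _ (Measure.restrict_mono (fun t ht => ?_) le_rfl)
  have := h _ ht
  simpa using this

/-- Backward differences vanish at nonpositive times. For `t` in `(0, T)` the point `t - s` lies in
`(-T, T - s)`, where forward differences are controlled. -/
theorem eLpNorm_shift_le_lpDiff {T s : ℝ} (hs : s ∈ Ioo 0 T) {g : ℝ → X}
    (hg : StronglyMeasurable g) (hg0 : ∀ t ≤ 0, g t = 0) {p : ENNReal} :
    eLpNorm (fun t => g (t - s) - g t) p (volume.restrict (Ioo (-T) T)) ≤
      lpDiff (-T) T p g s := by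
  have h1 : eLpNorm (fun t => g (t - s) - g t) p (volume.restrict (Ioo (-T) T)) =
      eLpNorm (fun t => g (t - s) - g t) p (volume.restrict (Ioo 0 T)) := by
    rw [← eLpNorm_indicator_eq_eLpNorm_restrict measurableSet_Ioo,
      ← eLpNorm_indicator_eq_eLpNorm_restrict measurableSet_Ioo]
    congr 1
    funext t
    have hs' := hs.1
    have hs2 := hs.2
    by_cases ht : t ∈ Ioo 0 T
    · rw [indicator_of_mem ht, indicator_of_mem (show t ∈ Ioo (-T) T from ⟨by linarith [ht.1], ht.2⟩)]
    · rw [indicator_of_notMem ht]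
      by_cases ht' : t ∈ Ioo (-T) T
      · rw [indicator_of_mem ht']
        have : t ≤ 0 := by
          by_contra hc
          exact ht ⟨not_le.1 hc, ht'.2⟩
        rw [hg0 t this, hg0 (t - s) (by linarith), sub_zero]
      · rw [indicator_of_notMem ht']
  rw [h1]
  have h2 := eLpNorm_comp_add_restrict_le (p := p) (σ := -s) (S := Ioo 0 T) (S' := Ioo (-T) (T - s))
    (G := fun t => g (t + s) - g t) ((hg.comp_measurable (by fun_prop)).sub hg) measurableSet_Ioo
    (fun t ht => ⟨by linarith [ht.1, hs.2], by linarith [ht.2]⟩)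
  refine le_trans (le_of_eq ?_) h2
  rw [← eLpNorm_neg]
  congr 1
  funext t
  simp [sub_eq_add_neg]

variable [NormedSpace ℂ X]

/-- Minkowski's inequality moves the `Lᵖ` norm inside the `ds/s` integral; what appears is the Hardy
operator applied to the modulus of `g`. -/
theorem eLpNorm_meanOsc_le {T : ℝ} {g : ℝ → X} (hg : StronglyMeasurable g)
    (hg0 : ∀ t ≤ 0, g t = 0) {p : ENNReal} (hp : 1 ≤ p) (h : ℝ) :
    eLpNorm (meanOsc T g h) p (volume.restrict (Ioo (-T) T)) ≤
      ENNReal.ofReal h * eLpNorm g p (volume.restrict (Ioo (-T) T)) +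
      ∫⁻ s, ENNReal.ofReal (min 1 (h / s)) *
        (Ioo 0 (T - -T)).indicator (lpDiff (-T) T p g) s ∂mulHaar := by
  set μ := volume.restrict (Ioo (-T) T) with hμ
  have hkm : Measurable fun p : ℝ × ℝ => ENNReal.ofReal (min 1 (h / p.2)) := by fun_prop
  have hF : Measurable (Function.uncurry fun t s : ℝ => ENNReal.ofReal (min 1 (h / s)) *
      ‖g (t - s) - g t‖ₑ) := hkm.mul ((hg.comp_measurable (by fun_prop)).sub
      (hg.comp_measurable (by fun_prop))).enorm
  have h1 : eLpNorm (meanOsc T g h) p μ ≤ eLpNorm (fun t => ENNReal.ofReal h * ‖g t‖ₑ) p μ +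
      eLpNorm (fun t => ∫⁻ s in Ioo 0 T, ENNReal.ofReal (min 1 (h / s)) *
        ‖g (t - s) - g t‖ₑ ∂mulHaar) p μ := by
    have e : meanOsc T g h = (fun t => ENNReal.ofReal h * ‖g t‖ₑ) + fun t =>
      ∫⁻ s in Ioo 0 T, ENNReal.ofReal (min 1 (h / s)) * ‖g (t - s) - g t‖ₑ ∂mulHaar := rfl
    have m1 : Measurable fun t => ENNReal.ofReal h * ‖g t‖ₑ := Measurable.const_mul hg.enorm _
    have m2 : Measurable fun t => ∫⁻ s in Ioo 0 T, ENNReal.ofReal (min 1 (h / s)) *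
        ‖g (t - s) - g t‖ₑ ∂mulHaar := Measurable.lintegral_prod_right' hF
    rw [e]
    exact eLpNorm_add_le m1.aestronglyMeasurable m2.aestronglyMeasurable hp
  refine h1.trans (add_le_add ?_ ?_)
  · refine (eLpNorm_const_mul_ennreal ENNReal.ofReal_ne_top _ p).trans_eq ?_
    rw [eLpNorm_enorm]
  · refine (eLpNorm_lintegral_le hF hp).trans ?_
    rw [← lintegral_indicator measurableSet_Ioo]
    refine lintegral_mono fun s => ?_
    by_cases hs : s ∈ Ioo 0 T
    · have hs1 := hs.1
      have hs2 := hs.2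
      rw [indicator_of_mem hs, indicator_of_mem (show s ∈ Ioo 0 (T - -T) from ⟨hs1, by linarith⟩)]
      refine (eLpNorm_const_mul_ennreal ENNReal.ofReal_ne_top _ p).trans ?_
      gcongr
      rw [eLpNorm_enorm (f := fun t => g (t - s) - g t)]
      exact eLpNorm_shift_le_lpDiff hs hg hg0
    · rw [indicator_of_notMem hs]
      exact zero_le

theorem measurable_hardy {ω : ℝ → ENNReal} (hω : Measurable ω) :
    Measurable fun h : ℝ => ∫⁻ s, ENNReal.ofReal (min 1 (h / s)) * ω s ∂mulHaar := by
  refine Measurable.lintegral_prod_right' (f := fun z : ℝ × ℝ =>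
    ENNReal.ofReal (min 1 (z.1 / z.2)) * ω z.2) ?_
  have : Measurable fun z : ℝ × ℝ => ENNReal.ofReal (min 1 (z.1 / z.2)) := by fun_prop
  exact this.mul (hω.comp measurable_snd)

theorem exists_eLpNorm_meanOsc_lt_top {T θ : ℝ} (hT : 0 < T) (hθ : θ ∈ Ioo (0 : ℝ) 1)
    {p q : ENNReal} (hp : 1 ≤ p) (hpt : p ≠ ⊤) (hq : 1 ≤ q) {g : ℝ → X}
    (hg : StronglyMeasurable g) (hg0 : ∀ t ≤ 0, g t = 0) (hgB : MemBesov (-T) T θ p q g) :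
    ∃ h ∈ Ioo 0 (2 * T), eLpNorm (meanOsc T g h) p (volume.restrict (Ioo (-T) T)) < ⊤ := by
  obtain ⟨hLp, hw⟩ := memBesov_iff.1 hgB
  set ω := (Ioo 0 (T - -T)).indicator (lpDiff (-T) T p g) with hω
  have hωm : Measurable ω := (measurable_lpDiff hp hpt hg).indicator measurableSet_Ioo
  obtain ⟨C, hCt, hC⟩ := exists_hardy_const hθ
  have h1 := (hC q hq ω hωm).trans_lt (ENNReal.mul_lt_top hCt.lt_top hw)
  obtain ⟨h, hh, hfin⟩ := exists_lt_top_of_wNorm_lt_top hq (measurable_hardy hωm) h1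
    (b := 2 * T) (by linarith)
  refine ⟨h, hh, (eLpNorm_meanOsc_le hg hg0 hp h).trans_lt ?_⟩
  exact ENNReal.add_lt_top.2 ⟨ENNReal.mul_lt_top ENNReal.ofReal_lt_top hLp.2, hfin⟩

variable [CompleteSpace X]

/-- Singular contour integrals act on Besov spaces of functions vanishing for negative times. -/
theorem MemBesov.contourOp {α : ℝ} (hα : α ∈ Ioo (Real.pi / 2) Real.pi) {T θ : ℝ} (hT : 0 < T)
    (hθ : θ ∈ Ioo (0 : ℝ) 1) {p q : ENNReal} (hp : 1 ≤ p) (hpt : p ≠ ⊤) (hq : 1 ≤ q)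
    {m : ℝ → X →L[ℂ] X} {C₀ : ℝ} (hm : IsContourMultiplier m C₀) {g : ℝ → X}
    (hg : StronglyMeasurable g) (hgi : Integrable g) (hg0 : ∀ t ≤ 0, g t = 0)
    (hgB : MemBesov (-T) T θ p q g) : MemBesov (-T) T θ p q (contourOp α m g) := by
  obtain ⟨hLp, hw⟩ := memBesov_iff.1 hgB
  obtain ⟨C, hCt, hC⟩ := exists_contourOp_bounds (X := X) hα hT (by linarith : 0 < 2 * T) C₀
  have hV := stronglyMeasurable_contourOp (α := α) hm.stronglyMeasurable hg hg0
  refine memBesov_iff.2 ⟨⟨hV.aestronglyMeasurable, ?_⟩, ?_⟩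
  -- Membership in `Lᵖ` needs only the pointwise bound at a single good scale.
  · obtain ⟨h, hh, hfin⟩ := exists_eLpNorm_meanOsc_lt_top hT hθ hp hpt hq hg hg0 hgB
    have hb := (hC m hm g hg hgi hg0 h ⟨hh.1, hh.2.le⟩).1
    have h1 : eLpNorm (_root_.contourOp α m g) p (volume.restrict (Ioo (-T) T)) ≤
        eLpNorm (fun t => C * ENNReal.ofReal h⁻¹ * meanOsc T g h t) p
          (volume.restrict (Ioo (-T) T)) := by
      refine eLpNorm_mono_enorm_ae ((ae_restrict_mem measurableSet_Ioo).mono fun t ht => ?_)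
      rw [enorm_eq_self, mul_assoc]
      exact (enorm_integral_le_lintegral_enorm _).trans (hb t ht.2.le)
    refine h1.trans_lt ((eLpNorm_const_mul_ennreal (by finiteness) _ p).trans_lt ?_)
    exact ENNReal.mul_lt_top (by finiteness) hfin
  set ω := (Ioo 0 (T - -T)).indicator (lpDiff (-T) T p g) with hω
  have hωm : Measurable ω := (measurable_lpDiff hp hpt hg).indicator measurableSet_Ioo
  obtain ⟨C', hC't, hC'⟩ := exists_hardy_const hθ
  set N := eLpNorm g p (volume.restrict (Ioo (-T) T)) with hN
  -- Taking `Lᵖ` norms in the pointwise bound: translates by at most `h` stay inside `(-T, T)`, so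
  -- each of the three `meanOsc` terms, at `t`, at `t + h` and averaged in between, is bounded by
  -- the same norm.
  have key : ∀ h ∈ Ioo 0 (T - -T), lpDiff (-T) T p (_root_.contourOp α m g) h ≤
      C * (lpDiff (-T) T p g h + 3 * (ENNReal.ofReal h * N +
        ∫⁻ s, ENNReal.ofReal (min 1 (h / s)) * ω s ∂mulHaar)) := by
    intro h hh
    have hh0 := hh.1
    have hb := (hC m hm g hg hgi hg0 h ⟨hh.1, by linarith [hh.2]⟩).2
    set G := meanOsc T g h with hG
    have hGm : Measurable G := measurable_meanOsc hg h
    set μ := volume.restrict (Ioo (-T) (T - h)) with hμ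
    have hshift : ∀ σ ∈ Icc 0 h, eLpNorm (fun t => G (t + σ)) p μ ≤
        eLpNorm G p (volume.restrict (Ioo (-T) T)) := by
      intro σ hσ
      exact eLpNorm_comp_add_restrict_le (S' := Ioo (-T) T) hGm.stronglyMeasurable measurableSet_Ioo
        fun t ht => ⟨by linarith [ht.1, hσ.1], by linarith [ht.2, hσ.2]⟩
    have havg : eLpNorm (fun t => ENNReal.ofReal h⁻¹ * ∫⁻ τ in Ioc t (t + h), G τ) p μ ≤
        eLpNorm G p (volume.restrict (Ioo (-T) T)) := by
      have e : ∀ t, ∫⁻ τ in Ioc t (t + h), G τ = ∫⁻ σ in Ioc 0 h, G (t + σ) := by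
        intro t
        rw [← lintegral_indicator measurableSet_Ioc, ← lintegral_indicator measurableSet_Ioc,
          ← lintegral_add_left_eq_self _ t]
        refine lintegral_congr fun σ => ?_
        simp only [indicator, mem_Ioc]
        congr 1
        simp
      simp only [e]
      refine (eLpNorm_const_mul_ennreal ENNReal.ofReal_ne_top _ p).trans ?_
      have h2 := eLpNorm_lintegral_le (μ := μ) (ν := volume.restrict (Ioc 0 h))
        (F := fun t σ => G (t + σ)) (hGm.comp (by fun_prop)) hp
      refine (mul_le_mul_right h2 _).trans ?_
      have h3 : ∫⁻ σ in Ioc 0 h, eLpNorm (fun t => G (t + σ)) p μ ≤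
          ∫⁻ _ in Ioc 0 h, eLpNorm G p (volume.restrict (Ioo (-T) T)) :=
        setLIntegral_mono' measurableSet_Ioc fun σ hσ => hshift σ (Ioc_subset_Icc_self hσ)
      refine (mul_le_mul_right h3 _).trans_eq ?_
      rw [lintegral_const, Measure.restrict_apply_univ, Real.volume_Ioc, sub_zero, mul_comm,
        mul_assoc, ← ENNReal.ofReal_mul hh0.le, mul_inv_cancel₀ hh0.ne', ENNReal.ofReal_one, mul_one]
    have hm1 : Measurable fun t => ‖g (t + h) - g t‖ₑ :=
      ((hg.comp_measurable (by fun_prop)).sub hg).enorm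
    have hm2 : Measurable fun t => G (t + h) := hGm.comp (by fun_prop)
    have hm3 : Measurable fun t => ENNReal.ofReal h⁻¹ * ∫⁻ τ in Ioc t (t + h), G τ := by
      refine Measurable.const_mul ?_ _
      have e : (fun t => ∫⁻ τ in Ioc t (t + h), G τ) = fun t => ∫⁻ τ,
          {z : ℝ × ℝ | z.2 ∈ Ioc z.1 (z.1 + h)}.indicator (fun z => G z.2) (t, τ) := by
        funext t
        rw [← lintegral_indicator measurableSet_Ioc]
        rfl
      rw [e]
      refine Measurable.lintegral_prod_right' ((hGm.comp measurable_snd).indicator ?_)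
      exact (measurableSet_lt measurable_fst measurable_snd).inter
        (measurableSet_le measurable_snd (by fun_prop))
    have h4 : lpDiff (-T) T p (_root_.contourOp α m g) h ≤ C * eLpNorm (fun t =>
        ‖g (t + h) - g t‖ₑ + G t + G (t + h) +
          ENNReal.ofReal h⁻¹ * ∫⁻ τ in Ioc t (t + h), G τ) p μ := by
      refine le_trans ?_ (eLpNorm_const_mul_ennreal hCt _ p)
      refine eLpNorm_mono_enorm_ae ((ae_restrict_mem measurableSet_Ioo).mono fun t ht => ?_)
      rw [enorm_eq_self]
      exact hb t (by linarith [ht.2])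
    refine h4.trans ?_
    gcongr
    have h5 := eLpNorm_add_le (μ := μ) ((hm1.add hGm).add hm2).aestronglyMeasurable
      hm3.aestronglyMeasurable hp
    have h6 := eLpNorm_add_le (μ := μ) (hm1.add hGm).aestronglyMeasurable
      hm2.aestronglyMeasurable hp
    have h7 := eLpNorm_add_le (μ := μ) hm1.aestronglyMeasurable
      hGm.aestronglyMeasurable hp
    have h8 : eLpNorm (fun t => ‖g (t + h) - g t‖ₑ) p μ = lpDiff (-T) T p g h :=
      eLpNorm_enorm (f := fun t => g (t + h) - g t)
    have h9 := hshift 0 ⟨le_rfl, hh0.le⟩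
    simp only [add_zero] at h9
    have h10 := hshift h ⟨hh0.le, le_rfl⟩
    have h11 := eLpNorm_meanOsc_le (T := T) hg hg0 hp h
    calc _ ≤ ((lpDiff (-T) T p g h + eLpNorm G p μ) + eLpNorm (fun t => G (t + h)) p μ) +
          eLpNorm (fun t => ENNReal.ofReal h⁻¹ * ∫⁻ τ in Ioc t (t + h), G τ) p μ := by
          refine h5.trans (add_le_add (h6.trans (add_le_add (h7.trans ?_) le_rfl)) le_rfl)
          rw [h8]
      _ ≤ ((lpDiff (-T) T p g h + eLpNorm G p (volume.restrict (Ioo (-T) T))) +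
          eLpNorm G p (volume.restrict (Ioo (-T) T))) +
          eLpNorm G p (volume.restrict (Ioo (-T) T)) := by gcongr
      _ = lpDiff (-T) T p g h + 3 * eLpNorm G p (volume.restrict (Ioo (-T) T)) := by ring
      _ ≤ _ := by gcongr
  have hle : ∀ h, 0 < h → (Ioo 0 (T - -T)).indicator (lpDiff (-T) T p (_root_.contourOp α m g)) h ≤
      C * (ω h + 3 * (N * (Ioo 0 (T - -T)).indicator (fun h => ENNReal.ofReal h) h +
        ∫⁻ s, ENNReal.ofReal (min 1 (h / s)) * ω s ∂mulHaar)) := by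
    intro h _
    by_cases hh : h ∈ Ioo 0 (T - -T)
    · rw [indicator_of_mem hh, indicator_of_mem hh, hω, indicator_of_mem hh, mul_comm N]
      exact key h hh
    · rw [indicator_of_notMem hh]
      exact zero_le
  have hidm : Measurable ((Ioo 0 (T - -T)).indicator fun h : ℝ => ENNReal.ofReal h) :=
    Measurable.indicator (by fun_prop) measurableSet_Ioo
  have hHm := measurable_hardy hωm
  have hNt : N ≠ ⊤ := hLp.2.ne
  refine (wNorm_mono hle).trans_lt ?_
  refine (wNorm_const_mul_le hCt _).trans_lt (ENNReal.mul_lt_top hCt.lt_top ?_)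
  refine (wNorm_add_le hq hωm (((hidm.const_mul N).add hHm).const_mul 3)).trans_lt ?_
  refine ENNReal.add_lt_top.2 ⟨hw, ?_⟩
  refine (wNorm_const_mul_le (by finiteness) _).trans_lt (ENNReal.mul_lt_top (by finiteness) ?_)
  refine (wNorm_add_le hq (hidm.const_mul N) hHm).trans_lt ?_
  refine ENNReal.add_lt_top.2 ⟨?_, ?_⟩
  · refine (wNorm_const_mul_le hNt _).trans_lt (ENNReal.mul_lt_top hNt.lt_top ?_)
    exact wNorm_indicator_id_lt_top hθ hq _
  · exact (hC' q hq ω hωm).trans_lt (ENNReal.mul_lt_top hC't.lt_top hw)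

end

/-! ### Extension by zero to negative times. -/

/-- This absorption step is valid only for finite `x`. Both zero-extension proofs therefore work
with a truncated quantity and remove the truncation afterwards. -/
theorem ENNReal.le_inv_one_sub_mul {x M κ : ENNReal} (hx : x ≠ ⊤) (hκ : κ < 1)
    (h : x ≤ M + κ * x) : x ≤ (1 - κ)⁻¹ * M := by
  have h1 : (1 - κ) * x ≤ M := by
    rw [ENNReal.sub_mul (fun _ _ => hx), one_mul]
    exact tsub_le_iff_right.2 h
  have h2 : 1 - κ ≠ 0 := (tsub_pos_of_lt hκ).ne'
  have h3 : 1 - κ ≠ ⊤ := (tsub_le_self.trans_lt ENNReal.one_lt_top).ne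
  calc x = (1 - κ)⁻¹ * ((1 - κ) * x) := by
        rw [← mul_assoc, ENNReal.inv_mul_cancel h2 h3, one_mul]
    _ ≤ _ := mul_le_mul_right h1 _

/-- This is Fatou's lemma, applied through real-valued functions; it carries uniform bounds for
truncations over to the limit. -/
theorem wNorm_le_of_tendsto {θ : ℝ} {q : ENNReal} {χ : ℕ → ℝ → ENNReal} {F : ℝ → ENNReal}
    {C : ENNReal} (hm : ∀ k, Measurable (χ k)) (hfin : ∀ k s, χ k s ≠ ⊤) (hF : ∀ s, F s ≠ ⊤)
    (hlim : ∀ s, 0 < s → Filter.Tendsto (fun k => χ k s) Filter.atTop (nhds (F s)))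
    (hC : ∀ k, wNorm θ q (χ k) ≤ C) : wNorm θ q F ≤ C := by
  have e : ∀ G : ℝ → ENNReal, (∀ s, G s ≠ ⊤) → wNorm θ q G =
      eLpNorm (fun s => (ENNReal.ofReal (s ^ (-θ)) * G s).toReal) q mulHaar := by
    intro G hG
    refine eLpNorm_congr_enorm_ae (Filter.Eventually.of_forall fun s => ?_)
    have : ENNReal.ofReal (s ^ (-θ)) * G s ≠ ⊤ := ENNReal.mul_ne_top ENNReal.ofReal_ne_top (hG s)
    rw [Real.enorm_of_nonneg ENNReal.toReal_nonneg, ENNReal.ofReal_toReal this]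
    exact enorm_eq_self _
  rw [e F hF]
  refine Lp.eLpNorm_le_of_ae_tendsto (u := Filter.atTop) (f := fun k s =>
    (ENNReal.ofReal (s ^ (-θ)) * χ k s).toReal)
    (Filter.Eventually.of_forall fun k => (e _ (hfin k)).symm.trans_le (hC k)) (fun k => ?_) ?_
  · exact ((measurable_weight θ).mul (hm k)).ennreal_toReal.aestronglyMeasurable
  · filter_upwards [ae_mulHaar_pos] with s hs
    refine (ENNReal.tendsto_toReal (ENNReal.mul_ne_top ENNReal.ofReal_ne_top (hF s))).comp ?_
    exact ENNReal.Tendsto.const_mul (hlim s hs) (Or.inr ENNReal.ofReal_ne_top)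

theorem wNorm_sum_le {θ : ℝ} {q : ENNReal} (hq : 1 ≤ q) {ι : Type*} (S : Finset ι)
    {F : ι → ℝ → ENNReal} (hF : ∀ i, Measurable (F i)) :
    wNorm θ q (fun h => ∑ i ∈ S, F i h) ≤ ∑ i ∈ S, wNorm θ q (F i) := by
  classical
  induction S using Finset.induction_on with
  | empty =>
    simp only [Finset.sum_empty, nonpos_iff_eq_zero]
    unfold wNorm
    simp
  | insert i S hi ih =>
    simp only [Finset.sum_insert hi]
    exact (wNorm_add_le hq (hF i) (Finset.measurable_fun_sum S fun i _ => hF i)).trans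
      (add_le_add le_rfl ih)

section

variable {X : Type*} [NormedAddCommGroup X]

theorem monotone_eLpNorm_restrict_Iic (g : ℝ → X) (p : ENNReal) :
    Monotone fun h : ℝ => eLpNorm g p (volume.restrict (Iic h)) := fun _ _ h =>
  eLpNorm_mono_measure _ (Measure.restrict_mono (Iic_subset_Iic.2 h) le_rfl)

theorem eLpNorm_restrict_Iic_eq {g : ℝ → X} (hg0 : ∀ t ≤ 0, g t = 0) (p : ENNReal) (s : ℝ) :
    eLpNorm g p (volume.restrict (Iic s)) = eLpNorm g p (volume.restrict (Ioc 0 s)) := by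
  rw [← eLpNorm_indicator_eq_eLpNorm_restrict measurableSet_Iic,
    ← eLpNorm_indicator_eq_eLpNorm_restrict measurableSet_Ioc]
  congr 1
  funext t
  simp only [indicator, mem_Iic, mem_Ioc]
  split_ifs with h1 h2 h2
  · rfl
  · exact hg0 t (by by_contra hc; exact h2 ⟨not_le.1 hc, h1⟩)
  · exact absurd h2.2 h1
  · rfl

theorem eLpNorm_Ioc_le_lpDiff_add {g : ℝ → X} (hg : StronglyMeasurable g) {T s σ : ℝ}
    (h : s + σ < T) {p : ENNReal} (hp : 1 ≤ p) :
    eLpNorm g p (volume.restrict (Ioc 0 s)) ≤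
      lpDiff 0 T p g σ + eLpNorm g p (volume.restrict (Ioc σ (σ + s))) := by
  have hm1 : StronglyMeasurable fun t => g (t + σ) := hg.comp_measurable (by fun_prop)
  have h1 := eLpNorm_sub_le (p := p) (μ := volume.restrict (Ioc 0 s)) hm1.aestronglyMeasurable
    (hm1.sub hg).aestronglyMeasurable hp
  rw [show (fun t => g (t + σ)) - ((fun t => g (t + σ)) - g) = g by simp, add_comm] at h1
  refine h1.trans (add_le_add ?_ ?_)
  · exact eLpNorm_mono_measure _ (Measure.restrict_mono
      (fun t ht => show t ∈ Ioo 0 (T - σ) from ⟨ht.1, by linarith [ht.2]⟩) le_rfl)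
  · exact eLpNorm_comp_add_restrict_le (S' := Ioc σ (σ + s)) hg measurableSet_Ioc
      fun t ht => ⟨by linarith [ht.1], by linarith [ht.2]⟩

theorem eLpNorm_Ioc_shift_le_lpDiff_add {g : ℝ → X} (hg : StronglyMeasurable g) {T s σ : ℝ}
    (h : s + σ < T) {p : ENNReal} (hp : 1 ≤ p) :
    eLpNorm g p (volume.restrict (Ioc σ (σ + s))) ≤
      lpDiff 0 T p g σ + eLpNorm g p (volume.restrict (Ioc 0 s)) := by
  have hm1 : StronglyMeasurable fun t => g (t + σ) := hg.comp_measurable (by fun_prop)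
  have h0 : eLpNorm g p (volume.restrict (Ioc σ (σ + s))) ≤
      eLpNorm (fun t => g (t + σ)) p (volume.restrict (Ioc 0 s)) := by
    have := eLpNorm_comp_add_restrict_le (p := p) (S := Ioc σ (σ + s)) (S' := Ioc 0 s) (σ := -σ) hm1
      measurableSet_Ioc fun t ht => ⟨by linarith [ht.1], by linarith [ht.2]⟩
    simpa using this
  refine h0.trans ?_
  have h1 := eLpNorm_add_le (p := p) (μ := volume.restrict (Ioc 0 s))
    (hm1.sub hg).aestronglyMeasurable hg.aestronglyMeasurable hp
  rw [sub_add_cancel] at h1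
  refine h1.trans (add_le_add ?_ le_rfl)
  exact eLpNorm_mono_measure _ (Measure.restrict_mono
      (fun t ht => show t ∈ Ioo 0 (T - σ) from ⟨ht.1, by linarith [ht.2]⟩) le_rfl)

/-- At `t ≤ 0` the difference is just `g (t + h)`, so extending by zero costs the mass of `g` on
`(0, h]`. -/
theorem lpDiff_le_lpDiff_add {T h : ℝ} {g : ℝ → X} (hg : StronglyMeasurable g)
    (hg0 : ∀ t ≤ 0, g t = 0) {p : ENNReal} (hp : 1 ≤ p) :
    lpDiff (-T) T p g h ≤ lpDiff 0 T p g h + eLpNorm g p (volume.restrict (Iic h)) := by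
  have hm1 : StronglyMeasurable fun t => g (t + h) := hg.comp_measurable (by fun_prop)
  have hA : StronglyMeasurable ((Ioo 0 (T - h)).indicator fun t => g (t + h) - g t) :=
    (hm1.sub hg).indicator measurableSet_Ioo
  have hB : StronglyMeasurable ((Iic 0).indicator fun t => g (t + h)) :=
    hm1.indicator measurableSet_Iic
  have h1 : lpDiff (-T) T p g h ≤ eLpNorm ((Ioo 0 (T - h)).indicator (fun t => g (t + h) - g t) +
      (Iic 0).indicator fun t => g (t + h)) p volume := by
    unfold lpDiff
    rw [← eLpNorm_indicator_eq_eLpNorm_restrict measurableSet_Ioo]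
    refine eLpNorm_mono fun t => ?_
    by_cases ht : t ∈ Ioo (-T) (T - h)
    · rw [indicator_of_mem ht, Pi.add_apply]
      rcases le_or_gt t 0 with h0 | h0
      · rw [indicator_of_notMem (fun hc => absurd hc.1 (not_lt.2 h0)),
          indicator_of_mem (show t ∈ Iic 0 from h0), hg0 t h0]
        simp
      · rw [indicator_of_mem (show t ∈ Ioo 0 (T - h) from ⟨h0, ht.2⟩),
          indicator_of_notMem (show t ∉ Iic 0 from not_le.2 h0)]
        simp
    · rw [indicator_of_notMem ht, norm_zero]
      exact norm_nonneg _
  refine h1.trans ((eLpNorm_add_le hA.aestronglyMeasurable hB.aestronglyMeasurable hp).trans ?_)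
  rw [eLpNorm_indicator_eq_eLpNorm_restrict measurableSet_Ioo,
    eLpNorm_indicator_eq_eLpNorm_restrict measurableSet_Iic]
  refine add_le_add le_rfl ?_
  exact eLpNorm_comp_add_restrict_le (S' := Iic h) hg measurableSet_Iic fun t ht => by
    simp only [mem_Iic] at ht ⊢; linarith

/-- A Besov function on `(0, T)` extends by zero if its norm near zero is small enough. -/
theorem memBesov_neg_of_wNorm_lt_top {T θ a : ℝ} (ha : 0 < a) (hθ : θ ∈ Ioo (0 : ℝ) 1)
    {p q : ENNReal} (hp : 1 ≤ p) (hpt : p ≠ ⊤) (hq : 1 ≤ q) {g : ℝ → X}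
    (hg : StronglyMeasurable g) (hg0 : ∀ t ≤ 0, g t = 0) (hgL : MemLp g p volume)
    (hgB : MemBesov 0 T θ p q g)
    (h : wNorm θ q ((Ioo 0 a).indicator fun h => eLpNorm g p (volume.restrict (Iic h))) < ⊤) :
    MemBesov (-T) T θ p q g := by
  obtain ⟨hLp, hw⟩ := memBesov_iff.1 hgB
  refine memBesov_iff.2 ⟨hgL.restrict _, ?_⟩
  set φ := fun h => eLpNorm g p (volume.restrict (Iic h)) with hφ
  have hφm : Measurable φ := (monotone_eLpNorm_restrict_Iic g p).measurable
  -- For `h ≥ a` the mass of `g` is at most `(‖g‖/a) · h`, a term of order `h`, so only `h < a`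
  -- matters.
  set D := eLpNorm g p volume * ENNReal.ofReal a⁻¹ with hD
  have hDt : D ≠ ⊤ := ENNReal.mul_ne_top hgL.2.ne ENNReal.ofReal_ne_top
  have hωm : Measurable ((Ioo 0 (T - 0)).indicator (lpDiff 0 T p g)) :=
    (measurable_lpDiff hp hpt hg).indicator measurableSet_Ioo
  have hidm : Measurable ((Ioo 0 (T - -T)).indicator fun h : ℝ => ENNReal.ofReal h) :=
    Measurable.indicator (by fun_prop) measurableSet_Ioo
  have hle : ∀ s, 0 < s → (Ioo 0 (T - -T)).indicator (lpDiff (-T) T p g) s ≤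
      (Ioo 0 (T - 0)).indicator (lpDiff 0 T p g) s + ((Ioo 0 a).indicator φ s +
        D * (Ioo 0 (T - -T)).indicator (fun h : ℝ => ENNReal.ofReal h) s) := by
    intro s hs
    by_cases hs' : s ∈ Ioo 0 (T - -T)
    · rw [indicator_of_mem hs', indicator_of_mem hs']
      refine (lpDiff_le_lpDiff_add hg hg0 hp).trans (add_le_add ?_ ?_)
      · by_cases hsT : s < T
        · rw [indicator_of_mem (show s ∈ Ioo 0 (T - 0) from ⟨hs, by linarith⟩)]
        · unfold lpDiff
          rw [Ioo_eq_empty (by linarith)]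
          simp
      · by_cases hsa : s < a
        · rw [indicator_of_mem (show s ∈ Ioo 0 a from ⟨hs, hsa⟩)]
          exact le_self_add
        · refine le_trans ?_ le_add_self
          rw [hD, mul_assoc, ← ENNReal.ofReal_mul (by positivity)]
          refine (eLpNorm_mono_measure _ Measure.restrict_le_self).trans ?_
          refine le_mul_of_one_le_right' ?_
          rw [← ENNReal.ofReal_one]
          refine ENNReal.ofReal_le_ofReal ?_
          rw [inv_mul_eq_div, one_le_div ha]
          exact not_lt.1 hsa
    · rw [indicator_of_notMem hs']
      exact zero_le
  refine (wNorm_mono hle).trans_lt ((wNorm_add_le hq hωm ((hφm.indicator measurableSet_Ioo).add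
    (hidm.const_mul D))).trans_lt (ENNReal.add_lt_top.2 ⟨hw, ?_⟩))
  refine (wNorm_add_le hq (hφm.indicator measurableSet_Ioo) (hidm.const_mul D)).trans_lt
    (ENNReal.add_lt_top.2 ⟨h, ?_⟩)
  exact (wNorm_const_mul_le hDt _).trans_lt
    (ENNReal.mul_lt_top hDt.lt_top (wNorm_indicator_id_lt_top hθ hq _))

theorem sum_lintegral_Ioc_le (F : ℝ → ENNReal) {s : ℝ} (hs : 0 ≤ s) (n : ℕ) :
    ∑ j ∈ Finset.range n, ∫⁻ t in Ioc (((j : ℝ) + 1) * s) (((j : ℝ) + 1) * s + s), F t ≤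
      ∫⁻ t in Iic (((n : ℝ) + 1) * s), F t := by
  induction n with
  | zero => simp
  | succ n ih =>
    rw [Finset.sum_range_succ]
    refine (add_le_add ih le_rfl).trans_eq ?_
    rw [← lintegral_union measurableSet_Ioc]
    · congr 2
      push_cast
      rw [Iic_union_Ioc_eq_Iic (by linarith)]
      congr 1
      ring
    · exact Set.disjoint_left.2 fun t ht ht' => absurd ht'.1 (not_lt.2 ht)

/-- Pigeonhole: among the `n` intervals following `(0, s]`, all of length `s`, one carries at most
`1/n` of the integral of `‖g‖^p` up to `(n + 1)s`. Comparing `g` on `(0, s]` with its translate to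
that interval costs one modulus and gains `n^{-1/p}`. -/
theorem eLpNorm_Iic_le_sum_lpDiff {g : ℝ → X} (hg : StronglyMeasurable g)
    (hg0 : ∀ t ≤ 0, g t = 0) {T s : ℝ} (hs : 0 < s) {n : ℕ} (hn : 0 < n)
    (h : ((n : ℝ) + 1) * s < T) {p : ENNReal} (hp : 1 ≤ p) (hpt : p ≠ ⊤) :
    eLpNorm g p (volume.restrict (Iic s)) ≤
      (∑ j ∈ Finset.range n, lpDiff 0 T p g (((j : ℝ) + 1) * s)) +
        ENNReal.ofReal ((n : ℝ) ^ (-(1 / p.toReal))) *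
          eLpNorm g p (volume.restrict (Iic (((n : ℝ) + 1) * s))) := by
  have hp0 : p ≠ 0 := (zero_lt_one.trans_le hp).ne'
  have hpr : 0 < p.toReal := ENNReal.toReal_pos hp0 hpt
  have hn' : (0 : ℝ) < n := by exact_mod_cast hn
  have h1 := sum_lintegral_Ioc_le (fun t => ‖g t‖ₑ ^ p.toReal) hs.le n
  obtain ⟨j, hj, hjle⟩ : ∃ j ∈ Finset.range n,
      ∫⁻ t in Ioc (((j : ℝ) + 1) * s) (((j : ℝ) + 1) * s + s), ‖g t‖ₑ ^ p.toReal ≤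
        ENNReal.ofReal (n : ℝ)⁻¹ * ∫⁻ t in Iic (((n : ℝ) + 1) * s), ‖g t‖ₑ ^ p.toReal := by
    by_contra! hcon
    refine absurd h1 (not_le.2 ?_)
    refine lt_of_eq_of_lt ?_
      (ENNReal.sum_lt_sum_of_nonempty (Finset.nonempty_range_iff.2 hn.ne') hcon)
    rw [Finset.sum_const, Finset.card_range, nsmul_eq_mul, ← mul_assoc,
      ENNReal.ofReal_inv_of_pos hn', ENNReal.ofReal_natCast,
      ENNReal.mul_inv_cancel (by exact_mod_cast hn.ne') (ENNReal.natCast_ne_top n), one_mul]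
  have hjn : ((j : ℝ) + 1) ≤ n := by exact_mod_cast Finset.mem_range.1 hj
  rw [eLpNorm_restrict_Iic_eq hg0]
  refine (eLpNorm_Ioc_le_lpDiff_add hg (σ := ((j : ℝ) + 1) * s) (T := T) ?_ hp).trans
    (add_le_add ?_ ?_)
  · refine lt_of_le_of_lt ?_ h
    nlinarith
  · exact Finset.single_le_sum (f := fun j : ℕ => lpDiff 0 T p g (((j : ℝ) + 1) * s))
      (fun _ _ => zero_le) hj
  · rw [eLpNorm_eq_lintegral_rpow_enorm_toReal hp0 hpt,
      eLpNorm_eq_lintegral_rpow_enorm_toReal hp0 hpt]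
    refine (ENNReal.rpow_le_rpow hjle (by positivity)).trans_eq ?_
    rw [ENNReal.mul_rpow_of_nonneg _ _ (by positivity),
      ENNReal.ofReal_rpow_of_pos (by positivity), Real.inv_rpow hn'.le, ← Real.rpow_neg hn'.le]

/-- With `ρ = 1/p > θ`, the pigeonhole gain `n^{-1/p}` beats the dilation loss `(n + 1)^θ` for large
`n`. -/
theorem exists_nat_rpow_mul_lt_one {θ ρ : ℝ} (hθ : 0 < θ) (h : θ < ρ) :
    ∃ n : ℕ, 0 < n ∧ (n : ℝ) ^ (-ρ) * ((n : ℝ) + 1) ^ θ < 1 := by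
  have h1 : Filter.Tendsto (fun n : ℕ => (2 : ℝ) ^ θ * (n : ℝ) ^ (-(ρ - θ))) Filter.atTop
      (nhds (2 ^ θ * 0)) :=
    ((tendsto_rpow_neg_atTop (sub_pos.2 h)).comp tendsto_natCast_atTop_atTop).const_mul _
  rw [mul_zero] at h1
  obtain ⟨n, hn, hn0⟩ := ((h1.eventually (gt_mem_nhds zero_lt_one)).and
    (Filter.eventually_gt_atTop 0)).exists
  refine ⟨n, hn0, lt_of_le_of_lt ?_ hn⟩
  have hn' : (1 : ℝ) ≤ n := by exact_mod_cast hn0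
  calc (n : ℝ) ^ (-ρ) * ((n : ℝ) + 1) ^ θ ≤ (n : ℝ) ^ (-ρ) * (2 * (n : ℝ)) ^ θ := by
        gcongr; linarith
    _ = 2 ^ θ * ((n : ℝ) ^ (-ρ) * (n : ℝ) ^ θ) := by
        rw [Real.mul_rpow (by norm_num) (by linarith)]; ring
    _ = _ := by
        rw [← Real.rpow_add (by linarith)]
        congr 2
        ring

/-- Zero extension for `θ < 1 / p`. -/
theorem memBesov_neg_of_lt {T θ : ℝ} (hT : 0 < T) (hθ : θ ∈ Ioo (0 : ℝ) 1)
    {p q : ENNReal} (hp : 1 ≤ p) (hpt : p ≠ ⊤) (hq : 1 ≤ q) (hθp : θ < 1 / p.toReal) {g : ℝ → X}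
    (hg : StronglyMeasurable g) (hg0 : ∀ t ≤ 0, g t = 0) (hgL : MemLp g p volume)
    (hgB : MemBesov 0 T θ p q g) : MemBesov (-T) T θ p q g := by
  obtain ⟨n, hn, hκ⟩ := exists_nat_rpow_mul_lt_one hθ.1 hθp
  have hn' : (0 : ℝ) < n := by exact_mod_cast hn
  set a := T / ((n : ℝ) + 1) with ha
  have ha0 : 0 < a := by positivity
  refine memBesov_neg_of_wNorm_lt_top ha0 hθ hp hpt hq hg hg0 hgL hgB ?_
  obtain ⟨hLp, hw⟩ := memBesov_iff.1 hgB
  set ω := (Ioo 0 (T - 0)).indicator (lpDiff 0 T p g) with hω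
  have hωm : Measurable ω := (measurable_lpDiff hp hpt hg).indicator measurableSet_Ioo
  set φ := fun h => eLpNorm g p (volume.restrict (Iic h)) with hφ
  have hφm : Measurable φ := (monotone_eLpNorm_restrict_Iic g p).measurable
  set N := eLpNorm g p volume with hN
  have hNt : N ≠ ⊤ := hgL.2.ne
  have hφN : ∀ s, φ s ≤ N := fun s => eLpNorm_mono_measure _ Measure.restrict_le_self
  set K := ENNReal.ofReal ((n : ℝ) ^ (-(1 / p.toReal))) with hK
  have hKt : K ≠ ⊤ := ENNReal.ofReal_ne_top
  -- This covers the scales `s < a` for which `(n + 1)s ≥ a` leaves the truncation window: there the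
  -- mass is at most `N ≤ D s`.
  set D := N * ENNReal.ofReal (a⁻¹ * ((n : ℝ) + 1)) with hD
  have hDt : D ≠ ⊤ := ENNReal.mul_ne_top hNt ENNReal.ofReal_ne_top
  set ι := (Ioo 0 a).indicator (fun h : ℝ => ENNReal.ofReal h) with hι
  have hιm : Measurable ι := Measurable.indicator (by fun_prop) measurableSet_Ioo
  set M := (∑ j ∈ Finset.range n, wNorm θ q fun s => ω (((j : ℝ) + 1) * s)) +
    K * (D * wNorm θ q ι) with hM
  have hMt : M < ⊤ := by
    refine ENNReal.add_lt_top.2 ⟨ENNReal.sum_lt_top.2 fun j _ => ?_, ?_⟩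
    · exact (wNorm_comp_mul (by positivity) hωm).trans_lt
        (ENNReal.mul_lt_top ENNReal.ofReal_lt_top hw)
    · exact ENNReal.mul_lt_top hKt.lt_top (ENNReal.mul_lt_top hDt.lt_top
        (wNorm_indicator_id_lt_top hθ hq _))
  have hκ' : K * ENNReal.ofReal (((n : ℝ) + 1) ^ θ) < 1 := by
    rw [hK, ← ENNReal.ofReal_mul (by positivity), ← ENNReal.ofReal_one]
    exact (ENNReal.ofReal_lt_ofReal_iff zero_lt_one).2 hκ
  -- Cutting off at `ε` makes the norm finite a priori, so the dilated copy can be absorbed.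
  -- Dilation by `n + 1` moves scales away from `ε`, hence the cut-off is compatible with the
  -- recursion, and the bound does not depend on `ε`.
  have key : ∀ ε, 0 < ε → wNorm θ q ((Ioo ε a).indicator φ) ≤
      (1 - K * ENNReal.ofReal (((n : ℝ) + 1) ^ θ))⁻¹ * M := by
    intro ε hε
    set χ := (Ioo ε a).indicator φ with hχ
    have hχm : Measurable χ := hφm.indicator measurableSet_Ioo
    have hχt : wNorm θ q χ ≠ ⊤ := by
      have hle : ∀ s, 0 < s → χ s ≤ N * ENNReal.ofReal ε⁻¹ * ι s := by
        intro s hs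
        by_cases h : s ∈ Ioo ε a
        · rw [hχ, indicator_of_mem h, hι, indicator_of_mem (show s ∈ Ioo 0 a from ⟨hs, h.2⟩),
            mul_assoc, ← ENNReal.ofReal_mul (by positivity)]
          refine (hφN s).trans (le_mul_of_one_le_right' ?_)
          rw [← ENNReal.ofReal_one]
          refine ENNReal.ofReal_le_ofReal ?_
          rw [inv_mul_eq_div, one_le_div hε]
          exact h.1.le
        · rw [hχ, indicator_of_notMem h]
          exact zero_le
      refine ((wNorm_mono hle).trans_lt ((wNorm_const_mul_le (by finiteness) _).trans_lt ?_)).ne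
      exact ENNReal.mul_lt_top (by finiteness) (wNorm_indicator_id_lt_top hθ hq _)
    refine ENNReal.le_inv_one_sub_mul hχt hκ' ?_
    have hle : ∀ s, 0 < s → χ s ≤ (∑ j ∈ Finset.range n, ω (((j : ℝ) + 1) * s)) +
        K * (D * ι s + χ (((n : ℝ) + 1) * s)) := by
      intro s hs
      by_cases h : s ∈ Ioo ε a
      · have hsT : ((n : ℝ) + 1) * s < T := by
          have := h.2
          rw [ha, lt_div_iff₀ (by positivity)] at this
          linarith
        rw [hχ, indicator_of_mem h]
        refine (eLpNorm_Iic_le_sum_lpDiff hg hg0 hs hn hsT hp hpt).trans (add_le_add ?_ ?_)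
        · refine Finset.sum_le_sum fun j hj => ?_
          have hjn : ((j : ℝ) + 1) ≤ n := by exact_mod_cast Finset.mem_range.1 hj
          rw [hω, indicator_of_mem (show ((j : ℝ) + 1) * s ∈ Ioo 0 (T - 0) from
            ⟨by positivity, by nlinarith⟩)]
        · refine mul_le_mul_right ?_ _
          by_cases h' : ((n : ℝ) + 1) * s < a
          · rw [indicator_of_mem (show ((n : ℝ) + 1) * s ∈ Ioo ε a from
              ⟨by nlinarith [h.1], h'⟩)]
            exact le_add_self
          · refine le_trans ((hφN _).trans ?_) le_self_add
            rw [hι, indicator_of_mem (show s ∈ Ioo 0 a from ⟨hs, h.2⟩), hD, mul_assoc,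
              ← ENNReal.ofReal_mul (by positivity)]
            refine le_mul_of_one_le_right' ?_
            rw [← ENNReal.ofReal_one]
            refine ENNReal.ofReal_le_ofReal ?_
            rw [mul_assoc, inv_mul_eq_div, one_le_div ha0]
            exact not_lt.1 h'
      · rw [hχ, indicator_of_notMem h]
        exact zero_le
    have hχcm : Measurable fun s => χ (((n : ℝ) + 1) * s) := hχm.comp (by fun_prop)
    have hωcm : ∀ j : ℕ, Measurable fun s => ω (((j : ℝ) + 1) * s) :=
      fun j => hωm.comp (by fun_prop)
    refine (wNorm_mono hle).trans ?_
    refine (wNorm_add_le hq (Finset.measurable_fun_sum _ fun j _ => hωcm j)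
      (((hιm.const_mul D).add hχcm).const_mul K)).trans ?_
    rw [hM, add_assoc, mul_assoc K, ← mul_add]
    refine add_le_add (wNorm_sum_le hq _ hωcm) ?_
    refine (wNorm_const_mul_le hKt _).trans (mul_le_mul_right ?_ _)
    refine (wNorm_add_le hq (hιm.const_mul D) hχcm).trans (add_le_add ?_ ?_)
    · exact wNorm_const_mul_le hDt _
    · exact wNorm_comp_mul (by positivity) hχm
  refine lt_of_le_of_lt (b := (1 - K * ENNReal.ofReal (((n : ℝ) + 1) ^ θ))⁻¹ * M) ?_ ?_
  · refine wNorm_le_of_tendsto (χ := fun k : ℕ => (Ioo (1 / ((k : ℝ) + 1)) a).indicator φ)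
      (fun k => hφm.indicator measurableSet_Ioo) (fun k s => ?_) (fun s => ?_) (fun s hs => ?_)
      fun k => key _ (by positivity)
    · exact ((indicator_le_self _ φ s).trans (hφN s)).trans_lt hNt.lt_top |>.ne
    · exact ((indicator_le_self _ φ s).trans (hφN s)).trans_lt hNt.lt_top |>.ne
    · refine tendsto_const_nhds.congr' ?_
      filter_upwards [tendsto_one_div_add_atTop_nhds_zero_nat.eventually (gt_mem_nhds hs)] with k hk
      by_cases h : s < a
      · rw [indicator_of_mem (show s ∈ Ioo 0 a from ⟨hs, h⟩), indicator_of_mem (show s ∈ Ioo _ a from ⟨hk, h⟩)]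
      · rw [indicator_of_notMem fun hc => h hc.2, indicator_of_notMem fun hc => h hc.2]
  · exact ENNReal.mul_lt_top (ENNReal.inv_lt_top.2 (tsub_pos_of_lt hκ')) hMt

end

section

variable {X : Type*} [NormedAddCommGroup X]

/-- Splitting at `s`, the second half is a translate of the first up to one modulus. Adding `p`-th
powers gives `2^{1/p}`, the doubling factor that `θ > 1/p` beats when scales are halved. -/
theorem eLpNorm_Iic_two_mul_le {g : ℝ → X} (hg : StronglyMeasurable g)
    (hg0 : ∀ t ≤ 0, g t = 0) {T s : ℝ} (hs : 0 < s) (h : 2 * s < T) {p : ENNReal} (hp : 1 ≤ p)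
    (hpt : p ≠ ⊤) :
    eLpNorm g p (volume.restrict (Iic (2 * s))) ≤ ENNReal.ofReal (2 ^ (1 / p.toReal)) *
      (lpDiff 0 T p g s + eLpNorm g p (volume.restrict (Iic s))) := by
  have hp0 : p ≠ 0 := (zero_lt_one.trans_le hp).ne'
  have hpr : 0 < p.toReal := ENNReal.toReal_pos hp0 hpt
  have e : ∀ S : Set ℝ, ∫⁻ t in S, ‖g t‖ₑ ^ p.toReal =
      eLpNorm g p (volume.restrict S) ^ p.toReal := by
    intro S
    rw [eLpNorm_eq_lintegral_rpow_enorm_toReal hp0 hpt, ← ENNReal.rpow_mul,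
      one_div_mul_cancel hpr.ne', ENNReal.rpow_one]
  have h1 := eLpNorm_Ioc_shift_le_lpDiff_add hg (s := s) (σ := s) (T := T) (by linarith) hp
  rw [← eLpNorm_restrict_Iic_eq hg0] at h1
  have hdis : Disjoint (Iic s) (Ioc s (s + s)) :=
    Set.disjoint_left.2 fun t ht ht' => absurd ht'.1 (not_lt.2 ht)
  have h2 : eLpNorm g p (volume.restrict (Iic (2 * s))) ^ p.toReal ≤
      2 * (lpDiff 0 T p g s + eLpNorm g p (volume.restrict (Iic s))) ^ p.toReal := by
    rw [← e, show Iic (2 * s) = Iic s ∪ Ioc s (s + s) by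
      rw [Iic_union_Ioc_eq_Iic (by linarith), two_mul],
      lintegral_union measurableSet_Ioc hdis, e, e, two_mul]
    gcongr
    exact le_add_self
  have h3 := ENNReal.rpow_le_rpow h2 (one_div_nonneg.2 hpr.le)
  rw [ENNReal.mul_rpow_of_nonneg _ _ (by positivity), ← ENNReal.rpow_mul, ← ENNReal.rpow_mul,
    mul_one_div_cancel hpr.ne', ENNReal.rpow_one, ENNReal.rpow_one] at h3
  refine h3.trans_eq ?_
  rw [← ENNReal.ofReal_rpow_of_pos (by norm_num)]
  norm_num

/-- A continuous representative that vanishes at `0` is at most `η` on a short interval, whose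
length contributes `s^{1/p}`. -/
theorem exists_eLpNorm_Iic_le {g v : ℝ → X} (hg0 : ∀ t ≤ 0, g t = 0) {T : ℝ} (hT : 0 < T)
    {p : ENNReal} (hp : 1 ≤ p)
    (hv : ContinuousOn v (Icc 0 T)) (hgv : g =ᵐ[volume.restrict (Ioo 0 T)] v) (hv0 : v 0 = 0)
    {η : ℝ} (hη : 0 < η) : ∃ δ ∈ Ioo 0 T, ∀ s ∈ Ioo 0 δ,
      eLpNorm g p (volume.restrict (Iic s)) ≤ ENNReal.ofReal (η * s ^ (1 / p.toReal)) := by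
  have hp0 : p ≠ 0 := (zero_lt_one.trans_le hp).ne'
  have h1 := Metric.continuousWithinAt_iff.1 (hv 0 ⟨le_rfl, hT.le⟩) η hη
  obtain ⟨δ, hδ, h2⟩ := h1
  refine ⟨min δ (T / 2), ⟨by positivity, (min_le_right _ _).trans_lt (by linarith)⟩,
    fun s hs => ?_⟩
  have hs0 := hs.1
  have hsδ : s < δ := hs.2.trans_le (min_le_left _ _)
  have hsT : s < T / 2 := hs.2.trans_le (min_le_right _ _)
  rw [eLpNorm_restrict_Iic_eq hg0]
  have h3 : ∀ᵐ t ∂(volume.restrict (Ioc 0 s)), ‖g t‖ ≤ η := by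
    have h4 := ae_restrict_of_ae_restrict_of_subset (s := Ioc 0 s) (t := Ioo 0 T)
      (fun t ht => ⟨ht.1, by linarith [ht.2]⟩) hgv
    filter_upwards [h4, ae_restrict_mem measurableSet_Ioc] with t ht ht'
    rw [ht]
    have := h2 (x := t) ⟨ht'.1.le, by linarith [ht'.2]⟩ (by
      rw [Real.dist_eq, sub_zero, abs_of_pos ht'.1]; linarith [ht'.2])
    rw [hv0, dist_zero_right] at this
    exact this.le
  refine (eLpNorm_le_of_ae_bound h3).trans_eq ?_
  rw [Measure.restrict_apply_univ, Real.volume_Ioc, sub_zero, mul_comm, one_div,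
    ENNReal.ofReal_mul hη.le, ENNReal.ofReal_rpow_of_pos hs0]

/-- Zero extension for `θ > 1 / p` and vanishing trace. -/
theorem memBesov_neg_of_gt {T θ : ℝ} (hT : 0 < T) (hθ : θ ∈ Ioo (0 : ℝ) 1)
    {p q : ENNReal} (hp : 1 ≤ p) (hpt : p ≠ ⊤) (hq : 1 ≤ q) (hθp : 1 / p.toReal < θ) {g v : ℝ → X}
    (hg : StronglyMeasurable g) (hg0 : ∀ t ≤ 0, g t = 0) (hgL : MemLp g p volume)
    (hgB : MemBesov 0 T θ p q g)
    (hv : ContinuousOn v (Icc 0 T)) (hgv : g =ᵐ[volume.restrict (Ioo 0 T)] v) (hv0 : v 0 = 0) :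
    MemBesov (-T) T θ p q g := by
  refine memBesov_neg_of_wNorm_lt_top hT hθ hp hpt hq hg hg0 hgL hgB ?_
  obtain ⟨hLp, hw⟩ := memBesov_iff.1 hgB
  set ω := (Ioo 0 (T - 0)).indicator (lpDiff 0 T p g) with hω
  have hωm : Measurable ω := (measurable_lpDiff hp hpt hg).indicator measurableSet_Ioo
  set φ := fun h => eLpNorm g p (volume.restrict (Iic h)) with hφ
  have hφm : Measurable φ := (monotone_eLpNorm_restrict_Iic g p).measurable
  set N := eLpNorm g p volume with hN
  have hNt : N ≠ ⊤ := hgL.2.ne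
  have hφN : ∀ s, φ s ≤ N := fun s => eLpNorm_mono_measure _ Measure.restrict_le_self
  set K := ENNReal.ofReal ((2 : ℝ) ^ (1 / p.toReal)) with hK
  have hKt : K ≠ ⊤ := ENNReal.ofReal_ne_top
  have hhalf : (0 : ℝ) < 2⁻¹ := by norm_num
  -- Here `κ = 2^{1/p - θ} < 1`.
  set κ := K * ENNReal.ofReal ((2⁻¹ : ℝ) ^ θ) with hκdef
  have hκ : κ < 1 := by
    rw [hκdef, hK, ← ENNReal.ofReal_mul (by positivity), ← ENNReal.ofReal_one]
    refine (ENNReal.ofReal_lt_ofReal_iff zero_lt_one).2 ?_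
    rw [Real.inv_rpow (by norm_num), ← Real.rpow_neg (by norm_num),
      ← Real.rpow_add (by norm_num)]
    exact Real.rpow_lt_one_of_one_lt_of_neg (by norm_num) (by linarith)
  set M := K * wNorm θ q fun s => ω (2⁻¹ * s) with hM
  have hMt : M < ⊤ := ENNReal.mul_lt_top hKt.lt_top ((wNorm_comp_mul hhalf hωm).trans_lt
        (ENNReal.mul_lt_top ENNReal.ofReal_lt_top hw))
  have hpm : ∀ η : ℝ, Measurable fun s : ℝ => ENNReal.ofReal (η * s ^ (1 / p.toReal)) :=
    fun η => by fun_prop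
  have hχm : ∀ η : ℝ, Measurable ((Ioo 0 T).indicator fun s =>
      φ s - ENNReal.ofReal (η * s ^ (1 / p.toReal))) :=
    fun η => (hφm.sub (hpm η)).indicator measurableSet_Ioo
  -- Cutting off at small scales would not survive halving. Instead `η s^{1/p}` is subtracted: the
  -- zero trace makes the difference vanish near `0`, so its norm is finite, and `s^{1/p}` scales
  -- under doubling by exactly the factor `K`, so the recursion is preserved. Letting `η` tend to
  -- `0` removes the correction.
  have key : ∀ η : ℝ, 0 < η → wNorm θ q ((Ioo 0 T).indicator fun s =>
      φ s - ENNReal.ofReal (η * s ^ (1 / p.toReal))) ≤ (1 - κ)⁻¹ * M := by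
    intro η hη
    have hχm := hχm η
    set χ := (Ioo 0 T).indicator fun s => φ s - ENNReal.ofReal (η * s ^ (1 / p.toReal)) with hχ
    obtain ⟨δ, hδ, hsmall⟩ := exists_eLpNorm_Iic_le hg0 hT hp hv hgv hv0 hη
    have hδ0 := hδ.1
    have hχt : wNorm θ q χ ≠ ⊤ := by
      have hle : ∀ s, 0 < s → χ s ≤ N * ENNReal.ofReal δ⁻¹ *
          (Ioo 0 T).indicator (fun h : ℝ => ENNReal.ofReal h) s := by
        intro s hs
        by_cases h : s ∈ Ioo 0 T
        · rw [hχ, indicator_of_mem h, indicator_of_mem h]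
          rcases lt_or_ge s δ with h' | h'
          · rw [tsub_eq_zero_of_le (hsmall s ⟨hs, h'⟩)]
            exact zero_le
          · rw [mul_assoc, ← ENNReal.ofReal_mul (by positivity)]
            refine tsub_le_self.trans ((hφN s).trans (le_mul_of_one_le_right' ?_))
            rw [← ENNReal.ofReal_one]
            refine ENNReal.ofReal_le_ofReal ?_
            rwa [inv_mul_eq_div, one_le_div hδ0]
        · rw [hχ, indicator_of_notMem h]
          exact zero_le
      refine ((wNorm_mono hle).trans_lt ((wNorm_const_mul_le (by finiteness) _).trans_lt ?_)).ne
      exact ENNReal.mul_lt_top (by finiteness) (wNorm_indicator_id_lt_top hθ hq _)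
    refine ENNReal.le_inv_one_sub_mul hχt hκ ?_
    have hle : ∀ s, 0 < s → χ s ≤ K * (ω (2⁻¹ * s) + χ (2⁻¹ * s)) := by
      intro s hs
      by_cases h : s ∈ Ioo 0 T
      · have h2 : 2 * (2⁻¹ * s) = s := by ring
        have hs2 : 2⁻¹ * s ∈ Ioo 0 T := ⟨by positivity, by linarith [h.2]⟩
        have h1 := eLpNorm_Iic_two_mul_le hg hg0 (s := 2⁻¹ * s) (T := T) (by positivity)
          (by linarith [h.2]) hp hpt
        rw [h2] at h1
        rw [hχ, indicator_of_mem h, indicator_of_mem hs2, hω, sub_zero, indicator_of_mem hs2]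
        refine tsub_le_iff_right.2 (h1.trans ?_)
        have h3 : φ (2⁻¹ * s) ≤ φ (2⁻¹ * s) - ENNReal.ofReal (η * (2⁻¹ * s) ^ (1 / p.toReal)) +
          ENNReal.ofReal (η * (2⁻¹ * s) ^ (1 / p.toReal)) := le_tsub_add
        refine (mul_le_mul_right (add_le_add le_rfl h3) K).trans_eq ?_
        rw [← add_assoc, mul_add K (_ + _)]
        congr 1
        rw [hK, ← ENNReal.ofReal_mul (by positivity)]
        congr 1
        rw [Real.mul_rpow (by norm_num) hs.le, Real.inv_rpow (by norm_num)]
        have : (2 : ℝ) ^ (1 / p.toReal) ≠ 0 := (Real.rpow_pos_of_pos (by norm_num) _).ne'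
        field_simp
      · rw [hχ, indicator_of_notMem h]
        exact zero_le
    have hχcm : Measurable fun s => χ (2⁻¹ * s) := hχm.comp (by fun_prop)
    have hωcm : Measurable fun s => ω (2⁻¹ * s) := hωm.comp (by fun_prop)
    refine (wNorm_mono hle).trans ((wNorm_const_mul_le hKt _).trans ?_)
    rw [hM, hκdef, mul_assoc K, ← mul_add]
    refine mul_le_mul_right ?_ _
    exact (wNorm_add_le hq hωcm hχcm).trans (add_le_add le_rfl (wNorm_comp_mul hhalf hχm))
  refine lt_of_le_of_lt (b := (1 - κ)⁻¹ * M) ?_ ?_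
  · refine wNorm_le_of_tendsto (χ := fun k : ℕ => (Ioo 0 T).indicator fun s =>
      φ s - ENNReal.ofReal (1 / ((k : ℝ) + 1) * s ^ (1 / p.toReal)))
      (fun k => hχm _) (fun k s => ?_) (fun s => ?_) (fun s hs => ?_)
      fun k => key _ (by positivity)
    · have h1 := indicator_le_self (Ioo 0 T)
        (fun s => φ s - ENNReal.ofReal (1 / ((k : ℝ) + 1) * s ^ (1 / p.toReal))) s
      exact (h1.trans (tsub_le_self.trans (hφN s))).trans_lt hNt.lt_top |>.ne
    · exact ((indicator_le_self _ φ s).trans (hφN s)).trans_lt hNt.lt_top |>.ne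
    · by_cases h : s ∈ Ioo 0 T
      · simp only [indicator_of_mem h]
        have h1 : Filter.Tendsto (fun k : ℕ => ENNReal.ofReal (1 / ((k : ℝ) + 1) *
            s ^ (1 / p.toReal))) Filter.atTop (nhds 0) := by
          have := tendsto_one_div_add_atTop_nhds_zero_nat (𝕜 := ℝ).mul_const (s ^ (1 / p.toReal))
          rw [zero_mul] at this
          simpa using ENNReal.tendsto_ofReal this
        have h2 := ENNReal.Tendsto.sub (tendsto_const_nhds (x := φ s)) h1
          (Or.inr ENNReal.zero_ne_top)
        simpa using h2
      · simp only [indicator_of_notMem h]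
        exact tendsto_const_nhds
  · exact ENNReal.mul_lt_top (ENNReal.inv_lt_top.2 (tsub_pos_of_lt hκ)) hMt

theorem lpDiff_congr {a b h : ℝ} (hh : 0 ≤ h) {p : ENNReal} {u v : ℝ → X}
    (huv : u =ᵐ[volume.restrict (Ioo a b)] v) : lpDiff a b p u h = lpDiff a b p v h := by
  refine eLpNorm_congr_ae ?_
  rw [Filter.EventuallyEq, ae_restrict_iff' measurableSet_Ioo] at huv ⊢
  filter_upwards [huv, (measurePreserving_add_right volume h).quasiMeasurePreserving.ae huv]
    with t h1 h2 ht
  rw [h1 ⟨ht.1, by linarith [ht.2]⟩, h2 ⟨by linarith [ht.1], by linarith [ht.2]⟩]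

theorem MemBesov.congr {a b θ : ℝ} {p q : ENNReal} {u v : ℝ → X} (hu : MemBesov a b θ p q u)
    (huv : u =ᵐ[volume.restrict (Ioo a b)] v) : MemBesov a b θ p q v := by
  rw [memBesov_iff] at hu ⊢
  refine ⟨hu.1.ae_eq huv, (wNorm_mono fun s hs => le_of_eq ?_).trans_lt hu.2⟩
  by_cases h : s ∈ Ioo 0 (b - a)
  · rw [indicator_of_mem h, indicator_of_mem h, lpDiff_congr hs.le huv]
  · rw [indicator_of_notMem h, indicator_of_notMem h]

theorem MemBesov.mono_interval {a a' b θ : ℝ} (ha : a ≤ a') {p q : ENNReal} {u : ℝ → X}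
    (hu : MemBesov a b θ p q u) : MemBesov a' b θ p q u := by
  rw [memBesov_iff] at hu ⊢
  refine ⟨hu.1.mono_measure (Measure.restrict_mono (Ioo_subset_Ioo_left ha) le_rfl),
    (wNorm_mono fun s hs => ?_).trans_lt hu.2⟩
  by_cases h : s ∈ Ioo 0 (b - a')
  · rw [indicator_of_mem h, indicator_of_mem (show s ∈ Ioo 0 (b - a) from ⟨h.1, by linarith [h.2]⟩)]
    exact eLpNorm_mono_measure _ (Measure.restrict_mono (Ioo_subset_Ioo_left ha) le_rfl)
  · rw [indicator_of_notMem h]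
    exact zero_le

/-- A uniform bound for the modulus of smoothness of a Besov function. -/
theorem MemBesov.exists_lpDiff_le {a b θ : ℝ} (hθ : θ ∈ Ioo (0 : ℝ) 1) {p q : ENNReal}
    (hp : 1 ≤ p) (hpt : p ≠ ⊤) (hq : 1 ≤ q)
    {u : ℝ → X} (hum : StronglyMeasurable u) (hu : MemBesov a b θ p q u) :
    ∃ C : ENNReal, C ≠ ⊤ ∧ ∀ h ∈ Ioo 0 (b - a), lpDiff a b p u h ≤ C * ENNReal.ofReal (h ^ θ) := by
  obtain ⟨hLp, hw⟩ := memBesov_iff.1 hu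
  set ω := (Ioo 0 (b - a)).indicator (lpDiff a b p u) with hω
  have hωm : Measurable ω := (measurable_lpDiff hp hpt hum).indicator measurableSet_Ioo
  have hdm := measurable_lpDiff (a := a) (b := b) hp hpt hum
  set W := wNorm θ q ω with hW
  refine ⟨ENNReal.ofReal 3 * (W * ENNReal.ofReal 2 ^ (1 / (1 : ENNReal).toReal - 1 / q.toReal)),
    ?_, fun h hh => ?_⟩
  · have : 0 ≤ 1 / (1 : ENNReal).toReal - 1 / q.toReal := by
      rcases eq_or_ne q ⊤ with rfl | hqt
      · simp
      · have : 1 ≤ q.toReal := by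
          have := ENNReal.toReal_mono hqt hq
          simpa using this
        have h2 : 1 / q.toReal ≤ 1 := by
          rw [div_le_one (by linarith)]; exact this
        simp only [ENNReal.toReal_one, div_one]
        linarith
    exact ENNReal.mul_ne_top ENNReal.ofReal_ne_top (ENNReal.mul_ne_top hw.ne
      (ENNReal.rpow_ne_top_of_nonneg this ENNReal.ofReal_ne_top))
  have hh0 := hh.1
  -- The step `h` is written as `s + (h - s)` with both parts in `J`. Averaging over `s` bounds the
  -- modulus at `h` by its mean over `J`, which the weighted `L^q` norm controls.
  set J := Ioo (h / 4) (3 * h / 4) with hJ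
  have htri : ∀ s ∈ J, lpDiff a b p u h ≤ ω s + ω (h - s) := by
    intro s hs
    have hs1 : s ∈ Ioo 0 (b - a) := ⟨by linarith [hs.1], by linarith [hs.2, hh.2]⟩
    have hs2 : h - s ∈ Ioo 0 (b - a) := ⟨by linarith [hs.2], by linarith [hs.1, hh.2]⟩
    rw [hω, indicator_of_mem hs1, indicator_of_mem hs2]
    have m0 : ∀ r : ℝ, StronglyMeasurable fun t => u (t + r) :=
      fun r => hum.comp_measurable (by fun_prop)
    have h1 := eLpNorm_add_le (p := p) (μ := volume.restrict (Ioo a (b - h)))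
      ((m0 s).sub hum).aestronglyMeasurable ((m0 h).sub (m0 s)).aestronglyMeasurable hp
    have e : ((fun t => u (t + s)) - u) + ((fun t => u (t + h)) - fun t => u (t + s)) =
        fun t => u (t + h) - u t := by
      funext t
      simp
    rw [e] at h1
    refine h1.trans (add_le_add ?_ ?_)
    · exact eLpNorm_mono_measure _ (Measure.restrict_mono
        (Ioo_subset_Ioo_right (by linarith [hs.2])) le_rfl)
    · have := eLpNorm_comp_add_restrict_le (p := p) (S := Ioo a (b - h)) (S' := Ioo a (b - (h - s)))
        (σ := s) ((m0 (h - s)).sub hum) measurableSet_Ioo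
        fun t ht => ⟨by linarith [ht.1, hs1.1], by linarith [ht.2]⟩
      refine le_trans (le_of_eq ?_) this
      congr 1
      funext t
      simp only [Pi.sub_apply]
      congr 2
      ring
  have hJv : volume J = ENNReal.ofReal (h / 2) := by
    rw [hJ, Real.volume_Ioo]; congr 1; ring
  have hrefl : ∫⁻ s in J, ω (h - s) = ∫⁻ s in J, ω s := by
    rw [← lintegral_indicator measurableSet_Ioo, ← lintegral_indicator measurableSet_Ioo,
      ← lintegral_sub_left_eq_self _ h]
    refine lintegral_congr fun s => ?_
    have hiff : h - s ∈ J ↔ s ∈ J := by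
      simp only [hJ, mem_Ioo]
      constructor <;> rintro ⟨h1, h2⟩ <;> constructor <;> linarith
    by_cases hs : s ∈ J
    · rw [indicator_of_mem hs, indicator_of_mem (hiff.2 hs), sub_sub_cancel]
    · rw [indicator_of_notMem hs, indicator_of_notMem (fun hc => hs (hiff.1 hc))]
  have havg : ENNReal.ofReal (h / 2) * lpDiff a b p u h ≤ 2 * ∫⁻ s in J, ω s := by
    calc ENNReal.ofReal (h / 2) * lpDiff a b p u h = ∫⁻ _ in J, lpDiff a b p u h := by
          rw [lintegral_const, Measure.restrict_apply_univ, hJv, mul_comm]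
      _ ≤ ∫⁻ s in J, (ω s + ω (h - s)) := setLIntegral_mono' measurableSet_Ioo htri
      _ = 2 * ∫⁻ s in J, ω s := by
          rw [lintegral_add_left hωm, hrefl, two_mul]
  have hJpos : J ⊆ Ioi 0 := fun s hs => show 0 < s by linarith [hs.1]
  have hmu : ∀ F : ℝ → ENNReal, Measurable F →
      ∫⁻ s in J, F s ∂mulHaar = ∫⁻ s in J, ENNReal.ofReal s⁻¹ * F s := by
    intro F hF
    rw [← lintegral_indicator measurableSet_Ioo, lintegral_mulHaar (hF.indicator measurableSet_Ioo),
      ← lintegral_indicator measurableSet_Ioi, ← lintegral_indicator measurableSet_Ioo]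
    refine lintegral_congr fun s => ?_
    by_cases hs : s ∈ J
    · rw [indicator_of_mem (hJpos hs), indicator_of_mem hs, indicator_of_mem hs]
    · rw [indicator_of_notMem hs]
      by_cases hs' : s ∈ Ioi (0 : ℝ)
      · rw [indicator_of_mem hs', indicator_of_notMem hs, mul_zero]
      · rw [indicator_of_notMem hs']
  -- The length `h/2` times the largest density `4/h`; the bound is independent of `h`, so Hölder on
  -- `J` costs only a fixed constant.
  have hmeas : mulHaar.restrict J univ ≤ ENNReal.ofReal 2 := by
    have h1 := hmu (fun _ => 1) measurable_const
    rw [lintegral_const, one_mul] at h1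
    rw [h1]
    have h2 : ∀ s ∈ J, ENNReal.ofReal s⁻¹ * 1 ≤ ENNReal.ofReal (4 / h) := by
      intro s hs
      rw [mul_one]
      refine ENNReal.ofReal_le_ofReal ?_
      have hs1 := hs.1
      rw [inv_eq_one_div, div_le_div_iff₀ (by linarith) hh0]
      linarith
    refine (setLIntegral_mono' measurableSet_Ioo h2).trans ?_
    rw [lintegral_const, Measure.restrict_apply_univ, hJv, ← ENNReal.ofReal_mul (by positivity)]
    refine ENNReal.ofReal_le_ofReal (le_of_eq ?_)
    field_simp
    norm_num
  have hF : Measurable fun s => ENNReal.ofReal (s ^ (-θ)) * ω s := (measurable_weight θ).mul hωm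
  have hint : ∫⁻ s in J, ω s ≤ ENNReal.ofReal (3 / 4 * h * h ^ θ) *
      ∫⁻ s in J, ENNReal.ofReal (s ^ (-θ)) * ω s ∂mulHaar := by
    rw [hmu _ hF, ← lintegral_const_mul _ (by fun_prop)]
    refine setLIntegral_mono' measurableSet_Ioo fun s hs => ?_
    have hs0 : 0 < s := hJpos hs
    rw [← mul_assoc, ← mul_assoc, ← ENNReal.ofReal_mul (by positivity),
      ← ENNReal.ofReal_mul (by positivity)]
    refine le_mul_of_one_le_left' ?_
    rw [← ENNReal.ofReal_one]
    refine ENNReal.ofReal_le_ofReal ?_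
    have h1 : 1 ≤ 3 / 4 * h * s⁻¹ := by
      rw [← div_eq_mul_inv, one_le_div hs0]; linarith [hs.2]
    have h2 : 1 ≤ h ^ θ * s ^ (-θ) := by
      rw [Real.rpow_neg hs0.le, ← div_eq_mul_inv, one_le_div (by positivity)]
      exact Real.rpow_le_rpow hs0.le (by linarith [hs.2]) hθ.1.le
    calc (1 : ℝ) ≤ (3 / 4 * h * s⁻¹) * (h ^ θ * s ^ (-θ)) := one_le_mul_of_one_le_of_one_le h1 h2
      _ = _ := by ring
  have hHol : ∫⁻ s in J, ENNReal.ofReal (s ^ (-θ)) * ω s ∂mulHaar ≤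
      W * ENNReal.ofReal 2 ^ (1 / (1 : ENNReal).toReal - 1 / q.toReal) := by
    have h1 := eLpNorm_le_eLpNorm_mul_rpow_measure_univ (μ := mulHaar.restrict J) hq
      hF.aestronglyMeasurable
    rw [eLpNorm_one_eq_lintegral_enorm] at h1
    simp only [enorm_eq_self] at h1
    refine h1.trans (mul_le_mul' ?_ ?_)
    · exact eLpNorm_mono_measure _ Measure.restrict_le_self
    · refine ENNReal.rpow_le_rpow hmeas ?_
      rcases eq_or_ne q ⊤ with rfl | hqt
      · simp
      · have : 1 ≤ q.toReal := by
          have := ENNReal.toReal_mono hqt hq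
          simpa using this
        have h2 : 1 / q.toReal ≤ 1 := by
          rw [div_le_one (by linarith)]; exact this
        simp only [ENNReal.toReal_one, div_one]
        linarith
  have hfin := havg.trans (mul_le_mul_right (hint.trans (mul_le_mul_right hHol _)) 2)
  have hh2 : ENNReal.ofReal (h / 2) ≠ 0 := (ENNReal.ofReal_pos.2 (by positivity)).ne'
  rw [← ENNReal.mul_le_mul_iff_right hh2 ENNReal.ofReal_ne_top]
  refine hfin.trans_eq ?_
  set Z := W * ENNReal.ofReal 2 ^ (1 / (1 : ENNReal).toReal - 1 / q.toReal)
  rw [← mul_assoc, show (2 : ENNReal) = ENNReal.ofReal 2 by simp,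
    ← ENNReal.ofReal_mul (by positivity)]
  rw [show ENNReal.ofReal (h / 2) * (ENNReal.ofReal 3 * Z * ENNReal.ofReal (h ^ θ)) =
    ENNReal.ofReal (h / 2) * ENNReal.ofReal 3 * ENNReal.ofReal (h ^ θ) * Z by ring,
    ← ENNReal.ofReal_mul (by positivity), ← ENNReal.ofReal_mul (by positivity)]
  congr 2
  ring

end

/-! ### Traces for `θ > 1/p`, and primitives. -/

section

variable {X : Type*} [NormedAddCommGroup X]

theorem lintegral_Ioo_enorm_sub_le {a b c d h : ℝ} (hc : a ≤ c) (hcd : c ≤ d) (hd : d ≤ b - h)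
    {p : ENNReal} (hp : 1 ≤ p) {u : ℝ → X} (hu : StronglyMeasurable u) :
    ∫⁻ t in Ioo c d, ‖u (t + h) - u t‖ₑ ≤
      lpDiff a b p u h * ENNReal.ofReal ((d - c) ^ (1 - 1 / p.toReal)) := by
  have hm : StronglyMeasurable fun t => u (t + h) - u t :=
    (hu.comp_measurable (by fun_prop)).sub hu
  have h1 := eLpNorm_le_eLpNorm_mul_rpow_measure_univ (μ := volume.restrict (Ioo c d)) hp
    hm.aestronglyMeasurable
  rw [eLpNorm_one_eq_lintegral_enorm, Measure.restrict_apply_univ, Real.volume_Ioo,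
    ENNReal.toReal_one, div_one] at h1
  refine h1.trans (mul_le_mul' (eLpNorm_mono_measure _ (Measure.restrict_mono
    (Ioo_subset_Ioo hc hd) le_rfl)) (le_of_eq ?_))
  refine ENNReal.ofReal_rpow_of_nonneg (sub_nonneg.2 hcd) ?_
  rcases eq_or_ne p ⊤ with rfl | hpt
  · simp
  · have h2 : 1 ≤ p.toReal := by simpa using ENNReal.toReal_mono hpt hp
    have h3 : 1 / p.toReal ≤ 1 := by
      rw [div_le_one (by linarith)]; exact h2
    linarith

variable [NormedSpace ℝ X]

/-- The mean over `(t - h, t)` is the mean of the means over its two halves. So the difference is an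
integral of increments of step `h/2` over one half, estimated by Hölder. -/
theorem norm_average_sub_average_half_le {T h t : ℝ} (hh : h ∈ Ioc 0 T) (ht : t ∈ Icc 0 T)
    {p : ENNReal} (hp : 1 ≤ p) {V : ℝ → X} (hV : StronglyMeasurable V)
    (hVi : Integrable ((Ioo (-T) T).indicator V)) {D : ℝ} (hD0 : 0 ≤ D)
    (hD : lpDiff (-T) T p V (h / 2) ≤ ENNReal.ofReal D) :
    ‖h⁻¹ • (∫ τ in (t - h)..t, (Ioo (-T) T).indicator V τ) -
      (h / 2)⁻¹ • ∫ τ in (t - h / 2)..t, (Ioo (-T) T).indicator V τ‖ ≤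
      h⁻¹ * (D * (h / 2) ^ (1 - 1 / p.toReal)) := by
  have hh0 := hh.1
  set W := (Ioo (-T) T).indicator V with hW
  have hii : ∀ a b, IntervalIntegrable W volume a b := fun a b => hVi.intervalIntegrable
  have e1 : ∫ τ in (t - h)..t, W τ =
      (∫ τ in (t - h)..(t - h / 2), W τ) + ∫ τ in (t - h / 2)..t, W τ :=
    (intervalIntegral.integral_add_adjacent_intervals (hii _ _) (hii _ _)).symm
  have e2 : ∫ τ in (t - h / 2)..t, W τ = ∫ τ in (t - h)..(t - h / 2), W (τ + h / 2) := by
    rw [intervalIntegral.integral_comp_add_right]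
    congr 1 <;> ring
  have hWi2 : Integrable fun τ => W (τ + h / 2) := hVi.comp_add_right (h / 2)
  have e3 : h⁻¹ • (∫ τ in (t - h)..t, W τ) - (h / 2)⁻¹ • ∫ τ in (t - h / 2)..t, W τ =
      -(h⁻¹ • ∫ τ in (t - h)..(t - h / 2), (W (τ + h / 2) - W τ)) := by
    rw [intervalIntegral.integral_sub hWi2.intervalIntegrable (hii _ _), ← e2, e1,
      show (h / 2)⁻¹ = h⁻¹ + h⁻¹ by field_simp; norm_num, add_smul, smul_add, smul_sub]
    abel
  rw [e3, norm_neg, norm_smul, Real.norm_of_nonneg (by positivity)]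
  refine mul_le_mul_of_nonneg_left ?_ (by positivity)
  rw [← ENNReal.ofReal_le_ofReal_iff (by positivity), ofReal_norm,
    intervalIntegral.integral_of_le (by linarith), integral_Ioc_eq_integral_Ioo]
  refine (enorm_integral_le_lintegral_enorm _).trans ?_
  have h4 : ∫⁻ τ in Ioo (t - h) (t - h / 2), ‖W (τ + h / 2) - W τ‖ₑ =
      ∫⁻ τ in Ioo (t - h) (t - h / 2), ‖V (τ + h / 2) - V τ‖ₑ := by
    refine setLIntegral_congr_fun measurableSet_Ioo fun τ hτ => ?_
    have hT := hh.2
    have h5 : τ ∈ Ioo (-T) T := ⟨by linarith [hτ.1, ht.1], by linarith [hτ.2, ht.2]⟩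
    have h6 : τ + h / 2 ∈ Ioo (-T) T := ⟨by linarith [hτ.1, ht.1], by linarith [hτ.2, ht.2]⟩
    simp only [hW, indicator_of_mem h5, indicator_of_mem h6]
  rw [h4]
  have h7 := lintegral_Ioo_enorm_sub_le (a := -T) (b := T) (c := t - h) (d := t - h / 2)
    (h := h / 2) (by linarith [hh.2, ht.1]) (by linarith) (by linarith [ht.2]) hp hV
  refine h7.trans ?_
  rw [ENNReal.ofReal_mul hD0, show t - h / 2 - (t - h) = h / 2 by ring]
  exact mul_le_mul_left hD _

variable [CompleteSpace X]

/-- The trace theorem: for `θ > 1 / p` a Besov function vanishing for negative times has a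
continuous representative vanishing at zero. -/
theorem MemBesov.exists_continuousOn {T θ : ℝ} (hT : 0 < T) (hθ : θ ∈ Ioo (0 : ℝ) 1)
    {p q : ENNReal} (hp : 1 ≤ p) (hpt : p ≠ ⊤) (hq : 1 ≤ q) (hθp : 1 / p.toReal < θ) {V : ℝ → X}
    (hV : StronglyMeasurable V) (hV0 : ∀ t ≤ 0, V t = 0) (hVB : MemBesov (-T) T θ p q V) :
    ∃ v : ℝ → X, ContinuousOn v (Icc 0 T) ∧ V =ᵐ[volume.restrict (Ioo 0 T)] v ∧ v 0 = 0 := by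
  obtain ⟨C, hCt, hC⟩ := hVB.exists_lpDiff_le hθ hp hpt hq hV
  set W := (Ioo (-T) T).indicator V with hW
  have hWi : Integrable W :=
    IntegrableOn.integrable_indicator (memLp_one_iff_integrable.1 (hVB.1.mono_exponent hp))
      measurableSet_Ioo
  have hii : ∀ a b, IntervalIntegrable W volume a b := fun a b => hWi.intervalIntegrable
  set F : ℝ → X := fun t => ∫ τ in (0 : ℝ)..t, W τ with hF
  have hFc : Continuous F := intervalIntegral.continuous_primitive hii 0
  have hFsub : ∀ a b, ∫ τ in a..b, W τ = F b - F a := fun a b =>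
    (intervalIntegral.integral_interval_sub_left (hii _ _) (hii _ _)).symm
  -- The representative is the limit of backward averages at dyadic scales. Consecutive averages
  -- differ by a multiple of `h^{θ - 1/p}`, a geometric sequence, so convergence is uniform on `[0,
  -- T]`.
  set h : ℕ → ℝ := fun k => T * (1 / 2) ^ k with hh
  have hh0 : ∀ k, 0 < h k := fun k => by positivity
  have hhT : ∀ k, h k ≤ T := fun k =>
    mul_le_of_le_one_right hT.le (pow_le_one₀ (by norm_num) (by norm_num))
  have hhs : ∀ k, h (k + 1) = h k / 2 := fun k => by simp only [hh, pow_succ]; ring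
  have hhlim : Filter.Tendsto h Filter.atTop (nhds 0) := by
    have := (tendsto_pow_atTop_nhds_zero_of_lt_one (r := (1 / 2 : ℝ)) (by norm_num)
      (by norm_num)).const_mul T
    rwa [mul_zero] at this
  set A : ℕ → ℝ → X := fun k t => (h k)⁻¹ • (F t - F (t - h k)) with hA
  have hAc : ∀ k, Continuous (A k) := fun k => by
    have : Continuous fun t => F (t - h k) := hFc.comp (by fun_prop)
    exact (hFc.sub this).const_smul _
  set δ := θ - 1 / p.toReal with hδ
  have hδ0 : 0 < δ := sub_pos.2 hθp
  set r : ℝ := (1 / 2) ^ δ with hr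
  have hr0 : 0 < r := by positivity
  have hr1 : r < 1 := Real.rpow_lt_one (by norm_num) (by norm_num) hδ0
  set K : ℝ := 2⁻¹ * C.toReal * (T / 2) ^ δ with hK
  have hstep : ∀ t ∈ Icc 0 T, ∀ k, dist (A k t) (A (k + 1) t) ≤ K * r ^ k := by
    intro t ht k
    have hk0 := hh0 k
    have h1 := hC (h k / 2) ⟨by positivity, by linarith [hhT k]⟩
    have h2 : lpDiff (-T) T p V (h k / 2) ≤ ENNReal.ofReal (C.toReal * (h k / 2) ^ θ) := by
      rwa [ENNReal.ofReal_mul ENNReal.toReal_nonneg, ENNReal.ofReal_toReal hCt]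
    have h3 := norm_average_sub_average_half_le ⟨hk0, hhT k⟩ ht hp hV hWi (by positivity) h2
    rw [dist_eq_norm]
    simp only [hA, hhs, ← hFsub]
    refine h3.trans_eq ?_
    have e1 : (h k / 2) ^ θ * (h k / 2) ^ (1 - 1 / p.toReal) = (h k / 2) * (h k / 2) ^ δ := by
      rw [← Real.rpow_add (by positivity), ← Real.rpow_one_add' (by positivity) (by positivity)]
      congr 1
      rw [hδ]; ring
    have e2 : (h k / 2) ^ δ = (T / 2) ^ δ * r ^ k := by
      rw [hr, ← Real.rpow_natCast, ← Real.rpow_mul (by norm_num), mul_comm δ, Real.rpow_mul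
        (by norm_num), Real.rpow_natCast, ← Real.mul_rpow (by positivity) (by positivity)]
      congr 1
      simp only [hh]; ring
    rw [mul_assoc, e1, e2, hK]
    field_simp
  have hlim : ∀ t ∈ Icc 0 T, ∃ x, Filter.Tendsto (fun k => A k t) Filter.atTop (nhds x) :=
    fun t ht => cauchySeq_tendsto_of_complete (cauchySeq_of_le_geometric r K hr1 (hstep t ht))
  choose! v hv using hlim
  refine ⟨v, ?_, ?_, ?_⟩
  · have hunif : TendstoUniformlyOn A v Filter.atTop (Icc 0 T) := by
      rw [Metric.tendstoUniformlyOn_iff]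
      intro ε hε
      have h1 : Filter.Tendsto (fun k : ℕ => K * r ^ k / (1 - r)) Filter.atTop (nhds 0) := by
        have := ((tendsto_pow_atTop_nhds_zero_of_lt_one hr0.le hr1).const_mul K).div_const (1 - r)
        simpa using this
      filter_upwards [h1.eventually (gt_mem_nhds hε)] with k hk t ht
      rw [dist_comm]
      exact (dist_le_of_le_geometric_of_tendsto r K hr1 (hstep t ht) (hv t ht) k).trans_lt hk
    exact hunif.continuousOn (Filter.Frequently.of_forall fun k => (hAc k).continuousOn)
  -- Lebesgue differentiation identifies the limit with `V` almost everywhere.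
  · have hd := LocallyIntegrable.ae_hasDerivAt_integral hWi.locallyIntegrable
    rw [Filter.EventuallyEq, ae_restrict_iff' measurableSet_Ioo]
    filter_upwards [hd] with t htd ht
    have h1 := (htd 0).tendsto_slope
    have h2 : Filter.Tendsto (fun k => t - h k) Filter.atTop (nhdsWithin t {t}ᶜ) := by
      refine tendsto_nhdsWithin_iff.2 ⟨?_, Filter.Eventually.of_forall fun k => ?_⟩
      · simpa using hhlim.const_sub t
      · have := hh0 k
        simp only [mem_compl_iff, mem_singleton_iff]
        intro hc
        linarith
    have h3 := h1.comp h2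
    have h4 : (fun k => A k t) = slope (fun x => ∫ τ in (0 : ℝ)..x, W τ) t ∘ fun k => t - h k := by
      funext k
      simp only [Function.comp, slope_def_module, hA, hF]
      rw [show t - h k - t = -h k by ring, inv_neg, neg_smul, ← smul_neg, neg_sub]
    have h5 := hv t ⟨ht.1.le, ht.2.le⟩
    rw [h4] at h5
    rw [tendsto_nhds_unique h5 h3, hW, indicator_of_mem (show t ∈ Ioo (-T) T from ⟨by linarith [ht.1], ht.2⟩)]
  -- Backward averages at `t = 0` see only nonpositive times, where `V` vanishes; this is why
  -- backward averages were chosen.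
  · refine tendsto_nhds_unique (hv 0 ⟨le_rfl, hT.le⟩) ?_
    refine tendsto_const_nhds.congr fun k => ?_
    have : F (0 - h k) = 0 := by
      simp only [hF]
      rw [intervalIntegral.integral_zero_ae]
      refine Filter.Eventually.of_forall fun τ hτ => ?_
      have hk := hh0 k
      rw [uIoc_of_ge (by linarith)] at hτ
      simp only [hW, indicator, hV0 τ hτ.2, ite_self]
    simp only [hA, this]
    simp [hF]

theorem eLpNorm_lintegral_Ioc_le {h : ℝ} {G : ℝ → ENNReal} (hG : Measurable G)
    {p : ENNReal} (hp : 1 ≤ p) :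
    eLpNorm (fun t => ∫⁻ τ in Ioc t (t + h), G τ) p volume ≤
      ENNReal.ofReal h * eLpNorm G p volume := by
  have e : ∀ t, ∫⁻ τ in Ioc t (t + h), G τ = ∫⁻ σ in Ioc 0 h, G (t + σ) := by
    intro t
    rw [← lintegral_indicator measurableSet_Ioc, ← lintegral_indicator measurableSet_Ioc,
      ← lintegral_add_left_eq_self _ t]
    refine lintegral_congr fun σ => ?_
    simp only [indicator, mem_Ioc]
    congr 1
    simp
  simp only [e]
  refine (eLpNorm_lintegral_le (μ := volume) (ν := volume.restrict (Ioc 0 h))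
    (F := fun t σ => G (t + σ)) (hG.comp (by fun_prop)) hp).trans ?_
  have h1 : ∀ σ, eLpNorm (fun t => G (t + σ)) p volume = eLpNorm G p volume := fun σ =>
    eLpNorm_comp_measurePreserving hG.aestronglyMeasurable (measurePreserving_add_right volume σ)
  simp only [h1]
  rw [lintegral_const, Measure.restrict_apply_univ, Real.volume_Ioc, sub_zero, mul_comm]

/-- Increments of a primitive over a step `h` have `Lᵖ` norm at most `h ‖v‖`, which is better than
any order `θ < 1`. This puts `u` and `u̇` into the space once `ü` is. -/
theorem memBesov_primitive {T θ : ℝ} (hθ : θ ∈ Ioo (0 : ℝ) 1)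
    {p q : ENNReal} (hp : 1 ≤ p) (hq : 1 ≤ q) {v : ℝ → X}
    (hv : StronglyMeasurable v) (hvi : Integrable v) (hvp : MemLp v p volume) :
    MemBesov (-T) T θ p q (fun t => ∫ s in (0 : ℝ)..t, v s) := by
  have hii : ∀ a b, IntervalIntegrable v volume a b := fun a b => hvi.intervalIntegrable
  have hc : Continuous fun t => ∫ s in (0 : ℝ)..t, v s := intervalIntegral.continuous_primitive hii 0
  refine memBesov_iff.2 ⟨?_, ?_⟩
  · refine MemLp.of_bound hc.aestronglyMeasurable (∫ s, ‖v s‖)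
      (Filter.Eventually.of_forall fun t => ?_)
    refine (intervalIntegral.norm_integral_le_integral_norm_uIoc).trans ?_
    exact setIntegral_le_integral hvi.norm (Filter.Eventually.of_forall fun s => norm_nonneg _)
  · set N := eLpNorm v p volume with hN
    have hNt : N ≠ ⊤ := hvp.2.ne
    have hle : ∀ h, 0 < h → (Ioo 0 (T - -T)).indicator
        (lpDiff (-T) T p fun t => ∫ s in (0 : ℝ)..t, v s) h ≤
          N * (Ioo 0 (T - -T)).indicator (fun h : ℝ => ENNReal.ofReal h) h := by
      intro h hh
      by_cases hm : h ∈ Ioo 0 (T - -T)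
      · rw [indicator_of_mem hm, indicator_of_mem hm, mul_comm]
        have h1 := eLpNorm_lintegral_Ioc_le (h := h) hv.enorm hp
        rw [eLpNorm_enorm] at h1
        refine le_trans ?_ h1
        refine (eLpNorm_mono_measure _ Measure.restrict_le_self).trans ?_
        refine eLpNorm_mono_enorm fun t => ?_
        rw [intervalIntegral.integral_interval_sub_left (hii _ _) (hii _ _), enorm_eq_self,
          intervalIntegral.integral_of_le (by linarith)]
        exact enorm_integral_le_lintegral_enorm _
      · rw [indicator_of_notMem hm]
        exact zero_le
    refine (wNorm_mono hle).trans_lt ((wNorm_const_mul_le hNt _).trans_lt ?_)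
    exact ENNReal.mul_lt_top hNt.lt_top (wNorm_indicator_id_lt_top hθ hq _)

end

/-! ### Contour operators on Hölder and little Hölder spaces. -/

/-- By homogeneity of the kernel, powers are eigenfunctions of the Hardy operator. -/
theorem exists_hardy_rpow {θ : ℝ} (hθ : θ ∈ Ioo (0 : ℝ) 1) :
    ∃ C : ℝ, 0 ≤ C ∧ ∀ h, 0 < h → ∫⁻ s, ENNReal.ofReal (min 1 (h / s)) * ENNReal.ofReal (s ^ θ)
      ∂mulHaar ≤ ENNReal.ofReal (C * h ^ θ) := by
  set c := ∫⁻ s, ENNReal.ofReal (min 1 s⁻¹ * s ^ θ) ∂mulHaar with hc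
  have hct : c ≠ ⊤ := (lintegral_Ioi_mul_rpow_lt_top hθ).ne
  refine ⟨c.toReal, ENNReal.toReal_nonneg, fun h hh => ?_⟩
  rw [ENNReal.ofReal_mul ENNReal.toReal_nonneg, ENNReal.ofReal_toReal hct, hc,
    ← lintegral_mul_const _ (by fun_prop),
    ← (measurePreserving_mul_mulHaar hh).lintegral_comp (by fun_prop)]
  refine le_of_eq (lintegral_congr_ae ?_)
  filter_upwards [ae_mulHaar_pos] with σ hσ
  rw [← ENNReal.ofReal_mul (by positivity), ← ENNReal.ofReal_mul (by positivity)]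
  have e1 : h / (h * σ) = σ⁻¹ := by field_simp
  rw [e1, Real.mul_rpow hh.le hσ.le]
  congr 1
  ring

section

variable {X : Type*} [NormedAddCommGroup X]

/-- Moduli with two powers serve the little Hölder space, where `ε` is small and `L` arbitrary for
some larger exponent. It matters that `C` does not depend on `ε`, `L` or `g`. -/
theorem exists_hardy_rpow_add {T θ ρ : ℝ} (hT : 0 < T) (hθ : θ ∈ Ioo (0 : ℝ) 1)
    (hρ : ρ ∈ Ioo (0 : ℝ) 1) :
    ∃ C : ℝ, 1 ≤ C ∧ ∀ (ε L : ℝ), 0 ≤ ε → 0 ≤ L → ∀ (g : ℝ → X), (∀ t ≤ 0, g t = 0) →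
      (∀ t ≤ T, ∀ s > 0, ‖g (t - s) - g t‖ ≤ ε * s ^ θ + L * s ^ ρ) →
      ∀ h ∈ Ioc 0 T, ∀ t ≤ T, meanOsc T g h t ≤ ENNReal.ofReal (C * (ε * h ^ θ + L * h ^ ρ)) := by
  obtain ⟨C₁, hC₁0, hC₁⟩ := exists_hardy_rpow hθ
  obtain ⟨C₂, hC₂0, hC₂⟩ := exists_hardy_rpow hρ
  refine ⟨1 + T + C₁ + C₂, by linarith, fun ε L hε hL g hg0 hg h hh t ht => ?_⟩
  have hh0 := hh.1
  -- The zeroth-order term `h ‖g t‖` is absorbed: `‖g t‖` is the increment from time `0`, hence at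
  -- most the modulus at `T`, and `h ≤ T`.
  have hpow : ∀ η : ℝ, η ∈ Ioo (0 : ℝ) 1 → h * T ^ η ≤ T * h ^ η := by
    intro η hη
    have h1 : h ^ (1 - η) ≤ T ^ (1 - η) :=
      Real.rpow_le_rpow hh0.le hh.2 (by linarith [hη.2])
    calc h * T ^ η = h ^ (1 - η) * h ^ η * T ^ η := by
          rw [← Real.rpow_add hh0, sub_add_cancel, Real.rpow_one]
      _ ≤ T ^ (1 - η) * h ^ η * T ^ η := by gcongr
      _ = T ^ (1 - η) * T ^ η * h ^ η := by ring
      _ = T * h ^ η := by rw [← Real.rpow_add hT, sub_add_cancel, Real.rpow_one]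
  have hgt : ‖g t‖ ≤ ε * T ^ θ + L * T ^ ρ := by
    rcases le_or_gt t 0 with h0 | h0
    · rw [hg0 t h0, norm_zero]; positivity
    · have h1 := hg t ht t h0
      rw [sub_self, hg0 0 le_rfl, zero_sub, norm_neg] at h1
      refine h1.trans ?_
      have := hθ.1.le
      have := hρ.1.le
      gcongr
  have hfirst : ENNReal.ofReal h * ‖g t‖ₑ ≤ ENNReal.ofReal (T * (ε * h ^ θ + L * h ^ ρ)) := by
    rw [← ofReal_norm, ← ENNReal.ofReal_mul hh0.le]
    refine ENNReal.ofReal_le_ofReal ?_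
    calc h * ‖g t‖ ≤ h * (ε * T ^ θ + L * T ^ ρ) := by gcongr
      _ = ε * (h * T ^ θ) + L * (h * T ^ ρ) := by ring
      _ ≤ ε * (T * h ^ θ) + L * (T * h ^ ρ) := by
          exact add_le_add (mul_le_mul_of_nonneg_left (hpow θ hθ) hε)
            (mul_le_mul_of_nonneg_left (hpow ρ hρ) hL)
      _ = _ := by ring
  have hsecond : ∫⁻ s in Ioo 0 T, ENNReal.ofReal (min 1 (h / s)) * ‖g (t - s) - g t‖ₑ ∂mulHaar ≤
      ENNReal.ofReal (ε * (C₁ * h ^ θ) + L * (C₂ * h ^ ρ)) := by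
    calc _ ≤ ∫⁻ s in Ioo 0 T, (ENNReal.ofReal ε * (ENNReal.ofReal (min 1 (h / s)) *
            ENNReal.ofReal (s ^ θ)) + ENNReal.ofReal L * (ENNReal.ofReal (min 1 (h / s)) *
            ENNReal.ofReal (s ^ ρ))) ∂mulHaar := by
          refine setLIntegral_mono' measurableSet_Ioo fun s hs => ?_
          have hs0 := hs.1
          have h1 : ‖g (t - s) - g t‖ₑ ≤
              ENNReal.ofReal ε * ENNReal.ofReal (s ^ θ) + ENNReal.ofReal L * ENNReal.ofReal (s ^ ρ) := by
            rw [← ENNReal.ofReal_mul hε, ← ENNReal.ofReal_mul hL,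
              ← ENNReal.ofReal_add (by positivity) (by positivity), ← ofReal_norm]
            exact ENNReal.ofReal_le_ofReal (hg t ht s hs0)
          refine (mul_le_mul_right h1 _).trans_eq ?_
          ring
      _ ≤ ∫⁻ s, (ENNReal.ofReal ε * (ENNReal.ofReal (min 1 (h / s)) *
            ENNReal.ofReal (s ^ θ)) + ENNReal.ofReal L * (ENNReal.ofReal (min 1 (h / s)) *
            ENNReal.ofReal (s ^ ρ))) ∂mulHaar := setLIntegral_le_lintegral _ _
      _ = ENNReal.ofReal ε * (∫⁻ s, ENNReal.ofReal (min 1 (h / s)) *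
            ENNReal.ofReal (s ^ θ) ∂mulHaar) + ENNReal.ofReal L *
            ∫⁻ s, ENNReal.ofReal (min 1 (h / s)) * ENNReal.ofReal (s ^ ρ) ∂mulHaar := by
          rw [lintegral_add_left (by fun_prop), lintegral_const_mul _ (by fun_prop),
            lintegral_const_mul _ (by fun_prop)]
      _ ≤ ENNReal.ofReal ε * ENNReal.ofReal (C₁ * h ^ θ) +
          ENNReal.ofReal L * ENNReal.ofReal (C₂ * h ^ ρ) := by
          gcongr
          · exact hC₁ h hh0
          · exact hC₂ h hh0
      _ = _ := by
          rw [← ENNReal.ofReal_mul hε, ← ENNReal.ofReal_mul hL,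
            ← ENNReal.ofReal_add (by positivity) (by positivity)]
  refine (add_le_add hfirst hsecond).trans ?_
  rw [← ENNReal.ofReal_add (by positivity) (by positivity)]
  refine ENNReal.ofReal_le_ofReal ?_
  have e1 : 0 ≤ ε * h ^ θ := by positivity
  have e2 : 0 ≤ L * h ^ ρ := by positivity
  nlinarith [mul_nonneg hC₁0 e2, mul_nonneg hC₂0 e1]

variable [NormedSpace ℂ X] [CompleteSpace X]

/-- Singular contour integrals act on Hölder functions vanishing for negative times. -/
theorem exists_contourOp_holder {α : ℝ} (hα : α ∈ Ioo (Real.pi / 2) Real.pi) {T θ ρ : ℝ}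
    (hT : 0 < T) (hθ : θ ∈ Ioo (0 : ℝ) 1) (hρ : ρ ∈ Ioo (0 : ℝ) 1)
    {m : ℝ → X →L[ℂ] X} {C₀ : ℝ} (hm : IsContourMultiplier m C₀) {g : ℝ → X}
    (hg : StronglyMeasurable g) (hgi : Integrable g) (hg0 : ∀ t ≤ 0, g t = 0) :
    ∃ C : ℝ, 0 ≤ C ∧ ∀ (ε L : ℝ), 0 ≤ ε → 0 ≤ L →
      (∀ t ≤ T, ∀ s > 0, ‖g (t - s) - g t‖ ≤ ε * s ^ θ + L * s ^ ρ) →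
      ∀ h ∈ Ioc 0 T, ∀ t, t + h ≤ T →
        ‖contourOp α m g (t + h) - contourOp α m g t‖ ≤ C * (ε * h ^ θ + L * h ^ ρ) := by
  obtain ⟨C, hCt, hC⟩ := exists_contourOp_bounds (X := X) hα hT hT C₀
  obtain ⟨K, hK1, hK⟩ := exists_hardy_rpow_add (X := X) hT hθ hρ
  refine ⟨C.toReal * (4 * K), by positivity, fun ε L hε hL hgH h hh t ht => ?_⟩
  have hh0 := hh.1
  have hb := (hC m hm g hg hgi hg0 h hh).2 t ht
  have hmO := hK ε L hε hL g hg0 hgH h hh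
  set B := ε * h ^ θ + L * h ^ ρ with hB
  have hB0 : 0 ≤ B := by positivity
  have h1 : ‖g (t + h) - g t‖ₑ ≤ ENNReal.ofReal (K * B) := by
    rw [← ofReal_norm]
    refine ENNReal.ofReal_le_ofReal ?_
    have := hgH (t + h) ht h hh0
    rw [add_sub_cancel_right, norm_sub_rev] at this
    exact this.trans (le_mul_of_one_le_left hB0 hK1)
  have h2 : ENNReal.ofReal h⁻¹ * ∫⁻ τ in Ioc t (t + h), meanOsc T g h τ ≤
      ENNReal.ofReal (K * B) := by
    have h3 : ∫⁻ τ in Ioc t (t + h), meanOsc T g h τ ≤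
        ∫⁻ _ in Ioc t (t + h), ENNReal.ofReal (K * B) :=
      setLIntegral_mono' measurableSet_Ioc fun τ hτ => hmO τ (hτ.2.trans ht)
    refine (mul_le_mul_right h3 _).trans_eq ?_
    rw [lintegral_const, Measure.restrict_apply_univ, Real.volume_Ioc, add_sub_cancel_left,
      mul_comm, mul_assoc, ← ENNReal.ofReal_mul hh0.le, mul_inv_cancel₀ hh0.ne',
      ENNReal.ofReal_one, mul_one]
  have h4 : ‖contourOp α m g (t + h) - contourOp α m g t‖ₑ ≤
      ENNReal.ofReal (C.toReal * (4 * K) * B) := by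
    refine hb.trans ?_
    rw [mul_assoc, ENNReal.ofReal_mul ENNReal.toReal_nonneg, ENNReal.ofReal_toReal hCt]
    refine mul_le_mul_right ?_ _
    refine (add_le_add (add_le_add (add_le_add h1 (hmO t (by linarith))) (hmO _ ht)) h2).trans_eq ?_
    rw [← ENNReal.ofReal_add (by positivity) (by positivity),
      ← ENNReal.ofReal_add (by positivity) (by positivity),
      ← ENNReal.ofReal_add (by positivity) (by positivity)]
    congr 1
    ring
  rw [← ofReal_norm] at h4
  exact (ENNReal.ofReal_le_ofReal_iff (by positivity)).1 h4

end

section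

variable {X : Type*} [NormedAddCommGroup X]

theorem memHolderSpace_of_le {T θ C : ℝ} (hθ : 0 < θ) {u : ℝ → X}
    (h : ∀ s ∈ Icc (0 : ℝ) T, ∀ t ∈ Icc (0 : ℝ) T, s < t → ‖u t - u s‖ ≤ C * (t - s) ^ θ) :
    MemHolderSpace T θ u := by
  have h' : ∀ s ∈ Icc (0 : ℝ) T, ∀ t ∈ Icc (0 : ℝ) T, ‖u t - u s‖ ≤ C * |t - s| ^ θ := by
    intro s hs t ht
    rcases lt_trichotomy s t with hst | rfl | hst
    · rw [abs_of_pos (sub_pos.2 hst)]; exact h s hs t ht hst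
    · simp [Real.zero_rpow hθ.ne']
    · rw [abs_sub_comm, abs_of_pos (sub_pos.2 hst), norm_sub_rev]; exact h t ht s hs hst
  refine ⟨fun s hs => ?_, C, h'⟩
  rw [ContinuousWithinAt, tendsto_iff_norm_sub_tendsto_zero]
  have h1 : Filter.Tendsto (fun t => C * |t - s| ^ θ) (nhdsWithin s (Icc 0 T)) (nhds 0) := by
    have hc : Continuous fun t : ℝ => C * |t - s| ^ θ :=
      continuous_const.mul ((continuous_id.sub continuous_const).abs.rpow_const
        fun _ => Or.inr hθ.le)
    have := (hc.tendsto s).mono_left (nhdsWithin_le_nhds (s := Icc 0 T))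
    simpa [Real.zero_rpow hθ.ne'] using this
  refine tendsto_of_tendsto_of_tendsto_of_le_of_le' tendsto_const_nhds h1
    (Filter.Eventually.of_forall fun _ => norm_nonneg _) ?_
  filter_upwards [self_mem_nhdsWithin] with t ht
  exact h' s hs t ht

/-- The term of higher order `ρ > θ` is negligible at small distances whatever `L` is. This form of
the little Hölder condition, unlike the limit, passes through linear estimates. -/
theorem memLittleHolderSpace_of_le {T θ ρ C : ℝ} (hθ : 0 < θ) (hρ : θ < ρ)
    (hC : 0 ≤ C) {u : ℝ → X}
    (h : ∀ ε > 0, ∃ L ≥ 0, ∀ s ∈ Icc (0 : ℝ) T, ∀ t ∈ Icc (0 : ℝ) T, s < t →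
      ‖u t - u s‖ ≤ C * (ε * (t - s) ^ θ + L * (t - s) ^ ρ)) :
    MemLittleHolderSpace T θ u := by
  refine ⟨?_, fun ε hε => ?_⟩
  · obtain ⟨L, hL0, hL⟩ := h 1 one_pos
    refine memHolderSpace_of_le (C := C * (1 + L * T ^ (ρ - θ))) hθ fun s hs t ht hst => ?_
    refine (hL s hs t ht hst).trans ?_
    rw [mul_assoc]
    refine mul_le_mul_of_nonneg_left ?_ hC
    have h0 : 0 < t - s := sub_pos.2 hst
    have h1 : (t - s) ^ ρ ≤ T ^ (ρ - θ) * (t - s) ^ θ := by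
      calc (t - s) ^ ρ = (t - s) ^ (ρ - θ) * (t - s) ^ θ := by
            rw [← Real.rpow_add h0, sub_add_cancel]
        _ ≤ _ := by
            have : t - s ≤ T := by linarith [hs.1, ht.2]
            have : 0 ≤ ρ - θ := by linarith
            gcongr
    nlinarith [mul_le_mul_of_nonneg_left h1 hL0]
  · obtain ⟨L, hL0, hL⟩ := h (ε / (2 * (C + 1))) (by positivity)
    have hlim : Filter.Tendsto (fun x : ℝ => C * L * x ^ (ρ - θ)) (nhds 0) (nhds 0) := by
      have hc : Continuous fun x : ℝ => C * L * x ^ (ρ - θ) :=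
        continuous_const.mul (continuous_id.rpow_const fun _ => Or.inr (by linarith))
      have := hc.tendsto 0
      simpa [Real.zero_rpow (sub_pos.2 hρ).ne'] using this
    obtain ⟨δ, hδ, hd⟩ := Metric.eventually_nhds_iff.1
      (hlim.eventually (gt_mem_nhds (show 0 < ε / 2 by positivity)))
    have key : ∀ s ∈ Icc (0 : ℝ) T, ∀ t ∈ Icc (0 : ℝ) T, s < t → t - s < δ →
        ‖u t - u s‖ ≤ ε * (t - s) ^ θ := by
      intro s hs t ht hst hlt
      have h0 : 0 < t - s := sub_pos.2 hst
      have h1 := hd (y := t - s) (by rw [Real.dist_eq, sub_zero, abs_of_pos h0]; exact hlt)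
      refine (hL s hs t ht hst).trans ?_
      have h2 : (t - s) ^ ρ = (t - s) ^ (ρ - θ) * (t - s) ^ θ := by
        rw [← Real.rpow_add h0, sub_add_cancel]
      have h3 : C * (ε / (2 * (C + 1))) ≤ ε / 2 := by
        rw [mul_div_assoc', div_le_div_iff₀ (by positivity) (by positivity)]
        nlinarith
      have h4 : 0 < (t - s) ^ θ := Real.rpow_pos_of_pos h0 _
      rw [h2]
      calc C * (ε / (2 * (C + 1)) * (t - s) ^ θ + L * ((t - s) ^ (ρ - θ) * (t - s) ^ θ)) =
          (C * (ε / (2 * (C + 1))) + C * L * (t - s) ^ (ρ - θ)) * (t - s) ^ θ := by ring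
        _ ≤ (ε / 2 + ε / 2) * (t - s) ^ θ := by gcongr
        _ = _ := by ring
    refine ⟨δ, hδ, fun s hs t ht hlt => ?_⟩
    rcases lt_trichotomy s t with hst | rfl | hst
    · rw [abs_of_pos (sub_pos.2 hst)] at hlt ⊢; exact key s hs t ht hst hlt
    · simp [Real.zero_rpow hθ.ne']
    · rw [abs_sub_comm, abs_of_pos (sub_pos.2 hst)] at hlt ⊢
      rw [norm_sub_rev]; exact key t ht s hs hst hlt

theorem memLittleHolderSpace_of_lipschitz {T θ K : ℝ} (hθ : θ ∈ Ioo (0 : ℝ) 1)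
    (hK : 0 ≤ K) {u : ℝ → X}
    (h : ∀ s ∈ Icc (0 : ℝ) T, ∀ t ∈ Icc (0 : ℝ) T, s < t → ‖u t - u s‖ ≤ K * (t - s)) :
    MemLittleHolderSpace T θ u := by
  refine memLittleHolderSpace_of_le (C := 1) (ρ := 1) hθ.1 hθ.2 zero_le_one fun ε hε =>
    ⟨K, hK, fun s hs t ht hst => (h s hs t ht hst).trans ?_⟩
  have h0 : 0 < t - s := sub_pos.2 hst
  have := Real.rpow_pos_of_pos h0 θ
  rw [Real.rpow_one]
  nlinarith [mul_pos hε this]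

theorem memLittleHolderSpace_primitive [NormedSpace ℝ X] {T θ : ℝ} (hθ : θ ∈ Ioo (0 : ℝ) 1)
    (hT : 0 < T) {v : ℝ → X} (hv : ContinuousOn v (Icc 0 T)) :
    MemLittleHolderSpace T θ fun t => ∫ s in (0 : ℝ)..t, v s := by
  obtain ⟨K, hK⟩ := isCompact_Icc.exists_bound_of_continuousOn hv
  have hK0 : 0 ≤ K := (norm_nonneg _).trans (hK 0 ⟨le_rfl, hT.le⟩)
  have hii : ∀ s ∈ Icc 0 T, IntervalIntegrable v volume 0 s := fun s hs =>
    (hv.mono (by rw [uIcc_of_le hs.1]; exact Icc_subset_Icc_right hs.2)).intervalIntegrable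
  refine memLittleHolderSpace_of_lipschitz hθ hK0 fun s hs t ht hst => ?_
  rw [intervalIntegral.integral_interval_sub_left (hii t ht) (hii s hs)]
  have := intervalIntegral.norm_integral_le_of_norm_le_const (a := s) (b := t) (C := K) (f := v)
    fun x hx => by
      rw [uIoc_of_le hst.le] at hx
      exact hK x ⟨by linarith [hx.1, hs.1], hx.2.trans ht.2⟩
  rwa [abs_of_pos (sub_pos.2 hst)] at this

/-- The extension of a function on `[0, T]` by zero to the line. -/
noncomputable def zeroExt (T : ℝ) (hT : 0 ≤ T) (f : ℝ → X) : ℝ → X :=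
  (Ioc 0 T).indicator (IccExtend hT ((Icc 0 T).domRestrict f))

theorem zeroExt_of_nonpos {T : ℝ} (hT : 0 ≤ T) (f : ℝ → X) {t : ℝ} (ht : t ≤ 0) :
    zeroExt T hT f t = 0 :=
  indicator_of_notMem (fun hc => absurd hc.1 (not_lt.2 ht)) _

theorem zeroExt_of_mem {T : ℝ} (hT : 0 ≤ T) {f : ℝ → X} (hf0 : f 0 = 0) {t : ℝ}
    (ht : t ∈ Icc 0 T) : zeroExt T hT f t = f t := by
  rcases ht.1.eq_or_lt with rfl | h0
  · rw [zeroExt_of_nonpos hT f le_rfl, hf0]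
  · rw [zeroExt, indicator_of_mem (show t ∈ Ioc 0 T from ⟨h0, ht.2⟩), IccExtend_of_mem _ _ ht]
    rfl

theorem stronglyMeasurable_zeroExt {T : ℝ} (hT : 0 ≤ T) {f : ℝ → X}
    (hf : ContinuousOn f (Icc 0 T)) : StronglyMeasurable (zeroExt T hT f) :=
  (hf.domRestrict.Icc_extend' (h := hT)).stronglyMeasurable.indicator measurableSet_Ioc

theorem integrable_zeroExt {T : ℝ} (hT : 0 ≤ T) {f : ℝ → X}
    (hf : ContinuousOn f (Icc 0 T)) : Integrable (zeroExt T hT f) := by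
  have hc : Continuous (IccExtend hT ((Icc 0 T).domRestrict f)) := hf.domRestrict.Icc_extend'
  exact ((hc.continuousOn.integrableOn_Icc (μ := volume) (a := 0) (b := T)).mono_set
    Ioc_subset_Icc_self).integrable_indicator measurableSet_Ioc

/-- Because `f 0 = 0`, a difference reaching into negative times is a difference from time `0` over
a shorter distance. -/
theorem norm_zeroExt_sub_le {T : ℝ} (hT : 0 ≤ T) {f : ℝ → X} (hf0 : f 0 = 0) {ω : ℝ → ℝ}
    (hω : MonotoneOn ω (Ioi 0)) (hω0 : ∀ s > 0, 0 ≤ ω s)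
    (hf : ∀ s ∈ Icc (0 : ℝ) T, ∀ t ∈ Icc (0 : ℝ) T, s < t → ‖f t - f s‖ ≤ ω (t - s)) :
    ∀ t ≤ T, ∀ s > 0, ‖zeroExt T hT f (t - s) - zeroExt T hT f t‖ ≤ ω s := by
  intro t ht s hs
  rcases le_or_gt t 0 with h0 | h0
  · rw [zeroExt_of_nonpos hT f h0, zeroExt_of_nonpos hT f (by linarith), sub_self, norm_zero]
    exact hω0 s hs
  · rw [zeroExt_of_mem hT hf0 ⟨h0.le, ht⟩, norm_sub_rev]
    rcases le_or_gt (t - s) 0 with h1 | h1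
    · rw [zeroExt_of_nonpos hT f h1, ← hf0]
      refine (hf 0 ⟨le_rfl, hT⟩ t ⟨h0.le, ht⟩ h0).trans ?_
      rw [sub_zero]
      exact hω h0 hs (by linarith)
    · rw [zeroExt_of_mem hT hf0 ⟨h1.le, by linarith⟩]
      have := hf (t - s) ⟨h1.le, by linarith⟩ t ⟨h0.le, ht⟩ (by linarith)
      rwa [sub_sub_cancel] at this

/-- Below `δ` the little Hölder condition applies; beyond `δ` the full Hölder bound is traded for
the power `ρ` at the cost of `δ^{θ - ρ}`. -/
theorem MemLittleHolderSpace.exists_le {T θ : ℝ} {ρ : ℝ}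
    (hρ : θ < ρ) {f : ℝ → X} (hf : MemLittleHolderSpace T θ f) {ε : ℝ} (hε : 0 < ε) :
    ∃ L ≥ 0, ∀ s ∈ Icc (0 : ℝ) T, ∀ t ∈ Icc (0 : ℝ) T, s < t →
      ‖f t - f s‖ ≤ ε * (t - s) ^ θ + L * (t - s) ^ ρ := by
  obtain ⟨⟨-, C, hC⟩, hl⟩ := hf
  obtain ⟨δ, hδ, hd⟩ := hl ε hε
  refine ⟨|C| * δ ^ (θ - ρ), by positivity, fun s hs t ht hst => ?_⟩
  have h0 : 0 < t - s := sub_pos.2 hst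
  rcases lt_or_ge (t - s) δ with h1 | h1
  · have := hd s hs t ht (by rwa [abs_of_pos h0])
    rw [abs_of_pos h0] at this
    refine this.trans (le_add_of_nonneg_right (by positivity))
  · have := hC s hs t ht
    rw [abs_of_pos h0] at this
    refine this.trans (le_trans ?_ (le_add_of_nonneg_left (by positivity)))
    have h2 : (t - s) ^ (θ - ρ) ≤ δ ^ (θ - ρ) :=
      Real.rpow_le_rpow_of_nonpos hδ h1 (by linarith)
    have h3 : (t - s) ^ θ = (t - s) ^ (θ - ρ) * (t - s) ^ ρ := by
      rw [← Real.rpow_add h0, sub_add_cancel]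
    rw [h3, mul_assoc]
    gcongr
    exact le_abs_self C

end

section

variable {X : Type*} [NormedAddCommGroup X] [NormedSpace ℂ X] [CompleteSpace X]

theorem MemHolderSpace.contourOp {α : ℝ} (hα : α ∈ Ioo (Real.pi / 2) Real.pi) {T θ : ℝ}
    (hT : 0 < T) (hθ : θ ∈ Ioo (0 : ℝ) 1) {m : ℝ → X →L[ℂ] X} {C₀ : ℝ}
    (hm : IsContourMultiplier m C₀) {f : ℝ → X} (hf : MemHolderSpace T θ f) (hf0 : f 0 = 0) :
    MemHolderSpace T θ (contourOp α m (zeroExt T hT.le f)) := by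
  obtain ⟨hfc, M, hM⟩ := hf
  obtain ⟨C, hC0, hC⟩ := exists_contourOp_holder hα hT hθ hθ hm
    (stronglyMeasurable_zeroExt hT.le hfc) (integrable_zeroExt hT.le hfc)
    fun t ht => zeroExt_of_nonpos hT.le f ht
  have h1 := hC |M| 0 (abs_nonneg M) le_rfl (norm_zeroExt_sub_le hT.le hf0
    (ω := fun s => |M| * s ^ θ + 0 * s ^ θ) (fun a ha b hb hab => by
      have := hθ.1.le
      have : (0 : ℝ) < a := ha
      simp only
      gcongr) (fun s hs => by positivity) fun s hs t ht hst => by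
      have := hM s hs t ht
      have h0 : 0 < t - s := sub_pos.2 hst
      rw [abs_of_pos h0] at this
      rw [zero_mul, add_zero]
      refine this.trans ?_
      gcongr
      exact le_abs_self M)
  refine memHolderSpace_of_le (C := C * |M|) hθ.1 fun s hs t ht hst => ?_
  have := h1 (t - s) ⟨sub_pos.2 hst, by linarith [hs.1, ht.2]⟩ s (by linarith [ht.2])
  rw [add_sub_cancel] at this
  refine this.trans_eq ?_
  ring

theorem MemLittleHolderSpace.contourOp {α : ℝ} (hα : α ∈ Ioo (Real.pi / 2) Real.pi) {T θ : ℝ}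
    (hT : 0 < T) (hθ : θ ∈ Ioo (0 : ℝ) 1) {m : ℝ → X →L[ℂ] X} {C₀ : ℝ}
    (hm : IsContourMultiplier m C₀) {f : ℝ → X} (hf : MemLittleHolderSpace T θ f)
    (hf0 : f 0 = 0) : MemLittleHolderSpace T θ (contourOp α m (zeroExt T hT.le f)) := by
  have hfc := hf.1.1
  -- Any exponent strictly between `θ` and `1` would do.
  have hρ : (1 + θ) / 2 ∈ Ioo (0 : ℝ) 1 := ⟨by linarith [hθ.1], by linarith [hθ.2]⟩
  have hθρ : θ < (1 + θ) / 2 := by linarith [hθ.2]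
  obtain ⟨C, hC0, hC⟩ := exists_contourOp_holder hα hT hθ hρ hm
    (stronglyMeasurable_zeroExt hT.le hfc) (integrable_zeroExt hT.le hfc)
    fun t ht => zeroExt_of_nonpos hT.le f ht
  refine memLittleHolderSpace_of_le hθ.1 hθρ hC0 fun ε hε => ?_
  obtain ⟨L, hL0, hL⟩ := hf.exists_le hθρ hε
  refine ⟨L, hL0, fun s hs t ht hst => ?_⟩
  have h1 := hC ε L hε.le hL0 (norm_zeroExt_sub_le hT.le hf0
    (ω := fun s => ε * s ^ θ + L * s ^ ((1 + θ) / 2)) (fun a ha b hb hab => by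
      have := hθ.1.le
      have := hρ.1.le
      have : (0 : ℝ) < a := ha
      simp only
      gcongr) (fun s hs => by positivity) hL)
  have := h1 (t - s) ⟨sub_pos.2 hst, by linarith [hs.1, ht.2]⟩ s (by linarith [ht.2])
  rwa [add_sub_cancel] at this

end

/-! ### The pencil inverse and its contour multipliers. -/

section

open Complex (I exp)

section

variable {X : Type*} [NormedAddCommGroup X] [NormedSpace ℂ X]

/-- `H z` inverts the pencil `z² + z B + A` and `S z` is the bounded operator `B H z`, on the sector
`openSector k`, with the parabolic bounds. -/
structure IsPencilResolvent (A B : X →ₗ.[ℂ] X) (k C : ℝ) (H S : ℂ → X →L[ℂ] X) : Prop where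
  inverse : ∀ z ∈ openSector k, IsPencilInverse A B z (H z)
  graph_B : ∀ z ∈ openSector k, ∀ x, (H z x, S z x) ∈ B.graph
  graph_A : ∀ z ∈ openSector k, ∀ x, (H z x, x - z ^ 2 • H z x - z • S z x) ∈ A.graph
  differentiableOn : DifferentiableOn ℂ H (openSector k)
  norm_le : ∀ z ∈ openSector k, ‖H z‖ ≤ C
  norm_sq_smul_le : ∀ z ∈ openSector k, ‖z ^ 2 • H z‖ ≤ C
  norm_smul_le : ∀ z ∈ openSector k, ‖z • S z‖ ≤ C

/-- `R` maps into the domain of `B`, so `B R` is an everywhere defined linear map. The assumed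
estimate on `z • b` makes it bounded. -/
theorem IsPencilInverse.exists_comp {A B : X →ₗ.[ℂ] X} {z : ℂ} (hz : z ≠ 0) {R : X →L[ℂ] X}
    (h : IsPencilInverse A B z R) {C : ℝ} (hC0 : 0 ≤ C)
    (hC : ∀ x b, (R x, b) ∈ B.graph → ‖z • b‖ ≤ C * ‖x‖) :
    ∃ S : X →L[ℂ] X, (∀ x, (R x, S x) ∈ B.graph) ∧
      (∀ x, (R x, x - z ^ 2 • R x - z • S x) ∈ A.graph) ∧ ‖z • S‖ ≤ C := by
  have hdom : ∀ x, R x ∈ B.domain := fun x => by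
    obtain ⟨b, a, hb, -, -⟩ := h.1 x
    exact LinearPMap.mem_domain_of_mem_graph hb
  set L : X →ₗ[ℂ] X := B.toFun ∘ₗ LinearMap.codRestrict B.domain R.toLinearMap hdom with hL
  have hg : ∀ x, (R x, L x) ∈ B.graph := fun x => B.mem_graph ⟨R x, hdom x⟩
  have hz' : 0 < ‖z‖ := norm_pos_iff.2 hz
  set S : X →L[ℂ] X := L.mkContinuous (C / ‖z‖) fun x => by
    have := hC x (L x) (hg x)
    rw [norm_smul] at this
    rw [div_mul_eq_mul_div, le_div_iff₀ hz']
    linarith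
  refine ⟨S, hg, fun x => ?_, ?_⟩
  · obtain ⟨b, a, hb, ha, he⟩ := h.1 x
    have hbL : S x = b := B.mem_graph_snd_inj (hg x) hb rfl
    have : x - z ^ 2 • R x - z • S x = a := by
      rw [hbL]
      nth_rewrite 1 [← he]
      abel
    rwa [this]
  · exact ContinuousLinearMap.opNorm_le_bound _ hC0 fun x => hC x (L x) (hg x)

variable {A B : X →ₗ.[ℂ] X} {k C : ℝ} {H S : ℂ → X →L[ℂ] X}

namespace IsPencilResolvent

theorem const_nonneg (h : IsPencilResolvent A B k C H S) (hk : 0 ≤ k) : 0 ≤ C :=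
  (norm_nonneg _).trans (h.norm_le 1 (by
    simp only [openSector, mem_ofPred_eq]
    simp only [Complex.one_re, norm_one, mul_one]
    linarith))

theorem resolvent_identity (h : IsPencilResolvent A B k C H S) {z w : ℂ} (hz : z ∈ openSector k)
    (hw : w ∈ openSector k) (x : X) :
    H w ((w ^ 2 - z ^ 2) • H z x + (w - z) • S z x) = H z x - H w x := by
  have h1 := (h.inverse w hw).2 _ _ _ (h.graph_B z hz x) (h.graph_A z hz x)
  have e : w ^ 2 • H z x + w • S z x + (x - z ^ 2 • H z x - z • S z x) =
      x + ((w ^ 2 - z ^ 2) • H z x + (w - z) • S z x) := by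
    rw [sub_smul, sub_smul]; abel
  rw [e, map_add] at h1
  exact eq_sub_of_add_eq' h1

theorem comp_sub_comp (h : IsPencilResolvent A B k C H S) {z w : ℂ} (hz : z ∈ openSector k)
    (hw : w ∈ openSector k) :
    S z - S w = (S w).comp ((w ^ 2 - z ^ 2) • H z + (w - z) • S z) := by
  ext x
  have h1 : (H z x - H w x, S z x - S w x) ∈ B.graph :=
    B.graph.sub_mem (h.graph_B z hz x) (h.graph_B w hw x)
  have h2 := h.graph_B w hw ((w ^ 2 - z ^ 2) • H z x + (w - z) • S z x)
  rw [h.resolvent_identity hz hw] at h2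
  exact B.mem_graph_snd_inj h1 h2 rfl

theorem norm_comp_le (h : IsPencilResolvent A B k C H S) {z : ℂ} (hz : z ∈ openSector k) :
    ‖S z‖ ≤ C / ‖z‖ := by
  have h1 := h.norm_smul_le z hz
  rw [norm_smul] at h1
  rw [le_div_iff₀ (norm_pos_iff.2 (ne_zero_of_mem_openSector hz))]
  linarith

theorem continuousOn_comp (h : IsPencilResolvent A B k C H S) : ContinuousOn S (openSector k) := by
  intro w hw
  have hnhds := (isOpen_openSector k).mem_nhds hw
  refine ContinuousAt.continuousWithinAt ?_
  rw [ContinuousAt, tendsto_iff_norm_sub_tendsto_zero]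
  have hHc : ContinuousAt H w := (h.differentiableOn.continuousOn).continuousAt hnhds
  have hw0 : ‖w‖ ≠ 0 := norm_ne_zero_iff.2 (ne_zero_of_mem_openSector hw)
  have hlim : Filter.Tendsto (fun z => ‖S w‖ * (‖w ^ 2 - z ^ 2‖ * ‖H z‖ + ‖w - z‖ * (C / ‖z‖)))
      (nhds w) (nhds (‖S w‖ * (‖w ^ 2 - w ^ 2‖ * ‖H w‖ + ‖w - w‖ * (C / ‖w‖)))) := by
    have h1 : ContinuousAt (fun z : ℂ => ‖w ^ 2 - z ^ 2‖) w := by fun_prop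
    have h2 : ContinuousAt (fun z : ℂ => ‖w - z‖) w := by fun_prop
    have h3 : ContinuousAt (fun z : ℂ => C / ‖z‖) w :=
      continuousAt_const.div continuous_norm.continuousAt hw0
    exact continuousAt_const.mul ((h1.mul hHc.norm).add (h2.mul h3))
  simp only [sub_self, norm_zero, zero_mul, add_zero, mul_zero] at hlim
  refine tendsto_of_tendsto_of_tendsto_of_le_of_le' tendsto_const_nhds hlim
    (Filter.Eventually.of_forall fun _ => norm_nonneg _) ?_
  filter_upwards [hnhds] with z hz
  rw [h.comp_sub_comp hz hw]
  refine (ContinuousLinearMap.opNorm_comp_le _ _).trans ?_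
  refine mul_le_mul_of_nonneg_left ((norm_add_le _ _).trans ?_) (norm_nonneg _)
  rw [norm_smul, norm_smul]
  gcongr
  exact h.norm_comp_le hz

/-- Holomorphy is assumed for `H` only. Applying `B` to the resolvent identity expresses the
difference quotient of `S` at `w` as `-S w ∘ ((w + z) H z + S z)`, which converges by the continuity
already obtained. -/
theorem differentiableOn_comp (h : IsPencilResolvent A B k C H S) :
    DifferentiableOn ℂ S (openSector k) := by
  intro w hw
  have hnhds := (isOpen_openSector k).mem_nhds hw
  refine DifferentiableAt.differentiableWithinAt ?_
  have hHc : ContinuousAt H w := (h.differentiableOn.continuousOn).continuousAt hnhds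
  have hSc : ContinuousAt S w := h.continuousOn_comp.continuousAt hnhds
  set G : ℂ → X →L[ℂ] X := fun z => -(S w).comp ((w + z) • H z + S z) with hG
  have hGc : ContinuousAt G w := by
    have h1 : ContinuousAt (fun z => (w + z) • H z + S z) w :=
      ((by fun_prop : ContinuousAt (fun z => w + z) w).smul hHc).add hSc
    exact (((ContinuousLinearMap.compL ℂ X X X (S w)).continuous.continuousAt).comp h1).neg
  refine HasDerivAt.differentiableAt (f' := G w) ?_
  rw [hasDerivAt_iff_tendsto_slope]
  refine (hGc.tendsto.mono_left nhdsWithin_le_nhds).congr' ?_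
  filter_upwards [self_mem_nhdsWithin, mem_nhdsWithin_of_mem_nhds hnhds] with z hz hzΩ
  have hz' : z - w ≠ 0 := sub_ne_zero.2 hz
  rw [slope_def_module, h.comp_sub_comp hzΩ hw]
  have e : (w ^ 2 - z ^ 2) • H z + (w - z) • S z = (-(z - w)) • ((w + z) • H z + S z) := by
    rw [smul_add, smul_smul]
    congr 2 <;> ring
  rw [e, ContinuousLinearMap.comp_smul, smul_smul, hG]
  simp only
  rw [mul_neg, inv_mul_cancel₀ hz', neg_one_smul]

end IsPencilResolvent

/-- The multiplier on the contour attached to an operator-valued symbol. -/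
noncomputable def contourMultiplier (α : ℝ) (G : ℂ → X →L[ℂ] X) (x : ℝ) : X →L[ℂ] X :=
  (2 * Real.pi * I)⁻¹ • contourDeriv α x • (contour α x)⁻¹ • G (contour α x)

variable [CompleteSpace X]

theorem norm_two_pi_I_inv_le : ‖((2 * Real.pi * I)⁻¹ : ℂ)‖ ≤ 1 := by
  rw [norm_inv, norm_mul, norm_mul, Complex.norm_I, Complex.norm_real, Complex.norm_ofNat,
    Real.norm_of_nonneg Real.pi_pos.le]
  refine inv_le_one_of_one_le₀ ?_
  linarith [Real.pi_gt_three]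

/-- Division by `z` gives decay of order `1/|z|`. Holomorphy is essential for the bound on truncated
integrals, which comes from closing the contour on the right. -/
theorem isContourMultiplier_contourMultiplier {α : ℝ} (hα : α ∈ Ioo (Real.pi / 2) Real.pi) {k : ℝ}
    (hk : -Real.cos α < k) (hk1 : k < 1) {G : ℂ → X →L[ℂ] X}
    (hG : DifferentiableOn ℂ G (openSector k)) {C : ℝ} (hC : ∀ z ∈ openSector k, ‖G z‖ ≤ C) :
    ∃ C', IsContourMultiplier (contourMultiplier α G) C' := by
  set δ := √((1 + Real.cos α) / 2) with hδ
  have hδ0 : 0 < δ := Real.sqrt_pos.2 (by linarith [one_add_cos_pos hα])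
  have hk0 : 0 ≤ k := by linarith [cos_neg_of_mem hα]
  have hcm := contour_mem_openSector hk hk0 hk1
  have hC0 : 0 ≤ C := (norm_nonneg _).trans (hC _ (hcm 0))
  have hG1 : DifferentiableOn ℂ (fun z => z⁻¹ • G z) (openSector k) :=
    (differentiableOn_inv.mono fun z hz => ne_zero_of_mem_openSector hz).smul hG
  have hc1 : Continuous fun x => (contour α x)⁻¹ • G (contour α x) :=
    hG1.continuousOn.comp_continuous (continuous_contour α) hcm
  have hnorm : ∀ z ∈ openSector k, ‖z⁻¹ • G z‖ ≤ C / ‖z‖ := by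
    intro z hz
    rw [norm_smul, norm_inv, inv_mul_eq_div]
    gcongr
    exact hC z hz
  refine ⟨C / δ + 2 * α * (|C| / δ), ?_, fun x => ?_, fun ρ hρ => ?_⟩
  · unfold contourMultiplier
    exact (((measurable_contourDeriv α).stronglyMeasurable.smul hc1.stronglyMeasurable).const_smul (2 * Real.pi * I : ℂ)⁻¹)
  · have h1 : 0 ≤ 2 * α * (|C| / δ) := by
      have : 0 < α := by linarith [hα.1, Real.pi_pos]
      positivity
    have h2 : ‖contourMultiplier α G x‖ ≤ C / (δ * (1 + |x|)) := by
      unfold contourMultiplier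
      rw [norm_smul, norm_smul, norm_contourDeriv, one_mul]
      refine (mul_le_of_le_one_left (norm_nonneg _) norm_two_pi_I_inv_le).trans
        ((hnorm _ (hcm x)).trans ?_)
      have := norm_contour_ge α x
      rw [← hδ] at this
      gcongr
    refine h2.trans ?_
    rw [← div_div]
    gcongr
    linarith
  · have h1 := exists_bound_intervalIntegral_contour hα hk hk1 hG1 hnorm hρ
    rw [← hδ] at h1
    unfold contourMultiplier
    rw [intervalIntegral.integral_smul, norm_smul]
    refine (mul_le_of_le_one_left (norm_nonneg _) norm_two_pi_I_inv_le).trans (h1.trans ?_)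
    have : 0 ≤ C / δ := by positivity
    linarith

theorem exists_isPencilResolvent {φ : ℝ} (hφ : φ ∈ Ioo (Real.pi / 2) Real.pi)
    (hb : ∀ z ∈ sector φ, z ≠ 0 → IsPencilInverse A B z (H z))
    (hc : DifferentiableOn ℂ H (interior (sector φ)) ∧
      ∃ C : ℝ, ∀ z ∈ sector φ, z ≠ 0 → ‖H z‖ ≤ C)
    (hd : ∃ C : ℝ, ∀ z ∈ sector φ, z ≠ 0 → ∀ x b a : X,
      (H z x, b) ∈ B.graph → (H z x, a) ∈ A.graph →
        ‖z ^ 2 • H z x‖ ≤ C * ‖x‖ ∧ ‖z • b‖ ≤ C * ‖x‖ ∧ ‖a‖ ≤ C * ‖x‖) :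
    ∃ (C : ℝ) (S : ℂ → X →L[ℂ] X), IsPencilResolvent A B (-Real.cos φ) C H S := by
  obtain ⟨hdiff, C₁, hC₁⟩ := hc
  obtain ⟨C₂, hC₂⟩ := hd
  have hle' : ∀ x : X, C₂ * ‖x‖ ≤ (|C₁| + |C₂|) * ‖x‖ := fun x =>
    mul_le_mul_of_nonneg_right ((le_abs_self _).trans (by linarith [abs_nonneg C₁])) (norm_nonneg _)
  have hC0 : 0 ≤ |C₁| + |C₂| := by positivity
  have hex : ∀ z ∈ openSector (-Real.cos φ), ∃ S : X →L[ℂ] X, (∀ x, (H z x, S x) ∈ B.graph) ∧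
      (∀ x, (H z x, x - z ^ 2 • H z x - z • S x) ∈ A.graph) ∧ ‖z • S‖ ≤ |C₁| + |C₂| := by
    intro z hz
    have hzs := openSector_subset_sector hφ hz
    have hz0 := ne_zero_of_mem_openSector hz
    refine (hb z hzs hz0).exists_comp hz0 hC0 fun x b hxb => ?_
    obtain ⟨b', a, -, ha, -⟩ := (hb z hzs hz0).1 x
    exact (hC₂ z hzs hz0 x b a hxb ha).2.1.trans (hle' x)
  choose! S hSB hSA hSn using hex
  refine ⟨|C₁| + |C₂|, S, fun z hz => hb z (openSector_subset_sector hφ hz)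
    (ne_zero_of_mem_openSector hz), hSB, hSA, hdiff.mono (openSector_subset_interior hφ),
    fun z hz => ?_, fun z hz => ?_, hSn⟩
  · exact (hC₁ z (openSector_subset_sector hφ hz) (ne_zero_of_mem_openSector hz)).trans
      ((le_abs_self _).trans (by linarith [abs_nonneg C₂]))
  · refine ContinuousLinearMap.opNorm_le_bound _ hC0 fun x => ?_
    exact ((hC₂ z (openSector_subset_sector hφ hz) (ne_zero_of_mem_openSector hz) x _ _
      (hSB z hz x) (hSA z hz x)).1).trans (hle' x)

end

end

/-! ### Closed graphs, time integration and the representation formula. -/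

section

open Complex (I exp)

section

variable {X : Type*} [NormedAddCommGroup X] [NormedSpace ℂ X] [CompleteSpace X]

/-- The quotient map by the closed subspace kills the integrand almost everywhere and commutes with
the integral. -/
theorem integral_prod_mem_of_ae_mem {β : Type*} [MeasurableSpace β] {μ : Measure β}
    {G : Submodule ℂ (X × X)} (hG : IsClosed (G : Set (X × X))) {a b : β → X}
    (ha : Integrable a μ) (hb : Integrable b μ) (h : ∀ᵐ x ∂μ, (a x, b x) ∈ G) :
    (∫ x, a x ∂μ, ∫ x, b x ∂μ) ∈ G := by
  have : IsClosed (G : Set (X × X)) := hG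
  have hab : Integrable (fun x => (a x, b x)) μ := ha.prodMk hb
  set q : (X × X) →L[ℂ] (X × X) ⧸ G := G.mkQL with hq
  have h1 : ∫ x, q (a x, b x) ∂μ = q (∫ x, (a x, b x) ∂μ) := q.integral_comp_comm hab
  have h2 : ∫ x, q (a x, b x) ∂μ = 0 :=
    integral_eq_zero_of_ae (h.mono fun x hx => (Submodule.Quotient.mk_eq_zero G).2 hx)
  rw [h2] at h1
  have h3 : ∫ x, (a x, b x) ∂μ ∈ G := (Submodule.Quotient.mk_eq_zero G).1 h1.symm
  rwa [integral_pair ha hb] at h3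

/-- Difference quotients stay in the subspace, which is closed. This is how relations proved for
primitives are differentiated. -/
theorem HasDerivWithinAt.prod_mem {G : Submodule ℂ (X × X)} (hG : IsClosed (G : Set (X × X)))
    {a b : ℝ → X} {a' b' : X} {s : Set ℝ} {t : ℝ} (hs : UniqueDiffWithinAt ℝ s t)
    (ha : HasDerivWithinAt a a' s t) (hb : HasDerivWithinAt b b' s t)
    (h : ∀ r ∈ s, (a r, b r) ∈ G) (ht : t ∈ s) : (a', b') ∈ G := by
  have h1 := (ha.prodMk hb)
  rw [hasDerivWithinAt_iff_tendsto_slope] at h1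
  have : (nhdsWithin t (s \ {t})).NeBot := by
    rw [← accPt_principal_iff_nhdsWithin]
    exact uniqueDiffWithinAt_iff_accPt.1 hs
  refine hG.mem_of_tendsto h1 ?_
  filter_upwards [self_mem_nhdsWithin] with r hr
  rw [slope_def_module]
  have h2 : (a r, b r) - (a t, b t) ∈ G := G.sub_mem (h r hr.1) (h t ht)
  have := G.smul_mem ((r - t : ℝ)⁻¹ : ℂ) h2
  simp only [SetLike.mem_coe]
  convert this using 1
  rw [← Complex.ofReal_inv]
  exact (Complex.coe_smul _ _).symm

variable {α k T : ℝ} {g : ℝ → X}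

theorem exists_lintegral_contourOp_le (hα : α ∈ Ioo (Real.pi / 2) Real.pi) (hT : 0 < T)
    {m : ℝ → X →L[ℂ] X} {C₀ : ℝ} (hm : IsContourMultiplier m C₀) (hg : StronglyMeasurable g)
    (hgi : Integrable g) (hg0 : ∀ t ≤ 0, g t = 0) {h : ℝ} (hh : 0 < h) :
    ∃ C : ENNReal, C ≠ ⊤ ∧ ∀ t ≤ T,
      ∫⁻ x, ‖m x (duhamelDeriv (contour α x) g t)‖ₑ ≤ C * meanOsc T g h t := by
  obtain ⟨C, hCt, hC⟩ := exists_contourOp_bounds (X := X) hα hT hh C₀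
  refine ⟨C * ENNReal.ofReal h⁻¹, ENNReal.mul_ne_top hCt ENNReal.ofReal_ne_top, fun t ht => ?_⟩
  rw [mul_assoc]
  exact (hC m hm g hg hgi hg0 h ⟨hh, le_rfl⟩).1 t ht

/-- Everything that is needed to exchange the contour integral with a time integral. -/
theorem integrable_prod_contour (hα : α ∈ Ioo (Real.pi / 2) Real.pi) (hT : 0 < T)
    {m : ℝ → X →L[ℂ] X} {C₀ : ℝ} (hm : IsContourMultiplier m C₀) (hg : StronglyMeasurable g)
    (hgi : Integrable g) (hg0 : ∀ t ≤ 0, g t = 0) {h : ℝ} (hh : 0 < h)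
    (hfin : ∫⁻ t in Ioc 0 T, meanOsc T g h t < ⊤) :
    Integrable (fun p : ℝ × ℝ => m p.1 (duhamelDeriv (contour α p.1) g p.2))
      (volume.prod (volume.restrict (Ioc 0 T))) := by
  have hsm : StronglyMeasurable fun p : ℝ × ℝ => m p.1 (duhamelDeriv (contour α p.1) g p.2) :=
    StronglyMeasurable.clm_apply_of (hm.stronglyMeasurable.comp_measurable measurable_fst)
      (stronglyMeasurable_duhamelDeriv hg hg0)
  obtain ⟨C, hCt, hC⟩ := exists_lintegral_contourOp_le hα hT hm hg hgi hg0 hh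
  refine ⟨hsm.aestronglyMeasurable, ?_⟩
  rw [HasFiniteIntegral, lintegral_prod_symm _ hsm.enorm.aemeasurable]
  refine lt_of_le_of_lt (b := C * ∫⁻ t in Ioc 0 T, meanOsc T g h t) ?_
    (ENNReal.mul_lt_top hCt.lt_top hfin)
  rw [← lintegral_const_mul' _ _ hCt]
  exact setLIntegral_mono' measurableSet_Ioc fun t ht => hC t ht.2

theorem integrable_apply_duhamel (hα : α ∈ Ioo (Real.pi / 2) Real.pi) (hT : 0 < T)
    {m : ℝ → X →L[ℂ] X} {C₀ : ℝ} (hm : IsContourMultiplier m C₀) (hg : StronglyMeasurable g)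
    (hgi : Integrable g) (hg0 : ∀ t ≤ 0, g t = 0) {h : ℝ} (hh : 0 < h)
    (hfin : ∫⁻ t in Ioc 0 T, meanOsc T g h t < ⊤) {t : ℝ} (ht : t ∈ Icc 0 T) :
    Integrable (fun x => m x (duhamel (contour α x) g t)) ∧
      ∫ s in (0 : ℝ)..t, contourOp α m g s = ∫ x, m x (duhamel (contour α x) g t) := by
  have hp := (integrable_prod_contour hα hT hm hg hgi hg0 hh hfin).mono_measure
    (μ := volume.prod (volume.restrict (Ioc 0 t)))
    (Measure.prod_mono le_rfl (Measure.restrict_mono (Ioc_subset_Ioc_right ht.2) le_rfl))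
  have e : ∀ x, ∫ s in Ioc 0 t, m x (duhamelDeriv (contour α x) g s) =
      m x (duhamel (contour α x) g t) := by
    intro x
    have h1 := intervalIntegrable_duhamelDeriv (z := contour α x) hgi 0 t
    rw [intervalIntegrable_iff_integrableOn_Ioc_of_le ht.1] at h1
    rw [(m x).integral_comp_comm h1, ← intervalIntegral.integral_of_le ht.1,
      integral_duhamelDeriv hgi ht.1]
  constructor
  · have := hp.integral_prod_left
    simpa only [e] using this
  · rw [intervalIntegral.integral_of_le ht.1]
    unfold contourOp
    rw [← integral_integral_swap hp]
    simp only [e]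

theorem integral_integral_apply_duhamel (hα : α ∈ Ioo (Real.pi / 2) Real.pi) (hT : 0 < T)
    {m : ℝ → X →L[ℂ] X} {C₀ : ℝ} (hm : IsContourMultiplier m C₀) (hg : StronglyMeasurable g)
    (hgi : Integrable g) (hg0 : ∀ t ≤ 0, g t = 0) {h : ℝ} (hh : 0 < h)
    (hfin : ∫⁻ t in Ioc 0 T, meanOsc T g h t < ⊤) {t : ℝ} (ht : t ∈ Icc 0 T) :
    ∫ s in (0 : ℝ)..t, ∫ x, m x (duhamel (contour α x) g s) =
      ∫ x, m x (∫ s in (0 : ℝ)..t, duhamel (contour α x) g s) := by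
  have hp := integrable_prod_contour hα hT hm hg hgi hg0 hh hfin
  have hsm : StronglyMeasurable fun p : ℝ × ℝ => m p.1 (duhamel (contour α p.1) g p.2) :=
    StronglyMeasurable.clm_apply_of (hm.stronglyMeasurable.comp_measurable measurable_fst)
      (stronglyMeasurable_duhamel hg hg0)
  -- As `duhamel` is the time integral of `duhamelDeriv`, the constant `K` dominates the contour
  -- integral uniformly in time, which justifies a second exchange.
  set K := ∫⁻ x, ∫⁻ s in Ioc 0 T, ‖m x (duhamelDeriv (contour α x) g s)‖ₑ with hK
  have hKt : K < ⊤ := by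
    have := hp.2
    rwa [HasFiniteIntegral, lintegral_prod _ hp.1.enorm] at this
  have hb : ∀ s ∈ Ioc 0 t, ∫⁻ x, ‖m x (duhamel (contour α x) g s)‖ₑ ≤ K := by
    intro s hs
    refine lintegral_mono fun x => ?_
    have h1 := intervalIntegrable_duhamelDeriv (z := contour α x) hgi 0 s
    rw [intervalIntegrable_iff_integrableOn_Ioc_of_le hs.1.le] at h1
    rw [← integral_duhamelDeriv hgi hs.1.le, intervalIntegral.integral_of_le hs.1.le,
      ← (m x).integral_comp_comm h1]
    refine (enorm_integral_le_lintegral_enorm _).trans ?_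
    exact lintegral_mono_set (Ioc_subset_Ioc_right (hs.2.trans ht.2))
  have hq : Integrable (fun p : ℝ × ℝ => m p.1 (duhamel (contour α p.1) g p.2))
      (volume.prod (volume.restrict (Ioc 0 t))) := by
    refine ⟨hsm.aestronglyMeasurable, ?_⟩
    rw [HasFiniteIntegral, lintegral_prod_symm _ hsm.enorm.aemeasurable]
    refine lt_of_le_of_lt (setLIntegral_mono' measurableSet_Ioc hb) ?_
    rw [lintegral_const]
    exact ENNReal.mul_lt_top hKt (by simp)
  rw [intervalIntegral.integral_of_le ht.1, ← integral_integral_swap hq]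
  refine integral_congr_ae (Filter.Eventually.of_forall fun x => ?_)
  simp only
  rw [intervalIntegral.integral_of_le ht.1, (m x).integral_comp_comm]
  exact ((continuous_duhamel hgi).integrableOn_Icc (a := 0) (b := t)).mono_set Ioc_subset_Icc_self

theorem contourMultiplier_smul (hcm : ∀ x, contour α x ∈ openSector k) (G : ℂ → X →L[ℂ] X)
    (x : ℝ) : contourMultiplier α (fun z => z • G z) x = contour α x • contourMultiplier α G x := by
  have h0 := ne_zero_of_mem_openSector (hcm x)
  unfold contourMultiplier
  simp only [smul_smul]
  congr 1
  ring

theorem contour_mem (hα : α ∈ Ioo (Real.pi / 2) Real.pi)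
    (hk : -Real.cos α < k) (hk1 : k < 1) (x : ℝ) : contour α x ∈ openSector k :=
  contour_mem_openSector hk (by linarith [cos_neg_of_mem hα]) hk1 x

/-- Integrating a contour integral in time removes a factor `z` of the symbol. -/
theorem integral_contourMultiplier_smul (hα : α ∈ Ioo (Real.pi / 2) Real.pi)
    (hk : -Real.cos α < k) (hk1 : k < 1) (hT : 0 < T)
    {G : ℂ → X →L[ℂ] X} (hG : DifferentiableOn ℂ G (openSector k)) {C C' : ℝ}
    (hC : ∀ z ∈ openSector k, ‖G z‖ ≤ C) (hzC : ∀ z ∈ openSector k, ‖z • G z‖ ≤ C')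
    (hg : StronglyMeasurable g)
    (hgi : Integrable g) (hg0 : ∀ t ≤ 0, g t = 0) {h : ℝ} (hh : 0 < h)
    (hfin : ∫⁻ t in Ioc 0 T, meanOsc T g h t < ⊤) {t : ℝ} (ht : t ∈ Icc 0 T) :
    ∫ s in (0 : ℝ)..t, ∫ x, contourMultiplier α (fun z => z • G z) x (duhamel (contour α x) g s) =
      ∫ x, contourMultiplier α G x (duhamel (contour α x) g t) := by
  have hcm := contour_mem hα hk hk1
  have hid : DifferentiableOn ℂ (fun z : ℂ => z) (openSector k) := differentiableOn_id
  have hzG : DifferentiableOn ℂ (fun z => z • G z) (openSector k) := hid.smul hG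
  obtain ⟨C₁, hm₁⟩ := isContourMultiplier_contourMultiplier hα hk hk1 hzG hzC
  obtain ⟨C₂, hm₂⟩ := isContourMultiplier_contourMultiplier hα hk hk1 hG hC
  set δ := √((1 + Real.cos α) / 2) with hδ
  have hδ0 : 0 < δ := Real.sqrt_pos.2 (by linarith [one_add_cos_pos hα])
  have hC'0 : 0 ≤ C' := (norm_nonneg _).trans (hzC _ (hcm 0))
  have hGle : ∀ z ∈ openSector k, ‖z⁻¹ • G z‖ ≤ C' / ‖z‖ ^ 2 := by
    intro z hz
    have hz0 := norm_pos_iff.2 (ne_zero_of_mem_openSector hz)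
    have h1 := hzC z hz
    rw [norm_smul] at h1 ⊢
    rw [norm_inv, le_div_iff₀ (by positivity)]
    calc ‖z‖⁻¹ * ‖G z‖ * ‖z‖ ^ 2 = ‖z‖ * ‖G z‖ := by field_simp
      _ ≤ C' := h1
  have hG1 : DifferentiableOn ℂ (fun z => z⁻¹ • G z) (openSector k) :=
    (differentiableOn_inv.mono fun z hz => ne_zero_of_mem_openSector hz).smul hG
  -- Boundedness of `z G z` means quadratic decay of `G z / z`. Its contour integral is therefore
  -- zero, and the term `∫ g` from `z ∫ y_z = y_z - ∫ g` drops out.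
  have hz : ∫ x, contourMultiplier α G x = 0 := by
    unfold contourMultiplier
    rw [integral_smul, integral_contour_eq_zero hα hk hk1 hG1 fun z hz _ => hGle z hz, smul_zero]
  have hmi : Integrable (contourMultiplier α G) := by
    refine (integrable_one_add_abs_sq_inv.const_mul (C' / δ ^ 2)).mono'
      hm₂.stronglyMeasurable.aestronglyMeasurable (Filter.Eventually.of_forall fun x => ?_)
    unfold contourMultiplier
    rw [norm_smul, norm_smul, norm_contourDeriv, one_mul]
    refine (mul_le_of_le_one_left (norm_nonneg _) norm_two_pi_I_inv_le).trans
      ((hGle _ (hcm x)).trans ?_)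
    have := norm_contour_ge α x
    rw [← hδ] at this
    rw [← div_eq_mul_inv, div_div, ← mul_pow]
    gcongr
  rw [integral_integral_apply_duhamel hα hT hm₁ hg hgi hg0 hh hfin ht]
  have e : ∀ x, contourMultiplier α (fun z => z • G z) x
      (∫ s in (0 : ℝ)..t, duhamel (contour α x) g s) =
      contourMultiplier α G x (duhamel (contour α x) g t) -
        contourMultiplier α G x (∫ s in (0 : ℝ)..t, g s) := by
    intro x
    rw [contourMultiplier_smul hcm, smul_apply, ← map_smul,
      smul_integral_duhamel hgi ht.1, map_sub]
  simp only [e]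
  rw [integral_sub (integrable_apply_duhamel hα hT hm₂ hg hgi hg0 hh hfin ht).1
    (hmi.apply_continuousLinearMap _), ← ContinuousLinearMap.integral_apply hmi, hz]
  simp

/-- The representation formula of `g` by a contour integral. -/
theorem integral_contour_duhamelDeriv (hα : α ∈ Ioo (Real.pi / 2) Real.pi) (hT : 0 < T)
    (hg : StronglyMeasurable g) (hgi : Integrable g) (hg0 : ∀ t ≤ 0, g t = 0)
    {h t : ℝ} (hh : 0 < h) (ht : t ≤ T) (hfin : meanOsc T g h t < ⊤) :
    ∫ x, contourDeriv α x • (contour α x)⁻¹ • duhamelDeriv (contour α x) g t =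
      (2 * Real.pi * I : ℂ) • g t := by
  set δ := √((1 + Real.cos α) / 2) with hδ
  have hδ0 : 0 < δ := Real.sqrt_pos.2 (by linarith [one_add_cos_pos hα])
  have hcos := cos_neg_of_mem hα
  have hz : ∀ x, δ ≤ ‖contour α x‖ := fun x =>
    le_trans (by nlinarith [abs_nonneg x]) (norm_contour_ge α x)
  have hz0 : ∀ x, contour α x ≠ 0 := fun x => norm_pos_iff.1 (hδ0.trans_le (hz x))
  set D : ℝ → X := fun s => g (t - s) - g t with hD
  have hDm : StronglyMeasurable D := (hg.comp_measurable (by fun_prop)).sub stronglyMeasurable_const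
  -- By the difference formula, the first term carries the scalar integral `2πi`. After Fubini the
  -- second contains the contour integral of `e^{zs}`, which vanishes for each `s > 0`.
  have e : ∀ x, contourDeriv α x • (contour α x)⁻¹ • duhamelDeriv (contour α x) g t =
      (contourDeriv α x • (exp (contour α x * T) / contour α x)) • g t +
        ∫ s in Ioc 0 T, (contourDeriv α x • exp (contour α x * s)) • D s := by
    intro x
    rw [duhamelDeriv_eq hgi hg0 ht, intervalIntegral.integral_of_le hT.le, smul_add, smul_add,
      inv_smul_smul₀ (hz0 x)]
    congr 1
    · rw [smul_smul, smul_smul, smul_eq_mul]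
      congr 1
      rw [div_eq_mul_inv]
      ring
    · rw [← integral_smul]
      simp only [smul_assoc, hD]
  have hint1 : Integrable fun x => contourDeriv α x • (exp (contour α x * T) / contour α x) := by
    have h1 := (integrable_exp_contour hα hT).norm
    refine (h1.const_mul δ⁻¹).mono' ?_ (Filter.Eventually.of_forall fun x => ?_)
    · refine (measurable_contourDeriv α).aestronglyMeasurable.smul ?_
      have := continuous_contour α
      exact ((by fun_prop : Continuous fun x => exp (contour α x * T)).div this
        hz0).aestronglyMeasurable
    · rw [norm_smul, norm_smul, norm_div, norm_contourDeriv, one_mul, one_mul, div_eq_inv_mul]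
      gcongr
      exact hz x
  -- On `(0, T)` the kernel `min(1, h/s)` is bounded below by `min(1, h/T)`, so finite mean
  -- oscillation is a Dini condition at `t`.
  have hfin2 : ∫⁻ s in Ioc 0 T, ENNReal.ofReal s⁻¹ * ‖D s‖ₑ < ⊤ := by
    have h1 : ∫⁻ s in Ioo 0 T, ENNReal.ofReal (min 1 (h / s)) * ‖D s‖ₑ ∂mulHaar < ⊤ :=
      lt_of_le_of_lt le_add_self hfin
    have hFm : Measurable fun s => ENNReal.ofReal (min 1 (h / s)) * ‖D s‖ₑ :=
      (by fun_prop : Measurable fun s : ℝ => ENNReal.ofReal (min 1 (h / s))).mul hDm.enorm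
    rw [setLIntegral_mulHaar hFm] at h1
    rw [setLIntegral_congr (Ioo_ae_eq_Ioc (a := (0 : ℝ)) (b := T)).symm]
    set c := min 1 (h / T) with hc
    have hc0 : 0 < c := lt_min one_pos (by positivity)
    refine lt_of_le_of_lt ?_ (ENNReal.mul_lt_top (ENNReal.ofReal_lt_top (r := c⁻¹)) h1)
    rw [← lintegral_const_mul' _ _ ENNReal.ofReal_ne_top]
    refine setLIntegral_mono' measurableSet_Ioo fun s hs => ?_
    have hs0 := hs.1
    calc ENNReal.ofReal s⁻¹ * ‖D s‖ₑ = ENNReal.ofReal c⁻¹ * (ENNReal.ofReal s⁻¹ *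
          (ENNReal.ofReal c * ‖D s‖ₑ)) := by
          rw [mul_left_comm, ← mul_assoc (ENNReal.ofReal c⁻¹), ← ENNReal.ofReal_mul (by positivity),
            inv_mul_cancel₀ hc0.ne', ENNReal.ofReal_one, one_mul]
      _ ≤ _ := by
          gcongr
          exact min_le_min le_rfl (by have := hs.2.le; gcongr)
  have hprod : Integrable (fun p : ℝ × ℝ => (contourDeriv α p.1 • exp (contour α p.1 * p.2)) • D p.2)
      (volume.prod (volume.restrict (Ioc 0 T))) := by
    have hsm : StronglyMeasurable fun p : ℝ × ℝ =>
        (contourDeriv α p.1 • exp (contour α p.1 * p.2)) • D p.2 := by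
      refine StronglyMeasurable.smul (StronglyMeasurable.smul
        ((measurable_contourDeriv α).stronglyMeasurable.comp_measurable measurable_fst) ?_)
        (hDm.comp_measurable measurable_snd)
      have := continuous_contour α
      exact (by fun_prop : Continuous fun p : ℝ × ℝ =>
        exp (contour α p.1 * p.2)).stronglyMeasurable
    refine ⟨hsm.aestronglyMeasurable, ?_⟩
    rw [HasFiniteIntegral, lintegral_prod_symm _ hsm.enorm.aemeasurable]
    set κ := ∫ x : ℝ, Real.exp (-|x|) with hκ
    have hκ0 : 0 ≤ κ := integral_nonneg fun x => (Real.exp_pos _).le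
    refine lt_of_le_of_lt (b := ENNReal.ofReal (Real.exp T * (κ / -Real.cos α)) *
      ∫⁻ s in Ioc 0 T, ENNReal.ofReal s⁻¹ * ‖D s‖ₑ) ?_ (ENNReal.mul_lt_top ENNReal.ofReal_lt_top hfin2)
    rw [← lintegral_const_mul' _ _ ENNReal.ofReal_ne_top]
    refine setLIntegral_mono' measurableSet_Ioc fun s hs => ?_
    have hs0 := hs.1
    have ha : 0 < -Real.cos α * s := mul_pos (by linarith) hs0
    have e1 : ∀ x, ‖(contourDeriv α x • exp (contour α x * s)) • D s‖ₑ =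
        ENNReal.ofReal (Real.exp s) *
          ENNReal.ofReal (Real.exp (-(-Real.cos α * s * |x|))) * ‖D s‖ₑ := by
      intro x
      rw [enorm_smul, enorm_smul, ← ofReal_norm (contourDeriv α x), norm_contourDeriv,
        ENNReal.ofReal_one, one_mul, ← ofReal_norm (exp _), norm_exp_contour_mul,
        ENNReal.ofReal_mul (Real.exp_pos _).le]
    simp only [e1]
    have hc0 : 0 < -Real.cos α := by linarith
    rw [lintegral_mul_const _ (by fun_prop), lintegral_const_mul _ (by fun_prop),
      lintegral_exp_neg_mul_abs ha, ← hκ, ← mul_assoc, ← ENNReal.ofReal_mul (by positivity),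
      ← ENNReal.ofReal_mul (by positivity)]
    refine mul_le_mul_left (ENNReal.ofReal_le_ofReal ?_) _
    calc Real.exp s * ((-Real.cos α * s)⁻¹ * κ) = Real.exp s * (κ / -Real.cos α) * s⁻¹ := by
          rw [mul_inv]; ring
      _ ≤ _ := by
        have := hs.2
        gcongr
  simp only [e]
  rw [integral_add (hint1.smul_const _) hprod.integral_prod_left, integral_smul_const,
    integral_exp_div_contour hα hT, integral_integral_swap hprod]
  have hz2 : ∀ s ∈ Ioc 0 T, ∫ x, (contourDeriv α x • exp (contour α x * s)) • D s = 0 := by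
    intro s hs
    rw [integral_smul_const, integral_exp_contour hα hs.1, zero_smul]
  rw [setIntegral_eq_zero_of_forall_eq_zero hz2, add_zero]

end

end

/-! ### Solutions from the three multipliers. -/

section

open Complex (I exp)

section

variable {X : Type*} [NormedAddCommGroup X] [NormedSpace ℂ X] [CompleteSpace X]

theorem contourMultiplier_prod_mem {G : Submodule ℂ (X × X)} {α : ℝ} {F K : ℂ → X →L[ℂ] X} {x : ℝ}
    {y : X} (h : (F (contour α x) y, K (contour α x) y) ∈ G) :
    (contourMultiplier α F x y, contourMultiplier α K x y) ∈ G :=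
  G.smul_mem (2 * Real.pi * I : ℂ)⁻¹
    (G.smul_mem (contourDeriv α x) (G.smul_mem (contour α x)⁻¹ h))

theorem contourMultiplier_add_add {α : ℝ} {F K L : ℂ → X →L[ℂ] X} {x : ℝ}
    (h : F (contour α x) + K (contour α x) + L (contour α x) = 1) (y : X) :
    contourMultiplier α F x y + contourMultiplier α K x y + contourMultiplier α L x y =
      (2 * Real.pi * I : ℂ)⁻¹ • contourDeriv α x • (contour α x)⁻¹ • y := by
  have h1 : F (contour α x) y + K (contour α x) y + L (contour α x) y = y := by
    have := congrArg (fun f : X →L[ℂ] X => f y) h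
    simpa using this
  unfold contourMultiplier
  simp only [_root_.smul_apply, ← smul_add]
  rw [h1]

variable {A B : X →ₗ.[ℂ] X} {k C : ℝ} {H S : ℂ → X →L[ℂ] X}

theorem IsPencilResolvent.norm_smul_resolvent_le (h : IsPencilResolvent A B k C H S) {z : ℂ}
    (hz : z ∈ openSector k) : ‖z • H z‖ ≤ C := by
  have h1 := h.norm_le z hz
  have h2 := h.norm_sq_smul_le z hz
  rw [norm_smul, norm_pow] at h2
  rw [norm_smul]
  rcases le_total ‖z‖ 1 with h3 | h3
  · exact (mul_le_of_le_one_left (norm_nonneg _) h3).trans h1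
  · refine le_trans (mul_le_mul_of_nonneg_right ?_ (norm_nonneg _)) h2
    nlinarith

/-- The operators giving `ü`, `B u̇` and `A u` from the right-hand side. -/
theorem IsPencilResolvent.exists_multipliers (h : IsPencilResolvent A B k C H S)
    (hA : A.IsClosed) (hB : B.IsClosed) {α : ℝ} (hα : α ∈ Ioo (Real.pi / 2) Real.pi)
    (hk : -Real.cos α < k) (hk1 : k < 1) {T : ℝ} (hT : 0 < T) :
    ∃ (m₀ m₁ m₂ : ℝ → X →L[ℂ] X) (C₀ C₁ C₂ : ℝ), IsContourMultiplier m₀ C₀ ∧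
      IsContourMultiplier m₁ C₁ ∧ IsContourMultiplier m₂ C₂ ∧
      ∀ g : ℝ → X, StronglyMeasurable g → Integrable g → (∀ t ≤ 0, g t = 0) → ∀ η > 0,
        ∫⁻ t in Ioc 0 T, meanOsc T g η t < ⊤ →
        (∀ t ∈ Icc 0 T, (∫ s in (0 : ℝ)..t, ∫ r in (0 : ℝ)..s, contourOp α m₂ g r,
          ∫ s in (0 : ℝ)..t, contourOp α m₁ g s) ∈ B.graph) ∧
        (∀ t ∈ Icc 0 T, (∫ s in (0 : ℝ)..t, ∫ r in (0 : ℝ)..s, ∫ τ in (0 : ℝ)..r,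
          contourOp α m₂ g τ, ∫ s in (0 : ℝ)..t, contourOp α m₀ g s) ∈ A.graph) ∧
        ∀ t ≤ T, meanOsc T g η t < ⊤ →
          contourOp α m₂ g t + contourOp α m₁ g t + contourOp α m₀ g t = g t := by
  have hcm := contour_mem hα hk hk1
  have hid : DifferentiableOn ℂ (fun z : ℂ => z) (openSector k) := differentiableOn_id
  set G₂ : ℂ → X →L[ℂ] X := fun z => z • z • H z with hG₂
  set G₁ : ℂ → X →L[ℂ] X := fun z => z • S z with hG₁
  -- The three symbols represent `z²H`, `zBH` and `AH`; defining the last one as a difference makes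
  -- holomorphy and the sum rule immediate.
  set G₀ : ℂ → X →L[ℂ] X := fun z => 1 - G₂ z - G₁ z with hG₀
  have hdH : DifferentiableOn ℂ (fun z => z • H z) (openSector k) := hid.smul h.differentiableOn
  have hd₂ : DifferentiableOn ℂ G₂ (openSector k) := hid.smul hdH
  have hd₁ : DifferentiableOn ℂ G₁ (openSector k) := hid.smul h.differentiableOn_comp
  have hd₀ : DifferentiableOn ℂ G₀ (openSector k) := ((differentiableOn_const _).sub hd₂).sub hd₁
  have hb₂ : ∀ z ∈ openSector k, ‖G₂ z‖ ≤ C := fun z hz => by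
    have := h.norm_sq_smul_le z hz
    rwa [pow_two, ← smul_smul] at this
  have hb₀ : ∀ z ∈ openSector k, ‖G₀ z‖ ≤ ‖(1 : X →L[ℂ] X)‖ + C + C := fun z hz =>
    (norm_sub_le _ _).trans (add_le_add ((norm_sub_le _ _).trans (add_le_add le_rfl (hb₂ z hz)))
      (h.norm_smul_le z hz))
  have hbH : ∀ z ∈ openSector k, ‖z • H z‖ ≤ C := fun z hz => h.norm_smul_resolvent_le hz
  obtain ⟨C₀, hm₀⟩ := isContourMultiplier_contourMultiplier hα hk hk1 hd₀ hb₀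
  obtain ⟨C₁, hm₁⟩ := isContourMultiplier_contourMultiplier hα hk hk1 hd₁ h.norm_smul_le
  obtain ⟨C₂, hm₂⟩ := isContourMultiplier_contourMultiplier hα hk hk1 hd₂ hb₂
  -- The auxiliary symbols `zH` and `H` are what is left of `z²H` after one and two further time
  -- integrations.
  obtain ⟨C₃, hm₃⟩ := isContourMultiplier_contourMultiplier hα hk hk1 hdH hbH
  obtain ⟨C₄, hm₄⟩ := isContourMultiplier_contourMultiplier hα hk hk1 h.differentiableOn h.norm_le
  refine ⟨contourMultiplier α G₀, contourMultiplier α G₁, contourMultiplier α G₂, C₀, C₁, C₂,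
    hm₀, hm₁, hm₂, fun g hg hgi hg0 η hη hfin => ?_⟩
  have hint : ∀ {m : ℝ → X →L[ℂ] X} {C₀ : ℝ}, IsContourMultiplier m C₀ → ∀ t ∈ Icc 0 T,
      Integrable (fun x => m x (duhamel (contour α x) g t)) := fun hm t ht =>
    (integrable_apply_duhamel hα hT hm hg hgi hg0 hη hfin ht).1
  have hval : ∀ {m : ℝ → X →L[ℂ] X} {C₀ : ℝ}, IsContourMultiplier m C₀ → ∀ t ∈ Icc 0 T,
      ∫ s in (0 : ℝ)..t, contourOp α m g s = ∫ x, m x (duhamel (contour α x) g t) := fun hm t ht =>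
    (integrable_apply_duhamel hα hT hm hg hgi hg0 hη hfin ht).2
  have hI2 : ∀ t ∈ Icc 0 T, ∫ s in (0 : ℝ)..t, ∫ r in (0 : ℝ)..s,
      contourOp α (contourMultiplier α G₂) g r =
      ∫ x, contourMultiplier α (fun z => z • H z) x (duhamel (contour α x) g t) := by
    intro t ht
    rw [← integral_contourMultiplier_smul hα hk hk1 hT hdH hbH hb₂ hg hgi hg0 hη hfin ht]
    refine intervalIntegral.integral_congr fun s hs => ?_
    rw [uIcc_of_le ht.1] at hs
    exact hval hm₂ s ⟨hs.1, hs.2.trans ht.2⟩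
  have hI3 : ∀ t ∈ Icc 0 T, ∫ s in (0 : ℝ)..t, ∫ r in (0 : ℝ)..s, ∫ τ in (0 : ℝ)..r,
      contourOp α (contourMultiplier α G₂) g τ =
      ∫ x, contourMultiplier α H x (duhamel (contour α x) g t) := by
    intro t ht
    rw [← integral_contourMultiplier_smul hα hk hk1 hT h.differentiableOn h.norm_le hbH hg hgi hg0
      hη hfin ht]
    refine intervalIntegral.integral_congr fun s hs => ?_
    rw [uIcc_of_le ht.1] at hs
    exact hI2 s ⟨hs.1, hs.2.trans ht.2⟩
  -- In integrated form both components of each pair are absolutely convergent contour integrals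
  -- applied to the same function `y_z`, so the graph relations of `H` and `S` hold under the
  -- integral sign and pass through it by closedness.
  refine ⟨fun t ht => ?_, fun t ht => ?_, fun t ht hO => ?_⟩
  · rw [hI2 t ht, hval hm₁ t ht]
    refine integral_prod_mem_of_ae_mem hB (hint hm₃ t ht) (hint hm₁ t ht)
      (Filter.Eventually.of_forall fun x => ?_)
    exact contourMultiplier_prod_mem (B.graph.smul_mem (contour α x) (h.graph_B _ (hcm x) _))
  · rw [hI3 t ht, hval hm₀ t ht]
    refine integral_prod_mem_of_ae_mem hA (hint hm₄ t ht) (hint hm₀ t ht)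
      (Filter.Eventually.of_forall fun x => ?_)
    refine contourMultiplier_prod_mem ?_
    have := h.graph_A _ (hcm x) (duhamel (contour α x) g t)
    rwa [pow_two, ← smul_smul] at this
  · have hint' : ∀ {m : ℝ → X →L[ℂ] X} {C₀ : ℝ}, IsContourMultiplier m C₀ →
        Integrable (fun x => m x (duhamelDeriv (contour α x) g t)) := by
      intro m C₀ hm
      obtain ⟨C', hC't, hC'⟩ := exists_lintegral_contourOp_le hα hT hm hg hgi hg0 hη
      exact ⟨(hm.stronglyMeasurable.clm_apply_of
        (continuous_duhamelDeriv_contour hgi t).stronglyMeasurable).aestronglyMeasurable,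
        (hC' t ht).trans_lt (ENNReal.mul_lt_top hC't.lt_top hO)⟩
    unfold contourOp
    rw [← integral_add (hint' hm₂) (hint' hm₁),
      ← integral_add (f := fun x => _ + _) ((hint' hm₂).add (hint' hm₁)) (hint' hm₀)]
    have e : ∀ x, contourMultiplier α G₂ x (duhamelDeriv (contour α x) g t) +
        contourMultiplier α G₁ x (duhamelDeriv (contour α x) g t) +
        contourMultiplier α G₀ x (duhamelDeriv (contour α x) g t) =
        (2 * Real.pi * I : ℂ)⁻¹ • contourDeriv α x • (contour α x)⁻¹ •
          duhamelDeriv (contour α x) g t := fun x =>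
      contourMultiplier_add_add (by simp only [hG₀]; abel) _
    simp only [e]
    rw [integral_smul, integral_contour_duhamelDeriv hα hT hg hgi hg0 hη ht hO,
      inv_smul_smul₀ Complex.two_pi_I_ne_zero]

end

section

variable {X : Type*} [NormedAddCommGroup X] [NormedSpace ℂ X] [CompleteSpace X]
  {A B : X →ₗ.[ℂ] X} {T : ℝ} {V₀ V₁ V₂ f : ℝ → X}

/-- A strong solution from its second derivative. -/
theorem isStrongSolution_of_graph (hA : A.IsClosed) (hB : B.IsClosed) (hT : 0 < T) {p : ENNReal}
    (hp : 1 ≤ p) (h₀ : MemLp V₀ p (volume.restrict (Ioo 0 T)))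
    (h₁ : MemLp V₁ p (volume.restrict (Ioo 0 T))) (h₂ : MemLp V₂ p (volume.restrict (Ioo 0 T)))
    (hgB : ∀ t ∈ Icc 0 T, (∫ s in (0 : ℝ)..t, ∫ r in (0 : ℝ)..s, V₂ r,
          ∫ s in (0 : ℝ)..t, V₁ s) ∈ B.graph)
    (hgA : ∀ t ∈ Icc 0 T, (∫ s in (0 : ℝ)..t, ∫ r in (0 : ℝ)..s, ∫ τ in (0 : ℝ)..r, V₂ τ,
          ∫ s in (0 : ℝ)..t, V₀ s) ∈ A.graph)
    (heq : ∀ᵐ t ∂(volume.restrict (Ioo 0 T)), V₂ t + V₁ t + V₀ t = f t) :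
    IsStrongSolution A B T p f (fun t => ∫ s in (0 : ℝ)..t, ∫ r in (0 : ℝ)..s, V₂ r)
      (fun t => ∫ s in (0 : ℝ)..t, V₂ s) V₂ V₁ V₀ := by
  have hii : ∀ {V : ℝ → X}, MemLp V p (volume.restrict (Ioo 0 T)) →
      IntegrableOn V (Ioc 0 T) := fun hV => by
    rw [integrableOn_Ioc_iff_integrableOn_Ioo]
    exact memLp_one_iff_integrable.1 (hV.mono_exponent hp)
  have hae : ∀ {V : ℝ → X}, MemLp V p (volume.restrict (Ioo 0 T)) →
      ∀ᵐ t ∂(volume.restrict (Ioo 0 T)),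
        HasDerivWithinAt (fun x => ∫ s in (0 : ℝ)..x, V s) (V t) (Icc 0 T) t := fun {V} hV => by
    have h1 : IntervalIntegrable V volume 0 T :=
      (intervalIntegrable_iff_integrableOn_Ioc_of_le hT.le).2 (hii hV)
    rw [ae_restrict_iff' measurableSet_Ioo]
    filter_upwards [IntervalIntegrable.ae_hasDerivAt_integral h1] with t h2 ht
    rw [uIcc_of_le hT.le] at h2
    exact (h2 ⟨ht.1.le, ht.2.le⟩ 0 ⟨le_rfl, hT.le⟩).hasDerivWithinAt
  have hc1 : ContinuousOn (fun t => ∫ s in (0 : ℝ)..t, V₂ s) (Icc 0 T) := by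
    have := intervalIntegral.continuousOn_primitive_interval (a := 0) (b := T) (f := V₂)
      (μ := volume) (by rw [uIcc_of_le hT.le, integrableOn_Icc_iff_integrableOn_Ioc]; exact hii h₂)
    rwa [uIcc_of_le hT.le] at this
  have hLp : ∀ {u : ℝ → X}, ContinuousOn u (Icc 0 T) → MemLp u p (volume.restrict (Ioo 0 T)) := by
    intro u hu
    obtain ⟨M, hM⟩ := isCompact_Icc.exists_bound_of_continuousOn hu
    refine MemLp.of_bound ((hu.mono Ioo_subset_Icc_self).aestronglyMeasurable measurableSet_Ioo) M ?_
    exact (ae_restrict_mem measurableSet_Ioo).mono fun t ht => hM t (Ioo_subset_Icc_self ht)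
  have hc2 : ContinuousOn (fun t => ∫ s in (0 : ℝ)..t, ∫ r in (0 : ℝ)..s, V₂ r) (Icc 0 T) := by
    have := intervalIntegral.continuousOn_primitive_interval (a := 0) (b := T)
      (f := fun t => ∫ s in (0 : ℝ)..t, V₂ s) (μ := volume)
      (by rw [uIcc_of_le hT.le]; exact hc1.integrableOn_Icc)
    rwa [uIcc_of_le hT.le] at this
  refine ⟨⟨hLp hc1, fun t ht => by simp⟩, ⟨h₂, fun t ht => by simp⟩, by simp, by simp, h₁, h₀, ?_, ?_,
    heq⟩
  -- Where both primitives are differentiable, hence almost everywhere, the integrated relation can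
  -- be differentiated.
  · filter_upwards [hae h₁, hae (hLp hc1), ae_restrict_mem measurableSet_Ioo] with t ht1 ht2 ht
    exact ht2.prod_mem hB (uniqueDiffOn_Icc hT t (Ioo_subset_Icc_self ht)) ht1 hgB
      (Ioo_subset_Icc_self ht)
  · filter_upwards [hae h₀, hae (hLp hc2), ae_restrict_mem measurableSet_Ioo] with t ht1 ht2 ht
    exact ht2.prod_mem hA (uniqueDiffOn_Icc hT t (Ioo_subset_Icc_self ht)) ht1 hgA
      (Ioo_subset_Icc_self ht)

theorem hasDerivWithinAt_primitive {V : ℝ → X} (hV : ContinuousOn V (Icc 0 T)) {t : ℝ}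
    (ht : t ∈ Icc 0 T) :
    HasDerivWithinAt (fun x => ∫ s in (0 : ℝ)..x, V s) (V t) (Icc 0 T) t := by
  have hi : IntervalIntegrable V volume 0 t :=
    (hV.mono (by rw [uIcc_of_le ht.1]; exact Icc_subset_Icc_right ht.2)).intervalIntegrable
  have : Fact (t ∈ Icc 0 T) := ⟨ht⟩
  exact intervalIntegral.integral_hasDerivWithinAt_right hi
    (hV.stronglyMeasurableAtFilter_nhdsWithin measurableSet_Icc t) (hV t ht)

/-- A classical solution from its second derivative. -/
theorem isClassicalSolution_of_graph (hA : A.IsClosed) (hB : B.IsClosed) (hT : 0 < T)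
    (h₀ : ContinuousOn V₀ (Icc 0 T)) (h₁ : ContinuousOn V₁ (Icc 0 T))
    (h₂ : ContinuousOn V₂ (Icc 0 T))
    (hgB : ∀ t ∈ Icc 0 T, (∫ s in (0 : ℝ)..t, ∫ r in (0 : ℝ)..s, V₂ r,
          ∫ s in (0 : ℝ)..t, V₁ s) ∈ B.graph)
    (hgA : ∀ t ∈ Icc 0 T, (∫ s in (0 : ℝ)..t, ∫ r in (0 : ℝ)..s, ∫ τ in (0 : ℝ)..r, V₂ τ,
          ∫ s in (0 : ℝ)..t, V₀ s) ∈ A.graph)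
    (heq : ∀ t ∈ Icc 0 T, V₂ t + V₁ t + V₀ t = f t) :
    IsClassicalSolution A B T f (fun t => ∫ s in (0 : ℝ)..t, ∫ r in (0 : ℝ)..s, V₂ r)
      (fun t => ∫ s in (0 : ℝ)..t, V₂ s) V₂ V₁ V₀ := by
  have hd1 : ∀ t ∈ Icc 0 T,
      HasDerivWithinAt (fun x => ∫ s in (0 : ℝ)..x, V₂ s) (V₂ t) (Icc 0 T) t :=
    fun t ht => hasDerivWithinAt_primitive h₂ ht
  have hc1 : ContinuousOn (fun t => ∫ s in (0 : ℝ)..t, V₂ s) (Icc 0 T) :=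
    fun t ht => (hd1 t ht).continuousWithinAt
  have hd2 := fun t (ht : t ∈ Icc 0 T) => hasDerivWithinAt_primitive hc1 ht
  have hc2 : ContinuousOn (fun t => ∫ s in (0 : ℝ)..t, ∫ r in (0 : ℝ)..s, V₂ r) (Icc 0 T) :=
    fun t ht => (hd2 t ht).continuousWithinAt
  refine ⟨hd2, hd1, h₂, by simp, by simp, h₁, h₀, fun t ht => ?_, fun t ht => ?_, heq⟩
  · exact (hd2 t ht).prod_mem hB (uniqueDiffOn_Icc hT t ht) (hasDerivWithinAt_primitive h₁ ht)
      hgB ht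
  · exact (hasDerivWithinAt_primitive hc2 ht).prod_mem hA (uniqueDiffOn_Icc hT t ht)
      (hasDerivWithinAt_primitive h₀ ht) hgA ht

end

end

/-! ### Uniqueness by Laplace transform and Liouville's theorem. -/

section

open Complex (I exp)

section

variable {X : Type*} [NormedAddCommGroup X] [NormedSpace ℂ X] [CompleteSpace X]

theorem duhamel_prod_mem {G : Submodule ℂ (X × X)} (hG : IsClosed (G : Set (X × X))) {z : ℂ}
    {a b : ℝ → X} {T : ℝ} (hT : 0 ≤ T) (ha : IntervalIntegrable a volume 0 T)
    (hb : IntervalIntegrable b volume 0 T)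
    (h : ∀ᵐ t ∂(volume.restrict (Ioc 0 T)), (a t, b t) ∈ G) :
    (duhamel z a T, duhamel z b T) ∈ G := by
  have ha' := (intervalIntegrable_exp_smul (z := z) (t := T) ha)
  have hb' := (intervalIntegrable_exp_smul (z := z) (t := T) hb)
  unfold duhamel
  rw [intervalIntegral.integral_of_le hT, intervalIntegral.integral_of_le hT]
  rw [intervalIntegrable_iff_integrableOn_Ioc_of_le hT] at ha' hb'
  refine integral_prod_mem_of_ae_mem hG ha' hb' ?_
  filter_upwards [h] with t ht
  exact G.smul_mem _ ht

theorem norm_duhamel_le_of_re_nonpos {z : ℂ} (hz : z.re ≤ 0) {v : ℝ → X} {T : ℝ} (hT : 0 ≤ T)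
    (hv : IntervalIntegrable v volume 0 T) : ‖duhamel z v T‖ ≤ ∫ s in (0 : ℝ)..T, ‖v s‖ := by
  unfold duhamel
  refine intervalIntegral.norm_integral_le_of_norm_le hT ?_ hv.norm
  refine Filter.Eventually.of_forall fun s hs => ?_
  rw [norm_smul, Complex.norm_exp]
  refine mul_le_of_le_one_left (norm_nonneg _) (Real.exp_le_one_iff.2 ?_)
  rw [← Complex.ofReal_sub, Complex.re_mul_ofReal]
  exact mul_nonpos_of_nonpos_of_nonneg hz (by linarith [hs.2])

theorem tendsto_duhamel_neg {v : ℝ → X} {T : ℝ} (hT : 0 ≤ T)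
    (hv : IntervalIntegrable v volume 0 T) :
    Filter.Tendsto (fun n : ℕ => duhamel (-(n : ℂ)) v T) Filter.atTop (nhds 0) := by
  have h0 : (0 : X) = ∫ s in (0 : ℝ)..T, (0 : X) := by simp
  rw [h0]
  refine intervalIntegral.tendsto_integral_filter_of_dominated_convergence (fun s => ‖v s‖)
    (Filter.Eventually.of_forall fun n => ?_) (Filter.Eventually.of_forall fun n => ?_) hv.norm ?_
  · exact (intervalIntegrable_exp_smul hv).def'.aestronglyMeasurable
  · refine Filter.Eventually.of_forall fun s hs => ?_
    rw [uIoc_of_le hT] at hs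
    rw [norm_smul, Complex.norm_exp]
    refine mul_le_of_le_one_left (norm_nonneg _) (Real.exp_le_one_iff.2 ?_)
    rw [← Complex.ofReal_sub, Complex.re_mul_ofReal]
    refine mul_nonpos_of_nonpos_of_nonneg ?_ (by linarith [hs.2])
    simp
  · have hne : ∀ᵐ s : ℝ, s ≠ T := by simp [ae_iff, measure_singleton]
    filter_upwards [hne] with s hsT hs
    rw [uIoc_of_le hT] at hs
    have hlt : 0 < T - s := sub_pos.2 (lt_of_le_of_ne hs.2 hsT)
    rw [tendsto_zero_iff_norm_tendsto_zero]
    have e : ∀ n : ℕ, ‖exp (-(n : ℂ) * (T - s)) • v s‖ = Real.exp (-((T - s) * n)) * ‖v s‖ := by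
      intro n
      rw [norm_smul, Complex.norm_exp, ← Complex.ofReal_sub, Complex.re_mul_ofReal]
      simp only [Complex.neg_re, Complex.natCast_re]
      congr 2
      ring
    simp only [e]
    have h1 : Filter.Tendsto (fun n : ℕ => (T - s) * (n : ℝ)) Filter.atTop Filter.atTop :=
      tendsto_natCast_atTop_atTop.const_mul_atTop hlt
    have h2 := (Real.tendsto_exp_neg_atTop_nhds_zero.comp h1).mul_const ‖v s‖
    rwa [zero_mul] at h2

/-- A function all of whose exponential moments vanish is zero. -/
theorem eq_zero_of_duhamel_eq_zero {v : ℝ → X} {T : ℝ} (hT : 0 < T) (hv : ContinuousOn v (Icc 0 T))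
    (h : ∀ z, duhamel z v T = 0) : EqOn v 0 (Icc 0 T) := by
  set w := (Ioc 0 T).indicator v with hw
  have hwi : Integrable w :=
    (hv.integrableOn_Icc.mono_set Ioc_subset_Icc_self).integrable_indicator measurableSet_Ioc
  -- The exponential moment at `z = 2πiξ` is, up to a factor of modulus one, the Fourier transform
  -- of the cut-off function at `ξ`.
  have hF : FourierTransform.fourier w = fun _ : ℝ => (0 : X) := by
    funext ξ
    rw [Real.fourier_real_eq_integral_exp_smul]
    have e : (fun x : ℝ => exp (↑(-2 * Real.pi * x * ξ) * I) • w x) = (Ioc 0 T).indicator fun x =>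
        exp (-(2 * Real.pi * ξ * I * T)) • exp (2 * Real.pi * ξ * I * (T - x)) • v x := by
      funext x
      simp only [hw]
      by_cases hx : x ∈ Ioc 0 T
      · rw [indicator_of_mem hx, indicator_of_mem hx, smul_smul, ← Complex.exp_add]
        congr 2
        push_cast
        ring
      · rw [indicator_of_notMem hx, indicator_of_notMem hx, smul_zero]
    rw [e, integral_indicator measurableSet_Ioc, integral_smul,
      ← intervalIntegral.integral_of_le hT.le]
    have := h (2 * Real.pi * ξ * I)
    rw [duhamel] at this
    rw [this, smul_zero]
  have hoo : ∀ t ∈ Ioo 0 T, v t = 0 := by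
    intro t ht
    have hc : ContinuousAt w t := by
      have h1 : ContinuousAt v t := hv.continuousAt (Icc_mem_nhds ht.1 ht.2)
      refine h1.congr ?_
      filter_upwards [Ioo_mem_nhds ht.1 ht.2] with s hs
      rw [hw, indicator_of_mem (Ioo_subset_Ioc_self hs)]
    have h2 := hwi.fourierInv_fourier_eq (by rw [hF]; exact integrable_zero _ _ _) hc
    rw [hF, hw, indicator_of_mem (Ioo_subset_Ioc_self ht)] at h2
    rw [← h2, Real.fourierInv_eq]
    simp
  have hcl : Icc 0 T ⊆ closure (Ioo 0 T) := by rw [closure_Ioo hT.ne]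
  exact Set.EqOn.of_subset_closure (s := Ioo 0 T) (g := 0) (fun t ht => hoo t ht) hv
    continuousOn_const Ioo_subset_Icc_self hcl

variable {A B : X →ₗ.[ℂ] X} {k C : ℝ} {H S : ℂ → X →L[ℂ] X} {T : ℝ}

/-- The Laplace transform of a solution of the homogeneous equation. -/
theorem IsPencilResolvent.duhamel_eq (h : IsPencilResolvent A B k C H S)
    (hA : A.IsClosed) (hB : B.IsClosed) (hT : 0 < T) {u u₁ u₂ b a : ℝ → X}
    (hu : IsStrongSolution A B T 1 0 u u₁ u₂ b a) {z : ℂ} (hz : z ∈ openSector k) :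
    duhamel z u T = -H z (u₁ T + z • u T + ∫ s in (0 : ℝ)..T, b s) := by
  have hz0 := ne_zero_of_mem_openSector hz
  have hTm : T ∈ Icc 0 T := ⟨hT.le, le_rfl⟩
  have hii : ∀ {v : ℝ → X}, MemLp v 1 (volume.restrict (Ioo 0 T)) →
      IntervalIntegrable v volume 0 T := fun hv => by
    rw [intervalIntegrable_iff_integrableOn_Ioc_of_le hT.le, integrableOn_Ioc_iff_integrableOn_Ioo]
    exact memLp_one_iff_integrable.1 hv
  have hae : ∀ {P : ℝ → Prop}, (∀ᵐ t ∂(volume.restrict (Ioo 0 T)), P t) →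
      ∀ᵐ t ∂(volume.restrict (Ioc 0 T)), P t := fun hP => by
    rwa [← Measure.restrict_congr_set (Ioo_ae_eq_Ioc (a := (0 : ℝ)) (b := T))]
  have hcongr : ∀ {v w : ℝ → X}, (∀ t ∈ Icc 0 T, v t = w t) → duhamel z v T = duhamel z w T := by
    intro v w hvw
    refine intervalIntegral.integral_congr fun s hs => ?_
    rw [uIcc_of_le hT.le] at hs
    simp only [hvw s hs]
  have hu1 : ∀ t ∈ Icc 0 T, u t = ∫ s in (0 : ℝ)..t, u₁ s := fun t ht => by
    rw [hu.deriv_fst.2 t ht, hu.init_fst, zero_add]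
  have hu2 : ∀ t ∈ Icc 0 T, u₁ t = ∫ s in (0 : ℝ)..t, u₂ s := fun t ht => by
    rw [hu.deriv_snd.2 t ht, hu.init_snd, zero_add]
  have hi1 := hii hu.deriv_fst.1
  have hi2 := hii hu.deriv_snd.1
  have hib := hii hu.memLp_B
  have hia := hii hu.memLp_A
  have hiu : IntervalIntegrable u volume 0 T := by
    have : ContinuousOn (fun t => ∫ s in (0 : ℝ)..t, u₁ s) (uIcc 0 T) :=
      intervalIntegral.continuousOn_primitive_interval (by
        rw [uIcc_of_le hT.le, integrableOn_Icc_iff_integrableOn_Ioc,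
          ← intervalIntegrable_iff_integrableOn_Ioc_of_le hT.le]; exact hi1)
    refine (this.congr fun t ht => ?_).intervalIntegrable
    rw [uIcc_of_le hT.le] at ht
    exact hu1 t ht
  have e1 : duhamel z u₁ T = u T + z • duhamel z u T := by
    rw [duhamel_eq_integral_add hT.le hi1, ← hu1 T hTm, ← hcongr hu1]
  have e2 : duhamel z u₂ T = u₁ T + z • duhamel z u₁ T := by
    rw [duhamel_eq_integral_add hT.le hi2, ← hu2 T hTm, ← hcongr hu2]
  have hgB := duhamel_prod_mem (z := z) hB hT.le hi1 hib (hae hu.graph_B)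
  have hgA := duhamel_prod_mem (z := z) hA hT.le hiu hia (hae hu.graph_A)
  have hgB0 := duhamel_prod_mem (z := 0) hB hT.le hi1 hib (hae hu.graph_B)
  have ed : ∀ v : ℝ → X, duhamel 0 v T = ∫ s in (0 : ℝ)..T, v s := fun v => by simp [duhamel]
  rw [ed, ed, ← hu1 T hTm] at hgB0
  -- `B` is known on `u̇` only, so its value on the transform of `u` is found from `z duhamel z u =
  -- duhamel z u₁ - u(T)`, where the pair for `u(T)` is the relation at `z = 0`.
  have hgB1 : (duhamel z u T, z⁻¹ • (duhamel z b T - ∫ s in (0 : ℝ)..T, b s)) ∈ B.graph := by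
    have := B.graph.smul_mem z⁻¹ (B.graph.sub_mem hgB hgB0)
    rw [e1] at this
    simpa [inv_smul_smul₀ hz0] using this
  have hsum : duhamel z u₂ T + duhamel z b T + duhamel z a T = 0 := by
    have hj := fun {v : ℝ → X} (hv : IntervalIntegrable v volume 0 T) =>
      intervalIntegrable_exp_smul (z := z) (t := T) hv
    unfold duhamel
    rw [← intervalIntegral.integral_add (hj hi2) (hj hib),
      ← intervalIntegral.integral_add ((hj hi2).add (hj hib)) (hj hia),
      intervalIntegral.integral_of_le hT.le]
    refine integral_eq_zero_of_ae ?_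
    filter_upwards [hae hu.equation] with t ht
    rw [← smul_add, ← smul_add, ht]
    simp
  have h1 := (h.inverse z hz).2 _ _ _ hgB1 hgA
  rw [← h1, ← map_neg]
  congr 1
  rw [smul_inv_smul₀ hz0]
  have h3 : duhamel z a T = -(duhamel z u₂ T + duhamel z b T) :=
    eq_neg_of_add_eq_zero_right hsum
  rw [h3, e2, e1, smul_add, smul_smul, ← pow_two]
  abel

/-- The homogeneous problem has only the trivial solution. -/
theorem IsPencilResolvent.eq_zero_of_isStrongSolution (h : IsPencilResolvent A B k C H S)
    (hk : 0 < k) (hA : A.IsClosed) (hB : B.IsClosed) (hT : 0 < T) {u u₁ u₂ b a : ℝ → X}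
    (hu : IsStrongSolution A B T 1 0 u u₁ u₂ b a) : EqOn u 0 (Icc 0 T) := by
  have hi1 : IntegrableOn u₁ (Icc 0 T) := by
    rw [integrableOn_Icc_iff_integrableOn_Ioo]
    exact memLp_one_iff_integrable.1 hu.deriv_fst.1
  have huc : ContinuousOn u (Icc 0 T) := by
    have : ContinuousOn (fun t => ∫ s in (0 : ℝ)..t, u₁ s) (uIcc 0 T) :=
      intervalIntegral.continuousOn_primitive_interval (by rwa [uIcc_of_le hT.le])
    rw [uIcc_of_le hT.le] at this
    refine this.congr fun t ht => ?_
    rw [hu.deriv_fst.2 t ht, hu.init_fst, zero_add]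
  have hui : IntervalIntegrable u volume 0 T :=
    (huc.mono (by rw [uIcc_of_le hT.le])).intervalIntegrable
  have hC0 := h.const_nonneg hk.le
  set J := ∫ s in (0 : ℝ)..T, b s with hJ
  -- For `Re z ≤ 0` the exponential is at most `1` in modulus. The half-plane `Re z > 0` lies in the
  -- sector, where the formula through `H z` and the bounds on `H z` and `z H z` apply.
  have hbd : Bornology.IsBounded (range fun z => duhamel z u T) := by
    rw [isBounded_iff_forall_norm_le]
    refine ⟨(∫ s in (0 : ℝ)..T, ‖u s‖) + C * (‖u₁ T‖ + ‖u T‖ + ‖J‖), ?_⟩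
    rintro _ ⟨z, rfl⟩
    have hn : 0 ≤ ∫ s in (0 : ℝ)..T, ‖u s‖ :=
      intervalIntegral.integral_nonneg hT.le fun s _ => norm_nonneg _
    have hn' : 0 ≤ C * (‖u₁ T‖ + ‖u T‖ + ‖J‖) := by positivity
    rcases le_or_gt z.re 0 with hz | hz
    · exact (norm_duhamel_le_of_re_nonpos hz hT.le hui).trans (by linarith)
    · have hzm : z ∈ openSector k := by
        simp only [openSector, mem_ofPred_eq]
        positivity
      simp only
      rw [h.duhamel_eq hA hB hT hu hzm, norm_neg, ← hJ]
      refine le_trans ?_ (le_add_of_nonneg_left hn)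
      have e : H z (u₁ T + z • u T + J) = H z (u₁ T) + (z • H z) (u T) + H z J := by
        simp [map_add]
      rw [e, mul_add, mul_add]
      refine (norm_add₃_le).trans (add_le_add (add_le_add ?_ ?_) ?_)
      · exact (ContinuousLinearMap.le_opNorm _ _).trans
          (mul_le_mul_of_nonneg_right (h.norm_le z hzm) (norm_nonneg _))
      · exact (ContinuousLinearMap.le_opNorm _ _).trans
          (mul_le_mul_of_nonneg_right (h.norm_smul_resolvent_le hzm) (norm_nonneg _))
      · exact (ContinuousLinearMap.le_opNorm _ _).trans
          (mul_le_mul_of_nonneg_right (h.norm_le z hzm) (norm_nonneg _))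
  -- Liouville's theorem; the constant is then the limit along `z = -n`, which is zero.
  have hconst := fun z => (differentiable_duhamel hui).apply_eq_apply_of_bounded hbd z 0
  refine eq_zero_of_duhamel_eq_zero hT huc fun z => ?_
  rw [hconst z]
  refine tendsto_nhds_unique ?_ (tendsto_duhamel_neg hT.le hui)
  exact tendsto_const_nhds.congr fun n => (hconst _).symm

/-- On a bounded interval every `Lᵖ` solution is an `L¹` solution, so one uniqueness proof at
exponent `1` serves all cases. -/
theorem IsStrongSolution.sub {p : ENNReal} (hp : 1 ≤ p) (hT : 0 ≤ T)
    {f u u₁ u₂ b a v v₁ v₂ b' a' : ℝ → X}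
    (hu : IsStrongSolution A B T p f u u₁ u₂ b a) (hv : IsStrongSolution A B T p f v v₁ v₂ b' a') :
    IsStrongSolution A B T 1 0 (u - v) (u₁ - v₁) (u₂ - v₂) (b - b') (a - a') := by
  have hs : ∀ {w w₁ y y₁ : ℝ → X}, IsSobolevDeriv T p w w₁ → IsSobolevDeriv T p y y₁ →
      IsSobolevDeriv T 1 (w - y) (w₁ - y₁) := by
    intro w w₁ y y₁ hw hy
    refine ⟨(hw.1.sub hy.1).mono_exponent hp, fun t ht => ?_⟩
    have hii : ∀ {v : ℝ → X}, MemLp v p (volume.restrict (Ioo 0 T)) →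
        IntervalIntegrable v volume 0 t := fun {v} hv => by
      have h1 : IntervalIntegrable v volume 0 T := by
        rw [intervalIntegrable_iff_integrableOn_Ioc_of_le hT,
          integrableOn_Ioc_iff_integrableOn_Ioo]
        exact memLp_one_iff_integrable.1 (hv.mono_exponent hp)
      exact h1.mono_set (by
        rw [uIcc_of_le ht.1, uIcc_of_le hT]; exact Icc_subset_Icc_right ht.2)
    simp only [Pi.sub_apply]
    rw [intervalIntegral.integral_sub (hii hw.1) (hii hy.1), hw.2 t ht, hy.2 t ht]
    abel
  refine ⟨hs hu.deriv_fst hv.deriv_fst, hs hu.deriv_snd hv.deriv_snd, ?_, ?_,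
    (hu.memLp_B.sub hv.memLp_B).mono_exponent hp, (hu.memLp_A.sub hv.memLp_A).mono_exponent hp,
    ?_, ?_, ?_⟩
  · simp [hu.init_fst, hv.init_fst]
  · simp [hu.init_snd, hv.init_snd]
  · filter_upwards [hu.graph_B, hv.graph_B] with t h1 h2
    exact B.graph.sub_mem h1 h2
  · filter_upwards [hu.graph_A, hv.graph_A] with t h1 h2
    exact A.graph.sub_mem h1 h2
  · filter_upwards [hu.equation, hv.equation] with t h1 h2
    simp only [Pi.sub_apply, Pi.zero_apply]
    rw [← sub_eq_zero.2 (h1.trans h2.symm)]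
    abel

theorem IsClassicalSolution.isStrongSolution {f u u₁ u₂ b a : ℝ → X}
    (hu : IsClassicalSolution A B T f u u₁ u₂ b a) : IsStrongSolution A B T 1 f u u₁ u₂ b a := by
  have hLp : ∀ {u : ℝ → X}, ContinuousOn u (Icc 0 T) → MemLp u 1 (volume.restrict (Ioo 0 T)) :=
    fun hu => memLp_one_iff_integrable.2 (hu.integrableOn_Icc.mono_set Ioo_subset_Icc_self)
  have hs : ∀ {w w' : ℝ → X}, (∀ t ∈ Icc 0 T, HasDerivWithinAt w (w' t) (Icc 0 T) t) →
      ContinuousOn w' (Icc 0 T) → IsSobolevDeriv T 1 w w' := by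
    intro w w' hd hc
    refine ⟨hLp hc, fun t ht => ?_⟩
    have hsub : Icc 0 t ⊆ Icc 0 T := Icc_subset_Icc_right ht.2
    rw [intervalIntegral.integral_eq_sub_of_hasDerivAt_of_le ht.1
      (fun s hs => ((hd s (hsub hs)).continuousWithinAt).mono hsub)
      (fun s hs => (hd s (hsub (Ioo_subset_Icc_self hs))).hasDerivAt
        (Icc_mem_nhds hs.1 (hs.2.trans_le ht.2)))
      ((hc.mono (by rw [uIcc_of_le ht.1]; exact hsub)).intervalIntegrable)]
    abel
  have hae : ∀ {P : ℝ → Prop}, (∀ t ∈ Icc 0 T, P t) → ∀ᵐ t ∂(volume.restrict (Ioo 0 T)), P t :=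
    fun hP => (ae_restrict_mem measurableSet_Ioo).mono fun t ht => hP t (Ioo_subset_Icc_self ht)
  have hc1 : ContinuousOn u₁ (Icc 0 T) := fun t ht => (hu.deriv_snd t ht).continuousWithinAt
  exact ⟨hs hu.deriv_fst hc1, hs hu.deriv_snd hu.cont_snd, hu.init_fst, hu.init_snd, hLp hu.cont_B,
    hLp hu.cont_A, hae hu.graph_B, hae hu.graph_A, hae hu.equation⟩

end

end

/-! ### Assembling the Besov and Hölder cases. -/

section

variable {X : Type*} [NormedAddCommGroup X]

/-- A strongly measurable representative vanishing outside `(0, T)`. -/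
theorem MemBesov.exists_stronglyMeasurable {T θ : ℝ} {p q : ENNReal} (hp : 1 ≤ p) {f : ℝ → X}
    (hf : MemBesov 0 T θ p q f) :
    ∃ g : ℝ → X, StronglyMeasurable g ∧ (∀ t ≤ 0, g t = 0) ∧ MemLp g p volume ∧ Integrable g ∧
      g =ᵐ[volume.restrict (Ioo 0 T)] f ∧
      (Ioo 0 T).indicator f =ᵐ[volume.restrict (Ioo (-T) T)] g := by
  set w := hf.1.1.mk f with hw
  have hwm : StronglyMeasurable w := hf.1.1.stronglyMeasurable_mk
  have hfw : f =ᵐ[volume.restrict (Ioo 0 T)] w := hf.1.1.ae_eq_mk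
  have hLp : MemLp w p (volume.restrict (Ioo 0 T)) := hf.1.ae_eq hfw
  refine ⟨(Ioo 0 T).indicator w, hwm.indicator measurableSet_Ioo,
    fun t ht => indicator_of_notMem (fun hc => absurd hc.1 (not_lt.2 ht)) _,
    (memLp_indicator_iff_restrict measurableSet_Ioo).2 hLp, ?_, ?_, ?_⟩
  · exact IntegrableOn.integrable_indicator (memLp_one_iff_integrable.1 (hLp.mono_exponent hp))
      measurableSet_Ioo
  · exact (indicator_ae_eq_restrict measurableSet_Ioo).trans hfw.symm
  · exact ae_restrict_of_ae ((ae_eq_restrict_iff_indicator_ae_eq measurableSet_Ioo).1 hfw)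

theorem MemBesovZeroTrace.congr {T θ : ℝ} {p q : ENNReal} {u v : ℝ → X}
    (hu : MemBesovZeroTrace T θ p q u) (huv : u =ᵐ[volume.restrict (Ioo 0 T)] v) :
    MemBesovZeroTrace T θ p q v := by
  obtain ⟨h, w, hw, huw, hw0⟩ := hu
  exact ⟨h.congr huv, w, hw, huv.symm.trans huw, hw0⟩

theorem MemBesovZeroExt.congr {T θ : ℝ} {p q : ENNReal} {u v : ℝ → X}
    (hu : MemBesovZeroExt T θ p q u) (huv : u =ᵐ[volume.restrict (Ioo 0 T)] v) :
    MemBesovZeroExt T θ p q v :=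
  ⟨hu.1.congr huv, hu.2.congr (ae_restrict_of_ae
    ((ae_eq_restrict_iff_indicator_ae_eq measurableSet_Ioo).1 huv))⟩

theorem MemBesov.memBesovZeroExt {T θ : ℝ} (hT : 0 < T) {p q : ENNReal} {V : ℝ → X}
    (hV0 : ∀ t ≤ 0, V t = 0) (hV : MemBesov (-T) T θ p q V) : MemBesovZeroExt T θ p q V := by
  refine ⟨hV.mono_interval (by linarith), hV.congr ?_⟩
  filter_upwards [ae_restrict_mem measurableSet_Ioo] with t ht
  by_cases h0 : 0 < t
  · rw [indicator_of_mem (show t ∈ Ioo 0 T from ⟨h0, ht.2⟩)]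
  · rw [indicator_of_notMem (fun hc => h0 hc.1), hV0 t (not_lt.1 h0)]

variable [NormedSpace ℝ X] [CompleteSpace X]

/-- The primitive of a function on `(0, T)`, extended to vanish for negative times. -/
theorem exists_memBesov_primitive {T θ : ℝ} (hθ : θ ∈ Ioo (0 : ℝ) 1)
    {p q : ENNReal} (hp : 1 ≤ p) (hq : 1 ≤ q) {V : ℝ → X} (hV : StronglyMeasurable V)
    (hVp : MemLp V p (volume.restrict (Ioo 0 T))) :
    ∃ W : ℝ → X, StronglyMeasurable W ∧ (∀ t ≤ 0, W t = 0) ∧ MemBesov (-T) T θ p q W ∧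
      ∀ t ∈ Icc 0 T, W t = ∫ s in (0 : ℝ)..t, V s := by
  set v := (Ioo 0 T).indicator V with hv
  have hvi : Integrable v := IntegrableOn.integrable_indicator
    (memLp_one_iff_integrable.1 (hVp.mono_exponent hp)) measurableSet_Ioo
  refine ⟨fun t => ∫ s in (0 : ℝ)..t, v s,
    (intervalIntegral.continuous_primitive (fun a b => hvi.intervalIntegrable) 0).stronglyMeasurable,
    fun t ht => ?_, memBesov_primitive hθ hp hq (hV.indicator measurableSet_Ioo) hvi
      ((memLp_indicator_iff_restrict measurableSet_Ioo).2 hVp), fun t ht => ?_⟩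
  · refine intervalIntegral.integral_zero_ae (Filter.Eventually.of_forall fun s hs => ?_)
    rw [uIoc_of_ge ht] at hs
    exact indicator_of_notMem (fun hc => absurd hc.1 (not_lt.2 hs.2)) _
  · refine intervalIntegral.integral_congr_ae ?_
    have hne : ∀ᵐ s : ℝ, s ≠ T := by simp [ae_iff, measure_singleton]
    filter_upwards [hne] with s hsT hs
    rw [uIoc_of_le ht.1] at hs
    exact indicator_of_mem
      (show s ∈ Ioo 0 T from ⟨hs.1, lt_of_le_of_ne (hs.2.trans ht.2) hsT⟩) _

end

section

variable {X : Type*} [NormedAddCommGroup X] [NormedSpace ℂ X] [CompleteSpace X]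
  {A B : X →ₗ.[ℂ] X} {k C : ℝ} {H S : ℂ → X →L[ℂ] X} {T θ α : ℝ}

theorem lintegral_meanOsc_lt_top_of_eLpNorm {T η : ℝ} {p : ENNReal} (hp : 1 ≤ p)
    (hT : 0 < T) {g : ℝ → X} (hg : StronglyMeasurable g)
    (h : eLpNorm (meanOsc T g η) p (volume.restrict (Ioo (-T) T)) < ⊤) :
    ∫⁻ t in Ioc 0 T, meanOsc T g η t < ⊤ := by
  have hm := measurable_meanOsc (T := T) hg η
  have h1 : MemLp (meanOsc T g η) p (volume.restrict (Ioo (-T) T)) :=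
    ⟨hm.aestronglyMeasurable, h⟩
  have h2 := (h1.mono_measure (Measure.restrict_mono
    (Ioo_subset_Ioo_left (by linarith : -T ≤ 0)) le_rfl)).mono_exponent hp
  have h3 := h2.2
  rw [eLpNorm_one_eq_lintegral_enorm] at h3
  rw [← setLIntegral_congr (Ioo_ae_eq_Ioc (a := (0 : ℝ)) (b := T))]
  simpa using h3

/-- The three Besov cases differ only in how the data extend by zero and in what is read off from
the result. Both are hypotheses here: `g` is the extension of `f`, and `E` contains every Besov
function on `(-T, T)` vanishing for negative times. -/
theorem IsPencilResolvent.exists_isStrongSolution (h : IsPencilResolvent A B k C H S)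
    (hA : A.IsClosed) (hB : B.IsClosed) (hα : α ∈ Ioo (Real.pi / 2) Real.pi)
    (hk : -Real.cos α < k) (hk1 : k < 1) (hT : 0 < T) (hθ : θ ∈ Ioo (0 : ℝ) 1)
    {p q : ENNReal} (hp : 1 ≤ p) (hpt : p ≠ ⊤) (hq : 1 ≤ q) {E : (ℝ → X) → Prop}
    (hE : ∀ V : ℝ → X, StronglyMeasurable V → (∀ t ≤ 0, V t = 0) → MemBesov (-T) T θ p q V → E V)
    (hE' : ∀ V W : ℝ → X, E V → V =ᵐ[volume.restrict (Ioo 0 T)] W → E W)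
    {f g : ℝ → X} (hg : StronglyMeasurable g) (hgi : Integrable g) (hg0 : ∀ t ≤ 0, g t = 0)
    (hgB : MemBesov (-T) T θ p q g) (hgf : g =ᵐ[volume.restrict (Ioo 0 T)] f) :
    ∃ u u₁ u₂ Bu₁ Au : ℝ → X, IsStrongSolution A B T p f u u₁ u₂ Bu₁ Au ∧
      E u ∧ E u₁ ∧ E u₂ ∧ E Bu₁ ∧ E Au := by
  obtain ⟨m₀, m₁, m₂, C₀, C₁, C₂, hm₀, hm₁, hm₂, hm⟩ :=
    h.exists_multipliers hA hB hα hk hk1 hT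
  obtain ⟨η, hη, hfin⟩ := exists_eLpNorm_meanOsc_lt_top hT hθ hp hpt hq hg hg0 hgB
  have hfin1 := lintegral_meanOsc_lt_top_of_eLpNorm hp hT hg hfin
  obtain ⟨hgrB, hgrA, heq⟩ := hm g hg hgi hg0 η hη.1 hfin1
  have hsm : ∀ {m : ℝ → X →L[ℂ] X} {C : ℝ}, IsContourMultiplier m C →
      StronglyMeasurable (contourOp α m g) := fun hm =>
    stronglyMeasurable_contourOp hm.stronglyMeasurable hg hg0
  have hz : ∀ m : ℝ → X →L[ℂ] X, ∀ t ≤ 0, contourOp α m g t = 0 := fun m t ht =>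
    contourOp_of_nonpos hg0 ht
  have hB' : ∀ {m : ℝ → X →L[ℂ] X} {C : ℝ}, IsContourMultiplier m C →
      MemBesov (-T) T θ p q (contourOp α m g) := fun hm =>
    MemBesov.contourOp hα hT hθ hp hpt hq hm hg hgi hg0 hgB
  have hLp : ∀ {V : ℝ → X}, MemBesov (-T) T θ p q V → MemLp V p (volume.restrict (Ioo 0 T)) :=
    fun hV => (hV.mono_interval (by linarith : -T ≤ 0)).1
  have hEV : ∀ {m : ℝ → X →L[ℂ] X} {C : ℝ}, IsContourMultiplier m C → E (contourOp α m g) :=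
    fun hm => hE _ (hsm hm) (hz _) (hB' hm)
  have hae : ∀ {V W : ℝ → X}, (∀ t ∈ Icc 0 T, V t = W t) → V =ᵐ[volume.restrict (Ioo 0 T)] W :=
    fun hVW => (ae_restrict_mem measurableSet_Ioo).mono fun t ht => hVW t (Ioo_subset_Icc_self ht)
  obtain ⟨W₁, hW₁m, hW₁0, hW₁B, hW₁⟩ := exists_memBesov_primitive (q := q) hθ hp hq (hsm hm₂)
    (hLp (hB' hm₂))
  obtain ⟨W, hWm, hW0, hWB, hW⟩ := exists_memBesov_primitive (q := q) hθ hp hq hW₁m (hLp hW₁B)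
  refine ⟨_, _, _, _, _, isStrongSolution_of_graph hA hB hT hp (hLp (hB' hm₀)) (hLp (hB' hm₁))
    (hLp (hB' hm₂)) hgrB hgrA ?_, hE' _ _ (hE W hWm hW0 hWB) (hae fun t ht => ?_),
    hE' _ _ (hE W₁ hW₁m hW₁0 hW₁B) (hae hW₁), hEV hm₂, hEV hm₁, hEV hm₀⟩
  · have hlt : ∀ᵐ t ∂(volume.restrict (Ioo 0 T)), meanOsc T g η t < ⊤ := by
      refine ae_lt_top (measurable_meanOsc hg η) ?_
      rw [setLIntegral_congr (Ioo_ae_eq_Ioc (a := (0 : ℝ)) (b := T))]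
      exact hfin1.ne
    filter_upwards [hlt, hgf, ae_restrict_mem measurableSet_Ioo] with t h1 h2 ht
    rw [heq t ht.2.le h1, h2]
  · rw [hW t ht]
    refine intervalIntegral.integral_congr fun s hs => ?_
    rw [uIcc_of_le ht.1] at hs
    exact hW₁ s ⟨hs.1, hs.2.trans ht.2⟩

/-- For Hölder data the mean oscillation is bounded at every time, so the representation formula and
the equation hold everywhere. The zero initial values of `ü`, `B u̇`, `A u` come from the causality
of the contour operator. -/
theorem IsPencilResolvent.exists_isClassicalSolution (h : IsPencilResolvent A B k C H S)
    (hA : A.IsClosed) (hB : B.IsClosed) (hα : α ∈ Ioo (Real.pi / 2) Real.pi)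
    (hk : -Real.cos α < k) (hk1 : k < 1) (hT : 0 < T) (hθ : θ ∈ Ioo (0 : ℝ) 1)
    {E : (ℝ → X) → Prop} (hE : ∀ V : ℝ → X, E V → ContinuousOn V (Icc 0 T))
    (hE' : ∀ V : ℝ → X, ContinuousOn V (Icc 0 T) → E fun t => ∫ s in (0 : ℝ)..t, V s)
    {f : ℝ → X} (hf : MemHolderSpace T θ f) (hf0 : f 0 = 0)
    (hEf : ∀ (m : ℝ → X →L[ℂ] X) (C : ℝ), IsContourMultiplier m C →
      E (contourOp α m (zeroExt T hT.le f))) :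
    ∃ u u₁ u₂ Bu₁ Au : ℝ → X, IsClassicalSolution A B T f u u₁ u₂ Bu₁ Au ∧
      (E u ∧ u 0 = 0) ∧ (E u₁ ∧ u₁ 0 = 0) ∧ (E u₂ ∧ u₂ 0 = 0) ∧ (E Bu₁ ∧ Bu₁ 0 = 0) ∧
      (E Au ∧ Au 0 = 0) := by
  obtain ⟨m₀, m₁, m₂, C₀, C₁, C₂, hm₀, hm₁, hm₂, hm⟩ :=
    h.exists_multipliers hA hB hα hk hk1 hT
  have hg0 : ∀ t ≤ 0, zeroExt T hT.le f t = 0 := fun t ht => zeroExt_of_nonpos hT.le f ht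
  obtain ⟨hfc, M, hM⟩ := hf
  obtain ⟨K, -, hK⟩ := exists_hardy_rpow_add (X := X) hT hθ hθ
  have hosc : ∀ t ≤ T, meanOsc T (zeroExt T hT.le f) T t ≤
      ENNReal.ofReal (K * (|M| * T ^ θ + 0 * T ^ θ)) :=
    hK |M| 0 (abs_nonneg M) le_rfl _ hg0 (norm_zeroExt_sub_le hT.le hf0
      (ω := fun s => |M| * s ^ θ + 0 * s ^ θ) (fun a ha b hb hab => by
        have := hθ.1.le
        have : (0 : ℝ) < a := ha
        simp only
        gcongr) (fun s hs => by positivity) fun s hs t ht hst => by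
        have := hM s hs t ht
        have h0 : 0 < t - s := sub_pos.2 hst
        rw [abs_of_pos h0] at this
        rw [zero_mul, add_zero]
        refine this.trans ?_
        gcongr
        exact le_abs_self M) T ⟨hT, le_rfl⟩
  have hfin : ∫⁻ t in Ioc 0 T, meanOsc T (zeroExt T hT.le f) T t < ⊤ := by
    refine (setLIntegral_mono measurable_const fun t ht => hosc t ht.2).trans_lt ?_
    rw [lintegral_const, Measure.restrict_apply_univ]
    exact ENNReal.mul_lt_top ENNReal.ofReal_lt_top measure_Ioc_lt_top
  obtain ⟨hgrB, hgrA, heq⟩ := hm _ (stronglyMeasurable_zeroExt hT.le hfc)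
    (integrable_zeroExt hT.le hfc) hg0 T hT hfin
  have hc : ∀ {m : ℝ → X →L[ℂ] X} {C : ℝ}, IsContourMultiplier m C →
      ContinuousOn (contourOp α m (zeroExt T hT.le f)) (Icc 0 T) := fun hm => hE _ (hEf _ _ hm)
  have hz := fun m : ℝ → X →L[ℂ] X => contourOp_of_nonpos (α := α) (m := m) hg0 le_rfl
  have hE₁ := hE' _ (hc hm₂)
  exact ⟨_, _, _, _, _, isClassicalSolution_of_graph hA hB hT (hc hm₀) (hc hm₁) (hc hm₂) hgrB hgrA
    fun t ht => by
      rw [heq t ht.2 ((hosc t ht.2).trans_lt ENNReal.ofReal_lt_top), zeroExt_of_mem hT.le hf0 ht],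
    ⟨hE' _ (hE _ hE₁), intervalIntegral.integral_same⟩, ⟨hE₁, intervalIntegral.integral_same⟩,
    ⟨hEf _ _ hm₂, hz m₂⟩, ⟨hEf _ _ hm₁, hz m₁⟩, ⟨hEf _ _ hm₀, hz m₀⟩⟩

end

theorem theorem4p1 {X : Type*} [NormedAddCommGroup X] [NormedSpace ℂ X] [CompleteSpace X]
    (A B : X →ₗ.[ℂ] X) (hA : A.IsClosed) (hB : B.IsClosed)
    (φ : ℝ) (hφ : φ ∈ Set.Ioo (Real.pi / 2) Real.pi)
    (H : ℂ → X →L[ℂ] X)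
    (hb : ∀ z ∈ sector φ, z ≠ 0 → IsPencilInverse A B z (H z))
    (hc : DifferentiableOn ℂ H (interior (sector φ)) ∧
      ∃ C : ℝ, ∀ z ∈ sector φ, z ≠ 0 → ‖H z‖ ≤ C)
    (hd : ∃ C : ℝ, ∀ z ∈ sector φ, z ≠ 0 → ∀ x b a : X,
      (H z x, b) ∈ B.graph → (H z x, a) ∈ A.graph →
        ‖z ^ 2 • H z x‖ ≤ C * ‖x‖ ∧ ‖z • b‖ ≤ C * ‖x‖ ∧ ‖a‖ ≤ C * ‖x‖)
    (T : ℝ) (hT : 0 < T) (θ : ℝ) (hθ : θ ∈ Set.Ioo (0 : ℝ) 1) :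
    (∀ p q : ENNReal, 1 ≤ p → p ≠ ⊤ → 1 ≤ q →
      (θ < 1 / p.toReal →
        HasMaximalRegularity T (IsStrongSolution A B T p) (MemBesov 0 T θ p q)) ∧
      (1 / p.toReal < θ →
        HasMaximalRegularity T (IsStrongSolution A B T p) (MemBesovZeroTrace T θ p q)) ∧
      (θ = 1 / p.toReal →
        HasMaximalRegularity T (IsStrongSolution A B T p) (MemBesovZeroExt T θ p q))) ∧
    HasMaximalRegularity T (IsClassicalSolution A B T) (fun u => MemHolderSpace T θ u ∧ u 0 = 0) ∧
    HasMaximalRegularity T (IsClassicalSolution A B T)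
      (fun u => MemLittleHolderSpace T θ u ∧ u 0 = 0) := by
  -- Any angle strictly between `π/2` and `φ` works: above `π/2` for decay of `e^{zs}` along the
  -- contour, below `φ` to leave room inside the sector.
  set α := (Real.pi / 2 + φ) / 2 with hαdef
  have hα : α ∈ Ioo (Real.pi / 2) Real.pi :=
    ⟨by linarith [hφ.1], by linarith [hφ.1, hφ.2, Real.pi_pos]⟩
  have hk : -Real.cos α < -Real.cos φ := neg_lt_neg (Real.cos_lt_cos_of_nonneg_of_le_pi
    (by linarith [hα.1, Real.pi_pos]) hφ.2.le (by linarith [hφ.1]))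
  have hk0 : 0 < -Real.cos φ := neg_pos.2 (Real.cos_neg_of_pi_div_two_lt_of_lt hφ.1
    (by linarith [hφ.2, Real.pi_pos]))
  have hk1 : -Real.cos φ < 1 := by
    have := Real.cos_lt_cos_of_nonneg_of_le_pi (by linarith [hφ.1, Real.pi_pos]) le_rfl hφ.2
    rw [Real.cos_pi] at this
    linarith
  obtain ⟨C, S, hR⟩ := exists_isPencilResolvent hφ hb hc hd
  have huniq : ∀ {p : ENNReal}, 1 ≤ p → ∀ f u u₁ u₂ Bu₁ Au v v₁ v₂ Bv₁ Av : ℝ → X,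
      IsStrongSolution A B T p f u u₁ u₂ Bu₁ Au → IsStrongSolution A B T p f v v₁ v₂ Bv₁ Av →
      EqOn u v (Icc 0 T) := fun hp f u u₁ u₂ Bu₁ Au v v₁ v₂ Bv₁ Av hu hv t ht =>
    sub_eq_zero.1 (hR.eq_zero_of_isStrongSolution hk0 hA hB hT (hu.sub hp hT.le hv) ht)
  have huniq' : ∀ f u u₁ u₂ Bu₁ Au v v₁ v₂ Bv₁ Av : ℝ → X,
      IsClassicalSolution A B T f u u₁ u₂ Bu₁ Au → IsClassicalSolution A B T f v v₁ v₂ Bv₁ Av →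
      EqOn u v (Icc 0 T) := fun f u u₁ u₂ Bu₁ Au v v₁ v₂ Bv₁ Av hu hv =>
    huniq le_rfl f _ _ _ _ _ _ _ _ _ _ hu.isStrongSolution hv.isStrongSolution
  have hT' : -T ≤ 0 := by linarith
  refine ⟨fun p q hp hpt hq => ⟨fun hθp f hf => ⟨?_, huniq hp f⟩, fun hθp f hf =>
    ⟨?_, huniq hp f⟩, fun _ f hf => ⟨?_, huniq hp f⟩⟩, fun f hf => ⟨?_, huniq' f⟩,
    fun f hf => ⟨?_, huniq' f⟩⟩
  · obtain ⟨g, hg, hg0, hgL, hgi, hgf, -⟩ := hf.exists_stronglyMeasurable hp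
    exact hR.exists_isStrongSolution hA hB hα hk hk1 hT hθ hp hpt hq
      (fun V _ _ hV => hV.mono_interval hT') (fun V W hV hVW => hV.congr hVW) hg hgi hg0
      (memBesov_neg_of_lt hT hθ hp hpt hq hθp hg hg0 hgL (hf.congr hgf.symm)) hgf
  -- For `θ > 1/p` the zero trace is used for extending the data and recovered for the solution by
  -- the trace theorem.
  · obtain ⟨hfB, v, hv, hfv, hv0⟩ := hf
    obtain ⟨g, hg, hg0, hgL, hgi, hgf, -⟩ := hfB.exists_stronglyMeasurable hp
    exact hR.exists_isStrongSolution hA hB hα hk hk1 hT hθ hp hpt hq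
      (fun V hVm hV0 hV => ⟨hV.mono_interval hT',
        hV.exists_continuousOn hT hθ hp hpt hq hθp hVm hV0⟩)
      (fun V W hV hVW => hV.congr hVW) hg hgi hg0
      (memBesov_neg_of_gt hT hθ hp hpt hq hθp hg hg0 hgL (hfB.congr hgf.symm) hv
        (hgf.trans hfv) hv0) hgf
  · obtain ⟨g, hg, hg0, hgL, hgi, hgf, hfg⟩ := hf.1.exists_stronglyMeasurable hp
    exact hR.exists_isStrongSolution hA hB hα hk hk1 hT hθ hp hpt hq
      (fun V _ hV0 hV => hV.memBesovZeroExt hT hV0) (fun V W hV hVW => hV.congr hVW) hg hgi hg0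
      (hf.2.congr hfg) hgf
  · exact hR.exists_isClassicalSolution hA hB hα hk hk1 hT hθ (fun V hV => hV.1)
      (fun V hV => (memLittleHolderSpace_primitive hθ hT hV).1) hf.1 hf.2
      fun m C hm => hf.1.contourOp hα hT hθ hm hf.2
  · exact hR.exists_isClassicalSolution hA hB hα hk hk1 hT hθ (fun V hV => hV.1.1)
      (fun V hV => memLittleHolderSpace_primitive hθ hT hV) hf.1.1 hf.2
      fun m C hm => hf.1.contourOp hα hT hθ hm hf.2
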